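/- Let $d\ge 0$, $m\ge 1$ be integers, let $\beta>0$, $\alpha_1,\dots,\alpha_m>0$, and let $\lambda_1,\dots,\lambda_m\in\mathbb R$ be not all zero. Let $Q$ be either the torus $\mathbb T^d=(\mathbb R/\mathbb Z)^d$ or $\mathbb R^d$, let $V\in C^2(Q)$ be real valued and, on the phase space $Q\times\mathbb R^d\times(\mathbb R^d)^m$ of points $(q,p,z)$, $z=(z_1,\dots,z_m)$, consider the operator $\mathcal L$ given on real smooth compactly supported functions by $$-\mathcal L = p\cdot\nabla_q-\nabla_qV(q)\cdot\nabla_p+\Big(\sum_{j=1}^m\lambda_j z_j\Big)\cdot\nabla_p+\sum_{j=1}^m\Big(-\alpha_j z_j\cdot\nabla_{z_j}-\lambda_j\,p\cdot\nabla_{z_j}+\beta^{-1}\alpha_j\Delta_{z_j}\Big),$$ the generator of the Markovian generalized Langevin dynamics. Let $\mu_\beta$ be the Gibbs measure with density $\rho=\mathcal Z^{-1}e^{-\beta(V(q)+\frac12|p|^2+\frac12|z|^2)}$, where $\mathcal Z$ is the normalization constant, let $L^2_\rho=L^2(\mu_\beta)$, and let $H^1_\rho$ be the space of $f\in L^2_\rho$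 whose weak gradient in all variables $(q,p,z)$ belongs to $L^2_\rho$, with norm $\|f\|_{H^1_\rho}^2=\|f\|_{L^2_\rho}^2+\|\nabla f\|_{L^2_\rho}^2$. Denote the closure of $\mathcal L$ in $L^2_\rho$ again by $\mathcal L$ and put $\mathcal K=\operatorname{Ker}\mathcal L$. Equip $H^1_\rho/\mathcal K$ with the quotient norm $\inf\{\|h-k\|_{H^1_\rho}: k\in\mathcal K\cap H^1_\rho\}$ of the class of $h$. (a) If $Q=\mathbb T^d$, then $-\mathcal L$ generates a strongly continuous semigroup $e^{-t\mathcal L}$ on $L^2_\rho$, this semigroup maps $H^1_\rho$ into itself, and there are constants $C,\kappa>0$ such that $$\|e^{-t\mathcal L}\|_{H^1_\rho/\mathcal K\to H^1_\rho/\mathcal K}\le C e^{-\kappa t}\qquad\text{for all } t\ge 0.$$ (b) The same holds if $Q=\mathbb R^d$, provided that the Hessian $\nabla^2V$ is bounded on $\mathbb R^d$ and $V$ is confining, in the sense that $e^{-\beta V}$ is integrable and both $V(q)\to+\infty$ and $\tfrac12|\nabla V(q)|^2-\Delta V(q)\to+\infty$ as $|q|\to\infty$. The constants $C,\kappa$ may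 depend on $d,m,\beta,V,(\alpha_j),(\lambda_j)$, but not on $t$ or on the function to which the semigroup is applied. -/

import Mathlib

open MeasureTheory Filter Topology
open scoped ContDiff Laplacian

noncomputable section

namespace GLE

/-- Euclidean space of dimension `d`. -/
abbrev Euc (d : ℕ) : Type := EuclideanSpace ℝ (Fin d)

/-- The phase space `Q × ℝᵈ × (ℝᵈ)ᵐ` of points `(q, p, z)`; the position space `Q` will be either
`ℝᵈ` or the torus `𝕋ᵈ`. -/
abbrev Phase (d m : ℕ) (Q : Type) : Type := Q × Euc d × (Fin m → Euc d)

/-- The coordinate projection `ℝᵈ → 𝕋ᵈ = (ℝ/ℤ)ᵈ`. -/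
def torusProj (d : ℕ) : Euc d →+ UnitAddTorus (Fin d) where
  toFun x i := ((x i : ℝ) : UnitAddCircle)
  map_zero' := by ext i; simp
  map_add' x y := by ext i; simp

/-- The coordinate directions of the phase space: `q_i`, `p_i` and `z_{j,i}`. -/
abbrev Coord (d m : ℕ) : Type := Fin d ⊕ Fin d ⊕ (Fin m × Fin d)

/-- The unit tangent vector of a coordinate direction. -/
def unitVec {d m : ℕ} : Coord d m → Phase d m (Euc d)
  | .inl i => (EuclideanSpace.single i 1, 0, 0)
  | .inr (.inl i) => (0, EuclideanSpace.single i 1, 0)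
  | .inr (.inr (j, i)) => (0, 0, Pi.single j (EuclideanSpace.single i 1))

section

variable {d m : ℕ} {Q : Type} [AddCommGroup Q]

/-- The map `ℝᵈ × ℝᵈ × (ℝᵈ)ᵐ → Q × ℝᵈ × (ℝᵈ)ᵐ` induced by `π : ℝᵈ → Q`. -/
def cover (π : Euc d →+ Q) (x : Phase d m (Euc d)) : Phase d m Q := (π x.1, x.2.1, x.2.2)

/-- The partial derivative `∂_k f` of a function on the phase space. -/
def pderiv (π : Euc d →+ Q) (k : Coord d m) (f : Phase d m Q → ℝ) (x : Phase d m Q) : ℝ :=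
  deriv (fun s : ℝ => f (x + cover π (s • unitVec k))) 0

/-- The partial derivative `∂V/∂q_i` of a function of the position. -/
def posDeriv (π : Euc d →+ Q) (i : Fin d) (V : Q → ℝ) (q : Q) : ℝ :=
  deriv (fun s : ℝ => V (q + π (s • EuclideanSpace.single i 1))) 0

/-- The differential expression `𝓛 φ`, where
`-𝓛 = p·∇_q - ∇_q V·∇_p + (∑ⱼ λⱼ zⱼ)·∇_p
      + ∑ⱼ (- αⱼ zⱼ·∇_{zⱼ} - λⱼ p·∇_{zⱼ} + β⁻¹ αⱼ Δ_{zⱼ})`. -/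
def operator (π : Euc d →+ Q) (lam alpha : Fin m → ℝ) (β : ℝ) (V : Q → ℝ)
    (φ : Phase d m Q → ℝ) (x : Phase d m Q) : ℝ :=
  -((∑ i, x.2.1 i * pderiv π (.inl i) φ x)
    - (∑ i, posDeriv π i V x.1 * pderiv π (.inr (.inl i)) φ x)
    + (∑ i, (∑ j, lam j * x.2.2 j i) * pderiv π (.inr (.inl i)) φ x)
    + ∑ j, ∑ i,
        (-(alpha j * x.2.2 j i * pderiv π (.inr (.inr (j, i))) φ x)
          - lam j * x.2.1 i * pderiv π (.inr (.inr (j, i))) φ x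
          + β⁻¹ * alpha j *
            pderiv π (.inr (.inr (j, i))) (pderiv π (.inr (.inr (j, i))) φ) x))

/-- Test functions: smooth functions with compact support on the phase space. -/
def IsTest [TopologicalSpace Q] (π : Euc d →+ Q) (φ : Phase d m Q → ℝ) : Prop :=
  ContDiff ℝ ∞ (fun x : Phase d m (Euc d) => φ (cover π x)) ∧ HasCompactSupport φ

/-- The unnormalised Gibbs weight `exp(-β(V(q) + |p|²/2 + |z|²/2))`. -/
def weight (β : ℝ) (V : Q → ℝ) (x : Phase d m Q) : ℝ :=
  Real.exp (-β * (V x.1 + ‖x.2.1‖ ^ 2 / 2 + (∑ j, ‖x.2.2 j‖ ^ 2) / 2))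

variable [MeasureSpace Q]

/-- The Gibbs measure `μ_β`, with density `Z⁻¹ exp(-β(V(q) + |p|²/2 + |z|²/2))`. -/
def gibbs (m : ℕ) (β : ℝ) (V : Q → ℝ) : Measure (Phase d m Q) :=
  volume.withDensity fun x =>
    ENNReal.ofReal (weight β V x / ∫ y : Phase d m Q, weight β V y)

/-- The space `L²_ρ = L²(μ_β)` of real functions on the phase space. -/
abbrev L2 (d m : ℕ) {Q : Type} [AddCommGroup Q] [MeasureSpace Q] (β : ℝ) (V : Q → ℝ) : Type :=
  Lp ℝ 2 (gibbs (d := d) m β V)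

variable [TopologicalSpace Q]

/-- The graph of the closure, in `L²_ρ`, of the operator `𝓛` on test functions. -/
def closedGraph (π : Euc d →+ Q) (lam alpha : Fin m → ℝ) (β : ℝ) (V : Q → ℝ) :
    Set (L2 d m β V × L2 d m β V) :=
  closure {fg | ∃ φ : Phase d m Q → ℝ, IsTest π φ ∧
    fg.1 =ᵐ[gibbs m β V] φ ∧ fg.2 =ᵐ[gibbs m β V] operator π lam alpha β V φ}

/-- The kernel `𝓚` of (the closure of) `𝓛`. -/
def kernel (π : Euc d →+ Q) (lam alpha : Fin m → ℝ) (β : ℝ) (V : Q → ℝ) : Set (L2 d m β V) :=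
  {h | (h, 0) ∈ closedGraph π lam alpha β V}

/-- `L²_ρ × (L²_ρ)^N`, `N = 2d + dm`, with the Hilbert norm
`‖(f, g)‖² = ‖f‖² + ∑ₖ ‖gₖ‖²`. -/
abbrev Jet (d m : ℕ) {Q : Type} [AddCommGroup Q] [MeasureSpace Q] (β : ℝ) (V : Q → ℝ) : Type :=
  WithLp 2 (L2 d m β V × PiLp 2 (fun _ : Coord d m => L2 d m β V))

/-- The weighted Sobolev space `H¹_ρ`: the pairs `(f, g)` where `f ∈ L²_ρ` and `g ∈ (L²_ρ)^N` is
the weak gradient of `f`. The norm of `(f, g)` is the `H¹_ρ` norm of `f`. -/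
def H1 (π : Euc d →+ Q) (m : ℕ) (β : ℝ) (V : Q → ℝ) : Set (Jet d m β V) :=
  {u | ∀ (k : Coord d m) (φ : Phase d m Q → ℝ), IsTest π φ →
    ∫ x, u.fst x * pderiv π k φ x = -∫ x, u.snd k x * φ x}

/-- The norm of the class of `u` in `H¹_ρ / 𝓚`: the distance from `u` to the elements of `𝓚`. -/
def quotNorm (π : Euc d →+ Q) (lam alpha : Fin m → ℝ) (β : ℝ) (V : Q → ℝ)
    (u : Jet d m β V) : ℝ :=
  Metric.infDist u {k | k ∈ H1 π m β V ∧ k.fst ∈ kernel π lam alpha β V}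

end

/-- `T`, restricted to times `t ≥ 0`, is a strongly continuous semigroup of bounded operators. -/
structure IsC0Semigroup {X : Type*} [NormedAddCommGroup X] [NormedSpace ℝ X]
    (T : ℝ → X →L[ℝ] X) : Prop where
  zero : T 0 = ContinuousLinearMap.id ℝ X
  add : ∀ s t : ℝ, 0 ≤ s → 0 ≤ t → T (s + t) = (T s).comp (T t)
  continuous : ∀ h : X, Tendsto (fun t => T t h) (𝓝[>] 0) (𝓝 h)

/-- `T_t = e^{-tL}`: a strongly continuous semigroup whose infinitesimal generator is `-L`, where
`L` is the operator with the given graph. -/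
def IsSemigroupOf {X : Type*} [NormedAddCommGroup X] [NormedSpace ℝ X]
    (T : ℝ → X →L[ℝ] X) (graph : Set (X × X)) : Prop :=
  IsC0Semigroup T ∧ ∀ h y : X,
    Tendsto (fun t : ℝ => t⁻¹ • (T t h - h)) (𝓝[>] 0) (𝓝 (-y)) ↔ (h, y) ∈ graph

/-- `-𝓛` generates a semigroup `e^{-t𝓛}` on `L²_ρ`, which preserves `H¹_ρ` and whose operator norm
on `H¹_ρ / 𝓚` is at most `C e^{-κ t}` for all `t ≥ 0`, with some constants `C, κ > 0`. -/
def ExponentialDecay {d m : ℕ} {Q : Type} [AddCommGroup Q] [MeasureSpace Q] [TopologicalSpace Q]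
    (π : Euc d →+ Q) (lam alpha : Fin m → ℝ) (β : ℝ) (V : Q → ℝ) : Prop :=
  ∃ T : ℝ → L2 d m β V →L[ℝ] L2 d m β V,
    IsSemigroupOf T (closedGraph π lam alpha β V) ∧
    ∃ C κ : ℝ, 0 < C ∧ 0 < κ ∧ ∀ t : ℝ, 0 ≤ t → ∀ u ∈ H1 π m β V,
      ∃ w ∈ H1 π m β V, w.fst = T t u.fst ∧
        quotNorm π lam alpha β V w ≤ C * Real.exp (-κ * t) * quotNorm π lam alpha β V u

/-- `V` is confining at inverse temperature `β`: `V(q) → ∞` and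
`|∇V(q)|²/2 - ΔV(q) → ∞` as `|q| → ∞`, and `e^{-βV}` is integrable. -/
structure IsConfining {d : ℕ} (β : ℝ) (V : Euc d → ℝ) : Prop where
  tendsto : Tendsto V (cocompact (Euc d)) atTop
  integrable : Integrable fun q => Real.exp (-β * V q)
  gradient : Tendsto (fun q => ‖gradient V q‖ ^ 2 / 2 - Δ V q) (cocompact (Euc d)) atTop

/-- The Hessian of `V` is bounded in the Frobenius norm. -/
def HasBoundedHessian {d : ℕ} (V : Euc d → ℝ) : Prop :=
  ∃ c : ℝ, ∀ q, √(∑ i, ∑ j, (iteratedFDeriv ℝ 2 V q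
    ![EuclideanSpace.single i 1, EuclideanSpace.single j 1]) ^ 2) ≤ c

end GLE

end

/-! The noise acts on the variables `z` alone, so the energy identity in `L²_ρ` controls only the
`z`-gradient. The other directions are recovered by hypocoercivity. With `G = -𝓛`, one has `G = (J -
D)∇H·∇ + β⁻¹ D:∇²`, where `J` is an antisymmetric matrix, `D` a nonnegative diagonal one and `H` the
Hamiltonian. Because the Hessian of `H` is bounded, the commutator of `∇` with `G` is a bounded
matrix acting on `∇`: differentiating in `z_j` produces `λ_j ∂_p`, and differentiating in `p`
produces `∂_q`. Small cross terms `∂_z·∂_p` and `∂_p·∂_q` added to the `H¹` norm turn these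
commutators into dissipation of `∂_p` (this needs some `λ_j ≠ 0`) and then of `∂_q`. Their
coefficients are powers of one small parameter, arranged so that both the modified form and its
dissipation are positive (`exists_hypoMatrix`). The second order terms have a good sign because the
matrix is constant and positive, so the whole gradient is dissipated (`exists_dissipation`).

For functions of mean zero the Poincaré inequality (`exists_poincare`) bounds the modified norm by
the gradient, whence strict dissipativity. That inequality holds because `|∇H|² f²` is integrable
with a bound by the `H¹` norm, so little mass sits where `|∇H|` is large; the remaining region is
the image of a bounded convex set, where the classical inequality applies.

Dissipativity generates a semigroup once `l + 𝓛` has dense range on smooth functions. For this `G`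
is replaced by a finite difference operator made of averages over shifts; its resolvent equation is
solved by contraction, with sup and Lipschitz bounds uniform in the step, and the solution is
mollified (`exists_approx_resolvent`). The residual is small relative to `1 + |∇H|²`, which is
square integrable, but its gradient is merely bounded in the same sense. This suffices in `L²_ρ`. In
`H¹_ρ` it also suffices: a sequence bounded in `H¹` and convergent in `L²` converges weakly, and a
closed subspace is weakly closed (`mem_closure_of_injOn`). The same principle gives density of
smooth functions in `H¹_ρ`.

Yosida approximation (`exists_semigroup`, `exists_semigroup_of_core`) then yields a semigroup on
`L²_ρ` and an exponentially decaying one on the mean zero part of `H¹_ρ`. The inclusion intertwines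
their generators, hence the semigroups. Since the `L²_ρ` semigroup fixes `𝓚`, and `𝓚` contains the
constants, decay passes to the quotient. The torus and the whole space enter only through the common
hypotheses `IsAdmissible`. -/

set_option linter.unusedSectionVars false

noncomputable section

namespace GLE

/-! ### Yosida approximations and their exponentials, for an equivalent inner product -/

section Yosida

variable {X : Type*} [NormedAddCommGroup X] [NormedSpace ℝ X]

/-- A symmetric bilinear form whose quadratic form is equivalent to the square of the norm. -/
structure IsCoerciveForm (B : X →L[ℝ] X →L[ℝ] ℝ) (c : ℝ) : Prop where
  symm : ∀ x y, B x y = B y x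
  pos : 0 < c
  le : ∀ x, c * ‖x‖ ^ 2 ≤ B x x

namespace IsCoerciveForm

variable {B : X →L[ℝ] X →L[ℝ] ℝ} {c : ℝ}

lemma nonneg (hB : IsCoerciveForm B c) (x : X) : 0 ≤ B x x :=
  le_trans (by have := hB.pos; positivity) (hB.le x)

lemma apply_le (B : X →L[ℝ] X →L[ℝ] ℝ) (x y : X) : B x y ≤ ‖B‖ * ‖x‖ * ‖y‖ :=
  (le_abs_self _).trans (B.le_opNorm₂ x y)

lemma eq_zero (hB : IsCoerciveForm B c) {x : X} (h : B x x ≤ 0) : x = 0 := by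
  have h1 := hB.le x
  have h2 : ‖x‖ ^ 2 ≤ 0 := by
    by_contra hc
    push Not at hc
    have := mul_pos hB.pos hc
    linarith
  exact norm_eq_zero.1 (pow_eq_zero_iff two_ne_zero |>.1 (le_antisymm h2 (sq_nonneg _)))

/-- The ratio of the two equivalent norms. -/
lemma norm_le (hB : IsCoerciveForm B c) {x y : X} {s : ℝ} (hs : 0 ≤ s)
    (h : B x x ≤ s ^ 2 * B y y) : ‖x‖ ≤ √(‖B‖ / c) * s * ‖y‖ := by
  have hc := hB.pos
  have h1 : c * ‖x‖ ^ 2 ≤ s ^ 2 * (‖B‖ * ‖y‖ * ‖y‖) :=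
    ((hB.le x).trans h).trans (by gcongr; exact apply_le B y y)
  refine le_of_sq_le_sq ?_ (by positivity)
  rw [mul_pow, mul_pow, Real.sq_sqrt (by positivity), div_mul_eq_mul_div, div_mul_eq_mul_div,
    le_div_iff₀ hc]
  nlinarith

end IsCoerciveForm

variable {B : X →L[ℝ] X →L[ℝ] ℝ} {c κ : ℝ} {G : Submodule ℝ (X × X)}

/-- With `S` the resolvent `(l + G)⁻¹`, the operator is `l² S - l`. Strict dissipativity `κ` of the
unbounded operator survives as `κ l / (l + κ)`, which tends back to `κ` as `l` grows. -/
lemma exists_yosida (hB : IsCoerciveForm B c) (hκ : 0 ≤ κ)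
    (hdiss : ∀ p ∈ G, κ * B p.1 p.1 ≤ B p.1 p.2) {l : ℝ} (hl : 0 < l)
    (hrange : ∀ f : X, ∃ p ∈ G, l • p.1 + p.2 = f) :
    ∃ A : X →L[ℝ] X, (∀ p ∈ G, A (l • p.1 + p.2) = -(l • p.2)) ∧
      ∀ x, B (A x) x ≤ -(κ * l / (l + κ)) * B x x := by
  choose R hRG hR using hrange
  -- Testing `l x + y` against `x` bounds the resolvent. The same bound makes `l + G` injective,
  -- which is what makes the chosen preimages depend linearly on the datum.
  have key : ∀ p ∈ G, ‖p.1‖ ≤ ‖B‖ / (l * c) * ‖l • p.1 + p.2‖ := by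
    intro p hp
    have h1 := hdiss p hp
    have h2 : l * B p.1 p.1 ≤ B p.1 (l • p.1 + p.2) := by
      simp only [map_add, map_smul, smul_eq_mul]
      nlinarith [hB.nonneg p.1]
    have h3 := IsCoerciveForm.apply_le B p.1 (l • p.1 + p.2)
    have h4 := hB.le p.1
    have hc := hB.pos
    rcases eq_or_ne ‖p.1‖ 0 with h0 | h0
    · rw [h0]; positivity
    have h0 : 0 < ‖p.1‖ := lt_of_le_of_ne (norm_nonneg _) h0.symm
    rw [div_mul_eq_mul_div, le_div_iff₀ (by positivity)]
    have h5 : ‖p.1‖ * (‖p.1‖ * (l * c)) ≤ ‖p.1‖ * (‖B‖ * ‖l • p.1 + p.2‖) := by nlinarith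
    exact le_of_mul_le_mul_left h5 h0
  have uniq : ∀ p ∈ G, ∀ q ∈ G, l • p.1 + p.2 = l • q.1 + q.2 → p.1 = q.1 := by
    intro p hp q hq h
    have := key (p - q) (G.sub_mem hp hq)
    have h0 : l • (p - q).1 + (p - q).2 = 0 := by
      have : l • (p - q).1 + (p - q).2 = (l • p.1 + p.2) - (l • q.1 + q.2) := by
        simp only [Prod.fst_sub, Prod.snd_sub, smul_sub]; abel
      rw [this, h, sub_self]
    rw [h0, norm_zero, mul_zero] at this
    have := norm_eq_zero.1 (le_antisymm this (norm_nonneg _))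
    exact sub_eq_zero.1 this
  let S : X →ₗ[ℝ] X :=
    { toFun := fun f => (R f).1
      map_add' := fun f g => by
        refine uniq _ (hRG _) ((R f) + (R g)) (G.add_mem (hRG _) (hRG _)) ?_
        rw [hR]
        conv_lhs => rw [← hR f, ← hR g]
        simp only [Prod.fst_add, Prod.snd_add, smul_add]; abel
      map_smul' := fun a f => by
        refine uniq _ (hRG _) (a • R f) (G.smul_mem _ (hRG _)) ?_
        rw [hR]
        conv_lhs => rw [← hR f]
        simp only [Prod.smul_fst, Prod.smul_snd, smul_add]
        rw [smul_comm] }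
  let S' : X →L[ℝ] X := S.mkContinuous (‖B‖ / (l * c)) (fun f => by
    have := key _ (hRG f)
    rwa [hR] at this)
  refine ⟨(l * l) • S' - l • ContinuousLinearMap.id ℝ X, ?_, ?_⟩
  · intro p hp
    have : S' (l • p.1 + p.2) = p.1 := uniq _ (hRG _) _ hp (hR _)
    simp only [sub_apply, smul_apply, this,
      ContinuousLinearMap.id_apply, smul_add, smul_smul]
    abel
  · intro f
    obtain ⟨x, y, hxy, hf⟩ : ∃ x y, (x, y) ∈ G ∧ f = l • x + y := ⟨_, _, hRG f, (hR f).symm⟩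
    have hS : S' f = x := by
      refine uniq _ (hRG _) (x, y) hxy ?_
      rw [hR, hf]
    have h1 : ((l * l) • S' - l • ContinuousLinearMap.id ℝ X) f = -(l • y) := by
      simp only [sub_apply, smul_apply, hS,
        ContinuousLinearMap.id_apply]
      rw [hf, smul_add, smul_smul]
      abel
    rw [h1, hf]
    have h2 : κ * B x x ≤ B x y := hdiss _ hxy
    -- This square upgrades `κ B x x ≤ B x y` to `κ B x y ≤ B y y`. The claim is then `l³` times the
    -- first gap plus `l²` times the second.
    have h3 := hB.nonneg (y - κ • x)
    have h4 := hB.symm y x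
    simp only [map_sub, map_smul, map_add, sub_apply,
      smul_apply, add_apply, smul_eq_mul, map_neg,
      neg_apply, h4] at h3 ⊢
    have hlk : 0 < l + κ := by linarith
    rw [← neg_div, div_mul_eq_mul_div, le_div_iff₀ hlk]
    have h5 : 0 ≤ l * l * l * (B x y - κ * B x x) := by
      have := sub_nonneg.2 h2; positivity
    have h6 : 0 ≤ l * l * (B y y - κ * B x y) := by
      have : 0 ≤ B y y - κ * B x y := by nlinarith
      positivity
    nlinarith

variable [CompleteSpace X]

open NormedSpace

lemma hasDerivAt_exp_smul_apply (A : X →L[ℝ] X) (x : X) (t : ℝ) :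
    HasDerivAt (fun s : ℝ => exp (s • A) x) (exp (t • A) (A x)) t :=
  (hasDerivAt_exp_smul_const A t).clm_apply (hasDerivAt_const t x) |>.congr_deriv (by simp)

lemma exp_smul_apply_comm (A : X →L[ℝ] X) (x : X) (t : ℝ) :
    exp (t • A) (A x) = A (exp (t • A) x) := by
  have : Commute (exp (t • A)) A := ((Commute.refl A).smul_left t).exp_left
  exact DFunLike.congr_fun this.eq x

/-- The function `s ↦ exp (2 r s) B(e^{sA} x, e^{sA} x)` is nonincreasing, by the sign of its
derivative. -/
lemma form_exp_le (hB : IsCoerciveForm B c) {A : X →L[ℝ] X} {r : ℝ}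
    (hA : ∀ x, B (A x) x ≤ -r * B x x) (x : X) {t : ℝ} (ht : 0 ≤ t) :
    B (exp (t • A) x) (exp (t • A) x) ≤ Real.exp (-(2 * r) * t) * B x x := by
  have hd : ∀ s : ℝ, HasDerivAt
      (fun s => Real.exp (2 * r * s) * B (exp (s • A) x) (exp (s • A) x))
      (Real.exp (2 * r * s) * (2 * r) * B (exp (s • A) x) (exp (s • A) x)
        + Real.exp (2 * r * s) * (2 * B (A (exp (s • A) x)) (exp (s • A) x))) s := by
    intro s
    have h1 := hasDerivAt_exp_smul_apply A x s
    rw [exp_smul_apply_comm] at h1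
    have h2 : HasDerivAt (fun s => B (exp (s • A) x)) (B (A (exp (s • A) x))) s :=
      (B.hasFDerivAt).comp_hasDerivAt s h1
    have h3 := h2.clm_apply h1
    have h4 : HasDerivAt (fun s => Real.exp (2 * r * s)) (Real.exp (2 * r * s) * (2 * r)) s := by
      simpa using ((hasDerivAt_id s).const_mul (2 * r)).exp
    refine (h4.mul h3).congr_deriv ?_
    rw [hB.symm (exp (s • A) x) (A _)]
    ring
  have hanti : Antitone (fun s => Real.exp (2 * r * s) * B (exp (s • A) x) (exp (s • A) x)) := by
    refine antitone_of_deriv_nonpos (fun s => (hd s).differentiableAt) (fun s => ?_)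
    rw [(hd s).deriv]
    have := hA (exp (s • A) x)
    have h0 := Real.exp_pos (2 * r * s)
    nlinarith
  have := hanti ht
  simp only [mul_zero, Real.exp_zero, zero_smul, exp_zero, one_mul,
    one_apply_eq_self] at this
  rw [neg_mul, Real.exp_neg, inv_mul_eq_div, le_div_iff₀ (Real.exp_pos _), mul_comm]
  exact this

lemma norm_exp_le (hB : IsCoerciveForm B c) {A : X →L[ℝ] X}
    (hA : ∀ x, B (A x) x ≤ 0) (x : X) {t : ℝ} (ht : 0 ≤ t) :
    ‖exp (t • A) x‖ ≤ √(‖B‖ / c) * ‖x‖ := by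
  have h := form_exp_le hB (r := 0) (fun x => by simpa using hA x) x ht
  have := hB.norm_le (s := 1) zero_le_one (by simpa using h)
  simpa using this

/-- Duhamel's argument: `e^{(t-s)A'} e^{sA} x` interpolates between the two exponentials, and by
commutation its derivative in `s` is `e^{(t-s)A'} e^{sA} (A - A') x`. -/
lemma norm_exp_sub_exp_le (hB : IsCoerciveForm B c) {A A' : X →L[ℝ] X}
    (hA : ∀ x, B (A x) x ≤ 0) (hA' : ∀ x, B (A' x) x ≤ 0) (hc : Commute A A') (x : X) {t : ℝ}
    (ht : 0 ≤ t) :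
    ‖exp (t • A) x - exp (t • A') x‖ ≤ (√(‖B‖ / c)) ^ 2 * ‖A x - A' x‖ * t := by
  have hd : ∀ s ∈ Set.Icc 0 t, HasDerivWithinAt
      (fun s => exp ((t - s) • A') (exp (s • A) x))
      (exp ((t - s) • A') (exp (s • A) (A x - A' x))) (Set.Icc 0 t) s := by
    intro s hs
    have h1 := hasDerivAt_exp_smul_apply A x s
    have h2 : HasDerivAt (fun s : ℝ => exp ((t - s) • A')) (-(exp ((t - s) • A') * A')) s := by
      have := (hasDerivAt_exp_smul_const A' (t - s)).scomp s ((hasDerivAt_id s).const_sub t)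
      exact (this.congr_deriv (by simp))
    refine ((h2.clm_apply h1).congr_deriv ?_).hasDerivWithinAt
    have h3 : Commute (exp (s • A)) A' := (hc.smul_left s).exp_left
    have h4 : exp (s • A) (A' x) = A' (exp (s • A) x) := DFunLike.congr_fun h3.eq x
    simp only [map_sub, h4, neg_apply, mul_apply_eq_comp]
    abel
  have := norm_image_sub_le_of_norm_deriv_le_segment' hd
    (C := (√(‖B‖ / c)) ^ 2 * ‖A x - A' x‖) (fun s hs => ?_) t ⟨ht, le_rfl⟩
  · simpa using this
  · have h1 := norm_exp_le hB hA' (exp (s • A) (A x - A' x)) (t := t - s) (by linarith [hs.2])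
    have h2 := norm_exp_le hB hA (A x - A' x) hs.1
    calc _ ≤ _ := h1
      _ ≤ √(‖B‖ / c) * (√(‖B‖ / c) * ‖A x - A' x‖) := by gcongr
      _ = _ := by ring

end Yosida

/-! ### Generation of semigroups with equality of the generator and the given graph -/

section Generation

open NormedSpace

variable {X : Type*} [NormedAddCommGroup X] [NormedSpace ℝ X]
variable {B : X →L[ℝ] X →L[ℝ] ℝ} {c κ : ℝ} {G : Submodule ℝ (X × X)}

/-- `A` is the Yosida approximation, with parameter `l`, of the operator with graph `-G`. -/
def IsYosida (G : Submodule ℝ (X × X)) (l : ℝ) (A : X →L[ℝ] X) : Prop :=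
  ∀ p ∈ G, A (l • p.1 + p.2) = -(l • p.2)

/-- Resolvents of one operator commute. Concretely, for `f = l x + y` and `x = l' x' + y'`, the pair
`(y', y - l' y')` is again in the graph, and both products send `f` to `l l' (y - l' y')`. -/
lemma IsYosida.commute {l l' : ℝ} {A A' : X →L[ℝ] X} (hA : IsYosida G l A)
    (hA' : IsYosida G l' A') (hrange : ∀ f : X, ∃ p ∈ G, l • p.1 + p.2 = f)
    (hrange' : ∀ f : X, ∃ p ∈ G, l' • p.1 + p.2 = f) : Commute A A' := by
  refine ContinuousLinearMap.ext fun f => ?_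
  obtain ⟨⟨x, y⟩, hxy, hf⟩ := hrange f
  obtain ⟨⟨x', y'⟩, hxy', hx⟩ := hrange' x
  simp only at hf hx
  have h1 : (y', y - l' • y') ∈ G := by
    have := G.sub_mem hxy (G.smul_mem l' hxy')
    convert this using 1
    simp only [Prod.smul_mk, Prod.mk_sub_mk, ← hx]
    simp
  set y'' := y - l' • y' with hy''
  have hy : y = l' • y' + y'' := by rw [hy'']; abel
  have e1 : A f = -(l • y) := by rw [← hf]; exact hA _ hxy
  have e2 : A' y = -(l' • y'') := by rw [hy]; exact hA' _ h1
  have e3 : A' f = -(l' • (l • y' + y'')) := by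
    have h2 := hA' _ (G.add_mem (G.smul_mem l hxy') h1)
    simp only [Prod.smul_mk, Prod.mk_add_mk] at h2
    rw [← h2, ← hf, ← hx, hy]
    congr 1
    simp only [smul_add, smul_smul, mul_comm l l']
    abel
  have e4 : A (l • y' + y'') = -(l • y'') := hA _ h1
  simp only [mul_apply_eq_comp, e1, e3, map_neg, map_smul, e2, e4, smul_neg, smul_smul, mul_comm]

/-- In the form `B`, dissipativity gives `B(y, y) ≤ B(l x + y, l x + y)`, so the approximation has
size at most `l`. -/
lemma IsYosida.norm_le (hB : IsCoerciveForm B c) (hdiss : ∀ p ∈ G, 0 ≤ B p.1 p.2) {l : ℝ}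
    (hl : 0 < l) {A : X →L[ℝ] X} (hA : IsYosida G l A)
    (hrange : ∀ f : X, ∃ p ∈ G, l • p.1 + p.2 = f) (f : X) :
    ‖A f‖ ≤ √(‖B‖ / c) * l * ‖f‖ := by
  refine hB.norm_le hl.le ?_
  obtain ⟨⟨x, y⟩, hxy, hf⟩ := hrange f
  have e1 : A f = -(l • y) := by rw [← hf]; exact hA _ hxy
  have h1 : 0 ≤ B x y := hdiss _ hxy
  have h2 := hB.nonneg x
  have h3 := hB.symm y x
  rw [e1, ← hf]
  simp only [map_neg, map_smul, map_add, neg_apply, smul_apply, add_apply, smul_eq_mul, h3]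
  have : 0 ≤ l ^ 2 * (l * l * B x x + 2 * l * B x y) := by positivity
  nlinarith

/-- On the graph `A_n x = -y - n⁻¹ A_n y`, so everything reduces to `n⁻¹ A_n → 0` strongly. -/
lemma tendsto_yosida (hB : IsCoerciveForm B c) (hdiss : ∀ p ∈ G, 0 ≤ B p.1 p.2) {n₀ : ℕ}
    {A : ℕ → X →L[ℝ] X} (hA : ∀ n ≥ n₀, 0 < n → IsYosida G n (A n))
    (hrange : ∀ n ≥ n₀, 0 < n → ∀ f : X, ∃ p ∈ G, (n : ℝ) • p.1 + p.2 = f)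
    (hdense : ∀ x : X, ∀ ε > 0, ∃ p ∈ G, ‖x - p.1‖ < ε) {p : X × X} (hp : p ∈ G) :
    Tendsto (fun n => A n p.1) atTop (𝓝 (-p.2)) := by
  set M := √(‖B‖ / c)
  have hev : ∀ᶠ n : ℕ in atTop, n₀ ≤ n ∧ 0 < n :=
    (eventually_ge_atTop n₀).and (eventually_gt_atTop 0)
  have hsplit : ∀ n ≥ n₀, 0 < n → ∀ q ∈ G, A n q.1 = -q.2 - (n : ℝ)⁻¹ • A n q.2 := by
    intro n hn hn0 q hq
    have h1 := hA n hn hn0 q hq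
    have hn' : (n : ℝ) ≠ 0 := by positivity
    rw [map_add, map_smul] at h1
    have h2 : (n : ℝ)⁻¹ • ((n : ℝ) • A n q.1) = (n : ℝ)⁻¹ • (-((n : ℝ) • q.2) - A n q.2) := by
      rw [← h1]; simp
    rwa [smul_smul, inv_mul_cancel₀ hn', one_smul, smul_sub, smul_neg, smul_smul,
      inv_mul_cancel₀ hn', one_smul] at h2
  have hbound : ∀ n ≥ n₀, 0 < n → ∀ y, ‖(n : ℝ)⁻¹ • A n y‖ ≤ M * ‖y‖ := by
    intro n hn hn0 y
    have hn' : (0 : ℝ) < n := by positivity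
    have := (hA n hn hn0).norm_le hB hdiss hn' (hrange n hn hn0) y
    rw [norm_smul, norm_inv, Real.norm_eq_abs, abs_of_pos hn', inv_mul_le_iff₀ hn']
    linarith
  -- On the domain `A_n` stays bounded, so `n⁻¹ A_n` vanishes in the limit; the bound uniform in `n`
  -- and density carry this to all vectors.
  have hzero : ∀ y, Tendsto (fun n : ℕ => (n : ℝ)⁻¹ • A n y) atTop (𝓝 0) := by
    intro y
    rw [Metric.tendsto_atTop']
    intro ε hε
    obtain ⟨q, hq, hqy⟩ := hdense y (ε / (2 * (M + 1))) (by positivity)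
    have hlim : Tendsto (fun n : ℕ => (n : ℝ)⁻¹ * ((1 + M) * ‖q.2‖)) atTop (𝓝 0) := by
      simpa using (tendsto_inv_atTop_nhds_zero_nat (𝕜 := ℝ)).mul_const ((1 + M) * ‖q.2‖)
    have h2 := ((hlim.eventually (gt_mem_nhds (half_pos hε))).and hev).exists_forall_of_atTop
    obtain ⟨N, hN⟩ := h2
    refine ⟨N, fun n hn => ?_⟩
    obtain ⟨h3, h4, h5⟩ := hN n hn.le
    have h6 : (n : ℝ)⁻¹ • A n y = (n : ℝ)⁻¹ • A n (y - q.1) + (n : ℝ)⁻¹ • A n q.1 := by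
      rw [map_sub, smul_sub]; abel
    rw [dist_zero_right, h6]
    have h7 := hbound n h4 h5 (y - q.1)
    have h8 : ‖(n : ℝ)⁻¹ • A n q.1‖ ≤ (n : ℝ)⁻¹ * ((1 + M) * ‖q.2‖) := by
      rw [norm_smul, hsplit n h4 h5 q hq, norm_inv, Real.norm_natCast]
      gcongr
      refine (norm_sub_le _ _).trans ?_
      rw [norm_neg]
      linarith [hbound n h4 h5 q.2]
    have h9 : M * ‖y - q.1‖ ≤ ε / 2 := by
      have h10 : (M + 1) * ‖y - q.1‖ ≤ (M + 1) * (ε / (2 * (M + 1))) := by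
        have : 0 ≤ M := Real.sqrt_nonneg _
        gcongr
      have h11 : (M + 1) * (ε / (2 * (M + 1))) = ε / 2 := by
        have : 0 ≤ M := Real.sqrt_nonneg _
        field_simp
      nlinarith [norm_nonneg (y - q.1)]
    calc _ ≤ _ := norm_add_le _ _
      _ < ε := by linarith
  have h := (hzero p.2).const_sub (-p.2)
  rw [sub_zero] at h
  refine h.congr' ?_
  filter_upwards [hev] with n hn
  exact (hsplit n hn.1 hn.2 p hp).symm

lemma tendsto_form {ι : Type*} {F : Filter ι} {f g : ι → X} {a b : X} (hf : Tendsto f F (𝓝 a))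
    (hg : Tendsto g F (𝓝 b)) : Tendsto (fun i => B (f i) (g i)) F (𝓝 (B a b)) :=
  (B.continuous₂.tendsto (a, b)).comp (hf.prodMk_nhds hg)

variable [CompleteSpace X]

/-- Uniform boundedness lets the Cauchy property pass from a dense set to the whole space. -/
lemma exists_limit_of_dense {F : ℕ → X →L[ℝ] X} {M : ℝ} (hM : ∀ᶠ n in atTop, ∀ x, ‖F n x‖ ≤ M * ‖x‖)
    {D : Set X} (hD : ∀ x : X, ∀ ε > 0, ∃ p ∈ D, ‖x - p‖ < ε)
    (hF : ∀ x ∈ D, CauchySeq fun n => F n x) :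
    ∃ S : X →L[ℝ] X, ∀ x, Tendsto (fun n => F n x) atTop (𝓝 (S x)) := by
  have hlim : ∀ x, ∃ z, Tendsto (fun n => F n x) atTop (𝓝 z) := by
    intro x
    refine cauchySeq_tendsto_of_complete ?_
    rw [Metric.cauchySeq_iff']
    intro ε hε
    obtain ⟨p, hp, hpx⟩ := hD x (ε / (3 * (|M| + 1))) (by positivity)
    obtain ⟨N, hN⟩ := Metric.cauchySeq_iff.1 (hF p hp) (ε / 3) (by positivity)
    obtain ⟨N', hN'⟩ := hM.exists_forall_of_atTop
    refine ⟨max N N', fun n hn => ?_⟩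
    have h1 : ∀ n ≥ max N N', ‖F n (x - p)‖ ≤ ε / 3 := by
      intro n hn
      calc _ ≤ M * ‖x - p‖ := hN' n (le_of_max_le_right hn) _
        _ ≤ (|M| + 1) * (ε / (3 * (|M| + 1))) := by
            gcongr; linarith [le_abs_self M]
        _ = ε / 3 := by field_simp
    have h2 := hN n (le_of_max_le_left hn) (max N N') (le_max_left _ _)
    rw [dist_eq_norm] at h2 ⊢
    have h3 : F n x - F (max N N') x =
        F n (x - p) + (F n p - F (max N N') p) - F (max N N') (x - p) := by
      simp only [map_sub]; abel
    rw [h3]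
    calc _ ≤ ‖F n (x - p) + (F n p - F (max N N') p)‖ + ‖F (max N N') (x - p)‖ := norm_sub_le _ _
      _ ≤ ‖F n (x - p)‖ + ‖F n p - F (max N N') p‖ + ‖F (max N N') (x - p)‖ := by
          gcongr; exact norm_add_le _ _
      _ < ε := by linarith [h1 n hn, h1 _ le_rfl]
  choose S hS using hlim
  let S' : X →ₗ[ℝ] X :=
    { toFun := S
      map_add' := fun x y => tendsto_nhds_unique (hS (x + y))
        (((hS x).add (hS y)).congr fun n => (map_add _ _ _).symm)
      map_smul' := fun a x => tendsto_nhds_unique (hS (a • x))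
        (((hS x).const_smul a).congr fun n => (map_smul _ _ _).symm) }
  refine ⟨S'.mkContinuous M fun x => ?_, hS⟩
  exact le_of_tendsto (hS x).norm (hM.mono fun n hn => hn x)

/-- Generation of a semigroup by a dissipative operator with dense domain and full range. -/
theorem exists_semigroup (hB : IsCoerciveForm B c) (hκ : 0 ≤ κ)
    (hdiss : ∀ p ∈ G, κ * B p.1 p.1 ≤ B p.1 p.2) {l₀ : ℝ} (hl₀ : 0 ≤ l₀)
    (hrange : ∀ l > l₀, ∀ f : X, ∃ p ∈ G, l • p.1 + p.2 = f)
    (hdense : ∀ x : X, ∀ ε > 0, ∃ p ∈ G, ‖x - p.1‖ < ε) :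
    ∃ (T : ℝ → X →L[ℝ] X) (A : ℕ → X →L[ℝ] X), IsSemigroupOf T (G : Set (X × X)) ∧
      (∀ t, 0 ≤ t → ∀ x, B (T t x) (T t x) ≤ Real.exp (-(2 * κ) * t) * B x x) ∧
      (∀ n : ℕ, l₀ < n → IsYosida G n (A n)) ∧
      ∀ t, 0 ≤ t → ∀ x, Tendsto (fun n => exp (t • A n) x) atTop (𝓝 (T t x)) := by
  have hdiss0 : ∀ p ∈ G, 0 ≤ B p.1 p.2 := fun p hp =>
    le_trans (mul_nonneg hκ (hB.nonneg _)) (hdiss p hp)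
  have hex : ∀ n : ℕ, ∃ A : X →L[ℝ] X, l₀ < n → (IsYosida G n A ∧
      ∀ x, B (A x) x ≤ -(κ * n / (n + κ)) * B x x) := by
    intro n
    by_cases hn : l₀ < n
    · obtain ⟨A, h1, h2⟩ := exists_yosida hB hκ hdiss (hl₀.trans_lt hn) (hrange n hn)
      exact ⟨A, fun _ => ⟨h1, h2⟩⟩
    · exact ⟨0, fun h => absurd h hn⟩
  choose A hA using hex
  obtain ⟨n₀, hn₀⟩ := exists_nat_gt l₀
  have hgt : ∀ n ≥ n₀, l₀ < n := fun n hn => hn₀.trans_le (by exact_mod_cast hn)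
  have hY : ∀ n ≥ n₀, IsYosida G n (A n) := fun n hn => (hA n (hgt n hn)).1
  have hneg : ∀ n ≥ n₀, ∀ x, B (A n x) x ≤ 0 := by
    intro n hn x
    refine ((hA n (hgt n hn)).2 x).trans ?_
    have := hB.nonneg x
    have h2 : 0 ≤ κ * n / (n + κ) := by positivity
    nlinarith [mul_nonneg h2 this]
  have hcomm : ∀ n ≥ n₀, ∀ m ≥ n₀, Commute (A n) (A m) := fun n hn m hm =>
    (hY n hn).commute (hY m hm) (hrange n (hgt n hn)) (hrange m (hgt m hm))
  set M := √(‖B‖ / c)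
  have hM0 : 0 ≤ M := Real.sqrt_nonneg _
  have hM : ∀ n ≥ n₀, ∀ t : ℝ, 0 ≤ t → ∀ x, ‖exp (t • A n) x‖ ≤ M * ‖x‖ :=
    fun n hn t ht x => norm_exp_le hB (hneg n hn) x ht
  have hAlim : ∀ p ∈ G, Tendsto (fun n => A n p.1) atTop (𝓝 (-p.2)) := fun p hp =>
    tendsto_yosida hB hdiss0 (fun n hn _ => hY n hn) (fun n hn _ => hrange n (hgt n hn)) hdense hp
  have hlim : ∀ t : ℝ, ∃ S : X →L[ℝ] X, 0 ≤ t →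
      ∀ x, Tendsto (fun n => exp (t • A n) x) atTop (𝓝 (S x)) := by
    intro t
    by_cases ht : 0 ≤ t
    swap
    · exact ⟨0, fun h => absurd h ht⟩
    obtain ⟨S, hS⟩ := exists_limit_of_dense (F := fun n => exp (t • A n)) (M := M)
      (D := Prod.fst '' (G : Set (X × X)))
      ((eventually_ge_atTop n₀).mono fun n hn x => hM n hn t ht x)
      (fun x ε hε => by
        obtain ⟨p, hp, hpx⟩ := hdense x ε hε
        exact ⟨p.1, ⟨p, hp, rfl⟩, hpx⟩)
      (by
        rintro _ ⟨p, hp, rfl⟩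
        rw [Metric.cauchySeq_iff]
        intro ε hε
        obtain ⟨N, hN⟩ := Metric.cauchySeq_iff.1 (hAlim p hp).cauchySeq (ε / (M ^ 2 * t + 1))
          (by positivity)
        refine ⟨max N n₀, fun m hm n hn => ?_⟩
        have h1 := hN m (le_of_max_le_left hm) n (le_of_max_le_left hn)
        rw [dist_eq_norm] at h1 ⊢
        -- The exponentials of two commuting Yosida approximations differ by at most a multiple of
        -- `t ‖A_m x - A_n x‖`, and `A_n x` converges on the domain.
        have h2 := norm_exp_sub_exp_le hB (hneg m (le_of_max_le_right hm))
          (hneg n (le_of_max_le_right hn))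
          (hcomm m (le_of_max_le_right hm) n (le_of_max_le_right hn)) p.1 ht
        rw [lt_div_iff₀ (by positivity)] at h1
        nlinarith [norm_nonneg (A m p.1 - A n p.1)])
    exact ⟨S, fun _ => hS⟩
  choose T hT using hlim
  have hTM : ∀ t, 0 ≤ t → ∀ x, ‖T t x‖ ≤ M * ‖x‖ := fun t ht x =>
    le_of_tendsto (hT t ht x).norm ((eventually_ge_atTop n₀).mono fun n hn => hM n hn t ht x)
  have hTB : ∀ t, 0 ≤ t → ∀ x, B (T t x) (T t x) ≤ Real.exp (-(2 * κ) * t) * B x x := by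
    intro t ht x
    have h1 : Tendsto (fun n => B (exp (t • A n) x) (exp (t • A n) x)) atTop
        (𝓝 (B (T t x) (T t x))) :=
      tendsto_form (hT t ht x) (hT t ht x)
    have h2 : Tendsto (fun n : ℕ => κ * n / (n + κ)) atTop (𝓝 κ) := by
      have h3 : Tendsto (fun n : ℕ => (n : ℝ) / (n + κ)) atTop (𝓝 1) :=
        tendsto_natCast_div_add_atTop κ
      simpa [mul_div_assoc] using h3.const_mul κ
    have h4 : Tendsto (fun n : ℕ => Real.exp (-(2 * (κ * n / (n + κ))) * t) * B x x) atTop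
        (𝓝 (Real.exp (-(2 * κ) * t) * B x x)) :=
      ((Real.continuous_exp.tendsto _).comp (((h2.const_mul 2).neg).mul_const t)).mul_const _
    refine le_of_tendsto_of_tendsto h1 h4 ((eventually_ge_atTop n₀).mono fun n hn => ?_)
    exact form_exp_le hB (hA n (hgt n hn)).2 x ht
  have hzero : T 0 = ContinuousLinearMap.id ℝ X := by
    ext x
    refine tendsto_nhds_unique (hT 0 le_rfl x) ?_
    simp
  have hadd : ∀ s t : ℝ, 0 ≤ s → 0 ≤ t → T (s + t) = (T s).comp (T t) := by
    intro s t hs ht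
    ext x
    refine tendsto_nhds_unique (hT (s + t) (by positivity) x) ?_
    have h1 : Tendsto (fun n => exp (s • A n) (exp (t • A n) x - T t x)) atTop (𝓝 0) := by
      refine squeeze_zero_norm' ((eventually_ge_atTop n₀).mono fun n hn => hM n hn s hs _) ?_
      have : Tendsto (fun n => M * ‖exp (t • A n) x - T t x‖) atTop (𝓝 (M * ‖T t x - T t x‖)) :=
        (((hT t ht x).sub_const _).norm).const_mul M
      simpa using this
    have h2 := h1.add (hT s hs (T t x))
    rw [zero_add] at h2
    refine h2.congr fun n => ?_
    let := NormedAlgebra.restrictScalars ℚ ℝ (X →L[ℝ] X)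
    rw [add_smul, exp_add_of_commute ((Commute.refl (A n)).smul_left s |>.smul_right t), map_sub]
    simp
  -- equicontinuity at time zero
  have hequi : ∀ y : X, ∀ ε > 0, ∃ δ > (0 : ℝ), ∃ N, ∀ n ≥ N, ∀ s : ℝ, 0 ≤ s → s ≤ δ →
      ‖exp (s • A n) y - y‖ ≤ ε := by
    intro y ε hε
    obtain ⟨p, hp, hpy⟩ := hdense y (ε / (2 * (M + 1))) (by positivity)
    have hK : ∀ᶠ n in atTop, ‖A n p.1‖ < ‖p.2‖ + 1 := by
      have := (hAlim p hp).norm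
      rw [norm_neg] at this
      exact this.eventually (gt_mem_nhds (by linarith))
    obtain ⟨N, hN⟩ := hK.exists_forall_of_atTop
    refine ⟨ε / (2 * (M * (‖p.2‖ + 1) + 1)), by positivity, max N n₀, fun n hn s hs hsδ => ?_⟩
    have hn' := le_of_max_le_right hn
    have h1 : ‖exp (s • A n) p.1 - p.1‖ ≤ M * (‖p.2‖ + 1) * s := by
      have hd : ∀ r ∈ Set.Icc 0 s, HasDerivWithinAt (fun r => exp (r • A n) p.1)
          (exp (r • A n) (A n p.1)) (Set.Icc 0 s) r := fun r _ =>
        (hasDerivAt_exp_smul_apply (A n) p.1 r).hasDerivWithinAt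
      have := norm_image_sub_le_of_norm_deriv_le_segment' hd (C := M * (‖p.2‖ + 1))
        (fun r hr => (hM n hn' r hr.1 _).trans
          (by gcongr; exact (hN n (le_of_max_le_left hn)).le)) s ⟨hs, le_rfl⟩
      simpa using this
    have h2 : exp (s • A n) y - y =
        exp (s • A n) (y - p.1) - (y - p.1) + (exp (s • A n) p.1 - p.1) := by
      rw [map_sub]; abel
    have h3 : (M + 1) * ‖y - p.1‖ ≤ ε / 2 := by
      have h10 : (M + 1) * ‖y - p.1‖ ≤ (M + 1) * (ε / (2 * (M + 1))) := by gcongr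
      have h11 : (M + 1) * (ε / (2 * (M + 1))) = ε / 2 := by field_simp
      linarith
    have h4 : M * (‖p.2‖ + 1) * s ≤ ε / 2 := by
      have h5 := (le_div_iff₀ (by positivity)).1 hsδ
      nlinarith
    rw [h2]
    calc _ ≤ ‖exp (s • A n) (y - p.1) - (y - p.1)‖ + ‖exp (s • A n) p.1 - p.1‖ := norm_add_le _ _
      _ ≤ (‖exp (s • A n) (y - p.1)‖ + ‖y - p.1‖) + ‖exp (s • A n) p.1 - p.1‖ := by
          gcongr; exact norm_sub_le _ _
      _ ≤ ε := by linarith [hM n hn' s hs (y - p.1)]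
  have hcont : ∀ x : X, Tendsto (fun t => T t x) (𝓝[>] 0) (𝓝 x) := by
    intro x
    rw [Metric.tendsto_nhdsWithin_nhds]
    intro ε hε
    obtain ⟨δ, hδ, N, hN⟩ := hequi x (ε / 2) (by positivity)
    refine ⟨δ, hδ, fun t ht htδ => ?_⟩
    rw [dist_eq_norm]
    have ht0 : (0 : ℝ) ≤ t := le_of_lt ht
    rw [Real.dist_0_eq_abs, abs_of_nonneg ht0] at htδ
    refine lt_of_le_of_lt ?_ (half_lt_self hε)
    exact le_of_tendsto ((hT t ht0 x).sub_const x).norm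
      ((eventually_ge_atTop N).mono fun n hn => hN n hn t ht0 htδ.le)
  have hgen : ∀ x y : X, (x, y) ∈ G →
      Tendsto (fun t : ℝ => t⁻¹ • (T t x - x)) (𝓝[>] 0) (𝓝 (-y)) := by
    intro x y hxy
    rw [Metric.tendsto_nhdsWithin_nhds]
    intro ε hε
    obtain ⟨δ, hδ, N, hN⟩ := hequi y (ε / 2) (by positivity)
    refine ⟨δ, hδ, fun t ht htδ => ?_⟩
    have ht' : (0 : ℝ) < t := ht
    rw [Real.dist_0_eq_abs, abs_of_pos ht'] at htδ
    -- Adding `r y` makes the derivative `e^{rA_n}(A_n x + y) - (e^{rA_n} y - y)`: the first term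
    -- disappears as `n → ∞`, the second is small by equicontinuity at time zero.
    have h1 : ∀ n ≥ max N n₀, ‖exp (t • A n) x - x + t • y‖ ≤ (M * ‖A n x + y‖ + ε / 2) * t := by
      intro n hn
      have hd : ∀ r ∈ Set.Icc 0 t, HasDerivWithinAt (fun r : ℝ => exp (r • A n) x + r • y)
          (exp (r • A n) (A n x + y) - (exp (r • A n) y - y)) (Set.Icc 0 t) r := by
        intro r _
        refine (((hasDerivAt_exp_smul_apply (A n) x r).add
          ((hasDerivAt_id r).smul_const y)).congr_deriv ?_).hasDerivWithinAt
        rw [map_add, one_smul]; abel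
      have := norm_image_sub_le_of_norm_deriv_le_segment' hd (C := M * ‖A n x + y‖ + ε / 2)
        (fun r hr => (norm_sub_le _ _).trans (add_le_add (hM n (le_of_max_le_right hn) r hr.1 _)
          (hN n (le_of_max_le_left hn) r hr.1 (hr.2.le.trans htδ.le)))) t ⟨ht'.le, le_rfl⟩
      simpa [add_sub_right_comm] using this
    have h2 : ‖T t x - x + t • y‖ ≤ (M * ‖-y + y‖ + ε / 2) * t := by
      refine le_of_tendsto_of_tendsto (((hT t ht'.le x).sub_const x).add_const (t • y)).norm
        (((((hAlim _ hxy).add_const y).norm.const_mul M).add_const (ε / 2)).mul_const t)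
        ((eventually_ge_atTop _).mono h1)
    rw [neg_add_cancel, norm_zero, mul_zero, zero_add] at h2
    have h3 : t⁻¹ • (T t x - x) - -y = t⁻¹ • (T t x - x + t • y) := by
      rw [smul_add, smul_smul, inv_mul_cancel₀ ht'.ne', one_smul, sub_neg_eq_add]
    rw [dist_eq_norm, h3, norm_smul, norm_inv, Real.norm_eq_abs, abs_of_pos ht',
      inv_mul_lt_iff₀ ht']
    nlinarith
  refine ⟨T, A, ⟨⟨hzero, hadd, hcont⟩, fun h y => ⟨fun hy => ?_, hgen h y⟩⟩, hTB,
    fun n hn => (hA n hn).1, hT⟩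
  -- Conversely, the generator is no larger than the graph. Solving the resolvent equation with
  -- datum `(l₀ + 1) h + y` inside the graph leaves a difference `w` which would be an eigenvector
  -- of the generator with eigenvalue `l₀ + 1 > 0`; contractivity excludes this unless `w = 0`.
  have hl1 : 0 < l₀ + 1 := by positivity
  obtain ⟨⟨x, z⟩, hxz, hf⟩ := hrange (l₀ + 1) (by linarith) ((l₀ + 1) • h + y)
  simp only at hf
  have hw : Tendsto (fun t : ℝ => t⁻¹ • (T t (h - x) - (h - x))) (𝓝[>] 0)
      (𝓝 ((l₀ + 1) • (h - x))) := by
    have h1 := hy.sub (hgen x z hxz)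
    have h2 : -y - -z = (l₀ + 1) • (h - x) := by
      have : z = (l₀ + 1) • h + y - (l₀ + 1) • x := by rw [← hf]; abel
      rw [this, smul_sub]; abel
    rw [h2] at h1
    refine h1.congr fun t => ?_
    rw [← smul_sub, map_sub]
    congr 1
    abel
  set w := h - x with hwdef
  -- This is `B(T_t w, T_t w) ≤ B(w, w)` with `T_t w = w + t e` expanded and divided by `t`. In the
  -- limit it forces `2 (l₀ + 1) B(w, w) ≤ 0`.
  have hineq : ∀ᶠ t : ℝ in 𝓝[>] 0, 2 * B (t⁻¹ • (T t w - w)) w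
      + t * B (t⁻¹ • (T t w - w)) (t⁻¹ • (T t w - w)) ≤ 0 := by
    filter_upwards [self_mem_nhdsWithin] with t ht
    have ht' : (0 : ℝ) < t := ht
    set e := t⁻¹ • (T t w - w) with he
    have h1 : T t w = w + t • e := by
      rw [he, smul_smul, mul_inv_cancel₀ ht'.ne', one_smul]; abel
    have h2 := hTB t ht'.le w
    have h3 : Real.exp (-(2 * κ) * t) ≤ 1 := Real.exp_le_one_iff.2 (by
      have : 0 ≤ κ * t := by positivity
      linarith)
    have h4 := hB.nonneg w
    have h5 : B (w + t • e) (w + t • e) ≤ B w w := by rw [← h1]; nlinarith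
    simp only [map_add, map_smul, add_apply, smul_apply, smul_eq_mul, hB.symm w e] at h5
    have h6 : t * (2 * B e w + t * B e e) ≤ 0 := by nlinarith
    by_contra hcon
    push Not at hcon
    exact absurd h6 (not_le.2 (mul_pos ht' hcon))
  have hlim2 : Tendsto (fun t : ℝ => 2 * B (t⁻¹ • (T t w - w)) w
      + t * B (t⁻¹ • (T t w - w)) (t⁻¹ • (T t w - w))) (𝓝[>] 0)
      (𝓝 (2 * B ((l₀ + 1) • w) w + 0 * B ((l₀ + 1) • w) ((l₀ + 1) • w))) := by
    refine ((tendsto_form hw tendsto_const_nhds).const_mul 2).add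
      (Tendsto.mul (tendsto_nhdsWithin_of_tendsto_nhds tendsto_id) (tendsto_form hw hw))
  have h7 := le_of_tendsto hlim2 hineq
  simp only [map_smul, smul_apply, smul_eq_mul, zero_mul, add_zero] at h7
  have hw0 : w = 0 := hB.eq_zero (by nlinarith)
  have hhx : h = x := sub_eq_zero.1 hw0
  have hyz : z = y := by rw [hhx] at hf; exact add_left_cancel hf
  rw [hhx, ← hyz]
  exact hxz

/-- `P` intertwines all powers, hence the exponential series term by term. -/
lemma map_exp_smul_of_intertwine {Y : Type*} [NormedAddCommGroup Y] [NormedSpace ℝ Y]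
    [CompleteSpace Y] (P : X →L[ℝ] Y) {A : X →L[ℝ] X} {A' : Y →L[ℝ] Y} (h : ∀ x, P (A x) = A' (P x)) (t : ℝ) (x : X) :
    P (exp (t • A) x) = exp (t • A') (P x) := by
  have hpow : ∀ n : ℕ, ∀ x, P ((A ^ n) x) = (A' ^ n) (P x) := by
    intro n
    induction n with
    | zero => intro x; simp
    | succ k ih => intro x; rw [pow_succ, pow_succ, mul_apply_eq_comp, mul_apply_eq_comp, ih, h]
  have h1 := (exp_series_hasSum_exp' (𝕂 := ℝ) (t • A))
  have h2 := (exp_series_hasSum_exp' (𝕂 := ℝ) (t • A'))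
  have h3 := h1.mapL (P.comp (ContinuousLinearMap.apply ℝ X x))
  have h4 := h2.mapL (ContinuousLinearMap.apply ℝ Y (P x))
  refine h3.unique ?_
  convert h4 using 1
  · ext n
    rw [smul_pow, smul_pow]
    change P ((_ : ℝ) • t ^ n • (A ^ n) x) = (_ : ℝ) • t ^ n • (A' ^ n) (P x)
    rw [map_smul, map_smul, hpow]
  · rfl

end Generation

/-! ### Differential calculus on the phase space through its Euclidean cover -/

section Calculus

variable {d m : ℕ} {Q : Type} [AddCommGroup Q] {π : Euc d →+ Q}

lemma cover_add (π : Euc d →+ Q) (x y : Phase d m (Euc d)) :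
    cover π (x + y) = cover π x + cover π y := by
  ext <;> simp [cover]

@[simp] lemma cover_zero (π : Euc d →+ Q) : cover π (0 : Phase d m (Euc d)) = 0 := by
  simp [cover]

lemma cover_neg (π : Euc d →+ Q) (x : Phase d m (Euc d)) : cover π (-x) = -cover π x := by
  ext <;> simp [cover]

lemma cover_sub (π : Euc d →+ Q) (x y : Phase d m (Euc d)) :
    cover π (x - y) = cover π x - cover π y := by
  ext <;> simp [cover]

lemma isOpenQuotientMap_cover [TopologicalSpace Q] (hπ : IsOpenQuotientMap π) :
    IsOpenQuotientMap (cover π : Phase d m (Euc d) → Phase d m Q) :=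
  hπ.prodMap IsOpenQuotientMap.id

/-- The coordinates of a tangent vector. -/
def coord (v : Phase d m (Euc d)) : Coord d m → ℝ
  | .inl i => v.1 i
  | .inr (.inl i) => v.2.1 i
  | .inr (.inr (j, i)) => v.2.2 j i

lemma sum_coord_smul (v : Phase d m (Euc d)) : ∑ k, coord v k • unitVec k = v := by
  rw [Fintype.sum_sum_type, Fintype.sum_sum_type, Fintype.sum_prod_type]
  ext i
  · simp [coord, unitVec, Prod.fst_sum, Pi.single_apply]
  · simp [coord, unitVec, Prod.fst_sum, Prod.snd_sum, Pi.single_apply]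
  · simp [coord, unitVec, Prod.snd_sum, Finset.sum_apply, Pi.single_apply, apply_ite,
      Finset.sum_ite_eq]

lemma abs_coord_le (v : Phase d m (Euc d)) (k : Coord d m) : |coord v k| ≤ ‖v‖ := by
  rcases k with i | i | ⟨j, i⟩
  · exact (PiLp.norm_apply_le v.1 i).trans (norm_fst_le v)
  · exact (PiLp.norm_apply_le v.2.1 i).trans ((norm_fst_le v.2).trans (norm_snd_le v))
  · exact (PiLp.norm_apply_le (v.2.2 j) i).trans
      ((norm_le_pi_norm v.2.2 j).trans ((norm_snd_le v.2).trans (norm_snd_le v)))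

lemma norm_unitVec_le (k : Coord d m) : ‖(unitVec k : Phase d m (Euc d))‖ ≤ 1 := by
  rcases k with i | i | ⟨j, i⟩
  · simp [unitVec, Prod.norm_def]
  · simp [unitVec, Prod.norm_def]
  · simp only [unitVec, Prod.norm_def, norm_zero]
    rw [Pi.norm_single]
    simp

lemma coord_unitVec (k l : Coord d m) :
    coord (unitVec k : Phase d m (Euc d)) l = if l = k then 1 else 0 := by
  rcases k with i | i | ⟨j, i⟩ <;> rcases l with i' | i' | ⟨j', i'⟩
  · simp [coord, unitVec]
  · simp [coord, unitVec]
  · simp [coord, unitVec]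
  · simp [coord, unitVec]
  · simp [coord, unitVec]
  · simp [coord, unitVec]
  · simp [coord, unitVec]
  · simp [coord, unitVec]
  · by_cases h : j' = j
    · subst h
      simp [coord, unitVec]
    · simp [coord, unitVec, h]

/-- The lift of `F` to Euclidean space is continuously differentiable of order `n`. -/
def IsCn (π : Euc d →+ Q) (n : ℕ∞ω) (F : Phase d m Q → ℝ) : Prop :=
  ContDiff ℝ n fun x : Phase d m (Euc d) => F (cover π x)

namespace IsCn

variable {n n' : ℕ∞ω} {F G : Phase d m Q → ℝ}

lemma of_le (h : IsCn π n F) (hn : n' ≤ n) : IsCn π n' F := ContDiff.of_le h hn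

lemma add (hF : IsCn π n F) (hG : IsCn π n G) : IsCn π n fun x => F x + G x := ContDiff.add hF hG

lemma sub (hF : IsCn π n F) (hG : IsCn π n G) : IsCn π n fun x => F x - G x := ContDiff.sub hF hG

lemma mul (hF : IsCn π n F) (hG : IsCn π n G) : IsCn π n fun x => F x * G x := ContDiff.mul hF hG

lemma const (c : ℝ) : IsCn π n fun _ : Phase d m Q => c := contDiff_const

lemma sum {ι : Type*} {s : Finset ι} {F : ι → Phase d m Q → ℝ} (h : ∀ i ∈ s, IsCn π n (F i)) :
    IsCn π n fun x => ∑ i ∈ s, F i x := ContDiff.sum h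

lemma continuous [TopologicalSpace Q] (hπ : IsOpenQuotientMap π) (h : IsCn π n F) :
    Continuous F :=
  (isOpenQuotientMap_cover hπ).continuous_comp_iff.1 (ContDiff.continuous h)

lemma hasFDerivAt (h : IsCn π n F) (hn : n ≠ 0) (x : Phase d m (Euc d)) :
    HasFDerivAt (fun x => F (cover π x)) (fderiv ℝ (fun x => F (cover π x)) x) x :=
  ((ContDiff.differentiable h hn) x).hasFDerivAt

lemma pderiv_cover (h : IsCn π n F) (hn : n ≠ 0) (k : Coord d m) (x : Phase d m (Euc d)) :
    pderiv π k F (cover π x) = fderiv ℝ (fun x => F (cover π x)) x (unitVec k) := by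
  have h1 : HasDerivAt (fun s : ℝ => x + s • unitVec k) (unitVec k) 0 := by
    simpa using ((hasDerivAt_id (0 : ℝ)).smul_const (unitVec k)).const_add x
  have h2 := (h.hasFDerivAt hn (x + (0 : ℝ) • unitVec k)).comp_hasDerivAt 0 h1
  have h3 : (fun s : ℝ => F (cover π x + cover π (s • unitVec k))) =
      (fun x => F (cover π x)) ∘ fun s : ℝ => x + s • unitVec k := by
    ext s; simp [cover_add]
  rw [pderiv, h3, h2.deriv]
  simp

lemma pderiv (h : IsCn π n F) (hn : n' + 1 ≤ n) (k : Coord d m) : IsCn π n' (pderiv π k F) := by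
  have hn0 : n ≠ 0 := by
    rintro rfl
    exact absurd (le_trans le_add_self hn) (by simp)
  have h1 : (fun x => GLE.pderiv π k F (cover π x)) =
      fun x => fderiv ℝ (fun x => F (cover π x)) x (unitVec k) :=
    funext fun x => h.pderiv_cover hn0 k x
  unfold IsCn
  rw [h1]
  exact (ContDiff.fderiv_right h hn).clm_apply contDiff_const

lemma fderiv_apply (h : IsCn π n F) (hn : n ≠ 0) (x v : Phase d m (Euc d)) :
    fderiv ℝ (fun x => F (cover π x)) x v = ∑ k, coord v k * GLE.pderiv π k F (cover π x) := by
  conv_lhs => rw [← sum_coord_smul v]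
  simp [h.pderiv_cover hn]

/-- No differentiability is needed: over a field, `deriv` commutes with constant factors
unconditionally. -/
lemma pderiv_const_mul (c : ℝ) (k : Coord d m) (x : Phase d m Q) :
    GLE.pderiv π k (fun x => c * F x) x = c * GLE.pderiv π k F x := by
  unfold GLE.pderiv
  exact deriv_const_mul_field c

lemma pderiv_const (c : ℝ) (k : Coord d m) (x : Phase d m Q) :
    GLE.pderiv π k (fun _ => c) x = 0 := by
  unfold GLE.pderiv
  exact deriv_const _ _

variable [TopologicalSpace Q]

/-- The derivative of `F` along a line. -/
lemma hasDerivAt_line (h : IsCn π n F) (hπ : IsOpenQuotientMap π) (hn : n ≠ 0) (x : Phase d m Q)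
    (v : Phase d m (Euc d)) (s : ℝ) :
    HasDerivAt (fun s : ℝ => F (x + cover π (s • v)))
      (∑ k, coord v k * GLE.pderiv π k F (x + cover π (s • v))) s := by
  obtain ⟨y, rfl⟩ := (isOpenQuotientMap_cover hπ).surjective x
  have h1 : HasDerivAt (fun s : ℝ => y + s • v) v s := by
    simpa using ((hasDerivAt_id s).smul_const v).const_add y
  have h2 := (h.hasFDerivAt hn (y + s • v)).comp_hasDerivAt s h1
  rw [h.fderiv_apply hn] at h2
  simpa only [cover_add, Function.comp_def] using h2

lemma hasDerivAt (h : IsCn π n F) (hπ : IsOpenQuotientMap π) (hn : n ≠ 0) (k : Coord d m)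
    (x : Phase d m Q) (s : ℝ) :
    HasDerivAt (fun s : ℝ => F (x + cover π (s • unitVec k)))
      (GLE.pderiv π k F (x + cover π (s • unitVec k))) s := by
  have := h.hasDerivAt_line hπ hn x (unitVec k) s
  simpa [coord_unitVec] using this

lemma hasDerivAt_zero (h : IsCn π n F) (hπ : IsOpenQuotientMap π) (hn : n ≠ 0) (k : Coord d m)
    (x : Phase d m Q) :
    HasDerivAt (fun s : ℝ => F (x + cover π (s • unitVec k))) (GLE.pderiv π k F x) 0 := by
  simpa using h.hasDerivAt hπ hn k x 0

lemma pderiv_add (hF : IsCn π n F) (hG : IsCn π n G) (hπ : IsOpenQuotientMap π) (hn : n ≠ 0)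
    (k : Coord d m) (x : Phase d m Q) :
    GLE.pderiv π k (fun x => F x + G x) x = GLE.pderiv π k F x + GLE.pderiv π k G x :=
  ((hF.hasDerivAt_zero hπ hn k x).add (hG.hasDerivAt_zero hπ hn k x)).deriv

lemma pderiv_sub (hF : IsCn π n F) (hG : IsCn π n G) (hπ : IsOpenQuotientMap π) (hn : n ≠ 0)
    (k : Coord d m) (x : Phase d m Q) :
    GLE.pderiv π k (fun x => F x - G x) x = GLE.pderiv π k F x - GLE.pderiv π k G x :=
  ((hF.hasDerivAt_zero hπ hn k x).sub (hG.hasDerivAt_zero hπ hn k x)).deriv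

lemma pderiv_mul (hF : IsCn π n F) (hG : IsCn π n G) (hπ : IsOpenQuotientMap π) (hn : n ≠ 0)
    (k : Coord d m) (x : Phase d m Q) :
    GLE.pderiv π k (fun x => F x * G x) x =
      GLE.pderiv π k F x * G x + F x * GLE.pderiv π k G x := by
  exact ((hF.hasDerivAt_zero hπ hn k x).fun_mul (hG.hasDerivAt_zero hπ hn k x)).deriv.trans
    (by simp)

lemma pderiv_sum {ι : Type*} {s : Finset ι} {F : ι → Phase d m Q → ℝ}
    (h : ∀ i ∈ s, IsCn π n (F i)) (hπ : IsOpenQuotientMap π) (hn : n ≠ 0) (k : Coord d m)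
    (x : Phase d m Q) :
    GLE.pderiv π k (fun x => ∑ i ∈ s, F i x) x = ∑ i ∈ s, GLE.pderiv π k (F i) x :=
  (HasDerivAt.fun_sum fun i hi => (h i hi).hasDerivAt_zero hπ hn k x).deriv

/-- Both sides are values of the second derivative of the lift to Euclidean space, which is
symmetric. -/
lemma pderiv_comm (h : IsCn π n F) (hπ : IsOpenQuotientMap π) (hn : 2 ≤ n) (k l : Coord d m)
    (x : Phase d m Q) :
    GLE.pderiv π k (GLE.pderiv π l F) x = GLE.pderiv π l (GLE.pderiv π k F) x := by
  obtain ⟨y, rfl⟩ := (isOpenQuotientMap_cover hπ).surjective x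
  have hn0 : n ≠ 0 := by rintro rfl; exact absurd hn (by simp)
  have h2 : IsCn π 2 F := h.of_le hn
  have key : ∀ k l : Coord d m, GLE.pderiv π k (GLE.pderiv π l F) (cover π y) =
      fderiv ℝ (fderiv ℝ fun x => F (cover π x)) y (unitVec k) (unitVec l) := by
    intro k l
    have h1 : IsCn π 1 (GLE.pderiv π l F) := h2.pderiv (by norm_num) l
    rw [h1.pderiv_cover one_ne_zero k]
    have h3 : (fun x => GLE.pderiv π l F (cover π x)) =
      fun x => fderiv ℝ (fun x => F (cover π x)) x (unitVec l) :=
      funext fun x => h.pderiv_cover hn0 l x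
    rw [h3]
    have h4 : DifferentiableAt ℝ (fderiv ℝ fun x => F (cover π x)) y :=
      (ContDiff.fderiv_right (m := 1) h2 (by norm_num)).differentiable one_ne_zero y
    rw [fderiv_clm_apply h4 (differentiableAt_const _)]
    simp
  rw [key, key]
  have hs : IsSymmSndFDerivAt ℝ (fun x => F (cover π x)) y :=
    ContDiffAt.isSymmSndFDerivAt (ContDiff.contDiffAt h2) (by simp)
  exact hs (unitVec k) (unitVec l)

/-- The mean value inequality along `s ↦ x + π(s v)`. It serves as a Lipschitz estimate without any
metric on `Q`. -/
lemma abs_line_sub_le (h : IsCn π n F) (hπ : IsOpenQuotientMap π) (hn : n ≠ 0) {C : ℝ}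
    (hC : ∀ k x, |GLE.pderiv π k F x| ≤ C) (x : Phase d m Q) (v : Phase d m (Euc d)) :
    |F (x + cover π v) - F x| ≤ Fintype.card (Coord d m) * C * ‖v‖ := by
  have h1 := norm_image_sub_le_of_norm_deriv_le_segment_01'
    (fun s _ => (h.hasDerivAt_line hπ hn x v s).hasDerivWithinAt)
    (C := Fintype.card (Coord d m) * C * ‖v‖) (fun s _ => ?_)
  · simpa using h1
  · refine (norm_sum_le _ _).trans ?_
    refine (Finset.sum_le_sum (g := fun _ => C * ‖v‖) fun k _ => ?_).trans (by simp [mul_assoc])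
    rw [norm_mul, mul_comm]
    exact mul_le_mul (hC _ _) (abs_coord_le v k) (norm_nonneg _) ((abs_nonneg _).trans (hC k x))

end IsCn

/-- Smooth functions all of whose derivatives are bounded. -/
def IsCb (π : Euc d →+ Q) (φ : Phase d m Q → ℝ) : Prop :=
  IsCn π ∞ φ ∧ ∀ l : List (Coord d m), ∃ C, ∀ x, |l.foldr (pderiv π) φ x| ≤ C

namespace IsCb

variable {φ ψ : Phase d m Q → ℝ}

lemma bounded (h : IsCb π φ) : ∃ C, ∀ x, |φ x| ≤ C := h.2 []

lemma pderiv (h : IsCb π φ) (k : Coord d m) : IsCb π (pderiv π k φ) :=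
  ⟨h.1.pderiv (by simp) k, fun l => by simpa using h.2 (l ++ [k])⟩

/-- Smoothness of the iterated derivatives is carried along in the induction because the next
derivative is additive only for differentiable functions. -/
lemma foldr_add [TopologicalSpace Q] (hπ : IsOpenQuotientMap π) (hφ : IsCn π ∞ φ)
    (hψ : IsCn π ∞ ψ) (a : ℝ) (l : List (Coord d m)) :
    IsCn π ∞ (l.foldr (GLE.pderiv π) φ) ∧ IsCn π ∞ (l.foldr (GLE.pderiv π) ψ) ∧
    l.foldr (GLE.pderiv π) (fun x => φ x + a * ψ x) =
      fun x => l.foldr (GLE.pderiv π) φ x + a * l.foldr (GLE.pderiv π) ψ x := by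
  induction l with
  | nil => exact ⟨hφ, hψ, rfl⟩
  | cons k l ih =>
    obtain ⟨h1, h2, h3⟩ := ih
    refine ⟨h1.pderiv (by simp) k, h2.pderiv (by simp) k, ?_⟩
    ext x
    rw [List.foldr_cons, h3, h1.pderiv_add ((IsCn.const a).mul h2) hπ (by simp) k x,
      IsCn.pderiv_const_mul]
    rfl

/-- One combination covers both sums (`a = 1`) and scalar multiples (`ψ = φ`), as used for all the
submodules of smooth functions below. -/
lemma add_mul [TopologicalSpace Q] (hπ : IsOpenQuotientMap π) (hφ : IsCb π φ) (hψ : IsCb π ψ)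
    (a : ℝ) : IsCb π fun x => φ x + a * ψ x := by
  refine ⟨hφ.1.add ((IsCn.const a).mul hψ.1), fun l => ?_⟩
  obtain ⟨C, hC⟩ := hφ.2 l
  obtain ⟨C', hC'⟩ := hψ.2 l
  refine ⟨C + |a| * C', fun x => ?_⟩
  rw [(foldr_add hπ hφ.1 hψ.1 a l).2.2]
  refine (abs_add_le _ _).trans (add_le_add (hC x) ?_)
  rw [abs_mul]
  exact mul_le_mul_of_nonneg_left (hC' x) (abs_nonneg _)

lemma const [TopologicalSpace Q] (c : ℝ) : IsCb π fun _ : Phase d m Q => c := by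
  refine ⟨IsCn.const c, fun l => ?_⟩
  have : ∃ c', l.foldr (GLE.pderiv π) (fun _ : Phase d m Q => c) = fun _ => c' := by
    induction l with
    | nil => exact ⟨c, rfl⟩
    | cons k l ih =>
      obtain ⟨c', h⟩ := ih
      refine ⟨0, ?_⟩
      rw [List.foldr_cons, h]
      ext x
      exact IsCn.pderiv_const c' k x
  obtain ⟨c', h⟩ := this
  exact ⟨|c'|, fun x => by rw [h]⟩

end IsCb

namespace IsTest

variable [TopologicalSpace Q] {φ ψ : Phase d m Q → ℝ}

lemma isCn (h : IsTest π φ) : IsCn π ∞ φ := h.1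

variable [IsTopologicalAddGroup Q]

/-- Where `φ` vanishes in a neighbourhood its difference quotients vanish too, so supports do not
grow. -/
lemma pderiv (h : IsTest π φ) (hπ : IsOpenQuotientMap π) (k : Coord d m) :
    IsTest π (pderiv π k φ) := by
  refine ⟨h.isCn.pderiv (n' := ∞) (by simp) k, h.2.mono' ?_⟩
  intro x hx
  by_contra hx'
  apply hx
  have h1 : φ =ᶠ[𝓝 x] 0 := notMem_tsupport_iff_eventuallyEq.1 hx'
  have hc : Continuous fun s : ℝ => x + cover π (s • unitVec k) :=
    continuous_const.add ((isOpenQuotientMap_cover hπ).continuous.comp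
      (continuous_id.smul continuous_const))
  have h2 : Tendsto (fun s : ℝ => x + cover π (s • unitVec k)) (𝓝 0) (𝓝 x) := by
    simpa using hc.tendsto 0
  have h3 : (fun s : ℝ => φ (x + cover π (s • unitVec k))) =ᶠ[𝓝 0] fun _ => 0 := h2.eventually h1
  rw [GLE.pderiv, h3.deriv_eq, deriv_const]

lemma isCb (h : IsTest π φ) (hπ : IsOpenQuotientMap π) : IsCb π φ := by
  refine ⟨h.1, fun l => ?_⟩
  have h1 : IsTest π (l.foldr (GLE.pderiv π) φ) := by
    induction l with
    | nil => exact h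
    | cons k l ih => exact ih.pderiv hπ k
  obtain ⟨C, hC⟩ := h1.2.exists_bound_of_continuous (h1.isCn.continuous hπ)
  exact ⟨C, hC⟩

lemma mul_left (h : IsTest π φ) (hψ : IsCn π ∞ ψ) : IsTest π fun x => φ x * ψ x :=
  ⟨h.isCn.mul hψ, h.2.mul_right⟩

end IsTest

end Calculus

/-! ### Integration by parts from translation invariance -/

section Integration

variable {d m : ℕ} {Q : Type} [AddCommGroup Q] [TopologicalSpace Q] [IsTopologicalAddGroup Q]
  [SecondCountableTopology Q] [T2Space Q] [LocallyCompactSpace Q] [MeasureSpace Q] [BorelSpace Q]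
  [(volume : Measure Q).IsAddHaarMeasure] {π : Euc d →+ Q}

instance : (volume : Measure (Fin m → Euc d)).IsAddHaarMeasure :=
  inferInstanceAs (Measure.pi fun _ => volume).IsAddHaarMeasure

instance : (volume : Measure (Euc d × (Fin m → Euc d))).IsAddHaarMeasure :=
  inferInstanceAs (Measure.prod volume volume).IsAddHaarMeasure

instance : (volume : Measure (Phase d m Q)).IsAddHaarMeasure :=
  Measure.prod.instIsAddHaarMeasure (volume : Measure Q)
    (volume : Measure (Euc d × (Fin m → Euc d)))

/-- The integral of a partial derivative vanishes. -/
lemma integral_pderiv_eq_zero (hπ : IsOpenQuotientMap π) {F : Phase d m Q → ℝ} (hF : IsCn π 1 F)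
    (hFi : Integrable F) {k : Coord d m} (hF' : Integrable (pderiv π k F)) :
    ∫ x, pderiv π k F x = 0 := by
  have hcont : Continuous (pderiv π k F) := (hF.pderiv (n' := 0) (by simp) k).continuous hπ
  have hcov : Continuous (fun s : ℝ => (cover π (s • unitVec k) : Phase d m Q)) :=
    (isOpenQuotientMap_cover hπ).continuous.comp (continuous_id.smul continuous_const)
  -- The unit increment in direction `k` is the average of translates of the derivative. Integrated
  -- over `x`, the increment gives zero by invariance of the measure, and the average gives `∫ ∂_k
  -- F` by Fubini. Integrability thus replaces any cutoff argument.
  have h1 : ∀ x : Phase d m Q, F (x + cover π (unitVec k)) - F x =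
      ∫ s in (0 : ℝ)..1, pderiv π k F (x + cover π (s • unitVec k)) := by
    intro x
    rw [intervalIntegral.integral_eq_sub_of_hasDerivAt
      (fun s _ => hF.hasDerivAt hπ one_ne_zero k x s)]
    · simp
    · exact (hcont.comp (continuous_const.add hcov)).intervalIntegrable _ _
  have h2 : ∫ x, (F (x + cover π (unitVec k)) - F x) = 0 := by
    rw [integral_sub (hFi.comp_add_right _) hFi, integral_add_right_eq_self, sub_self]
  simp_rw [h1, intervalIntegral.integral_of_le zero_le_one] at h2
  rw [integral_integral_swap] at h2
  · simpa [integral_add_right_eq_self] using h2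
  · have hm : AEStronglyMeasurable
        (Function.uncurry fun (x : Phase d m Q) (s : ℝ) => pderiv π k F (x + cover π (s • unitVec k)))
        (volume.prod (volume.restrict (Set.Ioc 0 1))) :=
      (hcont.comp (continuous_fst.add (hcov.comp continuous_snd))).aestronglyMeasurable
    rw [integrable_prod_iff' hm]
    simp only [Function.uncurry_apply_pair]
    refine ⟨Eventually.of_forall fun s => hF'.comp_add_right (cover π (s • unitVec k)), ?_⟩
    have : ∀ s : ℝ, ∫ x : Phase d m Q, ‖pderiv π k F (x + cover π (s • unitVec k))‖ =
        ∫ x, ‖pderiv π k F x‖ := fun s =>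
      integral_add_right_eq_self (μ := volume) (fun x => ‖pderiv π k F x‖) _
    simp_rw [this]
    exact integrable_const _

end Integration

/-! ### Admissible potentials, the Gibbs density and cutoff functions -/

section Weight

/-- The hypotheses on the potential shared by the torus and by the whole space. -/
structure IsAdmissible {d : ℕ} {Q : Type} [AddCommGroup Q] [TopologicalSpace Q] [MeasureSpace Q]
    (π : Euc d →+ Q) (β : ℝ) (V : Q → ℝ) : Prop where
  quot : IsOpenQuotientMap π
  pos : 0 < β
  smooth : ContDiff ℝ 2 fun q => V (π q)
  hess : ∃ C, ∀ i k q, |posDeriv π k (posDeriv π i V) q| ≤ C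
  integrable : Integrable fun q => Real.exp (-β * V q)
  bddBelow : ∃ c, ∀ q, c ≤ V q
  -- Only first derivatives need a uniform bound, since the generator is of first order in the
  -- position. The compact torus can use the constant `1`.
  cutoff : ∃ (κ : ℕ → Q → ℝ) (C : ℝ), (∀ n, ContDiff ℝ ∞ (fun q => κ n (π q)) ∧
    HasCompactSupport (κ n) ∧ (∀ q, |κ n q| ≤ 1) ∧ ∀ i q, |posDeriv π i (κ n) q| ≤ C) ∧
    ∀ q, ∀ᶠ n in atTop, ∀ᶠ q' in 𝓝 q, κ n q' = 1
  -- Each set `|∇V|² ≤ M` lies in the measure preserving image of a bounded convex set. This is the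
  -- geometric input of the Poincaré inequality; convexity is required upstairs only, so that the
  -- fundamental cube can serve for the torus.
  region : ∀ M : ℝ, ∃ (B : Set (Euc d)) (A : Set Q), Convex ℝ B ∧ Bornology.IsBounded B ∧
    B.Nonempty ∧ MeasurableSet B ∧ MeasurableSet A ∧ volume B ≠ 0 ∧
    (∀ q, ∑ i, posDeriv π i V q ^ 2 ≤ M → q ∈ A) ∧
    MeasurePreserving π (volume.restrict B) (volume.restrict A)

variable {d m : ℕ} {Q : Type} [AddCommGroup Q] [TopologicalSpace Q] [IsTopologicalAddGroup Q]
  [SecondCountableTopology Q] [T2Space Q] [LocallyCompactSpace Q] [MeasureSpace Q] [BorelSpace Q]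
  [(volume : Measure Q).IsAddHaarMeasure] {π : Euc d →+ Q}

variable {β : ℝ} {V : Q → ℝ}

/-- The partial derivatives of the Hamiltonian `V(q) + |p|²/2 + |z|²/2`. -/
def gradH (π : Euc d →+ Q) (V : Q → ℝ) (k : Coord d m) (x : Phase d m Q) : ℝ :=
  match k with
  | .inl i => posDeriv π i V x.1
  | .inr (.inl i) => x.2.1 i
  | .inr (.inr (j, i)) => x.2.2 j i

/-- The Hamiltonian. -/
def ham (V : Q → ℝ) (x : Phase d m Q) : ℝ :=
  V x.1 + ‖x.2.1‖ ^ 2 / 2 + (∑ j, ‖x.2.2 j‖ ^ 2) / 2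

lemma pderiv_pos (i : Fin d) (f : Q → ℝ) (x : Phase d m Q) :
    pderiv π (.inl i) (fun x => f x.1) x = posDeriv π i f x.1 := by
  simp [pderiv, posDeriv, cover, unitVec]

lemma pderiv_pos_inr (k : Fin d ⊕ (Fin m × Fin d)) (f : Q → ℝ) (x : Phase d m Q) :
    pderiv π (.inr k) (fun x => f x.1) x = 0 := by
  have h : (fun s : ℝ => f ((x + cover π (s • unitVec (.inr k))).1)) = fun _ => f x.1 := by
    ext s
    rcases k with i | ⟨j, i⟩ <;> simp [cover, unitVec]
  rw [pderiv, h, deriv_const]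

lemma exists_bump_with_bounds {F ι : Type*} [NormedAddCommGroup F] [NormedSpace ℝ F]
    [FiniteDimensional ℝ F] [Fintype ι] (e : ι → F) : ∃ (ψ : F → ℝ) (C : ℝ), ContDiff ℝ ∞ ψ ∧
    HasCompactSupport ψ ∧ 0 ≤ C ∧ (∀ y, |ψ y| ≤ 1) ∧ (∀ k y, |fderiv ℝ ψ y (e k)| ≤ C) ∧
    (∀ k y, |fderiv ℝ (fun y => fderiv ℝ ψ y (e k)) y (e k)| ≤ C) ∧ ∀ y, ‖y‖ ≤ 1 → ψ y = 1 := by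
  obtain ⟨ψ, hψ, hψs, hψ1, hψone⟩ : ∃ ψ : F → ℝ, ContDiff ℝ ∞ ψ ∧ HasCompactSupport ψ ∧
      (∀ y, |ψ y| ≤ 1) ∧ ∀ y, ‖y‖ ≤ 1 → ψ y = 1 := by
    -- Introduced by `have`, the bump forgets its radii; dilating by `φ.rIn` recovers a function
    -- equal to one on the unit ball.
    have φ : ContDiffBump (0 : F) := ⟨1, 2, one_pos, one_lt_two⟩
    refine ⟨fun y => φ (φ.rIn • y), φ.contDiff.comp (contDiff_const_smul _),
      φ.hasCompactSupport.comp_smul φ.rIn_pos.ne', fun y => ?_, fun y hy => ?_⟩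
    · rw [abs_of_nonneg φ.nonneg]
      exact φ.le_one
    · refine φ.one_of_mem_closedBall (mem_closedBall_zero_iff.2 ?_)
      rw [norm_smul, Real.norm_eq_abs, abs_of_pos φ.rIn_pos]
      exact mul_le_of_le_one_right φ.rIn_pos.le hy
  have hd : ∀ f : F → ℝ, ContDiff ℝ ∞ f → ∀ v, ContDiff ℝ ∞ fun y => fderiv ℝ f y v :=
    fun f hf v => (hf.fderiv_right (by simp)).clm_apply contDiff_const
  have hs : ∀ f : F → ℝ, HasCompactSupport f → ∀ v, HasCompactSupport fun y => fderiv ℝ f y v :=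
    fun f hf v => hf.fderiv_apply (𝕜 := ℝ) v
  choose C₁ hC₁ using fun k => (hs ψ hψs (e k)).exists_bound_of_continuous (hd ψ hψ (e k)).continuous
  choose C₂ hC₂ using fun k => (hs _ (hs ψ hψs (e k)) (e k)).exists_bound_of_continuous
    (hd _ (hd ψ hψ (e k)) (e k)).continuous
  refine ⟨ψ, ∑ k, (|C₁ k| + |C₂ k|), hψ, hψs, by positivity, hψ1, fun k y => ?_, fun k y => ?_,
    hψone⟩
  · refine (hC₁ k y).trans (le_trans ?_ (Finset.single_le_sum (f := fun k => |C₁ k| + |C₂ k|)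
      (fun k _ => by positivity) (Finset.mem_univ k)))
    linarith [le_abs_self (C₁ k), abs_nonneg (C₂ k)]
  · refine (hC₂ k y).trans (le_trans ?_ (Finset.single_le_sum (f := fun k => |C₁ k| + |C₂ k|)
      (fun k _ => by positivity) (Finset.mem_univ k)))
    linarith [le_abs_self (C₂ k), abs_nonneg (C₁ k)]

namespace IsAdmissible

variable (hV : IsAdmissible π β V)
include hV

lemma isCn_pot : IsCn π 2 fun x : Phase d m Q => V x.1 := hV.smooth.comp contDiff_fst

lemma isCn_gradH (k : Coord d m) : IsCn π 1 (gradH π V k : Phase d m Q → ℝ) := by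
  rcases k with i | i | ⟨j, i⟩
  · have h := (hV.isCn_pot (m := m)).pderiv (n' := 1) (by norm_num) (.inl i)
    have h2 : pderiv π (.inl i) (fun x : Phase d m Q => V x.1) = gradH π V (.inl i) :=
      funext fun x => pderiv_pos i V x
    rwa [h2] at h
  · change ContDiff ℝ 1 fun x : Phase d m (Euc d) => x.2.1 i
    fun_prop
  · change ContDiff ℝ 1 fun x : Phase d m (Euc d) => x.2.2 j i
    fun_prop

lemma isCn_ham : IsCn π 2 (ham V : Phase d m Q → ℝ) := by
  have h1 : IsCn π 2 (fun x : Phase d m Q => ‖x.2.1‖ ^ 2 / 2) := by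
    change ContDiff ℝ 2 fun x : Phase d m (Euc d) => ‖x.2.1‖ ^ 2 / 2
    exact (contDiff_snd.fst.norm_sq ℝ).div_const _
  have h2 : IsCn π 2 (fun x : Phase d m Q => (∑ j, ‖x.2.2 j‖ ^ 2) / 2) := by
    change ContDiff ℝ 2 fun x : Phase d m (Euc d) => (∑ j, ‖x.2.2 j‖ ^ 2) / 2
    refine (ContDiff.sum fun j _ => ContDiff.norm_sq ℝ ?_).div_const _
    fun_prop
  exact (hV.isCn_pot.add h1).add h2

lemma pderiv_ham (k : Coord d m) (x : Phase d m Q) : pderiv π k (ham V) x = gradH π V k x := by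
  have h0 : HasDerivAt (fun s : ℝ => V (x + cover π (s • unitVec k)).1)
      (pderiv π k (fun x => V x.1) x) 0 :=
    hV.isCn_pot.hasDerivAt_zero hV.quot (by norm_num) k x
  have h1 : HasDerivAt (fun s : ℝ => x.2.1 + s • (unitVec k : Phase d m (Euc d)).2.1)
      ((unitVec k : Phase d m (Euc d)).2.1) 0 := by
    have := ((hasDerivAt_id (0 : ℝ)).smul_const
      ((unitVec k : Phase d m (Euc d)).2.1)).const_add x.2.1
    rwa [one_smul] at this
  have h2 : ∀ j, HasDerivAt (fun s : ℝ => x.2.2 j + s • (unitVec k : Phase d m (Euc d)).2.2 j)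
      ((unitVec k : Phase d m (Euc d)).2.2 j) 0 := fun j => by
    have := ((hasDerivAt_id (0 : ℝ)).smul_const
      ((unitVec k : Phase d m (Euc d)).2.2 j)).const_add (x.2.2 j)
    rwa [one_smul] at this
  have h3 := ((h0.add (h1.norm_sq.div_const 2)).add
    ((HasDerivAt.fun_sum (u := Finset.univ) fun j _ => (h2 j).norm_sq).div_const 2)).deriv
  refine Eq.trans h3 ?_
  rcases k with i | i | ⟨j, i⟩
  · simp [pderiv_pos, gradH, unitVec]
  · simp [pderiv_pos_inr, gradH, unitVec, EuclideanSpace.inner_single_right]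
  · simp only [pderiv_pos_inr, gradH, unitVec, zero_smul, add_zero, inner_zero_right, mul_zero,
      zero_div, zero_add]
    rw [Finset.sum_eq_single j]
    · simp [EuclideanSpace.inner_single_right]
    · intro j' _ hj
      simp [hj]
    · simp

lemma isCn_weight : IsCn π 2 (weight β V : Phase d m Q → ℝ) :=
  Real.contDiff_exp.comp ((hV.isCn_ham.const_smul (-β) : ContDiff ℝ 2 _))

lemma pderiv_weight (k : Coord d m) (x : Phase d m Q) :
    pderiv π k (weight β V) x = -β * gradH π V k x * weight β V x := by
  have h := ((hV.isCn_ham (m := m)).hasDerivAt_zero hV.quot (by norm_num) k x)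
  have h2 := ((h.const_mul (-β)).exp).deriv
  rw [hV.pderiv_ham] at h2
  refine Eq.trans h2 ?_
  simp only [zero_smul, cover_zero, add_zero, weight, ham]
  ring

/-- The Hessian of the Hamiltonian is bounded. -/
lemma exists_hess_le : ∃ C : ℝ, 0 < C ∧ ∀ (k l : Coord d m) (x : Phase d m Q),
    |pderiv π k (gradH π V l) x| ≤ C := by
  obtain ⟨C, hC⟩ := hV.hess
  refine ⟨max C 1, by positivity, fun k l x => ?_⟩
  -- The momentum and auxiliary components of `∇H` are linear, so their derivatives are coordinates
  -- of a unit vector.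
  have hlin : ∀ (f : Phase d m (Euc d) → ℝ), (∀ v (s : ℝ), f (s • v) = s * f v) →
      ∀ F : Phase d m Q → ℝ, (∀ (y : Phase d m Q) v, F (y + cover π v) = F y + f v) →
      |f (unitVec k)| ≤ 1 → |pderiv π k F x| ≤ max C 1 := by
    intro f hf F hF h1
    have : (fun s : ℝ => F (x + cover π (s • unitVec k))) = fun s => F x + s * f (unitVec k) := by
      ext s; rw [hF, hf]
    have h2 : HasDerivAt (fun s => F x + s * f (unitVec k)) (1 * f (unitVec k)) 0 :=
      ((hasDerivAt_id (0 : ℝ)).mul_const _).const_add _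
    rw [pderiv, this, h2.deriv, one_mul]
    exact h1.trans (le_max_right _ _)
  rcases l with i | i | ⟨j, i⟩
  · rcases k with k | k
    · have := pderiv_pos (π := π) k (posDeriv π i V) x
      have h2 : pderiv π (.inl k) (gradH π V (.inl i)) x = _ := this
      rw [h2]
      exact (hC i k x.1).trans (le_max_left _ _)
    · have := pderiv_pos_inr (π := π) k (posDeriv π i V) x
      have h2 : pderiv π (.inr k) (gradH π V (.inl i)) x = _ := this
      rw [h2, abs_zero]
      positivity
  · refine hlin (fun v => v.2.1 i) (fun v s => by simp) _ (fun y v => by simp [gradH, cover]) ?_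
    exact (abs_coord_le (unitVec k) (.inr (.inl i))).trans (norm_unitVec_le k)
  · refine hlin (fun v => v.2.2 j i) (fun v s => by simp) _ (fun y v => by simp [gradH, cover]) ?_
    exact (abs_coord_le (unitVec k) (.inr (.inr (j, i)))).trans (norm_unitVec_le k)

/-- The weight factors into `e^{-βV}` and Gaussians in `p` and in each `z_j`. -/
lemma integrable_weight : Integrable (weight β V : Phase d m Q → ℝ) := by
  have hb : 0 < β / 2 := half_pos hV.pos
  have h1 : Integrable fun p : Euc d => Real.exp (-(β / 2) * ‖p‖ ^ 2) := by
    -- The value of the Gaussian integral is known and positive, whereas the integral of a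
    -- nonintegrable function is zero by convention.
    by_contra hc
    have h := GaussianFourier.integral_rexp_neg_mul_sq_norm (V := Euc d) hb
    rw [integral_undef hc] at h
    have : 0 < (Real.pi / (β / 2)) ^ ((Module.finrank ℝ (Euc d) : ℝ) / 2) := by positivity
    linarith
  have h2 : Integrable fun z : Fin m → Euc d => ∏ j, Real.exp (-(β / 2) * ‖z j‖ ^ 2) :=
    Integrable.fintype_prod fun _ => h1
  have h3 := hV.integrable.mul_prod (h1.mul_prod h2)
  refine h3.congr (Eventually.of_forall fun x => ?_)
  simp only [weight, ← Real.exp_sum, ← Real.exp_add, ← Finset.mul_sum]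
  congr 1
  ring

lemma integral_weight_pos : 0 < ∫ x : Phase d m Q, weight β V x := by
  rw [integral_pos_iff_support_of_nonneg (f := weight β V) (fun x => (Real.exp_pos _).le)
    hV.integrable_weight]
  have : Function.support (weight β V : Phase d m Q → ℝ) = Set.univ := by
    ext x; simp [weight]
  rw [this]
  exact Measure.measure_univ_pos.2 (NeZero.ne _)

end IsAdmissible

/-- The density of the Gibbs measure. -/
def dens (β : ℝ) (V : Q → ℝ) (x : Phase d m Q) : ℝ := weight β V x / ∫ y : Phase d m Q, weight β V y

namespace IsAdmissible

variable (hV : IsAdmissible π β V)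
include hV

lemma dens_pos (x : Phase d m Q) : 0 < dens β V x := div_pos (Real.exp_pos _) hV.integral_weight_pos

lemma isCn_dens : IsCn π 2 (dens β V : Phase d m Q → ℝ) := ContDiff.div_const hV.isCn_weight _

lemma continuous_dens : Continuous (dens β V : Phase d m Q → ℝ) := hV.isCn_dens.continuous hV.quot

lemma pderiv_dens (k : Coord d m) (x : Phase d m Q) :
    pderiv π k (dens β V) x = -β * gradH π V k x * dens β V x := by
  have h := IsCn.pderiv_const_mul (π := π) (F := weight β V)
    (∫ y : Phase d m Q, weight β V y)⁻¹ k x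
  rw [hV.pderiv_weight] at h
  have h2 : (fun x : Phase d m Q => (∫ y : Phase d m Q, weight β V y)⁻¹ * weight β V x) =
    dens β V := by ext x; rw [dens, div_eq_inv_mul]
  rw [h2] at h
  rw [h, dens]
  ring

lemma exists_dens_le : ∃ C : ℝ, 0 < C ∧ ∀ x : Phase d m Q, dens β V x ≤ C := by
  obtain ⟨c, hc⟩ := hV.bddBelow
  have hZ := hV.integral_weight_pos (m := m)
  refine ⟨Real.exp (-β * c) / ∫ y : Phase d m Q, weight β V y, by positivity, fun x => ?_⟩
  have := hV.pos
  refine div_le_div_of_nonneg_right (Real.exp_le_exp.2 ?_) hZ.le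
  have h1 : 0 ≤ ‖x.2.1‖ ^ 2 / 2 + (∑ j, ‖x.2.2 j‖ ^ 2) / 2 := by positivity
  nlinarith [hc x.1]

omit hV in
lemma gibbs_eq : gibbs (d := d) m β V = volume.withDensity fun x => ENNReal.ofReal (dens β V x) :=
  rfl

lemma integrable_gibbs_iff {F : Phase d m Q → ℝ} :
    Integrable F (gibbs m β V) ↔ Integrable fun x => dens β V x * F x := by
  rw [gibbs_eq, integrable_withDensity_iff_integrable_smul'
    (hV.continuous_dens.measurable.ennreal_ofReal) (by simp)]
  refine integrable_congr (Eventually.of_forall fun x => ?_)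
  simp only
  rw [ENNReal.toReal_ofReal (hV.dens_pos x).le, smul_eq_mul]

lemma integral_gibbs (F : Phase d m Q → ℝ) :
    ∫ x, F x ∂(gibbs m β V) = ∫ x, dens β V x * F x := by
  rw [gibbs_eq, integral_withDensity_eq_integral_toReal_smul
    (hV.continuous_dens.measurable.ennreal_ofReal) (by simp)]
  refine integral_congr_ae (Eventually.of_forall fun x => ?_)
  simp only
  rw [ENNReal.toReal_ofReal (hV.dens_pos x).le, smul_eq_mul]

lemma isProbabilityMeasure : IsProbabilityMeasure (gibbs (d := d) (Q := Q) m β V) := by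
  have h0 : Integrable (dens β V : Phase d m Q → ℝ) := hV.integrable_weight.div_const _
  refine ⟨?_⟩
  rw [gibbs, withDensity_apply _ MeasurableSet.univ, Measure.restrict_univ]
  have := ofReal_integral_eq_lintegral_ofReal h0
    (Eventually.of_forall fun x => (hV.dens_pos x).le)
  refine this.symm.trans ?_
  have h1 : ∫ x : Phase d m Q, dens β V x = 1 := by
    unfold dens
    rw [integral_div, div_self hV.integral_weight_pos.ne']
  rw [h1, ENNReal.ofReal_one]

lemma gibbs_ac : gibbs (d := d) m β V ≪ volume := withDensity_absolutelyContinuous _ _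

lemma ac_gibbs : (volume : Measure (Phase d m Q)) ≪ gibbs m β V :=
  withDensity_absolutelyContinuous' (hV.continuous_dens.measurable.ennreal_ofReal).aemeasurable
    (Eventually.of_forall fun x => (ENNReal.ofReal_pos.2 (hV.dens_pos x)).ne')

lemma integrable_of_bounded {F : Phase d m Q → ℝ} (hF : Continuous F) {C : ℝ}
    (hC : ∀ x, |F x| ≤ C) : Integrable F (gibbs m β V) := by
  have := hV.isProbabilityMeasure (m := m)
  exact Integrable.of_bound hF.aestronglyMeasurable C (Eventually.of_forall hC)

/-- Integration by parts with respect to the Gibbs measure. -/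
lemma integral_pderiv {F : Phase d m Q → ℝ} (hF : IsCn π 1 F) (k : Coord d m)
    (h1 : Integrable F (gibbs m β V)) (h2 : Integrable (pderiv π k F) (gibbs m β V))
    (h3 : Integrable (fun x => gradH π V k x * F x) (gibbs m β V)) :
    ∫ x, pderiv π k F x ∂(gibbs m β V) = β * ∫ x, gradH π V k x * F x ∂(gibbs m β V) := by
  have hd : IsCn π 1 (dens β V : Phase d m Q → ℝ) := hV.isCn_dens.of_le (by norm_num)
  have e1 : pderiv π k (fun x => dens β V x * F x) =
      fun x => dens β V x * pderiv π k F x - β * (dens β V x * (gradH π V k x * F x)) := by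
    ext x
    rw [hd.pderiv_mul hF hV.quot one_ne_zero, hV.pderiv_dens]
    ring
  have h2' := hV.integrable_gibbs_iff.1 h2
  have h3' := (hV.integrable_gibbs_iff.1 h3).const_mul β
  have h4 := integral_pderiv_eq_zero hV.quot (hd.mul hF) (hV.integrable_gibbs_iff.1 h1) (k := k)
    (by rw [e1]; exact h2'.sub h3')
  rw [e1, integral_sub h2' h3', integral_const_mul] at h4
  rw [hV.integral_gibbs, hV.integral_gibbs]
  linarith

omit hV in
lemma pderiv_snd {g : Euc d × (Fin m → Euc d) → ℝ} (hg : Differentiable ℝ g) (c : ℝ)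
    (k : Coord d m) (x : Phase d m Q) :
    pderiv π k (fun x => g (c • x.2)) x = c * fderiv ℝ g (c • x.2) (unitVec k).2 := by
  have h1 : HasDerivAt (fun s : ℝ => c • (x.2 + s • (unitVec k : Phase d m (Euc d)).2))
      (c • (unitVec k).2) 0 := by
    have := (((hasDerivAt_id (0 : ℝ)).smul_const
      ((unitVec k : Phase d m (Euc d)).2)).const_add x.2).const_smul c
    rwa [one_smul] at this
  have h2 := ((hg (c • (x.2 + (0 : ℝ) • (unitVec k : Phase d m (Euc d)).2))).hasFDerivAt.comp_hasDerivAt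
    (0 : ℝ) h1).deriv
  refine Eq.trans h2 ?_
  simp

/-- Cutoff functions on the phase space. -/
lemma exists_cutoff : ∃ (χ : ℕ → Phase d m Q → ℝ) (C : ℝ), 0 < C ∧ (∀ n, IsTest π (χ n) ∧
    (∀ x, |χ n x| ≤ 1) ∧ (∀ k x, |pderiv π k (χ n) x| ≤ C) ∧
    ∀ k x, |pderiv π (.inr k) (pderiv π (.inr k) (χ n)) x| ≤ C) ∧
    ∀ x, ∀ᶠ n in atTop, ∀ᶠ y in 𝓝 x, χ n y = 1 := by
  obtain ⟨κ, C, hκ, hκ1⟩ := hV.cutoff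
  obtain ⟨ψ, C₁, hψ, hψs, hC₁0, hψ1, hC₁, hC₂, hψone⟩ :=
    exists_bump_with_bounds fun k : Coord d m => (unitVec k : Phase d m (Euc d)).2
  have hψd : Differentiable ℝ ψ := hψ.differentiable (by simp)
  -- Dilations by `1 / (n + 1) ≤ 1` let the cutoff in `(p, z)` grow to everything without increasing
  -- its derivatives.
  let c : ℕ → ℝ := fun n => ((n : ℝ) + 1)⁻¹
  have hc0 : ∀ n, 0 < c n := fun n => by positivity
  have hc1 : ∀ n, c n ≤ 1 := fun n => inv_le_one_of_one_le₀ (by linarith [n.cast_nonneg (α := ℝ)])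
  have hC1 : ∀ n k y, |c n * fderiv ℝ ψ y (unitVec (d := d) (m := m) k).2| ≤ C₁ := by
    intro n k y
    rw [abs_mul, abs_of_pos (hc0 n)]
    exact (mul_le_mul (hc1 n) (hC₁ k y) (abs_nonneg _) zero_le_one).trans (one_mul _).le
  have hk : ∀ n, IsCn π ∞ fun x : Phase d m Q => κ n x.1 := fun n => (hκ n).1.comp contDiff_fst
  have hg : ∀ n, IsCn π ∞ fun x : Phase d m Q => ψ (c n • x.2) := fun n =>
    hψ.comp (contDiff_snd.const_smul (c n))
  have hp : ∀ n k x, pderiv π k (fun x : Phase d m Q => κ n x.1 * ψ (c n • x.2)) x =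
      pderiv π k (fun x => κ n x.1) x * ψ (c n • x.2) +
        κ n x.1 * (c n * fderiv ℝ ψ (c n • x.2) (unitVec k).2) := by
    intro n k x
    rw [(hk n).pderiv_mul (hg n) hV.quot (by simp), pderiv_snd hψd]
  have hkb : ∀ n k (x : Phase d m Q), |pderiv π k (fun x => κ n x.1) x| ≤ max C 0 := by
    intro n k x
    rcases k with i | k
    · rw [pderiv_pos]
      exact ((hκ n).2.2.2 i x.1).trans (le_max_left _ _)
    · rw [pderiv_pos_inr]
      simp
  refine ⟨fun n x => κ n x.1 * ψ (c n • x.2), max C 0 + C₁ + 1, by positivity,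
    fun n => ⟨⟨(hk n).mul (hg n), ?_⟩, fun x => ?_, fun k x => ?_, fun k x => ?_⟩, fun x => ?_⟩
  · have h1 : HasCompactSupport fun y => ψ (c n • y) :=
      hψs.comp_smul (hc0 n).ne'
    refine HasCompactSupport.intro ((hκ n).2.1.isCompact.prod h1.isCompact) fun x hx => ?_
    rw [Set.mem_prod, not_and_or] at hx
    change κ n x.1 * ψ (c n • x.2) = 0
    rcases hx with hx | hx
    · rw [image_eq_zero_of_notMem_tsupport hx, zero_mul]
    · have : ψ (c n • x.2) = 0 :=
        image_eq_zero_of_notMem_tsupport (f := fun y => ψ (c n • y)) hx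
      rw [this, mul_zero]
  · rw [abs_mul]
    exact mul_le_one₀ ((hκ n).2.2.1 _) (abs_nonneg _) (hψ1 _)
  · rw [hp]
    refine (abs_add_le _ _).trans ?_
    have h1 : |pderiv π k (fun x => κ n x.1) x * ψ (c n • x.2)| ≤ max C 0 * 1 := by
      rw [abs_mul]
      exact mul_le_mul (hkb n k x) (hψ1 _) (abs_nonneg _) (le_max_right _ _)
    have h2 : |κ n x.1 * (c n * fderiv ℝ ψ (c n • x.2) (unitVec k).2)| ≤ 1 * C₁ := by
      rw [abs_mul]
      exact mul_le_mul ((hκ n).2.2.1 _) (hC1 n k _) (abs_nonneg _) zero_le_one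
    linarith
  -- The position cutoff is constant in these directions, so no second derivative of it appears.
  · have h0 : pderiv π (.inr k) (fun x : Phase d m Q => κ n x.1 * ψ (c n • x.2)) =
        fun x => κ n x.1 * (c n * fderiv ℝ ψ (c n • x.2) (unitVec (.inr k)).2) := by
      ext x
      rw [hp, pderiv_pos_inr, zero_mul, zero_add]
    have hg' : ContDiff ℝ ∞ fun y => fderiv ℝ ψ y (unitVec (d := d) (m := m) (.inr k)).2 :=
      (hψ.fderiv_right (by simp)).clm_apply contDiff_const
    have hg2 : IsCn π ∞ fun x : Phase d m Q =>
        c n * fderiv ℝ ψ (c n • x.2) (unitVec (.inr k)).2 :=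
      ContDiff.mul contDiff_const (hg'.comp (contDiff_snd.const_smul (c n)))
    rw [h0, (hk n).pderiv_mul hg2 hV.quot (by simp), pderiv_pos_inr, zero_mul, zero_add,
      IsCn.pderiv_const_mul, pderiv_snd (hg'.differentiable (by simp))]
    have h4 := hC₂ (.inr k) (c n • x.2)
    have h5 := hc0 n
    rw [abs_mul, abs_mul, abs_mul, abs_of_pos h5]
    have h7 : |κ n x.1| * (c n * (c n * |fderiv ℝ (fun y => fderiv ℝ ψ y
        (unitVec (d := d) (m := m) (.inr k)).2) (c n • x.2) (unitVec (.inr k)).2|)) ≤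
        1 * (1 * (1 * C₁)) := by
      gcongr
      · exact (hκ n).2.2.1 _
      · exact hc1 n
      · exact hc1 n
    have h6 : (0 : ℝ) ≤ max C 0 := le_max_right _ _
    linarith
  · have h1 : ∀ᶠ n : ℕ in atTop, ‖x.2‖ + 1 ≤ n + 1 := by
      filter_upwards [tendsto_natCast_atTop_atTop.eventually_ge_atTop (‖x.2‖)] with n hn
      linarith
    filter_upwards [h1, hκ1 x.1] with n hn hn'
    have h2 : ∀ᶠ y : Phase d m Q in 𝓝 x, κ n y.1 = 1 :=
      (continuous_fst.tendsto x).eventually hn'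
    have h3 : ∀ᶠ y : Phase d m Q in 𝓝 x, ‖y.2‖ < ‖x.2‖ + 1 :=
      (continuous_snd.norm.tendsto x).eventually (gt_mem_nhds (lt_add_one _))
    filter_upwards [h2, h3] with y hy hy'
    have h4 : ‖c n • y.2‖ ≤ 1 := by
      rw [norm_smul, Real.norm_eq_abs, abs_of_pos (hc0 n), inv_mul_le_iff₀ (by positivity)]
      linarith
    rw [hy, hψone _ h4, one_mul]

end IsAdmissible

end Weight

/-! ### Moments of `∇H` under the Gibbs measure, from the bounded Hessian -/

section Moments

variable {d m : ℕ} {Q : Type} [AddCommGroup Q] [TopologicalSpace Q] [IsTopologicalAddGroup Q]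
  [SecondCountableTopology Q] [T2Space Q] [LocallyCompactSpace Q] [MeasureSpace Q] [BorelSpace Q]
  [(volume : Measure Q).IsAddHaarMeasure] {π : Euc d →+ Q}

variable {β : ℝ} {V : Q → ℝ}

/-- A weight controlling the coefficients of the operator. -/
def growth (π : Euc d →+ Q) (V : Q → ℝ) (x : Phase d m Q) : ℝ := 1 + ∑ k, gradH π V k x ^ 2

lemma one_le_growth (x : Phase d m Q) : 1 ≤ growth π V x :=
  le_add_of_nonneg_right (Finset.sum_nonneg fun _ _ => sq_nonneg _)

lemma abs_gradH_le_growth (k : Coord d m) (x : Phase d m Q) : |gradH π V k x| ≤ growth π V x := by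
  have h : gradH π V k x ^ 2 ≤ ∑ k, gradH π V k x ^ 2 :=
    Finset.single_le_sum (f := fun k => gradH π V k x ^ 2) (fun _ _ => sq_nonneg _)
      (Finset.mem_univ k)
  rw [growth]
  nlinarith [sq_abs (gradH π V k x), sq_nonneg (|gradH π V k x| - 1)]

namespace IsAdmissible

variable (hV : IsAdmissible π β V)
include hV

lemma continuous_gradH (k : Coord d m) : Continuous (gradH π V k : Phase d m Q → ℝ) :=
  (hV.isCn_gradH k).continuous hV.quot

lemma continuous_growth : Continuous (growth π V : Phase d m Q → ℝ) :=
  continuous_const.add (continuous_finsetSum _ fun k _ => (hV.continuous_gradH k).pow 2)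

lemma continuous_pderiv {F : Phase d m Q → ℝ} {n : ℕ∞ω} (hF : IsCn π n F) (hn : 1 ≤ n)
    (k : Coord d m) : Continuous (pderiv π k F) :=
  (hF.pderiv (n' := 0) (by simpa using hn) k).continuous hV.quot

/-- Fatou's lemma along the cutoffs. -/
lemma integrable_of_integral_cutoff_le {χ : ℕ → Phase d m Q → ℝ} (hχ : ∀ n, Continuous (χ n))
    (hχ1 : ∀ x, ∀ᶠ n in atTop, χ n x = 1) {f : Phase d m Q → ℝ} (hf : Continuous f)
    (hf0 : ∀ x, 0 ≤ f x) {K : ℝ}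
    (hi : ∀ n, Integrable (fun x => χ n x ^ 2 * f x) (gibbs m β V))
    (hK : ∀ n, ∫ x, χ n x ^ 2 * f x ∂(gibbs m β V) ≤ K) : Integrable f (gibbs m β V) := by
  refine ⟨hf.aestronglyMeasurable, ?_⟩
  rw [hasFiniteIntegral_iff_ofReal (Eventually.of_forall hf0)]
  have h1 : ∀ x, liminf (fun n => ENNReal.ofReal (χ n x ^ 2 * f x)) atTop =
      ENNReal.ofReal (f x) := by
    intro x
    refine Tendsto.liminf_eq (tendsto_const_nhds.congr' ?_)
    filter_upwards [hχ1 x] with n hn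
    rw [hn, one_pow, one_mul]
  have h2 := lintegral_liminf_le (μ := gibbs m β V) (u := atTop)
    (f := fun n x => ENNReal.ofReal (χ n x ^ 2 * f x))
    (fun n => (((hχ n).pow 2).mul hf).measurable.ennreal_ofReal)
  simp_rw [h1] at h2
  refine lt_of_le_of_lt (h2.trans ?_) (ENNReal.ofReal_lt_top (r := K))
  refine liminf_le_of_le (by isBoundedDefault) fun b hb => ?_
  obtain ⟨n, hn⟩ := hb.exists
  refine hn.trans ?_
  rw [← ofReal_integral_eq_lintegral_ofReal (hi n)
    (Eventually.of_forall fun x => mul_nonneg (sq_nonneg _) (hf0 x))]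
  exact ENNReal.ofReal_le_ofReal (hK n)

/-- Integrating by parts against `χ² g^{2j+1}`, with `g = ∂_k H`, gives `β ∫ χ² g^{2j+2} = ∫ ∂_k(χ²
g^{2j+1})`. The derivative of `g` is bounded, and the term with `∂_k χ` is half absorbed into the
left side, so only the moment of order `2j` remains. -/
lemma integrable_gradH_pow_succ (k : Coord d m) (j : ℕ)
    (hj : Integrable (fun x => gradH π V k x ^ (2 * j)) (gibbs m β V)) :
    Integrable (fun x => gradH π V k x ^ (2 * j + 2)) (gibbs m β V) := by
  obtain ⟨χ, C, hC0, hχ, hχ1⟩ := hV.exists_cutoff (m := m)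
  obtain ⟨C', hC0', hC'⟩ := hV.exists_hess_le (m := m)
  have hβ := hV.pos
  set μ := gibbs (d := d) m β V
  set g : Phase d m Q → ℝ := gradH π V k with hg
  have hgc : Continuous g := hV.continuous_gradH k
  have hχc : ∀ n, Continuous (χ n) := fun n => (hχ n).1.isCn.continuous hV.quot
  have hcs : ∀ n (F : Phase d m Q → ℝ), Continuous F → Integrable (fun x => χ n x * F x) μ := by
    intro n F hF
    obtain ⟨K, hK⟩ := ((hχ n).1.2.mul_right (f' := F)).exists_bound_of_continuous
      ((hχc n).mul hF)
    exact hV.integrable_of_bounded ((hχc n).mul hF) hK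
  have hpow : ∀ p : ℕ, IsCn π 1 fun x => g x ^ p := fun p => ContDiff.pow (hV.isCn_gradH k) p
  have hpg : ∀ (p : ℕ) x, pderiv π k (fun x => g x ^ (p + 1)) x = (p + 1) * g x ^ p * pderiv π k g x := by
    intro p x
    refine (((hV.isCn_gradH k).hasDerivAt_zero hV.quot one_ne_zero k x).fun_pow (p + 1)).deriv.trans ?_
    simp [hg]
  have hχ2 : ∀ n, IsCn π ∞ fun x => χ n x * χ n x := fun n => (hχ n).1.isCn.mul (hχ n).1.isCn
  have hF : ∀ n, IsCn π 1 fun x => χ n x * χ n x * g x ^ (2 * j + 1) := fun n =>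
    ((hχ2 n).of_le (by simp)).mul (hpow _)
  have hpd : ∀ n, pderiv π k (fun x => χ n x * χ n x * g x ^ (2 * j + 1)) = fun x =>
      χ n x * (2 * pderiv π k (χ n) x * g x ^ (2 * j + 1) +
        χ n x * ((2 * j + 1) * g x ^ (2 * j) * pderiv π k g x)) := by
    intro n
    ext x
    rw [((hχ2 n).of_le (by simp) : IsCn π 1 _).pderiv_mul (hpow _) hV.quot one_ne_zero, hpg,
      (hχ n).1.isCn.pderiv_mul (hχ n).1.isCn hV.quot (by simp)]
    push_cast
    ring
  have hint : ∀ n, Integrable (fun x => χ n x ^ 2 * g x ^ (2 * j + 2)) μ := fun n => by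
    refine (hcs n (fun x => χ n x * g x ^ (2 * j + 2)) ((hχc n).mul (hgc.pow _))).congr
      (Eventually.of_forall fun x => ?_)
    simp only
    ring
  have hgd : Continuous (pderiv π k g) := hV.continuous_pderiv (hV.isCn_gradH k) le_rfl k
  have hparts : ∀ n, ∫ x, pderiv π k (fun x => χ n x * χ n x * g x ^ (2 * j + 1)) x ∂μ =
      β * ∫ x, χ n x ^ 2 * g x ^ (2 * j + 2) ∂μ := by
    intro n
    rw [hV.integral_pderiv (hF n) k]
    · congr 1
      refine integral_congr_ae (Eventually.of_forall fun x => ?_)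
      simp only [← hg]
      ring
    · refine (hcs n (fun x => χ n x * g x ^ (2 * j + 1)) ((hχc n).mul (hgc.pow _))).congr
        (Eventually.of_forall fun x => ?_)
      simp only
      ring
    · rw [hpd n]
      have := hV.continuous_pderiv (hχ n).1.isCn (by simp) k
      exact hcs n _ (by fun_prop)
    · refine (hcs n (fun x => χ n x * (g x * g x ^ (2 * j + 1))) (by fun_prop)).congr
        (Eventually.of_forall fun x => ?_)
      simp only [← hg]
      ring
  -- The factor `2 / β` is what remains after half of `β ∫ χ² g^{2j+2}` has been absorbed; the bound
  -- does not depend on the cutoff.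
  refine hV.integrable_of_integral_cutoff_le hχc (fun x => (hχ1 x).mono fun n hn => hn.self_of_nhds)
    (hgc.pow _) (fun x => ?_) hint
    (K := 2 / β * ((2 * C ^ 2 / β + (2 * j + 1) * C') * ∫ x, g x ^ (2 * j) ∂μ)) fun n => ?_
  · rw [show 2 * j + 2 = 2 * (j + 1) by ring, pow_mul]
    positivity
  · have h1 : ∫ x, pderiv π k (fun x => χ n x * χ n x * g x ^ (2 * j + 1)) x ∂μ ≤
        ∫ x, (β / 2 * (χ n x ^ 2 * g x ^ (2 * j + 2)) +
          (2 * C ^ 2 / β + (2 * j + 1) * C') * g x ^ (2 * j)) ∂μ := by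
      refine integral_mono ?_ (((hint n).const_mul _).add (hj.const_mul _)) fun x => ?_
      · rw [hpd n]
        have := hV.continuous_pderiv (hχ n).1.isCn (by simp) k
        exact hcs n _ (by fun_prop)
      · rw [hpd n]
        have ha := (hχ n).2.1 x
        have hb := (hχ n).2.2.1 k x
        have hc := hC' k k x
        simp only
        have hG : 0 ≤ g x ^ (2 * j) := by rw [pow_mul]; positivity
        have e1 : g x ^ (2 * j + 2) = g x ^ (2 * j) * g x ^ 2 := by ring
        have e2 : g x ^ (2 * j + 1) = g x ^ (2 * j) * g x := by ring
        rw [e1, e2]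
        set G := g x ^ (2 * j)
        have k1 : χ n x ^ 2 * pderiv π k g x ≤ C' := by
          calc χ n x ^ 2 * pderiv π k g x ≤ χ n x ^ 2 * C' := by
                gcongr; exact (le_abs_self _).trans hc
            _ ≤ 1 * C' := by
                gcongr
                rw [← sq_abs]
                exact pow_le_one₀ (abs_nonneg _) ha
            _ = C' := one_mul _
        have k2 : 2 * χ n x * pderiv π k (χ n) x * g x ≤
            β / 2 * (χ n x ^ 2 * g x ^ 2) + 2 * C ^ 2 / β := by
          have hsq : pderiv π k (χ n) x ^ 2 ≤ C ^ 2 := sq_le_sq' (abs_le.1 hb).1 (abs_le.1 hb).2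
          have h3 : 0 ≤ (β * (χ n x * g x) - 2 * pderiv π k (χ n) x) ^ 2 := sq_nonneg _
          have h4 : 2 * χ n x * pderiv π k (χ n) x * g x * (2 * β) ≤
              (β / 2 * (χ n x ^ 2 * g x ^ 2) + 2 * C ^ 2 / β) * (2 * β) := by
            have : (β / 2 * (χ n x ^ 2 * g x ^ 2) + 2 * C ^ 2 / β) * (2 * β) =
                β ^ 2 * (χ n x * g x) ^ 2 + 4 * C ^ 2 := by field_simp; ring
            rw [this]
            nlinarith
          exact le_of_mul_le_mul_right h4 (by positivity)
        have k3 := mul_le_mul_of_nonneg_left k2 hG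
        have k4 := mul_le_mul_of_nonneg_left k1 (mul_nonneg (by positivity : (0 : ℝ) ≤ 2 * j + 1) hG)
        linarith
    rw [hparts, integral_add ((hint n).const_mul _) (hj.const_mul _), integral_const_mul,
      integral_const_mul] at h1
    rw [div_mul_eq_mul_div, le_div_iff₀ hβ]
    linarith

/-- Two applications of the moment step, starting from the integrability of constants, reach the
fourth moments. -/
lemma integrable_growth_sq : Integrable (fun x : Phase d m Q => growth π V x ^ 2)
    (gibbs m β V) := by
  have := hV.isProbabilityMeasure (m := m)
  have h4 : ∀ k : Coord d m, Integrable (fun x => gradH π V k x ^ 4) (gibbs m β V) := fun k =>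
    hV.integrable_gradH_pow_succ k 1 (hV.integrable_gradH_pow_succ k 0 (by simp))
  have h5 : Integrable (fun x : Phase d m Q => 2 + 2 * (Fintype.card (Coord d m) *
      ∑ k, gradH π V k x ^ 4)) (gibbs m β V) :=
    (integrable_const _).add (((integrable_finsetSum _ fun k _ => h4 k).const_mul _).const_mul _)
  refine h5.mono' (hV.continuous_growth.pow 2).aestronglyMeasurable
    (Eventually.of_forall fun x => ?_)
  rw [Real.norm_eq_abs, abs_of_nonneg (sq_nonneg _), growth]
  have h6 := sq_sum_le_card_mul_sum_sq (s := Finset.univ) (f := fun k : Coord d m => gradH π V k x ^ 2)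
  have h7 : ∑ k : Coord d m, (gradH π V k x ^ 2) ^ 2 = ∑ k, gradH π V k x ^ 4 :=
    Finset.sum_congr rfl fun k _ => by ring
  rw [h7, Finset.card_univ] at h6
  nlinarith [sq_nonneg ((∑ k : Coord d m, gradH π V k x ^ 2) - 1)]

lemma integrable_of_le {F : Phase d m Q → ℝ} (hF : Continuous F) {C : ℝ}
    (hC : ∀ x, |F x| ≤ C * growth π V x ^ 2) : Integrable F (gibbs m β V) :=
  (hV.integrable_growth_sq.const_mul C).mono' hF.aestronglyMeasurable (Eventually.of_forall hC)

lemma memLp_of_le {F : Phase d m Q → ℝ} (hF : Continuous F) {C : ℝ}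
    (hC : ∀ x, |F x| ≤ C * growth π V x) : MemLp F 2 (gibbs m β V) := by
  rw [memLp_two_iff_integrable_sq hF.aestronglyMeasurable]
  refine hV.integrable_of_le (hF.pow 2) (C := C ^ 2) fun x => ?_
  rw [abs_of_nonneg (sq_nonneg _), ← sq_abs, ← mul_pow]
  exact pow_le_pow_left₀ (abs_nonneg _) (hC x) 2

/-- The gradient of the Hamiltonian is bounded relative to the Sobolev norm. -/
lemma exists_integral_gradH_sq_le : ∃ C : ℝ, 0 < C ∧ ∀ (k : Coord d m) (F : Phase d m Q → ℝ),
    IsCn π 1 F → (∃ M, ∀ x, |F x| ≤ M) → (∃ M, ∀ x, |pderiv π k F x| ≤ M) →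
    ∫ x, gradH π V k x ^ 2 * F x ^ 2 ∂(gibbs m β V) ≤
      C * (∫ x, F x ^ 2 ∂(gibbs m β V) + ∫ x, pderiv π k F x ^ 2 ∂(gibbs m β V)) := by
  obtain ⟨C', hC0', hC'⟩ := hV.exists_hess_le (m := m)
  have hβ := hV.pos
  -- Integration by parts with `∂_k H · F²` yields `β I₂ ≤ C' I₀ + (β/2) I₂ + (2/β) I₁`, where `I₂`
  -- is the weighted integral, `I₀` that of `F²` and `I₁` that of `(∂_k F)²`. Hence `I₂ ≤ (2C'/β) I₀
  -- + (4/β²) I₁`, and the sum of both coefficients serves for both terms.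
  refine ⟨2 * C' / β + 4 / β ^ 2, by positivity, fun k F hF ⟨M, hM⟩ ⟨M', hM'⟩ => ?_⟩
  have hFc := hF.continuous hV.quot
  have hFd := hV.continuous_pderiv hF le_rfl k
  have hgc : Continuous (gradH π V k : Phase d m Q → ℝ) := hV.continuous_gradH k
  have hgd : Continuous (pderiv π k (gradH π V k) : Phase d m Q → ℝ) :=
    hV.continuous_pderiv (hV.isCn_gradH k) le_rfl k
  have hM2 : ∀ x, F x ^ 2 ≤ M ^ 2 := fun x => by
    rw [← sq_abs]; exact pow_le_pow_left₀ (abs_nonneg _) (hM x) 2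
  have hG : ∀ x : Phase d m Q, |gradH π V k x| ≤ growth π V x := abs_gradH_le_growth k
  have hg1 : ∀ x : Phase d m Q, growth π V x ≤ growth π V x ^ 2 := fun x =>
    le_self_pow₀ (one_le_growth x) two_ne_zero
  have hG2 : ∀ x : Phase d m Q, gradH π V k x ^ 2 ≤ growth π V x ^ 2 := fun x => by
    rw [← sq_abs]; exact pow_le_pow_left₀ (abs_nonneg _) (hG x) 2
  have hFF : IsCn π 1 fun x => F x * F x := hF.mul hF
  have e1 : pderiv π k (fun x => gradH π V k x * (F x * F x)) = fun x =>
      pderiv π k (gradH π V k) x * F x ^ 2 + 2 * (gradH π V k x * (F x * pderiv π k F x)) := by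
    ext x
    rw [(hV.isCn_gradH k).pderiv_mul hFF hV.quot one_ne_zero,
      hF.pderiv_mul hF hV.quot one_ne_zero]
    ring
  have i0 : Integrable (fun x => F x ^ 2) (gibbs m β V) :=
    hV.integrable_of_bounded (hFc.pow 2) (C := M ^ 2) fun x => by
      rw [abs_of_nonneg (sq_nonneg _)]; exact hM2 x
  have i1 : Integrable (fun x => pderiv π k F x ^ 2) (gibbs m β V) :=
    hV.integrable_of_bounded (hFd.pow 2) (C := M' ^ 2) fun x => by
      rw [abs_of_nonneg (sq_nonneg _), ← sq_abs]; exact pow_le_pow_left₀ (abs_nonneg _) (hM' x) 2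
  have i2 : Integrable (fun x => gradH π V k x ^ 2 * F x ^ 2) (gibbs m β V) :=
    hV.integrable_of_le (by fun_prop) (C := M ^ 2) fun x => by
      rw [abs_of_nonneg (by positivity), mul_comm]
      exact mul_le_mul (hM2 x) (hG2 x) (sq_nonneg _) (sq_nonneg _)
  have i3 : Integrable (fun x => pderiv π k (gradH π V k) x * F x ^ 2) (gibbs m β V) :=
    hV.integrable_of_bounded (by fun_prop) (C := C' * M ^ 2) fun x => by
      rw [abs_mul, abs_of_nonneg (sq_nonneg (F x))]
      exact mul_le_mul (hC' k k x) (hM2 x) (sq_nonneg _) hC0'.le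
  have i4 : Integrable (fun x => gradH π V k x * (F x * pderiv π k F x)) (gibbs m β V) :=
    hV.integrable_of_le (by fun_prop) (C := M * M') fun x => by
      rw [abs_mul, abs_mul, mul_comm]
      have : |F x| * |pderiv π k F x| ≤ M * M' :=
        mul_le_mul (hM x) (hM' x) (abs_nonneg _) ((abs_nonneg _).trans (hM x))
      exact mul_le_mul this ((hG x).trans (hg1 x)) (abs_nonneg _)
        ((by positivity : (0 : ℝ) ≤ |F x| * |pderiv π k F x|).trans this)
  have i5 : Integrable (fun x => gradH π V k x * (F x * F x)) (gibbs m β V) :=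
    hV.integrable_of_le (by fun_prop) (C := M ^ 2) fun x => by
      rw [abs_mul, mul_comm, ← sq, abs_of_nonneg (sq_nonneg (F x))]
      exact mul_le_mul (hM2 x) ((hG x).trans (hg1 x)) (abs_nonneg _) (sq_nonneg _)
  have h := hV.integral_pderiv ((hV.isCn_gradH k).mul hFF) k i5
    (by rw [e1]; exact i3.add (i4.const_mul 2))
    (i2.congr (Eventually.of_forall fun x => by simp only; ring))
  have h' : ∫ x, gradH π V k x * (gradH π V k x * (F x * F x)) ∂(gibbs m β V) =
      ∫ x, gradH π V k x ^ 2 * F x ^ 2 ∂(gibbs m β V) :=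
    integral_congr_ae (Eventually.of_forall fun x => by simp only; ring)
  rw [h', e1] at h
  have h2 : ∫ x, (pderiv π k (gradH π V k) x * F x ^ 2 +
      2 * (gradH π V k x * (F x * pderiv π k F x))) ∂(gibbs m β V) ≤
      ∫ x, (C' * F x ^ 2 + (β / 2 * (gradH π V k x ^ 2 * F x ^ 2) +
        2 / β * pderiv π k F x ^ 2)) ∂(gibbs m β V) := by
    refine integral_mono (i3.add (i4.const_mul 2))
      ((i0.const_mul _).add ((i2.const_mul _).add (i1.const_mul _))) fun x => ?_
    simp only
    have k1 : pderiv π k (gradH π V k) x * F x ^ 2 ≤ C' * F x ^ 2 :=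
      mul_le_mul_of_nonneg_right ((le_abs_self _).trans (hC' k k x)) (sq_nonneg _)
    have k2 : 2 * (gradH π V k x * (F x * pderiv π k F x)) ≤
        β / 2 * (gradH π V k x ^ 2 * F x ^ 2) + 2 / β * pderiv π k F x ^ 2 := by
      have h3 : 0 ≤ (β * (gradH π V k x * F x) - 2 * pderiv π k F x) ^ 2 := sq_nonneg _
      refine le_of_mul_le_mul_right ?_ (by positivity : 0 < 2 * β)
      have : (β / 2 * (gradH π V k x ^ 2 * F x ^ 2) + 2 / β * pderiv π k F x ^ 2) * (2 * β) =
          β ^ 2 * (gradH π V k x * F x) ^ 2 + 4 * pderiv π k F x ^ 2 := by field_simp; ring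
      rw [this]
      nlinarith
    linarith
  have i6 : Integrable (fun x => β / 2 * (gradH π V k x ^ 2 * F x ^ 2) +
      2 / β * pderiv π k F x ^ 2) (gibbs m β V) := (i2.const_mul _).add (i1.const_mul _)
  rw [h, integral_add (i0.const_mul _) i6,
    integral_add (i2.const_mul _) (i1.const_mul _), integral_const_mul, integral_const_mul,
    integral_const_mul] at h2
  set I0 := ∫ x, F x ^ 2 ∂(gibbs m β V)
  set I1 := ∫ x, pderiv π k F x ^ 2 ∂(gibbs m β V)
  set I2 := ∫ x, gradH π V k x ^ 2 * F x ^ 2 ∂(gibbs m β V)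
  have p0 : 0 ≤ I0 := integral_nonneg fun x => sq_nonneg _
  have p1 : 0 ≤ I1 := integral_nonneg fun x => sq_nonneg _
  have h5 : I2 ≤ 2 * C' / β * I0 + 4 / β ^ 2 * I1 := by
    refine le_of_mul_le_mul_right ?_ (by positivity : 0 < β / 2)
    have : (2 * C' / β * I0 + 4 / β ^ 2 * I1) * (β / 2) = C' * I0 + 2 / β * I1 := by
      field_simp; ring
    rw [this]
    linarith
  have h6 : 0 ≤ 2 * C' / β * I1 := by positivity
  have h7 : 0 ≤ 4 / β ^ 2 * I0 := by positivity
  linarith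

end IsAdmissible

end Moments

/-! ### The drift in the form `(J - D)∇H` -/

section Operator

variable {d m : ℕ} {Q : Type} [AddCommGroup Q] [TopologicalSpace Q] [IsTopologicalAddGroup Q]
  [SecondCountableTopology Q] [T2Space Q] [LocallyCompactSpace Q] [MeasureSpace Q] [BorelSpace Q]
  [(volume : Measure Q).IsAddHaarMeasure] {π : Euc d →+ Q}

variable {β : ℝ} {V : Q → ℝ} {lam alpha : Fin m → ℝ}

/-- Continuous functions that grow at most like `1 + |∇H|²`. -/
def IsTame (π : Euc d →+ Q) (V : Q → ℝ) (F : Phase d m Q → ℝ) : Prop :=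
  Continuous F ∧ ∃ C, ∀ x, |F x| ≤ C * growth π V x

namespace IsTame

variable {F G : Phase d m Q → ℝ}

lemma of_bounded (hF : Continuous F) (h : ∃ C, ∀ x, |F x| ≤ C) : IsTame π V F := by
  obtain ⟨C, hC⟩ := h
  refine ⟨hF, |C|, fun x => ((hC x).trans (le_abs_self C)).trans ?_⟩
  exact le_mul_of_one_le_right (abs_nonneg C) (one_le_growth x)

lemma add (hF : IsTame π V F) (hG : IsTame π V G) : IsTame π V fun x => F x + G x := by
  obtain ⟨C, hC⟩ := hF.2
  obtain ⟨C', hC'⟩ := hG.2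
  refine ⟨hF.1.add hG.1, C + C', fun x => (abs_add_le _ _).trans ?_⟩
  linarith [hC x, hC' x]

lemma mul_bounded (hF : IsTame π V F) (hG : Continuous G) (h : ∃ C, ∀ x, |G x| ≤ C) :
    IsTame π V fun x => F x * G x := by
  obtain ⟨C, hC⟩ := hF.2
  obtain ⟨C', hC'⟩ := h
  refine ⟨hF.1.mul hG, C * C', fun x => ?_⟩
  rw [abs_mul]
  have h1 := mul_le_mul (hC x) (hC' x) (abs_nonneg _) ((abs_nonneg _).trans (hC x))
  linarith

lemma const_mul (hF : IsTame π V F) (c : ℝ) : IsTame π V fun x => c * F x := by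
  simp only [mul_comm c]
  exact hF.mul_bounded continuous_const ⟨|c|, fun _ => le_rfl⟩

lemma sub (hF : IsTame π V F) (hG : IsTame π V G) : IsTame π V fun x => F x - G x := by
  have := hF.add (hG.const_mul (-1))
  simpa only [neg_one_mul, ← sub_eq_add_neg] using this

lemma neg (hF : IsTame π V F) : IsTame π V fun x => -F x := by
  simpa only [neg_one_mul] using hF.const_mul (-1)

lemma sum {ι : Type*} {s : Finset ι} {F : ι → Phase d m Q → ℝ} (h : ∀ i ∈ s, IsTame π V (F i)) :
    IsTame π V fun x => ∑ i ∈ s, F i x := by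
  classical
  induction s using Finset.induction_on with
  | empty => exact of_bounded (by simpa using continuous_const) ⟨0, by simp⟩
  | insert a s ha ih =>
    simp only [Finset.sum_insert ha]
    exact (h a (by simp)).add (ih fun i hi => h i (by simp [hi]))

lemma gradH (hV : IsAdmissible π β V) (k : Coord d m) :
    IsTame π V (gradH π V k : Phase d m Q → ℝ) :=
  ⟨hV.continuous_gradH k, 1, fun x => by simpa using abs_gradH_le_growth k x⟩

lemma memLp (hV : IsAdmissible π β V) (hF : IsTame π V F) : MemLp F 2 (gibbs m β V) := by
  obtain ⟨C, hC⟩ := hF.2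
  exact hV.memLp_of_le hF.1 hC

lemma integrable (hV : IsAdmissible π β V) (hF : IsTame π V F) : Integrable F (gibbs m β V) := by
  have := hV.isProbabilityMeasure (m := m)
  exact (hF.memLp hV).integrable (by norm_num)

end IsTame

/-- The antisymmetric matrix of the conservative part of the drift. -/
def symplectic (lam : Fin m → ℝ) : Coord d m → Coord d m → ℝ
  | .inl i, .inr (.inl i') => if i = i' then 1 else 0
  | .inr (.inl i), .inl i' => if i = i' then -1 else 0
  | .inr (.inl i), .inr (.inr (j, i')) => if i = i' then lam j else 0
  | .inr (.inr (j, i)), .inr (.inl i') => if i = i' then -lam j else 0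
  | _, _ => 0

/-- The diffusion coefficients. -/
def diffusion (alpha : Fin m → ℝ) : Coord d m → ℝ
  | .inr (.inr (j, _)) => alpha j
  | _ => 0

/-- The drift of the dynamics. -/
def drift (π : Euc d →+ Q) (lam alpha : Fin m → ℝ) (V : Q → ℝ) (k : Coord d m)
    (x : Phase d m Q) : ℝ :=
  ∑ l, symplectic lam k l * gradH π V l x - diffusion alpha k * gradH π V k x

/-- The second order part of `-𝓛`. -/
def noise (π : Euc d →+ Q) (alpha : Fin m → ℝ) (β : ℝ) (φ : Phase d m Q → ℝ)
    (x : Phase d m Q) : ℝ :=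
  ∑ k, β⁻¹ * diffusion alpha k * pderiv π k (pderiv π k φ) x

omit [TopologicalSpace Q] [IsTopologicalAddGroup Q] [SecondCountableTopology Q] [T2Space Q]
  [LocallyCompactSpace Q] [MeasureSpace Q] [BorelSpace Q]
  [(volume : Measure Q).IsAddHaarMeasure] in
lemma symplectic_antisymm (k l : Coord d m) : symplectic lam k l = -symplectic lam l k := by
  rcases k with i | i | ⟨j, i⟩ <;> rcases l with i' | i' | ⟨j', i'⟩ <;>
    simp [symplectic, eq_comm] <;> split_ifs <;> simp

lemma drift_pos (i : Fin d) (x : Phase d m Q) : drift π lam alpha V (.inl i) x = x.2.1 i := by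
  simp [drift, symplectic, diffusion, gradH, Fintype.sum_sum_type]

lemma drift_mom (i : Fin d) (x : Phase d m Q) : drift π lam alpha V (.inr (.inl i)) x =
    -posDeriv π i V x.1 + ∑ j, lam j * x.2.2 j i := by
  simp [drift, symplectic, diffusion, gradH, Fintype.sum_sum_type, Fintype.sum_prod_type]

lemma drift_aux (j : Fin m) (i : Fin d) (x : Phase d m Q) :
    drift π lam alpha V (.inr (.inr (j, i))) x = -(lam j * x.2.1 i) - alpha j * x.2.2 j i := by
  simp [drift, symplectic, diffusion, gradH, Fintype.sum_sum_type]

/-- Rewriting the drift through `∇H` reduces invariance of the Gibbs measure to the antisymmetry of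
`J` and the balance between friction and noise. -/
lemma operator_eq (φ : Phase d m Q → ℝ) (x : Phase d m Q) : operator π lam alpha β V φ x =
    -(∑ k, drift π lam alpha V k x * pderiv π k φ x + noise π alpha β φ x) := by
  rw [operator, noise]
  simp only [Fintype.sum_sum_type, Fintype.sum_prod_type, drift_pos, drift_mom, drift_aux,
    diffusion, mul_zero, zero_mul, Finset.sum_const_zero, zero_add, add_mul, neg_mul, sub_mul,
    Finset.sum_add_distrib, Finset.sum_sub_distrib, Finset.sum_neg_distrib]
  ring

namespace IsAdmissible

variable (hV : IsAdmissible π β V)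
include hV

lemma isCn_drift (k : Coord d m) : IsCn π 1 (drift π lam alpha V k : Phase d m Q → ℝ) :=
  (IsCn.sum fun l _ => (IsCn.const _).mul (hV.isCn_gradH l)).sub
    ((IsCn.const _).mul (hV.isCn_gradH k))

lemma isTame_drift (k : Coord d m) : IsTame π V (drift π lam alpha V k : Phase d m Q → ℝ) :=
  (IsTame.sum fun l _ => (IsTame.gradH hV l).const_mul _).sub ((IsTame.gradH hV k).const_mul _)

lemma pderiv_drift (r k : Coord d m) (x : Phase d m Q) :
    pderiv π r (drift π lam alpha V k) x =
      ∑ l, symplectic lam k l * pderiv π r (gradH π V l) x -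
        diffusion alpha k * pderiv π r (gradH π V k) x := by
  have h0 := fun l => (IsCn.const (π := π) (n := 1) (symplectic lam k l)).mul (hV.isCn_gradH l)
  unfold drift
  rw [IsCn.pderiv_sub (IsCn.sum fun l _ => h0 l) ((IsCn.const _).mul (hV.isCn_gradH k)) hV.quot
    one_ne_zero, IsCn.pderiv_sum (fun l _ => h0 l) hV.quot one_ne_zero, IsCn.pderiv_const_mul]
  simp only [IsCn.pderiv_const_mul]

lemma continuous_pderiv_drift (r k : Coord d m) :
    Continuous (pderiv π r (drift π lam alpha V k) : Phase d m Q → ℝ) :=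
  hV.continuous_pderiv (hV.isCn_drift k) le_rfl r

/-- The derivatives of the drift are constant combinations of Hessian entries of `H`. This is the
bound on the commutator of the gradient with the generator. -/
lemma exists_pderiv_drift_le : ∃ C, 0 ≤ C ∧ ∀ (r k : Coord d m) (x : Phase d m Q),
    |pderiv π r (drift π lam alpha V k) x| ≤ C := by
  obtain ⟨C', hC0', hC'⟩ := hV.exists_hess_le (m := m)
  refine ⟨∑ k : Coord d m, (∑ l, |symplectic lam k l| * C' + |diffusion alpha k| * C'),
    by positivity, fun r k x => ?_⟩
  rw [hV.pderiv_drift]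
  refine le_trans ?_ (Finset.single_le_sum (f := fun k : Coord d m =>
    ∑ l, |symplectic lam k l| * C' + |diffusion alpha k| * C') (fun k _ => by positivity)
    (Finset.mem_univ k))
  refine (abs_sub _ _).trans (add_le_add ?_ ?_)
  · refine (Finset.abs_sum_le_sum_abs _ _).trans (Finset.sum_le_sum fun l _ => ?_)
    rw [abs_mul]
    exact mul_le_mul_of_nonneg_left (hC' r l x) (abs_nonneg _)
  · rw [abs_mul]
    exact mul_le_mul_of_nonneg_left (hC' r k x) (abs_nonneg _)

end IsAdmissible

end Operator

/-! ### Invariance, Dirichlet form and commutators of the generator -/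

section Generator

variable {d m : ℕ} {Q : Type} [AddCommGroup Q] [TopologicalSpace Q] [IsTopologicalAddGroup Q]
  [SecondCountableTopology Q] [T2Space Q] [LocallyCompactSpace Q] [MeasureSpace Q] [BorelSpace Q]
  [(volume : Measure Q).IsAddHaarMeasure] {π : Euc d →+ Q}

variable {β : ℝ} {V : Q → ℝ} {lam alpha : Fin m → ℝ}

/-- The differential expression `-𝓛 φ`. -/
def generator (π : Euc d →+ Q) (lam alpha : Fin m → ℝ) (β : ℝ) (V : Q → ℝ)
    (φ : Phase d m Q → ℝ) (x : Phase d m Q) : ℝ :=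
  ∑ k, drift π lam alpha V k x * pderiv π k φ x + noise π alpha β φ x

lemma operator_eq_neg (φ : Phase d m Q → ℝ) :
    operator π lam alpha β V φ = fun x => -generator π lam alpha β V φ x :=
  funext fun x => operator_eq φ x

lemma two_le_smooth : (2 : ℕ∞ω) ≤ ∞ := by
  exact (WithTop.coe_le_coe.2 (le_top : (2 : ℕ∞) ≤ ⊤) : ((2 : ℕ∞) : ℕ∞ω) ≤ ∞)

/-- Functions of class `C²` that are bounded together with their derivatives. -/
structure IsCb2 (π : Euc d →+ Q) (φ : Phase d m Q → ℝ) : Prop where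
  isCn : IsCn π 2 φ
  bounded : ∃ C, ∀ x, |φ x| ≤ C
  pderiv_bounded : ∀ k, ∃ C, ∀ x, |pderiv π k φ x| ≤ C
  pderiv_pderiv_bounded : ∀ k l, ∃ C, ∀ x, |pderiv π k (pderiv π l φ) x| ≤ C

lemma IsCb.isCb2 {φ : Phase d m Q → ℝ} (h : IsCb π φ) : IsCb2 π φ :=
  ⟨h.1.of_le two_le_smooth, h.bounded, fun k => (h.pderiv k).bounded,
    fun k l => ((h.pderiv l).pderiv k).bounded⟩

lemma exists_bound_add {f g : Phase d m Q → ℝ} (hf : ∃ C, ∀ x, |f x| ≤ C)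
    (hg : ∃ C, ∀ x, |g x| ≤ C) : ∃ C, ∀ x, |f x + g x| ≤ C := by
  obtain ⟨C, hC⟩ := hf
  obtain ⟨C', hC'⟩ := hg
  exact ⟨C + C', fun x => (abs_add_le _ _).trans (add_le_add (hC x) (hC' x))⟩

lemma exists_bound_mul {f g : Phase d m Q → ℝ} (hf : ∃ C, ∀ x, |f x| ≤ C)
    (hg : ∃ C, ∀ x, |g x| ≤ C) : ∃ C, ∀ x, |f x * g x| ≤ C := by
  obtain ⟨C, hC⟩ := hf
  obtain ⟨C', hC'⟩ := hg
  exact ⟨C * C', fun x => (abs_mul _ _).trans_le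
    (mul_le_mul (hC x) (hC' x) (abs_nonneg _) ((abs_nonneg _).trans (hC x)))⟩

namespace IsCb2

variable {φ ψ : Phase d m Q → ℝ}

lemma isCn_pderiv (h : IsCb2 π φ) (k : Coord d m) : IsCn π 1 (pderiv π k φ) :=
  h.isCn.pderiv (by norm_num) k

lemma pderiv_mul (hφ : IsCb2 π φ) (hψ : IsCb2 π ψ) (hπ : IsOpenQuotientMap π) (k : Coord d m) :
    pderiv π k (fun x => φ x * ψ x) = fun x => pderiv π k φ x * ψ x + φ x * pderiv π k ψ x :=
  funext fun x => hφ.isCn.pderiv_mul hψ.isCn hπ two_ne_zero k x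

lemma pderiv_pderiv_mul (hφ : IsCb2 π φ) (hψ : IsCb2 π ψ) (hπ : IsOpenQuotientMap π)
    (k l : Coord d m) (x : Phase d m Q) : pderiv π k (pderiv π l fun x => φ x * ψ x) x =
      (pderiv π k (pderiv π l φ) x * ψ x + pderiv π l φ x * pderiv π k ψ x) +
      (pderiv π k φ x * pderiv π l ψ x + φ x * pderiv π k (pderiv π l ψ) x) := by
  have h1 := hφ.isCn.of_le (n' := 1) (by norm_num)
  have h2 := hψ.isCn.of_le (n' := 1) (by norm_num)
  rw [hφ.pderiv_mul hψ hπ, IsCn.pderiv_add ((hφ.isCn_pderiv l).mul h2) (h1.mul (hψ.isCn_pderiv l))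
    hπ one_ne_zero, (hφ.isCn_pderiv l).pderiv_mul h2 hπ one_ne_zero,
    h1.pderiv_mul (hψ.isCn_pderiv l) hπ one_ne_zero]

lemma mul (hφ : IsCb2 π φ) (hψ : IsCb2 π ψ) (hπ : IsOpenQuotientMap π) :
    IsCb2 π fun x => φ x * ψ x := by
  refine ⟨hφ.isCn.mul hψ.isCn, exists_bound_mul hφ.bounded hψ.bounded, fun k => ?_, fun k l => ?_⟩
  · rw [hφ.pderiv_mul hψ hπ]
    exact exists_bound_add (exists_bound_mul (hφ.pderiv_bounded k) hψ.bounded)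
      (exists_bound_mul hφ.bounded (hψ.pderiv_bounded k))
  · simp only [hφ.pderiv_pderiv_mul hψ hπ]
    exact exists_bound_add (exists_bound_add
      (exists_bound_mul (hφ.pderiv_pderiv_bounded k l) hψ.bounded)
      (exists_bound_mul (hφ.pderiv_bounded l) (hψ.pderiv_bounded k)))
      (exists_bound_add (exists_bound_mul (hφ.pderiv_bounded k) (hψ.pderiv_bounded l))
      (exists_bound_mul hφ.bounded (hψ.pderiv_pderiv_bounded k l)))

end IsCb2

namespace IsAdmissible

variable (hV : IsAdmissible π β V)
include hV

lemma isTame_of_isCb2 {φ : Phase d m Q → ℝ} (h : IsCb2 π φ) : IsTame π V φ :=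
  IsTame.of_bounded (h.isCn.continuous hV.quot) h.bounded

lemma continuous_pderiv_isCb2 {φ : Phase d m Q → ℝ} (h : IsCb2 π φ) (k : Coord d m) :
    Continuous (pderiv π k φ) := hV.continuous_pderiv h.isCn (by norm_num) k

lemma isTame_pderiv {φ : Phase d m Q → ℝ} (h : IsCb2 π φ) (k : Coord d m) :
    IsTame π V (pderiv π k φ) :=
  IsTame.of_bounded (hV.continuous_pderiv_isCb2 h k) (h.pderiv_bounded k)

lemma isTame_pderiv_pderiv {φ : Phase d m Q → ℝ} (h : IsCb2 π φ) (k l : Coord d m) :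
    IsTame π V (pderiv π k (pderiv π l φ)) :=
  IsTame.of_bounded (hV.continuous_pderiv (h.isCn_pderiv l) le_rfl k) (h.pderiv_pderiv_bounded k l)

lemma isTame_drift_mul {φ : Phase d m Q → ℝ} (h : IsCb2 π φ) (k l : Coord d m) :
    IsTame π V fun x => drift π lam alpha V k x * pderiv π l φ x :=
  (hV.isTame_drift k).mul_bounded (hV.continuous_pderiv_isCb2 h l) (h.pderiv_bounded l)

lemma isTame_noise {φ : Phase d m Q → ℝ} (h : IsCb2 π φ) : IsTame π V (noise π alpha β φ) :=
  IsTame.sum fun k _ => (hV.isTame_pderiv_pderiv h k k).const_mul _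

lemma isTame_generator {φ : Phase d m Q → ℝ} (h : IsCb2 π φ) :
    IsTame π V (generator π lam alpha β V φ) :=
  (IsTame.sum fun k _ => hV.isTame_drift_mul h k k).add (hV.isTame_noise h)

/-- The Gibbs measure is invariant. -/
lemma integral_generator {φ : Phase d m Q → ℝ} (h : IsCb2 π φ) :
    ∫ x, generator π lam alpha β V φ x ∂(gibbs m β V) = 0 := by
  have hβ := hV.pos
  -- Since `β I l k = ∫ ∂_l ∂_k φ`, this matrix is symmetric. Its contraction with the antisymmetric
  -- `J` vanishes, and the friction term is exactly compensated by the noise.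
  set I : Coord d m → Coord d m → ℝ := fun l k =>
    ∫ x, gradH π V l x * pderiv π k φ x ∂(gibbs m β V) with hI
  have t1 : ∀ l k, IsTame π V fun x => gradH π V l x * pderiv π k φ x := fun l k =>
    (IsTame.gradH hV l).mul_bounded (hV.continuous_pderiv_isCb2 h k) (h.pderiv_bounded k)
  have e1 : ∀ l k, ∫ x, pderiv π l (pderiv π k φ) x ∂(gibbs m β V) = β * I l k := fun l k =>
    hV.integral_pderiv (h.isCn_pderiv k) l ((hV.isTame_pderiv h k).integrable hV)
      ((hV.isTame_pderiv_pderiv h l k).integrable hV) ((t1 l k).integrable hV)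
  have hsymm : ∀ l k, I l k = I k l := fun l k => by
    have := e1 l k
    rw [show pderiv π l (pderiv π k φ) = pderiv π k (pderiv π l φ) from
      funext fun x => h.isCn.pderiv_comm hV.quot le_rfl l k x, e1 k l] at this
    exact (mul_left_cancel₀ hβ.ne' this).symm
  have e2 : ∀ k, ∫ x, drift π lam alpha V k x * pderiv π k φ x ∂(gibbs m β V) =
      ∑ l, symplectic lam k l * I l k - diffusion alpha k * I k k := fun k => by
    have : (fun x => drift π lam alpha V k x * pderiv π k φ x) = fun x =>
        ∑ l, symplectic lam k l * (gradH π V l x * pderiv π k φ x) -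
          diffusion alpha k * (gradH π V k x * pderiv π k φ x) := by
      ext x
      simp only [drift, sub_mul, Finset.sum_mul, mul_assoc]
    rw [this, integral_sub ((IsTame.sum fun l _ => (t1 l k).const_mul _).integrable hV)
      (((t1 k k).const_mul _).integrable hV),
      integral_finsetSum _ fun l _ => ((t1 l k).const_mul _).integrable hV]
    simp only [integral_const_mul, hI]
  have e3 : ∫ x, noise π alpha β φ x ∂(gibbs m β V) = ∑ k, diffusion alpha k * I k k := by
    simp only [noise]
    rw [integral_finsetSum _ fun k _ =>
      ((hV.isTame_pderiv_pderiv h k k).const_mul _).integrable hV]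
    refine Finset.sum_congr rfl fun k _ => ?_
    rw [integral_const_mul, e1]
    field_simp
  have e4 : ∑ k, ∑ l, symplectic lam k l * I l k = 0 := by
    have h1 : ∑ k, ∑ l, symplectic lam k l * I l k = -∑ k, ∑ l, symplectic lam k l * I l k := by
      conv_lhs => rw [Finset.sum_comm]
      rw [← Finset.sum_neg_distrib]
      refine Finset.sum_congr rfl fun k _ => ?_
      rw [← Finset.sum_neg_distrib]
      refine Finset.sum_congr rfl fun l _ => ?_
      rw [symplectic_antisymm, hsymm, neg_mul]
    linarith
  unfold generator
  rw [integral_add ((IsTame.sum fun k _ => hV.isTame_drift_mul h k k).integrable hV)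
    ((hV.isTame_noise h).integrable hV),
    integral_finsetSum _ fun k _ => (hV.isTame_drift_mul h k k).integrable hV, e3]
  simp only [e2, Finset.sum_sub_distrib, e4]
  ring

/-- Leibniz's rule; the last term is the carré du champ. Integrated against the invariant measure,
it identifies the symmetric part of the generator. -/
lemma generator_mul {φ ψ : Phase d m Q → ℝ} (hφ : IsCb2 π φ) (hψ : IsCb2 π ψ) (x : Phase d m Q) :
    generator π lam alpha β V (fun x => φ x * ψ x) x =
      φ x * generator π lam alpha β V ψ x + ψ x * generator π lam alpha β V φ x +
      2 * β⁻¹ * ∑ k, diffusion alpha k * (pderiv π k φ x * pderiv π k ψ x) := by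
  simp only [generator, noise, hφ.pderiv_pderiv_mul hψ hV.quot]
  simp only [hφ.pderiv_mul hψ hV.quot, mul_add, Finset.mul_sum, ← Finset.sum_add_distrib]
  refine Finset.sum_congr rfl fun k _ => ?_
  ring

/-- The symmetric part of the generator is its second order part. -/
lemma integral_mul_generator {φ ψ : Phase d m Q → ℝ} (hφ : IsCb2 π φ) (hψ : IsCb2 π ψ) :
    ∫ x, φ x * generator π lam alpha β V ψ x ∂(gibbs m β V) +
      ∫ x, ψ x * generator π lam alpha β V φ x ∂(gibbs m β V) =
    -(2 * β⁻¹ * ∑ k, diffusion alpha k *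
      ∫ x, pderiv π k φ x * pderiv π k ψ x ∂(gibbs m β V)) := by
  have h0 := hV.integral_generator (lam := lam) (alpha := alpha) (hφ.mul hψ hV.quot)
  have t : ∀ {φ ψ : Phase d m Q → ℝ}, IsCb2 π φ → IsCb2 π ψ →
      IsTame π V fun x => φ x * generator π lam alpha β V ψ x := fun {φ ψ} hφ hψ => by
    simp only [mul_comm (φ _)]
    exact (hV.isTame_generator hψ).mul_bounded (hφ.isCn.continuous hV.quot) hφ.bounded
  have t2 : ∀ k, IsTame π V fun x => diffusion alpha k * (pderiv π k φ x * pderiv π k ψ x) :=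
    fun k => ((hV.isTame_pderiv hφ k).mul_bounded (hV.continuous_pderiv_isCb2 hψ k)
      (hψ.pderiv_bounded k)).const_mul _
  simp only [hV.generator_mul hφ hψ] at h0
  rw [integral_add (((t hφ hψ).add (t hψ hφ)).integrable hV)
    (((IsTame.sum fun k _ => t2 k).const_mul _).integrable hV),
    integral_add ((t hφ hψ).integrable hV) ((t hψ hφ).integrable hV), integral_const_mul,
    integral_finsetSum _ fun k _ => (t2 k).integrable hV] at h0
  simp only [integral_const_mul] at h0
  linarith

lemma isCn_generator {φ : Phase d m Q → ℝ} (h : IsCb π φ) :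
    IsCn π 1 (generator π lam alpha β V φ) :=
  (IsCn.sum fun k _ => (hV.isCn_drift k).mul ((h.pderiv k).1.of_le (by simp))).add
    (IsCn.sum fun k _ => (IsCn.const _).mul (((h.pderiv k).pderiv k).1.of_le (by simp)))

/-- The commutator of the generator with a partial derivative. -/
lemma pderiv_generator {φ : Phase d m Q → ℝ} (h : IsCb π φ) (k : Coord d m) (x : Phase d m Q) :
    pderiv π k (generator π lam alpha β V φ) x = generator π lam alpha β V (pderiv π k φ) x +
      ∑ r, pderiv π k (drift π lam alpha V r) x * pderiv π r φ x := by
  have d1 : ∀ r, IsCn π 1 (pderiv π r φ) := fun r => (h.pderiv r).1.of_le (by simp)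
  have d2 : ∀ r, IsCn π 1 (pderiv π r (pderiv π r φ)) := fun r =>
    ((h.pderiv r).pderiv r).1.of_le (by simp)
  have c1 := fun r => (hV.isCn_drift (lam := lam) (alpha := alpha) r).mul (d1 r)
  have c2 := fun r => (IsCn.const (π := π) (n := 1) (β⁻¹ * diffusion alpha r)).mul (d2 r)
  have hc : ∀ r, pderiv π k (pderiv π r φ) = pderiv π r (pderiv π k φ) := fun r =>
    funext fun x => h.1.pderiv_comm hV.quot two_le_smooth k r x
  have hc2 : ∀ r, pderiv π k (pderiv π r (pderiv π r φ)) x =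
      pderiv π r (pderiv π r (pderiv π k φ)) x := fun r => by
    rw [(h.pderiv r).1.pderiv_comm hV.quot two_le_smooth, hc]
  -- The noise has constant coefficients and partial derivatives commute, so only the derivative of
  -- the drift survives in the commutator.
  unfold generator noise
  rw [IsCn.pderiv_add (IsCn.sum fun r _ => c1 r) (IsCn.sum fun r _ => c2 r) hV.quot one_ne_zero,
    IsCn.pderiv_sum (fun r _ => c1 r) hV.quot one_ne_zero,
    IsCn.pderiv_sum (fun r _ => c2 r) hV.quot one_ne_zero]
  simp only [IsCn.pderiv_const_mul, hc2, fun r => (hV.isCn_drift (lam := lam) (alpha := alpha)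
    r).pderiv_mul (d1 r) hV.quot one_ne_zero k x, Finset.sum_add_distrib, hc]
  ring

/-- By the commutator formula, beyond the generator applied to `∂_k φ` only second derivatives of
`V` enter, and they are bounded. -/
lemma isTame_pderiv_generator {φ : Phase d m Q → ℝ} (h : IsCb π φ) (k : Coord d m) :
    IsTame π V (pderiv π k (generator π lam alpha β V φ)) := by
  obtain ⟨C, _, hC⟩ := hV.exists_pderiv_drift_le (m := m) (lam := lam) (alpha := alpha)
  rw [show pderiv π k (generator π lam alpha β V φ) = _ from
    funext fun x => hV.pderiv_generator h k x]
  exact (hV.isTame_generator (h.pderiv k).isCb2).add (IsTame.sum fun r _ =>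
    (IsTame.of_bounded (hV.continuous_pderiv_drift k r) ⟨C, hC k r⟩).mul_bounded
      (hV.continuous_pderiv_isCb2 h.isCb2 r) (h.isCb2.pderiv_bounded r))

end IsAdmissible

end Generator

/-! ### The algebra of hypocoercivity -/

section Coercivity

variable {d m : ℕ}

lemma mul_mul_le_young (c x y : ℝ) {s : ℝ} (hs : 0 < s) :
    c * (x * y) ≤ s * x ^ 2 + c ^ 2 / (4 * s) * y ^ 2 := by
  have h : s * x ^ 2 + c ^ 2 / (4 * s) * y ^ 2 - c * (x * y) =
      (2 * s * x - c * y) ^ 2 / (4 * s) := by field_simp; ring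
  have : 0 ≤ (2 * s * x - c * y) ^ 2 / (4 * s) := by positivity
  linarith

/-- The matrix of the quadratic form in the gradient used to modify the norm of `H¹_ρ`. -/
def hypoMatrix (lam : Fin m → ℝ) (ε : ℝ) : Coord d m → Coord d m → ℝ
  | .inl i, .inl i' => if i = i' then ε ^ 10 else 0
  | .inl i, .inr (.inl i') => if i = i' then -ε ^ 9 else 0
  | .inr (.inl i), .inl i' => if i = i' then -ε ^ 9 else 0
  | .inr (.inl i), .inr (.inl i') => if i = i' then ε ^ 7 else 0
  | .inr (.inl i), .inr (.inr (j, i')) => if i = i' then -ε ^ 4 * lam j else 0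
  | .inr (.inr (j, i)), .inr (.inl i') => if i = i' then -ε ^ 4 * lam j else 0
  | .inr (.inr (j, i)), .inr (.inr (j', i')) => if j = j' then if i = i' then 1 else 0 else 0
  | _, _ => 0

lemma hypoMatrix_symm (lam : Fin m → ℝ) (ε : ℝ) (k l : Coord d m) :
    hypoMatrix lam ε k l = hypoMatrix lam ε l k := by
  rcases k with i | i | ⟨j, i⟩ <;> rcases l with i' | i' | ⟨j', i'⟩ <;>
    simp [hypoMatrix, eq_comm]

/-- The matrix couples only equal spatial indices, so the form splits into `d` blocks, in which `z`
meets `p` only through `∑ λ_j z_j`. -/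
lemma sum_hypoMatrix (lam : Fin m → ℝ) (ε : ℝ) (ξ η : Coord d m → ℝ) :
    ∑ k, ∑ l, hypoMatrix lam ε k l * (ξ k * η l) =
      ∑ i, (∑ j, ξ (.inr (.inr (j, i))) * η (.inr (.inr (j, i))) -
        ε ^ 4 * ((∑ j, lam j * ξ (.inr (.inr (j, i)))) * η (.inr (.inl i)) +
          ξ (.inr (.inl i)) * ∑ j, lam j * η (.inr (.inr (j, i)))) +
        ε ^ 7 * (ξ (.inr (.inl i)) * η (.inr (.inl i))) -
        ε ^ 9 * (ξ (.inr (.inl i)) * η (.inl i) + ξ (.inl i) * η (.inr (.inl i))) +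
        ε ^ 10 * (ξ (.inl i) * η (.inl i))) := by
  have h1 : ∀ f : Fin m → Fin d → ℝ, ∑ j, ∑ i, f j i = ∑ i, ∑ j, f j i :=
    fun f => Finset.sum_comm
  simp only [Fintype.sum_sum_type, Fintype.sum_prod_type, hypoMatrix, ite_mul, zero_mul,
    Finset.sum_ite_eq, Finset.mem_univ, if_true, Finset.sum_const_zero, add_zero, zero_add,
    Finset.sum_add_distrib, Finset.sum_sub_distrib, Finset.sum_ite_irrel, mul_add, Finset.mul_sum,
    Finset.sum_mul, h1]
  simp only [← Finset.sum_add_distrib, ← Finset.sum_sub_distrib]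
  refine Finset.sum_congr rfl fun i _ => ?_
  have h2 : ∑ j, -ε ^ 4 * lam j * (ξ (.inr (.inr (j, i))) * η (.inr (.inl i))) =
      -∑ j, ε ^ 4 * (lam j * ξ (.inr (.inr (j, i))) * η (.inr (.inl i))) := by
    rw [← Finset.sum_neg_distrib]
    exact Finset.sum_congr rfl fun j _ => by ring
  have h3 : ∑ j, -ε ^ 4 * lam j * (ξ (.inr (.inl i)) * η (.inr (.inr (j, i)))) =
      -∑ j, ε ^ 4 * (ξ (.inr (.inl i)) * (lam j * η (.inr (.inr (j, i))))) := by
    rw [← Finset.sum_neg_distrib]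
    exact Finset.sum_congr rfl fun j _ => by ring
  simp only [Finset.sum_add_distrib, Finset.sum_sub_distrib, one_mul, h2, h3]
  ring

/-- The cross terms are dominated by the diagonal because `2·4 > 0 + 7` and `2·9 > 7 + 10` leave a
spare factor `ε` in each Young inequality. Here `z` stands for `∑ z_j²` and `y` for `∑ λ_j z_j`, so
the hypothesis is Cauchy–Schwarz. -/
lemma hypo_pos_aux {ε Λ : ℝ} (hε : 0 < ε) (hΛ : 0 < Λ) (h1 : ε ≤ 1 / (8 * Λ)) (h2 : ε ≤ 1 / 8)
    (z p q y : ℝ) (hy : y ^ 2 ≤ Λ * z) :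
    1 / 2 * z + ε ^ 7 / 2 * p ^ 2 + ε ^ 10 / 2 * q ^ 2 ≤
      z - ε ^ 4 * (y * p + p * y) + ε ^ 7 * (p * p) - ε ^ 9 * (p * q + q * p) +
        ε ^ 10 * (q * q) := by
  have a1 := mul_mul_le_young (2 * ε ^ 4) y p (s := 1 / (2 * Λ)) (by positivity)
  have a2 := mul_mul_le_young (2 * ε ^ 9) p q (s := ε ^ 7 / 4) (by positivity)
  have a3 : (2 * ε ^ 4) ^ 2 / (4 * (1 / (2 * Λ))) = 2 * Λ * ε * ε ^ 7 := by field_simp; ring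
  have a4 : (2 * ε ^ 9) ^ 2 / (4 * (ε ^ 7 / 4)) = 4 * ε * ε ^ 10 := by field_simp; ring
  have a5 : 1 / (2 * Λ) * y ^ 2 ≤ 1 / 2 * z := by
    rw [div_mul_eq_mul_div, div_le_iff₀ (by positivity)]
    linarith
  have a6 : 2 * Λ * ε ≤ 1 / 4 := by
    have := (le_div_iff₀ (by positivity)).1 h1
    linarith
  have a7 : 2 * Λ * ε * ε ^ 7 * p ^ 2 ≤ 1 / 4 * ε ^ 7 * p ^ 2 := by gcongr
  have a8 : 4 * ε * ε ^ 10 * q ^ 2 ≤ 1 / 2 * ε ^ 10 * q ^ 2 := by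
    gcongr
    linarith
  rw [a3] at a1
  rw [a4] at a2
  linarith

/-- The cross terms contribute `ε⁴ Λ p²` and `ε⁹ q²` to the dissipation. Errors containing `y = ∑
λ_j z_j` or `w = ∑ λ_j α_j z_j` go into `A`, and `η`, up to sign the Hessian term, keeps a small
factor. The remaining error `ε⁷ p q` is harmless because `2·7 > 4 + 9`. -/
lemma hypo_diss_aux {ε Λ : ℝ} (hε : 0 < ε) (hΛ : 0 < Λ) (h1 : ε ≤ Λ / 16) (h2 : ε ≤ 1 / 8) : ∃ A, 0 < A ∧ ∀ p q y w η : ℝ,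
    ε ^ 4 * Λ / 4 * p ^ 2 + ε ^ 9 / 4 * q ^ 2 ≤
      A * (y ^ 2 + w ^ 2) + ε ^ 9 * η ^ 2 - y * p + ε ^ 4 * (y * (q - y) + p * (Λ * p - w)) -
        ε ^ 7 * (p * (q - y)) + ε ^ 9 * (p * -η + q * (q - y)) - ε ^ 10 * (q * -η) := by
  have hε1 : ε ≤ 1 := by linarith
  -- The Young costs of `y²`, then of `w²`. They may be large, since the weight `a` of the
  -- undifferentiated `L²` part is chosen after `ε`.
  set A₁ := (-1 + ε ^ 7) ^ 2 / (4 * (ε ^ 4 * Λ / 8)) + ε ^ 8 / (4 * (ε ^ 9 / 8)) + ε ^ 4 +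
    (ε ^ 9) ^ 2 / (4 * (ε ^ 9 / 8)) with hA₁
  set A₂ := (ε ^ 4) ^ 2 / (4 * (ε ^ 4 * Λ / 8)) with hA₂
  have hA₁0 : 0 < A₁ := by positivity
  have hA₂0 : 0 < A₂ := by positivity
  refine ⟨A₁ + A₂, by positivity, fun p q y w η => ?_⟩
  have sp : 0 < ε ^ 4 * Λ / 8 := by positivity
  have sq : 0 < ε ^ 9 / 8 := by positivity
  have b1 := mul_mul_le_young (-(-1 + ε ^ 7)) p y sp
  have b2 := mul_mul_le_young (-ε ^ 4) q y sq
  have b3 := mul_mul_le_young (ε ^ 4) p w sp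
  have b4 := mul_mul_le_young (ε ^ 7) p q sp
  have b5 := mul_mul_le_young (ε ^ 9) p η (s := ε ^ 9 / 2) (by positivity)
  have b6 := mul_mul_le_young (ε ^ 9) q y sq
  have b7 := mul_mul_le_young (-ε ^ 10) q η sq
  -- The left coefficient is `2 ε¹⁰ / Λ`; this is where `ε ≤ Λ / 16` is spent.
  have e4 : (ε ^ 7) ^ 2 / (4 * (ε ^ 4 * Λ / 8)) * q ^ 2 ≤ ε ^ 9 / 8 * q ^ 2 := by
    refine mul_le_mul_of_nonneg_right ?_ (sq_nonneg q)
    rw [div_le_iff₀ (by positivity)]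
    have : ε ^ 13 * ε ≤ ε ^ 13 * (Λ / 16) := by gcongr
    calc (ε ^ 7) ^ 2 = ε ^ 13 * ε := by ring
      _ ≤ ε ^ 13 * (Λ / 16) := this
      _ = _ := by ring
  have e5 : ε ^ 9 / 2 * p ^ 2 ≤ ε ^ 4 * Λ / 8 * p ^ 2 := by
    refine mul_le_mul_of_nonneg_right ?_ (sq_nonneg p)
    have h5 : ε ^ 5 ≤ ε := pow_le_of_le_one hε.le hε1 (by norm_num)
    have : ε ^ 4 * ε ^ 5 ≤ ε ^ 4 * (Λ / 4) := by
      gcongr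
      linarith
    calc ε ^ 9 / 2 = ε ^ 4 * ε ^ 5 / 2 := by ring
      _ ≤ ε ^ 4 * (Λ / 4) / 2 := by linarith
      _ = _ := by ring
  have e6 : (ε ^ 9) ^ 2 / (4 * (ε ^ 9 / 2)) = ε ^ 9 / 2 := by field_simp; ring
  have e7 : (-ε ^ 10) ^ 2 / (4 * (ε ^ 9 / 8)) * η ^ 2 ≤ ε ^ 9 / 2 * η ^ 2 := by
    refine mul_le_mul_of_nonneg_right ?_ (sq_nonneg η)
    rw [div_le_iff₀ (by positivity)]
    have h5 : ε ^ 18 * ε ^ 2 ≤ ε ^ 18 * (1 / 4) := by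
      gcongr
      nlinarith
    calc (-ε ^ 10) ^ 2 = ε ^ 18 * ε ^ 2 := by ring
      _ ≤ ε ^ 18 * (1 / 4) := h5
      _ = _ := by ring
  have e8 : (-(-1 + ε ^ 7)) ^ 2 = (-1 + ε ^ 7) ^ 2 := by ring
  have e9 : (-ε ^ 4) ^ 2 = ε ^ 8 := by ring
  rw [e8] at b1
  rw [e9] at b2
  rw [e6] at b5
  have f1 : A₁ * y ^ 2 = (-1 + ε ^ 7) ^ 2 / (4 * (ε ^ 4 * Λ / 8)) * y ^ 2 +
    ε ^ 8 / (4 * (ε ^ 9 / 8)) * y ^ 2 + ε ^ 4 * y ^ 2 +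
    (ε ^ 9) ^ 2 / (4 * (ε ^ 9 / 8)) * y ^ 2 := by rw [hA₁]; ring
  have f2 : 0 ≤ A₂ * y ^ 2 := by positivity
  have f3 : 0 ≤ A₁ * w ^ 2 := by positivity
  have f4 : 0 ≤ ε ^ 4 * Λ / 4 * p ^ 2 := by positivity
  have f5 : 0 ≤ ε ^ 9 / 4 * q ^ 2 := by positivity
  linarith

/-- Coercivity of the modified quadratic form and of its dissipation. -/
lemma exists_hypoMatrix {β : ℝ} (hβ : 0 < β) {lam alpha : Fin m → ℝ} (halpha : ∀ j, 0 < alpha j)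
    (hlam : ∃ j, lam j ≠ 0) {K : ℝ} (hK : 0 ≤ K) : ∃ ε a c : ℝ, 0 < a ∧ 0 < c ∧
    (∀ ξ : Coord d m → ℝ, c * ∑ k, ξ k ^ 2 ≤ ∑ k, ∑ l, hypoMatrix lam ε k l * (ξ k * ξ l)) ∧
    ∀ ξ ζ : Coord d m → ℝ, ∑ i, ζ (.inl i) ^ 2 ≤ K * ∑ i, ξ (.inr (.inl i)) ^ 2 →
      (∀ i, ζ (.inr (.inl i)) = ξ (.inl i) - ∑ j, lam j * ξ (.inr (.inr (j, i)))) →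
      (∀ j i, ζ (.inr (.inr (j, i))) =
        lam j * ξ (.inr (.inl i)) - alpha j * ξ (.inr (.inr (j, i)))) →
      c * ∑ k, ξ k ^ 2 ≤ a * β⁻¹ * ∑ k, diffusion alpha k * ξ k ^ 2 -
        ∑ k, ∑ l, hypoMatrix lam ε k l * (ξ k * ζ l) := by
  set Λ := ∑ j, lam j ^ 2 with hΛdef
  have hΛ : 0 < Λ := by
    obtain ⟨j, hj⟩ := hlam
    exact Finset.sum_pos' (fun j _ => sq_nonneg _) ⟨j, Finset.mem_univ _, by positivity⟩
  -- The first two thresholds make the form positive, the second and third its dissipation, and the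
  -- fourth absorbs the Hessian bound `K`.
  obtain ⟨ε, hε, e1, e2, e3, e4⟩ : ∃ ε : ℝ, 0 < ε ∧ ε ≤ 1 / (8 * Λ) ∧ ε ≤ 1 / 8 ∧ ε ≤ Λ / 16 ∧
      ε ≤ Λ / (8 * (K + 1)) :=
    ⟨min (min (1 / (8 * Λ)) (1 / 8)) (min (Λ / 16) (Λ / (8 * (K + 1)))), by positivity,
      (min_le_left _ _).trans (min_le_left _ _), (min_le_left _ _).trans (min_le_right _ _),
      (min_le_right _ _).trans (min_le_left _ _), (min_le_right _ _).trans (min_le_right _ _)⟩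
  obtain ⟨A, hA, hdiss⟩ := hypo_diss_aux hε hΛ e3 e2
  have hε1 : ε ≤ 1 := by linarith
  set W := ∑ j, (lam j * alpha j) ^ 2 with hW
  have hW0 : 0 ≤ W := Finset.sum_nonneg fun j _ => sq_nonneg _
  set D := A * (Λ + W) + 1 with hD
  have hD0 : 0 < D := by positivity
  -- Chosen so that `a β⁻¹ α_j ≥ D` for every `j`: the direct dissipation by the noise then pays for
  -- all errors in `z`. The added `1` keeps `a` positive in any case.
  set a := β * (1 + ∑ j, D / alpha j) with ha
  have ha0 : 0 < a := mul_pos hβ (add_pos_of_pos_of_nonneg one_pos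
    (Finset.sum_nonneg fun j _ => (div_pos hD0 (halpha j)).le))
  have haj : ∀ j, D ≤ a * β⁻¹ * alpha j := fun j => by
    have h1 : D / alpha j ≤ ∑ j, D / alpha j := Finset.single_le_sum
      (f := fun j => D / alpha j) (fun j _ => (div_pos hD0 (halpha j)).le) (Finset.mem_univ j)
    rw [ha, mul_right_comm β, mul_inv_cancel₀ hβ.ne', one_mul]
    calc D = D / alpha j * alpha j := (div_mul_cancel₀ _ (halpha j).ne').symm
      _ ≤ _ := mul_le_mul_of_nonneg_right (by linarith) (halpha j).le
  have p7 : ε ^ 10 ≤ ε ^ 7 := pow_le_pow_of_le_one hε.le hε1 (by norm_num)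
  have p9 : ε ^ 10 ≤ ε ^ 9 := pow_le_pow_of_le_one hε.le hε1 (by norm_num)
  set c := min (min (1 / 2) (ε ^ 4 * Λ / 8)) (ε ^ 10 / 4) with hc
  have c1 : c ≤ 1 / 2 := (min_le_left _ _).trans (min_le_left _ _)
  have c2 : c ≤ ε ^ 4 * Λ / 8 := (min_le_left _ _).trans (min_le_right _ _)
  have c3 : c ≤ ε ^ 10 / 4 := min_le_right _ _
  have hc0 : 0 < c := by positivity
  have hy : ∀ z : Fin m → ℝ, (∑ j, lam j * z j) ^ 2 ≤ Λ * ∑ j, z j ^ 2 := fun z =>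
    Finset.sum_mul_sq_le_sq_mul_sq _ _ _
  have hsum : ∀ ξ : Coord d m → ℝ, ∑ k, ξ k ^ 2 = ∑ i, (ξ (.inl i) ^ 2 + ξ (.inr (.inl i)) ^ 2 +
      ∑ j, ξ (.inr (.inr (j, i))) ^ 2) := fun ξ => by
    rw [Fintype.sum_sum_type, Fintype.sum_sum_type, Fintype.sum_prod_type, Finset.sum_comm,
      Finset.sum_add_distrib, Finset.sum_add_distrib, add_assoc]
  refine ⟨ε, a, c, ha0, hc0, fun ξ => ?_, fun ξ ζ h1 h2 h3 => ?_⟩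
  · rw [sum_hypoMatrix, hsum, Finset.mul_sum]
    refine Finset.sum_le_sum fun i _ => ?_
    have := hypo_pos_aux hε hΛ e1 e2 (∑ j, ξ (.inr (.inr (j, i))) ^ 2) (ξ (.inr (.inl i)))
      (ξ (.inl i)) _ (hy fun j => ξ (.inr (.inr (j, i))))
    have hz : 0 ≤ ∑ j, ξ (.inr (.inr (j, i))) ^ 2 := Finset.sum_nonneg fun j _ => sq_nonneg _
    have g1 : c * ∑ j, ξ (.inr (.inr (j, i))) ^ 2 ≤ 1 / 2 * ∑ j, ξ (.inr (.inr (j, i))) ^ 2 :=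
      mul_le_mul_of_nonneg_right c1 hz
    have g2 : c * ξ (.inr (.inl i)) ^ 2 ≤ ε ^ 7 / 2 * ξ (.inr (.inl i)) ^ 2 :=
      mul_le_mul_of_nonneg_right (by nlinarith [pow_pos hε 10]) (sq_nonneg _)
    have g3 : c * ξ (.inl i) ^ 2 ≤ ε ^ 10 / 2 * ξ (.inl i) ^ 2 :=
      mul_le_mul_of_nonneg_right (by nlinarith [pow_pos hε 10]) (sq_nonneg _)
    have g4 : ∑ j, ξ (.inr (.inr (j, i))) * ξ (.inr (.inr (j, i))) =
        ∑ j, ξ (.inr (.inr (j, i))) ^ 2 := Finset.sum_congr rfl fun j _ => (sq _).symm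
    rw [g4]
    linarith
  -- The Hessian term is bounded by `K` times the `p`-gradient; `ε⁹ K` is small compared with `ε⁴
  -- Λ`.
  · have hη : ε ^ 9 * ∑ i, ζ (.inl i) ^ 2 ≤ ε ^ 4 * Λ / 8 * ∑ i, ξ (.inr (.inl i)) ^ 2 := by
      have hp : 0 ≤ ∑ i, ξ (.inr (.inl i)) ^ 2 := Finset.sum_nonneg fun j _ => sq_nonneg _
      have h5 : ε ^ 5 ≤ ε := pow_le_of_le_one hε.le hε1 (by norm_num)
      have h6 : ε * (8 * (K + 1)) ≤ Λ := (le_div_iff₀ (by positivity)).1 e4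
      have h7 : ε ^ 5 * K ≤ Λ / 8 := by nlinarith
      calc ε ^ 9 * ∑ i, ζ (.inl i) ^ 2 ≤ ε ^ 9 * (K * ∑ i, ξ (.inr (.inl i)) ^ 2) := by gcongr
        _ = ε ^ 4 * (ε ^ 5 * K) * ∑ i, ξ (.inr (.inl i)) ^ 2 := by ring
        _ ≤ ε ^ 4 * (Λ / 8) * ∑ i, ξ (.inr (.inl i)) ^ 2 := by gcongr
        _ = _ := by ring
    have hdiff : ∑ k, diffusion alpha k * ξ k ^ 2 =
        ∑ i, ∑ j, alpha j * ξ (.inr (.inr (j, i))) ^ 2 := by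
      rw [Fintype.sum_sum_type, Fintype.sum_sum_type, Fintype.sum_prod_type, Finset.sum_comm]
      simp [diffusion]
    have key : ∀ i, c * (ξ (.inl i) ^ 2 + ξ (.inr (.inl i)) ^ 2 +
          ∑ j, ξ (.inr (.inr (j, i))) ^ 2) + ε ^ 4 * Λ / 8 * ξ (.inr (.inl i)) ^ 2 -
          ε ^ 9 * ζ (.inl i) ^ 2 ≤
        a * β⁻¹ * ∑ j, alpha j * ξ (.inr (.inr (j, i))) ^ 2 -
        (∑ j, ξ (.inr (.inr (j, i))) * ζ (.inr (.inr (j, i))) -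
        ε ^ 4 * ((∑ j, lam j * ξ (.inr (.inr (j, i)))) * ζ (.inr (.inl i)) +
          ξ (.inr (.inl i)) * ∑ j, lam j * ζ (.inr (.inr (j, i)))) +
        ε ^ 7 * (ξ (.inr (.inl i)) * ζ (.inr (.inl i))) -
        ε ^ 9 * (ξ (.inr (.inl i)) * ζ (.inl i) + ξ (.inl i) * ζ (.inr (.inl i))) +
        ε ^ 10 * (ξ (.inl i) * ζ (.inl i))) := fun i => by
      set z : Fin m → ℝ := fun j => ξ (.inr (.inr (j, i))) with hz
      set p := ξ (.inr (.inl i)) with hp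
      set q := ξ (.inl i) with hq
      set y := ∑ j, lam j * z j with hydef
      set w := ∑ j, lam j * alpha j * z j with hw
      set S := ∑ j, z j ^ 2 with hS
      have hS0 : 0 ≤ S := Finset.sum_nonneg fun j _ => sq_nonneg _
      have d1 := hdiss p q y w (-ζ (.inl i))
      have d2 : y ^ 2 ≤ Λ * S := hy z
      have d3 : w ^ 2 ≤ W * S := Finset.sum_mul_sq_le_sq_mul_sq _ _ _
      have d4 : D * S ≤ a * β⁻¹ * ∑ j, alpha j * z j ^ 2 := by
        rw [Finset.mul_sum, Finset.mul_sum]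
        refine Finset.sum_le_sum fun j _ => ?_
        rw [← mul_assoc]
        exact mul_le_mul_of_nonneg_right (haj j) (sq_nonneg _)
      have d5 : ∑ j, z j * ζ (.inr (.inr (j, i))) = y * p - ∑ j, alpha j * z j ^ 2 := by
        rw [hydef, Finset.sum_mul, ← Finset.sum_sub_distrib]
        refine Finset.sum_congr rfl fun j _ => ?_
        rw [h3]
        ring
      have d6 : ∑ j, lam j * ζ (.inr (.inr (j, i))) = Λ * p - w := by
        rw [hΛdef, hw, Finset.sum_mul, ← Finset.sum_sub_distrib]
        refine Finset.sum_congr rfl fun j _ => ?_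
        rw [h3]
        ring
      have d7 : 0 ≤ ∑ j, alpha j * z j ^ 2 :=
        Finset.sum_nonneg fun j _ => mul_nonneg (halpha j).le (sq_nonneg _)
      have d8 : A * (y ^ 2 + w ^ 2) ≤ A * (Λ * S + W * S) := by gcongr
      have g1 : c * S ≤ 1 / 2 * S := mul_le_mul_of_nonneg_right c1 hS0
      have g2 : c * p ^ 2 ≤ ε ^ 4 * Λ / 8 * p ^ 2 := mul_le_mul_of_nonneg_right c2 (sq_nonneg _)
      have g3 : c * q ^ 2 ≤ ε ^ 9 / 4 * q ^ 2 :=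
        mul_le_mul_of_nonneg_right (by linarith) (sq_nonneg _)
      have g4 : D * S = A * (Λ * S + W * S) + S := by rw [hD]; ring
      rw [d5, d6, h2]
      rw [neg_neg, neg_sq] at d1
      linarith
    have := Finset.sum_le_sum fun i (_ : i ∈ Finset.univ) => key i
    rw [sum_hypoMatrix, hsum, hdiff]
    simp only [Finset.sum_add_distrib, Finset.sum_sub_distrib, ← Finset.mul_sum] at this ⊢
    linarith

end Coercivity

/-! ### The Poincaré inequality on a bounded convex set -/

section LocalPoincare

open scoped ENNReal

variable {E : Type*} [NormedAddCommGroup E] [NormedSpace ℝ E] [FiniteDimensional ℝ E]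
  [MeasurableSpace E] [BorelSpace E] {μ : Measure E} [μ.IsAddHaarMeasure] {B : Set E}

/-- By convexity the homothety with centre `y` and ratio `s` maps `B` into itself; its inverse
Jacobian is `s^{-N} ≤ 2^N` because `s ≥ 1/2`. -/
lemma setLIntegral_homothety_le (hB : Convex ℝ B) (hBm : MeasurableSet B) {G : E → ℝ≥0∞}
    (hG : Measurable G) {s : ℝ} (hs : s ∈ Set.Icc (1 / 2 : ℝ) 1) {y : E} (hy : y ∈ B) :
    ∫⁻ x in B, G (s • x + (1 - s) • y) ∂μ ≤ 2 ^ Module.finrank ℝ E * ∫⁻ x in B, G x ∂μ := by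
  have hs0 : (0 : ℝ) < s := by linarith [hs.1]
  have hm : Measurable (B.indicator G) := hG.indicator hBm
  calc ∫⁻ x in B, G (s • x + (1 - s) • y) ∂μ
      ≤ ∫⁻ x, B.indicator G (s • x + (1 - s) • y) ∂μ := by
        rw [← lintegral_indicator hBm]
        refine lintegral_mono fun x => ?_
        by_cases hx : x ∈ B
        · rw [Set.indicator_of_mem hx, Set.indicator_of_mem]
          exact hB hx hy hs0.le (by linarith [hs.2]) (by ring)
        · rw [Set.indicator_of_notMem hx]
          exact zero_le
    _ = ∫⁻ x, B.indicator G (x + (1 - s) • y) ∂(μ.map (s • ·)) := by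
        exact (lintegral_map (f := fun x => B.indicator G (x + (1 - s) • y))
          (hm.comp (measurable_add_const _)) (measurable_const_smul s)).symm
    _ = ENNReal.ofReal |(s ^ Module.finrank ℝ E)⁻¹| * ∫⁻ x in B, G x ∂μ := by
        rw [Measure.map_addHaar_smul μ hs0.ne', lintegral_smul_measure,
          lintegral_add_right_eq_self, lintegral_indicator hBm, smul_eq_mul]
    _ ≤ _ := by
        gcongr
        have h2 : |(s ^ Module.finrank ℝ E)⁻¹| ≤ 2 ^ Module.finrank ℝ E := by
          rw [abs_of_nonneg (by positivity), ← inv_pow]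
          gcongr
          rw [inv_le_comm₀ hs0 two_pos]
          linarith [hs.1]
        calc ENNReal.ofReal |(s ^ Module.finrank ℝ E)⁻¹|
            ≤ ENNReal.ofReal (2 ^ Module.finrank ℝ E) := ENNReal.ofReal_le_ofReal h2
          _ = _ := by
            rw [ENNReal.ofReal_pow two_pos.le]
            norm_num

omit [FiniteDimensional ℝ E] [MeasurableSpace E] [BorelSpace E] in
-- The fundamental theorem of calculus and Cauchy–Schwarz on the half of the segment between the
-- midpoint and `x`. Restriction to that half keeps `s ≥ 1/2`, as the change of variables requires.
lemma sq_sub_midpoint_le {F : E → ℝ} (hF : ContDiff ℝ 1 F) {D : ℝ} {x y : E} (hD : ‖x - y‖ ≤ D) :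
    ENNReal.ofReal ((F x - F ((1 / 2 : ℝ) • x + (1 - 1 / 2 : ℝ) • y)) ^ 2) ≤
      ∫⁻ s in Set.Ioc (1 / 2 : ℝ) 1,
        ENNReal.ofReal (D ^ 2 * ‖fderiv ℝ F (s • x + (1 - s) • y)‖ ^ 2) := by
  have hγ : ∀ s : ℝ, HasDerivAt (fun s : ℝ => s • x + (1 - s) • y) (x - y) s := fun s => by
    have h1 : HasDerivAt (fun s : ℝ => s • x + (1 - s) • y) ((1 : ℝ) • x + (-1 : ℝ) • y) s :=
      ((hasDerivAt_id s).smul_const x).add (((hasDerivAt_id s).const_sub 1).smul_const y)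
    rwa [one_smul, neg_one_smul, ← sub_eq_add_neg] at h1
  have hγc : Continuous fun s : ℝ => s • x + (1 - s) • y :=
    continuous_iff_continuousAt.2 fun s => (hγ s).continuousAt
  set a : ℝ → ℝ := fun s => fderiv ℝ F (s • x + (1 - s) • y) (x - y) with ha
  have hF' : Continuous fun s : ℝ => fderiv ℝ F (s • x + (1 - s) • y) :=
    (hF.continuous_fderiv one_ne_zero).comp hγc
  have hac : Continuous a := hF'.clm_apply continuous_const
  have hder : ∀ s : ℝ, HasDerivAt (fun s : ℝ => F (s • x + (1 - s) • y)) (a s) s := fun s =>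
    (((hF.differentiable one_ne_zero) _).hasFDerivAt.comp_hasDerivAt s (hγ s))
  have hJ : ∫ s in (1 / 2 : ℝ)..1, a s =
      F x - F ((1 / 2 : ℝ) • x + (1 - 1 / 2 : ℝ) • y) := by
    rw [intervalIntegral.integral_eq_sub_of_hasDerivAt (fun s _ => hder s)
      (hac.intervalIntegrable _ _)]
    simp
  -- Cauchy–Schwarz by expanding `∫ (a - 2J)² ≥ 0`, where `2J` is the mean of `a` over an interval
  -- of length `1/2`.
  have hcs : (∫ s in (1 / 2 : ℝ)..1, a s) ^ 2 ≤ 1 / 2 * ∫ s in (1 / 2 : ℝ)..1, a s ^ 2 := by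
    set J := ∫ s in (1 / 2 : ℝ)..1, a s with hJdef
    have h0 : 0 ≤ ∫ s in (1 / 2 : ℝ)..1, (a s - 2 * J) ^ 2 :=
      intervalIntegral.integral_nonneg (by norm_num) fun s _ => sq_nonneg _
    have h1 : ∀ s, (a s - 2 * J) ^ 2 = a s ^ 2 - 4 * J * a s + 4 * J ^ 2 := fun s => by ring
    simp only [h1] at h0
    have c1 : Continuous fun s => a s ^ 2 - 4 * J * a s :=
      (hac.pow 2).sub (continuous_const.mul hac)
    have c2 : Continuous fun s => 4 * J * a s := continuous_const.mul hac
    rw [intervalIntegral.integral_add (c1.intervalIntegrable _ _)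
      (continuous_const.intervalIntegrable _ _),
      intervalIntegral.integral_sub (f := fun s => a s ^ 2)
      ((hac.pow 2).intervalIntegrable _ _) (c2.intervalIntegrable _ _), intervalIntegral.integral_const_mul,
      intervalIntegral.integral_const, ← hJdef, smul_eq_mul] at h0
    linarith
  have hle : ∫ s in (1 / 2 : ℝ)..1, a s ^ 2 ≤
      ∫ s in (1 / 2 : ℝ)..1, D ^ 2 * ‖fderiv ℝ F (s • x + (1 - s) • y)‖ ^ 2 := by
    refine intervalIntegral.integral_mono (by norm_num) ((hac.pow 2).intervalIntegrable _ _)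
      ((continuous_const.mul (hF'.norm.pow 2)).intervalIntegrable _ _) fun s => ?_
    have h1 : |a s| ≤ D * ‖fderiv ℝ F (s • x + (1 - s) • y)‖ := by
      rw [mul_comm]
      exact (ContinuousLinearMap.le_opNorm _ _).trans
        (mul_le_mul_of_nonneg_left hD (norm_nonneg (fderiv ℝ F (s • x + (1 - s) • y))))
    rw [← mul_pow, ← sq_abs]
    exact pow_le_pow_left₀ (abs_nonneg _) h1 2
  have h0 : 0 ≤ ∫ s in (1 / 2 : ℝ)..1, a s ^ 2 :=
    intervalIntegral.integral_nonneg (by norm_num) fun s _ => sq_nonneg _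
  rw [← hJ]
  refine (ENNReal.ofReal_le_ofReal (hcs.trans (by linarith) :
    _ ≤ ∫ s in (1 / 2 : ℝ)..1, D ^ 2 * ‖fderiv ℝ F (s • x + (1 - s) • y)‖ ^ 2)).trans ?_
  rw [intervalIntegral.integral_of_le (by norm_num), ofReal_integral_eq_lintegral_ofReal]
  · exact ((continuous_const.mul (hF'.norm.pow 2)).integrableOn_Icc (a := (1 / 2 : ℝ))
      (b := 1)).mono_set Set.Ioc_subset_Icc_self
  · exact Eventually.of_forall fun s => by positivity

/-- The Poincaré inequality on a bounded convex set. -/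
lemma exists_local_poincare (hB : Convex ℝ B) (hBm : MeasurableSet B)
    (hBb : Bornology.IsBounded B) (hB0 : μ B ≠ 0) : ∃ C : ℝ≥0∞, C ≠ ⊤ ∧ ∀ F : E → ℝ,
    ContDiff ℝ 1 F → ∃ m : ℝ, ∫⁻ x in B, ENNReal.ofReal ((F x - m) ^ 2) ∂μ ≤
      C * ∫⁻ x in B, ENNReal.ofReal (‖fderiv ℝ F x‖ ^ 2) ∂μ := by
  have hBtop : μ B ≠ ⊤ := hBb.measure_lt_top.ne
  set D := Metric.diam B
  set N := Module.finrank ℝ E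
  refine ⟨(μ B)⁻¹ * (4 * (μ B * (ENNReal.ofReal (D ^ 2) * 2 ^ N))), by finiteness, fun F hF => ?_⟩
  set G : E → ℝ≥0∞ := fun x => ENNReal.ofReal (‖fderiv ℝ F x‖ ^ 2) with hG
  have hGc : Continuous G :=
    ENNReal.continuous_ofReal.comp ((hF.continuous_fderiv one_ne_zero).norm.pow 2)
  set I := ∫⁻ x in B, G x ∂μ with hI
  set M : E → E → ℝ≥0∞ := fun x y =>
    ENNReal.ofReal ((F x - F ((1 / 2 : ℝ) • x + (1 - 1 / 2 : ℝ) • y)) ^ 2) with hM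
  have hMc : Continuous fun p : E × E => M p.1 p.2 := by
    refine ENNReal.continuous_ofReal.comp (((hF.continuous.comp continuous_fst).sub
      (hF.continuous.comp ?_)).pow 2)
    fun_prop
  have hmid : ∫⁻ y in B, ∫⁻ x in B, M x y ∂μ ∂μ ≤ μ B * (ENNReal.ofReal (D ^ 2) * 2 ^ N) * I := by
    calc ∫⁻ y in B, ∫⁻ x in B, M x y ∂μ ∂μ
        ≤ ∫⁻ y in B, ENNReal.ofReal (D ^ 2) * 2 ^ N * I ∂μ := by
          refine setLIntegral_mono' hBm fun y hy => ?_
          calc ∫⁻ x in B, M x y ∂μ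
              ≤ ∫⁻ x in B, (∫⁻ s in Set.Ioc (1 / 2 : ℝ) 1,
                ENNReal.ofReal (D ^ 2) * G (s • x + (1 - s) • y)) ∂μ := by
                refine setLIntegral_mono' hBm fun x hx => ?_
                refine (sq_sub_midpoint_le hF (D := D) ?_).trans_eq ?_
                · rw [← dist_eq_norm]
                  exact Metric.dist_le_diam_of_mem hBb hx hy
                · simp only [hG, ENNReal.ofReal_mul (sq_nonneg D)]
            _ = ∫⁻ s in Set.Ioc (1 / 2 : ℝ) 1, (∫⁻ x in B,
                ENNReal.ofReal (D ^ 2) * G (s • x + (1 - s) • y) ∂μ) := by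
                rw [lintegral_lintegral_swap]
                refine Measurable.aemeasurable ?_
                refine Measurable.const_mul (hGc.measurable.comp ?_) _
                exact Continuous.measurable (by fun_prop)
            _ ≤ ∫⁻ s in Set.Ioc (1 / 2 : ℝ) 1, ENNReal.ofReal (D ^ 2) * (2 ^ N * I) := by
                refine setLIntegral_mono' measurableSet_Ioc fun s hs => ?_
                have hm : Measurable fun x => G (s • x + (1 - s) • y) :=
                  hGc.measurable.comp (Continuous.measurable (by fun_prop))
                rw [lintegral_const_mul _ hm]
                gcongr
                exact setLIntegral_homothety_le hB hBm hGc.measurable ⟨hs.1.le, hs.2⟩ hy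
            _ ≤ ENNReal.ofReal (D ^ 2) * 2 ^ N * I := by
                rw [setLIntegral_const, Real.volume_Ioc, ← mul_assoc]
                refine mul_le_of_le_one_right zero_le ?_
                rw [ENNReal.ofReal_le_one]
                norm_num
      _ = _ := by
          rw [setLIntegral_const]
          ring
  -- Both points are compared with their common midpoint, which makes the two resulting terms
  -- symmetric in `x` and `y`.
  have hsq : ∀ x y, ENNReal.ofReal ((F x - F y) ^ 2) ≤ 2 * M x y + 2 * M y x := fun x y => by
    have e : (1 / 2 : ℝ) • y + (1 - 1 / 2 : ℝ) • x = (1 / 2 : ℝ) • x + (1 - 1 / 2 : ℝ) • y := by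
      module
    have e2 : ENNReal.ofReal 2 = 2 := by norm_num
    simp only [hM, e]
    rw [← e2, ← ENNReal.ofReal_mul two_pos.le, ← ENNReal.ofReal_mul two_pos.le,
      ← ENNReal.ofReal_add (by positivity) (by positivity)]
    refine ENNReal.ofReal_le_ofReal ?_
    set w := F ((1 / 2 : ℝ) • x + (1 - 1 / 2 : ℝ) • y)
    nlinarith [sq_nonneg (F x - w + (F y - w))]
  have hMx : ∀ y, Measurable fun x => M x y := fun y =>
    (hMc.comp (continuous_id.prodMk continuous_const)).measurable
  have hMy : ∀ y, Measurable fun x => M y x := fun y =>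
    (hMc.comp (continuous_const.prodMk continuous_id)).measurable
  have hdouble : ∫⁻ y in B, (∫⁻ x in B, ENNReal.ofReal ((F x - F y) ^ 2) ∂μ) ∂μ ≤
      4 * (μ B * (ENNReal.ofReal (D ^ 2) * 2 ^ N) * I) := by
    calc ∫⁻ y in B, (∫⁻ x in B, ENNReal.ofReal ((F x - F y) ^ 2) ∂μ) ∂μ
        ≤ ∫⁻ y in B, (2 * (∫⁻ x in B, M x y ∂μ) + 2 * ∫⁻ x in B, M y x ∂μ) ∂μ := by
          refine lintegral_mono fun y => ?_
          rw [← lintegral_const_mul _ (hMx y), ← lintegral_const_mul _ (hMy y),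
            ← lintegral_add_left ((hMx y).const_mul 2)]
          exact lintegral_mono fun x => hsq x y
      _ = 2 * (∫⁻ y in B, ∫⁻ x in B, M x y ∂μ ∂μ) + 2 * ∫⁻ y in B, ∫⁻ x in B, M y x ∂μ ∂μ := by
          have m1 : Measurable fun y => ∫⁻ x in B, M x y ∂μ :=
            Measurable.lintegral_prod_left' hMc.measurable
          have m2 : Measurable fun y => ∫⁻ x in B, M y x ∂μ :=
            Measurable.lintegral_prod_right' hMc.measurable
          rw [lintegral_add_left (m1.const_mul 2), lintegral_const_mul _ m1,
            lintegral_const_mul _ m2]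
      _ = 4 * ∫⁻ y in B, ∫⁻ x in B, M x y ∂μ ∂μ := by
          rw [lintegral_lintegral_swap (f := fun y x => M y x) hMc.measurable.aemeasurable]
          ring
      _ ≤ _ := by gcongr
  have hmeas : Measurable fun y => ∫⁻ x in B, ENNReal.ofReal ((F x - F y) ^ 2) ∂μ :=
    Measurable.lintegral_prod_left' (f := fun p : E × E => ENNReal.ofReal ((F p.1 - F p.2) ^ 2))
      (Continuous.measurable (ENNReal.continuous_ofReal.comp
        (((hF.continuous.comp continuous_fst).sub (hF.continuous.comp continuous_snd)).pow 2)))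
  -- Some `y` does no worse than average in the double integral, and `F y` is then an admissible
  -- constant.
  obtain ⟨y, -, hy⟩ := exists_le_setLAverage hB0 hBtop hmeas.aemeasurable
  refine ⟨F y, hy.trans ?_⟩
  rw [setLAverage_eq, ENNReal.div_eq_inv_mul, mul_assoc]
  gcongr
  refine hdouble.trans_eq ?_
  ring

end LocalPoincare

/-! ### The Poincaré inequality for the Gibbs measure -/

section Poincare

variable {d m : ℕ} {Q : Type} [AddCommGroup Q] [TopologicalSpace Q] [IsTopologicalAddGroup Q]
  [SecondCountableTopology Q] [T2Space Q] [LocallyCompactSpace Q] [MeasureSpace Q] [BorelSpace Q]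
  [(volume : Measure Q).IsAddHaarMeasure] {π : Euc d →+ Q}

variable {β : ℝ} {V : Q → ℝ}

namespace IsAdmissible

variable (hV : IsAdmissible π β V)
include hV

/-- The `p` and `z` components of `∇H` are the coordinates themselves, so bounding `|∇H|` confines
`(p, z)` to a ball, while the position is confined by hypothesis. -/
lemma exists_region (M : ℝ) (hM : 0 < M) : ∃ (B : Set (Phase d m (Euc d))) (S : Set (Phase d m Q)),
    Convex ℝ B ∧ MeasurableSet B ∧ Bornology.IsBounded B ∧ volume B ≠ 0 ∧ MeasurableSet S ∧
    (∀ x, ∑ k, gradH π V k x ^ 2 ≤ M → x ∈ S) ∧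
    MeasurePreserving (cover π) (volume.restrict B) (volume.restrict S) := by
  obtain ⟨B, A, hB, hBb, hBn, hBm, hAm, hB0, hA, hp⟩ := hV.region M
  set R : Set (Euc d × (Fin m → Euc d)) := Metric.closedBall 0 (√M) with hR
  have hsM : 0 < √M := Real.sqrt_pos.2 hM
  refine ⟨B ×ˢ R, A ×ˢ R, hB.prod (convex_closedBall _ _), hBm.prod measurableSet_closedBall,
    hBb.prod Metric.isBounded_closedBall, ?_, hAm.prod measurableSet_closedBall,
    fun x hx => ⟨hA _ ?_, ?_⟩, ?_⟩
  · rw [Measure.volume_eq_prod, Measure.prod_prod]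
    exact mul_ne_zero hB0 (Metric.measure_closedBall_pos _ _ hsM).ne'
  · refine le_trans ?_ hx
    rw [Fintype.sum_sum_type]
    exact le_add_of_nonneg_right (Finset.sum_nonneg fun k _ => sq_nonneg _)
  · have h1 : ∑ i, x.2.1 i ^ 2 + ∑ j, ∑ i, x.2.2 j i ^ 2 ≤ M := by
      rw [Fintype.sum_sum_type, Fintype.sum_sum_type, Fintype.sum_prod_type] at hx
      refine le_trans ?_ hx
      exact le_add_of_nonneg_left (Finset.sum_nonneg fun k _ => sq_nonneg _)
    have h2 : ∀ v : Euc d, ∑ i, v i ^ 2 ≤ M → ‖v‖ ≤ √M := fun v hv => by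
      rw [EuclideanSpace.norm_eq]
      simpa using Real.sqrt_le_sqrt hv
    have h3 : 0 ≤ ∑ j, ∑ i, x.2.2 j i ^ 2 :=
      Finset.sum_nonneg fun j _ => Finset.sum_nonneg fun i _ => sq_nonneg _
    have h4 : 0 ≤ ∑ i, x.2.1 i ^ 2 := Finset.sum_nonneg fun i _ => sq_nonneg _
    rw [hR, mem_closedBall_zero_iff, Prod.norm_def, max_le_iff]
    refine ⟨h2 _ (by linarith), (pi_norm_le_iff_of_nonneg hsM.le).2 fun j => h2 _ ?_⟩
    have h5 := Finset.single_le_sum (f := fun j => ∑ i, x.2.2 j i ^ 2)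
      (fun j _ => Finset.sum_nonneg fun i _ => sq_nonneg _) (Finset.mem_univ j)
    simp only at h5
    linarith
  · have := hp.prod (MeasurePreserving.id (volume.restrict R))
    rw [Measure.prod_restrict, Measure.prod_restrict] at this
    exact this

omit [IsTopologicalAddGroup Q] [SecondCountableTopology Q] [T2Space Q] [LocallyCompactSpace Q]
  [MeasureSpace Q] [BorelSpace Q] [(volume : Measure Q).IsAddHaarMeasure] hV in
lemma norm_fderiv_le {F : Phase d m Q → ℝ} {n : ℕ∞ω} (hF : IsCn π n F) (hn : n ≠ 0)
    (x : Phase d m (Euc d)) :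
    ‖fderiv ℝ (fun x => F (cover π x)) x‖ ^ 2 ≤
      Fintype.card (Coord d m) * ∑ k, pderiv π k F (cover π x) ^ 2 := by
  have h1 : ‖fderiv ℝ (fun x => F (cover π x)) x‖ ≤ ∑ k, |pderiv π k F (cover π x)| := by
    refine ContinuousLinearMap.opNorm_le_bound _ (by positivity) fun v => ?_
    rw [hF.fderiv_apply hn, Finset.sum_mul]
    refine (norm_sum_le _ _).trans (Finset.sum_le_sum fun k _ => ?_)
    rw [Real.norm_eq_abs, abs_mul, mul_comm]
    exact mul_le_mul_of_nonneg_left (abs_coord_le v k) (abs_nonneg _)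
  calc _ ≤ (∑ k, |pderiv π k F (cover π x)|) ^ 2 := pow_le_pow_left₀ (norm_nonneg _) h1 2
    _ ≤ Fintype.card (Coord d m) * ∑ k, |pderiv π k F (cover π x)| ^ 2 :=
        sq_sum_le_card_mul_sum_sq
    _ = _ := by simp only [sq_abs]

/-- The density is bounded above everywhere and below on the bounded set `B`, so the unweighted
inequality on `B` transfers through the measure preserving projection. -/
lemma exists_region_poincare (M : ℝ) (hM : 0 < M) : ∃ (S : Set (Phase d m Q)) (C : ℝ), 0 ≤ C ∧
    MeasurableSet S ∧ (∀ x, ∑ k, gradH π V k x ^ 2 ≤ M → x ∈ S) ∧ ∀ f : Phase d m Q → ℝ,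
    IsCb2 π f → ∃ c, ∫ x in S, (f x - c) ^ 2 ∂(gibbs m β V) ≤
      C * ∫ x, ∑ k, pderiv π k f x ^ 2 ∂(gibbs m β V) := by
  obtain ⟨B, S, hB, hBm, hBb, hB0, hSm, hS, hp⟩ := hV.exists_region (m := m) M hM
  obtain ⟨C, hC, hloc⟩ := exists_local_poincare hB hBm hBb hB0
  obtain ⟨D, hD0, hD⟩ := hV.exists_dens_le (m := m)
  have hcov : Continuous (cover π : Phase d m (Euc d) → Phase d m Q) :=
    (isOpenQuotientMap_cover hV.quot).continuous
  have hρ := hV.continuous_dens (m := m)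
  obtain ⟨δ, hδ0, hδ⟩ : ∃ δ : ℝ, 0 < δ ∧ ∀ x ∈ B, δ ≤ dens β V (cover π x) := by
    obtain ⟨y, hy⟩ := nonempty_of_measure_ne_zero hB0
    obtain ⟨x₀, -, hx₀⟩ := hBb.isCompact_closure.exists_isMinOn ⟨y, subset_closure hy⟩
      (hρ.comp hcov).continuousOn
    exact ⟨_, hV.dens_pos (cover π x₀), fun x hx => hx₀ (subset_closure hx)⟩
  set N := Fintype.card (Coord d m)
  have hset : ∀ F : Phase d m Q → ℝ, Continuous F → (∀ x, 0 ≤ F x) →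
      ∫⁻ x in S, ENNReal.ofReal (F x) ∂(gibbs m β V) =
        ∫⁻ x in B, ENNReal.ofReal (dens β V (cover π x)) * ENNReal.ofReal (F (cover π x)) := by
    intro F hF hF0
    rw [gibbs_eq, setLIntegral_withDensity_eq_setLIntegral_mul _ hρ.measurable.ennreal_ofReal
      hF.measurable.ennreal_ofReal hSm]
    exact (hp.lintegral_comp
      (hρ.measurable.ennreal_ofReal.mul hF.measurable.ennreal_ofReal)).symm
  set K := ENNReal.ofReal D * C * ENNReal.ofReal (δ⁻¹ * N) with hK
  have hKtop : K ≠ ⊤ := by finiteness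
  refine ⟨S, K.toReal, ENNReal.toReal_nonneg, hSm, hS, fun f hf => ?_⟩
  have hf1 : ContDiff ℝ 1 fun x => f (cover π x) := hf.isCn.of_le (by norm_num)
  obtain ⟨c, hc⟩ := hloc _ hf1
  have hfc := hf.isCn.continuous hV.quot
  have hΓc : Continuous fun x => ∑ k, pderiv π k f x ^ 2 :=
    continuous_finsetSum _ fun k _ => (hV.continuous_pderiv_isCb2 hf k).pow 2
  have hΓ0 : ∀ x, 0 ≤ ∑ k, pderiv π k f x ^ 2 := fun x => Finset.sum_nonneg fun k _ => sq_nonneg _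
  have hΓi : Integrable (fun x => ∑ k, pderiv π k f x ^ 2) (gibbs m β V) := by
    refine integrable_finsetSum _ fun k _ => ?_
    obtain ⟨M, hM⟩ := hf.pderiv_bounded k
    refine hV.integrable_of_bounded ((hV.continuous_pderiv_isCb2 hf k).pow 2) (C := M ^ 2)
      fun x => ?_
    rw [abs_pow]
    exact pow_le_pow_left₀ (abs_nonneg _) (hM x) 2
  have key : ∫⁻ x in S, ENNReal.ofReal ((f x - c) ^ 2) ∂(gibbs m β V) ≤
      K * ENNReal.ofReal (∫ x, ∑ k, pderiv π k f x ^ 2 ∂(gibbs m β V)) := by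
    calc ∫⁻ x in S, ENNReal.ofReal ((f x - c) ^ 2) ∂(gibbs m β V)
        = ∫⁻ x in B, ENNReal.ofReal (dens β V (cover π x)) *
            ENNReal.ofReal ((f (cover π x) - c) ^ 2) :=
          hset (fun x => (f x - c) ^ 2) ((hfc.sub continuous_const).pow 2) fun x => sq_nonneg _
      _ ≤ ∫⁻ x in B, ENNReal.ofReal D * ENNReal.ofReal ((f (cover π x) - c) ^ 2) := by
          refine lintegral_mono fun x => ?_
          gcongr
          exact hD _
      _ = ENNReal.ofReal D * ∫⁻ x in B, ENNReal.ofReal ((f (cover π x) - c) ^ 2) :=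
          lintegral_const_mul _
            ((((hfc.comp hcov).sub continuous_const).pow 2).measurable.ennreal_ofReal)
      _ ≤ ENNReal.ofReal D * (C * ∫⁻ x in B,
            ENNReal.ofReal (‖fderiv ℝ (fun x => f (cover π x)) x‖ ^ 2)) := by gcongr
      _ ≤ ENNReal.ofReal D * (C * ∫⁻ x in B, ENNReal.ofReal (δ⁻¹ * N) *
            (ENNReal.ofReal (dens β V (cover π x)) *
              ENNReal.ofReal (∑ k, pderiv π k f (cover π x) ^ 2))) := by
          gcongr 2
          refine setLIntegral_mono' hBm fun x hx => ?_
          rw [← ENNReal.ofReal_mul (hV.dens_pos _).le, ← ENNReal.ofReal_mul (by positivity)]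
          refine ENNReal.ofReal_le_ofReal ((norm_fderiv_le hf.isCn two_ne_zero x).trans ?_)
          have h1 : 1 ≤ δ⁻¹ * dens β V (cover π x) := by
            rw [inv_mul_eq_div, one_le_div hδ0]
            exact hδ x hx
          have h2 : 0 ≤ N * ∑ k, pderiv π k f (cover π x) ^ 2 :=
            mul_nonneg (Nat.cast_nonneg _) (hΓ0 _)
          calc N * ∑ k, pderiv π k f (cover π x) ^ 2
              ≤ (δ⁻¹ * dens β V (cover π x)) * (N * ∑ k, pderiv π k f (cover π x) ^ 2) :=
                le_mul_of_one_le_left h2 h1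
            _ = _ := by ring
      _ = K * ∫⁻ x in S, ENNReal.ofReal (∑ k, pderiv π k f x ^ 2) ∂(gibbs m β V) := by
          rw [lintegral_const_mul' _ _ (by finiteness), ← hset _ hΓc hΓ0, hK]
          ring
      _ ≤ K * ∫⁻ x, ENNReal.ofReal (∑ k, pderiv π k f x ^ 2) ∂(gibbs m β V) := by
          gcongr
          exact Measure.restrict_le_self
      _ = _ := by rw [ofReal_integral_eq_lintegral_ofReal hΓi (Eventually.of_forall hΓ0)]
  refine ⟨c, ?_⟩
  rw [integral_eq_lintegral_of_nonneg_ae (Eventually.of_forall fun x => sq_nonneg _)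
    (Continuous.aestronglyMeasurable (f := fun x => (f x - c) ^ 2)
      ((hfc.sub continuous_const).pow 2))]
  refine (ENNReal.toReal_mono (by finiteness) key).trans_eq ?_
  rw [ENNReal.toReal_mul, ENNReal.toReal_ofReal (integral_nonneg hΓ0)]

/-- The Poincaré inequality for the Gibbs measure. -/
lemma exists_poincare : ∃ C : ℝ, 0 < C ∧ ∀ f : Phase d m Q → ℝ, IsCb2 π f →
    ∫ x, f x ∂(gibbs m β V) = 0 →
    ∫ x, f x ^ 2 ∂(gibbs m β V) ≤ C * ∑ k, ∫ x, pderiv π k f x ^ 2 ∂(gibbs m β V) := by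
  have := hV.isProbabilityMeasure (m := m)
  set μ := gibbs (d := d) m β V with hμ
  obtain ⟨C, hC0, hardy⟩ := hV.exists_integral_gradH_sq_le (m := m)
  set N := Fintype.card (Coord d m)
  -- Large enough that the mass of `g²` outside the region, at most `M⁻¹ C (N ∫ g² + Γ)`, can be
  -- half absorbed into `∫ g²`.
  set M := 2 * (N * C) + 1 with hM
  have hM0 : 0 < M := by positivity
  obtain ⟨S, C', hC', hSm, hS, hloc⟩ := hV.exists_region_poincare (m := m) M hM0
  refine ⟨2 * C' + 2 * C + 1, by positivity, fun f hf hf0 => ?_⟩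
  have hsqb : ∀ {F : Phase d m Q → ℝ}, Continuous F → (∃ K, ∀ x, |F x| ≤ K) →
      Integrable (fun x => F x ^ 2) μ := fun {F} hF ⟨K, hK⟩ =>
    hV.integrable_of_bounded (hF.pow 2) (C := K ^ 2) fun x => by
      rw [abs_pow]; exact pow_le_pow_left₀ (abs_nonneg _) (hK x) 2
  have hfc := hf.isCn.continuous hV.quot
  have hpi : ∀ k, Integrable (fun x => pderiv π k f x ^ 2) μ := fun k =>
    hsqb (hV.continuous_pderiv_isCb2 hf k) (hf.pderiv_bounded k)
  obtain ⟨c, hc⟩ := hloc f hf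
  rw [← hμ, integral_finsetSum _ fun k _ => hpi k] at hc
  set Γ := ∑ k, ∫ x, pderiv π k f x ^ 2 ∂μ with hΓ
  have hΓ0 : 0 ≤ Γ := Finset.sum_nonneg fun k _ => integral_nonneg fun x => sq_nonneg _
  set g : Phase d m Q → ℝ := fun x => f x - c with hg
  have hg1 : IsCn π 1 g := (hf.isCn.of_le (by norm_num)).sub (IsCn.const c)
  have hgc : Continuous g := hfc.sub continuous_const
  have hgb : ∃ K, ∀ x, |g x| ≤ K := by
    obtain ⟨K, hK⟩ := hf.bounded
    exact ⟨K + |c|, fun x => (abs_sub _ _).trans (by linarith [hK x])⟩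
  have hgd : ∀ k, pderiv π k g = pderiv π k f := fun k => funext fun x => by
    rw [hg, IsCn.pderiv_sub (hf.isCn.of_le (n' := 1) (by norm_num)) (IsCn.const c) hV.quot
      one_ne_zero, IsCn.pderiv_const, sub_zero]
  have hgi := hsqb hgc hgb
  have hwi : ∀ k, Integrable (fun x => gradH π V k x ^ 2 * g x ^ 2) μ := fun k => by
    obtain ⟨K, hK⟩ := hgb
    refine hV.integrable_of_le (((hV.continuous_gradH k).pow 2).mul (hgc.pow 2)) (C := K ^ 2)
      fun x => ?_
    have h1 : gradH π V k x ^ 2 ≤ growth π V x ^ 2 := by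
      rw [← sq_abs]
      exact pow_le_pow_left₀ (abs_nonneg _) (abs_gradH_le_growth k x) 2
    have h2 : g x ^ 2 ≤ K ^ 2 := by
      rw [← sq_abs]
      exact pow_le_pow_left₀ (abs_nonneg _) (hK x) 2
    rw [abs_of_nonneg (by positivity), mul_comm]
    exact mul_le_mul h2 h1 (sq_nonneg _) (sq_nonneg _)
  -- Outside the region `|∇H|² ≥ M`, which is a Markov type gain.
  have h1 : ∫ x in Sᶜ, g x ^ 2 ∂μ ≤ M⁻¹ * ∑ k, ∫ x, gradH π V k x ^ 2 * g x ^ 2 ∂μ := by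
    rw [← integral_finsetSum _ fun k _ => hwi k, ← integral_const_mul]
    have hi : Integrable (fun x => M⁻¹ * ∑ k, gradH π V k x ^ 2 * g x ^ 2) μ :=
      (integrable_finsetSum _ fun k _ => hwi k).const_mul _
    refine le_trans (setIntegral_mono_on hgi.integrableOn hi.integrableOn hSm.compl
      fun x hx => ?_) (setIntegral_le_integral hi (Eventually.of_forall fun x => ?_))
    · have : M ≤ ∑ k, gradH π V k x ^ 2 := (not_le.1 fun h => hx (hS x h)).le
      rw [← Finset.sum_mul, ← mul_assoc, inv_mul_eq_div]
      exact le_mul_of_one_le_left (sq_nonneg _) ((one_le_div hM0).2 this)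
    · exact mul_nonneg (inv_nonneg.2 hM0.le) (Finset.sum_nonneg fun k _ => by positivity)
  have h2 : ∑ k, ∫ x, gradH π V k x ^ 2 * g x ^ 2 ∂μ ≤ C * (N * ∫ x, g x ^ 2 ∂μ + Γ) := by
    refine (Finset.sum_le_sum fun k _ => hardy k g hg1 hgb
      (by rw [hgd]; exact hf.pderiv_bounded k)).trans_eq ?_
    rw [← Finset.mul_sum, Finset.sum_add_distrib, Finset.sum_const, Finset.card_univ, nsmul_eq_mul,
      hΓ]
    simp only [hgd]
    rfl
  have h3 : ∫ x in S, g x ^ 2 ∂μ + ∫ x in Sᶜ, g x ^ 2 ∂μ = ∫ x, g x ^ 2 ∂μ :=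
    integral_add_compl hSm hgi
  set I := ∫ x, g x ^ 2 ∂μ
  have hI0 : 0 ≤ I := integral_nonneg fun x => sq_nonneg _
  have h4 : ∫ x in Sᶜ, g x ^ 2 ∂μ ≤ I / 2 + C * Γ := by
    refine h1.trans ((mul_le_mul_of_nonneg_left h2 (inv_nonneg.2 hM0.le)).trans ?_)
    rw [inv_mul_le_iff₀ hM0, hM]
    have : 0 ≤ (N * C) * (C * Γ) := by positivity
    nlinarith [mul_nonneg hC0.le hΓ0]
  have h5 : I ≤ 2 * C' * Γ + 2 * C * Γ := by linarith
  -- For mean zero `f` the constant `0` minimises the distance to constants, so the local constant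
  -- `c` can be discarded.
  have h6 : ∫ x, f x ^ 2 ∂μ + c ^ 2 = I := by
    have e : ∀ x, g x ^ 2 = f x ^ 2 - 2 * c * f x + c ^ 2 := fun x => by rw [hg]; ring
    have fi : Integrable (fun x => 2 * c * f x) μ :=
      (hV.integrable_of_bounded hfc hf.bounded.choose_spec).const_mul _
    have fi2 : Integrable (fun x => f x ^ 2 - 2 * c * f x) μ := (hsqb hfc hf.bounded).sub fi
    simp only [I, e]
    rw [integral_add fi2 (integrable_const _), integral_sub (hsqb hfc hf.bounded) fi,
      integral_const_mul, hf0, integral_const]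
    simp
  nlinarith [sq_nonneg c]

end IsAdmissible

end Poincare

/-! ### Convolution of functions on the phase space with kernels on its cover -/

section Mollify

variable {d m : ℕ} {Q : Type} [AddCommGroup Q] [TopologicalSpace Q] [IsTopologicalAddGroup Q]
  [SecondCountableTopology Q] [T2Space Q] [LocallyCompactSpace Q] [MeasureSpace Q] [BorelSpace Q]
  [(volume : Measure Q).IsAddHaarMeasure] {π : Euc d →+ Q}

instance : (volume : Measure (Phase d m (Euc d))).Regular :=
  Measure.Regular.of_sigmaCompactSpace_of_isLocallyFiniteMeasure _

instance : (volume : Measure (Phase d m (Euc d))).IsNegInvariant :=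
  Measure.IsAddHaarMeasure.isNegInvariant_of_regular _

/-- Smooth functions with compact support on the tangent space, used as convolution kernels. -/
structure IsKernel (θ : Phase d m (Euc d) → ℝ) : Prop where
  smooth : ContDiff ℝ ∞ θ
  compact : HasCompactSupport θ

/-- The partial derivatives of a kernel. -/
def kernelDeriv (k : Coord d m) (θ : Phase d m (Euc d) → ℝ) (y : Phase d m (Euc d)) : ℝ :=
  fderiv ℝ θ y (unitVec k)

/-- The convolution of a kernel with a function on the phase space. -/
def mollify (π : Euc d →+ Q) (θ : Phase d m (Euc d) → ℝ) (u : Phase d m Q → ℝ)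
    (x : Phase d m Q) : ℝ :=
  ∫ y, θ y * u (x - cover π y)

lemma continuous_sub_cover (hπ : IsOpenQuotientMap π) (x : Phase d m Q) :
    Continuous fun y : Phase d m (Euc d) => x - cover π y :=
  continuous_const.sub (isOpenQuotientMap_cover hπ).continuous

namespace IsKernel

variable {θ : Phase d m (Euc d) → ℝ} {u : Phase d m Q → ℝ}

omit [TopologicalSpace Q] [IsTopologicalAddGroup Q] [SecondCountableTopology Q] [T2Space Q]
  [LocallyCompactSpace Q] [MeasureSpace Q] [BorelSpace Q]
  [(volume : Measure Q).IsAddHaarMeasure] in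
lemma kernelDeriv (h : IsKernel θ) (k : Coord d m) : IsKernel (kernelDeriv k θ) :=
  ⟨(h.smooth.fderiv_right (by simp)).clm_apply contDiff_const, h.compact.fderiv_apply (𝕜 := ℝ) _⟩

lemma integrable_mul (h : IsKernel θ) {g : Phase d m (Euc d) → ℝ} (hg : Continuous g) :
    Integrable fun y => θ y * g y :=
  (h.smooth.continuous.mul hg).integrable_of_hasCompactSupport h.compact.mul_right

lemma integrable_abs_mul (h : IsKernel θ) {g : Phase d m (Euc d) → ℝ} (hg : Continuous g) :
    Integrable fun y => |θ y| * g y :=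
  (h.smooth.continuous.abs.mul hg).integrable_of_hasCompactSupport
    (HasCompactSupport.mul_right (h.compact.comp_left (g := fun t : ℝ => |t|) abs_zero))

lemma integrable_mollify (h : IsKernel θ) (hπ : IsOpenQuotientMap π) (hu : Continuous u)
    (x : Phase d m Q) : Integrable fun y => θ y * u (x - cover π y) :=
  h.integrable_mul (hu.comp (continuous_sub_cover hπ x))

/-- An upper bound for integrals against a kernel. -/
lemma abs_integral_mul_le (h : IsKernel θ) {g b : Phase d m (Euc d) → ℝ} (hb : Continuous b)
    (hgb : ∀ y, |g y| ≤ b y) : |∫ y, θ y * g y| ≤ ∫ y, |θ y| * b y := by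
  refine (norm_integral_le_integral_norm fun y => θ y * g y).trans ?_
  refine integral_mono_of_nonneg (Eventually.of_forall fun y => norm_nonneg _)
    (h.integrable_abs_mul hb) (Eventually.of_forall fun y => ?_)
  simp only [Real.norm_eq_abs, abs_mul]
  exact mul_le_mul_of_nonneg_left (hgb y) (abs_nonneg _)

lemma abs_mollify_le (h : IsKernel θ) {K : ℝ} (hK : ∀ x, |u x| ≤ K) (x : Phase d m Q) :
    |mollify π θ u x| ≤ K * ∫ y, |θ y| := by
  refine (h.abs_integral_mul_le (b := fun _ => K) continuous_const fun y => hK _).trans_eq ?_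
  rw [integral_mul_const, mul_comm]

/-- Translations commute with mollification, so a Lipschitz bound is kept up to the factor `∫ |θ|`.
-/
lemma abs_mollify_sub_le (h : IsKernel θ) (hπ : IsOpenQuotientMap π) (hu : Continuous u) {ℓ : ℝ}
    (hℓ : ∀ x (v : Phase d m (Euc d)), |u (x + cover π v) - u x| ≤ ℓ * ‖v‖) (x : Phase d m Q)
    (v : Phase d m (Euc d)) :
    |mollify π θ u (x + cover π v) - mollify π θ u x| ≤ ℓ * ‖v‖ * ∫ y, |θ y| := by
  rw [mollify, mollify, ← integral_sub (h.integrable_mollify hπ hu _)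
    (h.integrable_mollify hπ hu _), ← integral_const_mul]
  simp only [← mul_sub]
  refine (h.abs_integral_mul_le (b := fun _ => ℓ * ‖v‖) continuous_const fun y => ?_).trans_eq ?_
  · have := hℓ (x - cover π y) v
    rwa [sub_add_eq_add_sub] at this
  · simp only [mul_comm]

omit [IsTopologicalAddGroup Q] [SecondCountableTopology Q] [T2Space Q]
  [LocallyCompactSpace Q] [MeasureSpace Q] [BorelSpace Q] [TopologicalSpace Q]
  [(volume : Measure Q).IsAddHaarMeasure] in
-- On the cover the operation is ordinary convolution, whose smoothness and derivative formula can
-- be used directly.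
lemma mollify_cover (x : Phase d m (Euc d)) : mollify π θ u (cover π x) =
    convolution (fun x => u (cover π x)) θ (ContinuousLinearMap.mul ℝ ℝ) volume x := by
  rw [convolution_mul_swap]
  simp only [mollify, cover_sub]
  exact integral_congr_ae (Eventually.of_forall fun y => mul_comm _ _)

lemma isCn_mollify (h : IsKernel θ) (hπ : IsOpenQuotientMap π) (hu : Continuous u) :
    IsCn π ∞ (mollify π θ u) := by
  have h1 : Continuous fun x : Phase d m (Euc d) => u (cover π x) :=
    hu.comp (isOpenQuotientMap_cover hπ).continuous
  have h2 := h.compact.contDiff_convolution_right (ContinuousLinearMap.mul ℝ ℝ)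
    (h1.locallyIntegrable (μ := volume)) h.smooth
  unfold IsCn
  simpa only [mollify_cover] using h2

lemma pderiv_mollify (h : IsKernel θ) (hπ : IsOpenQuotientMap π) (hu : Continuous u)
    (k : Coord d m) : pderiv π k (mollify π θ u) = mollify π (GLE.kernelDeriv k θ) u := by
  ext x
  obtain ⟨y, rfl⟩ := (isOpenQuotientMap_cover hπ).surjective x
  have h1 : Continuous fun x : Phase d m (Euc d) => u (cover π x) :=
    hu.comp (isOpenQuotientMap_cover hπ).continuous
  have h2 := h.compact.hasFDerivAt_convolution_right (ContinuousLinearMap.mul ℝ ℝ)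
    (h1.locallyIntegrable (μ := volume)) (h.smooth.of_le (by simp)) y
  rw [(h.isCn_mollify hπ hu).pderiv_cover (by simp)]
  have h3 : (fun x => mollify π θ u (cover π x)) =
    convolution (fun x => u (cover π x)) θ (ContinuousLinearMap.mul ℝ ℝ) volume :=
    funext fun x => mollify_cover x
  rw [h3, h2.fderiv, convolution_precompR_apply _ (h1.locallyIntegrable (μ := volume))
    (h.compact.fderiv (𝕜 := ℝ)) (h.smooth.continuous_fderiv (by simp)), mollify_cover]
  rfl

/-- Every derivative can be moved onto the kernel, so only the sup norm of `u` matters. -/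
lemma isCb_mollify (h : IsKernel θ) (hπ : IsOpenQuotientMap π) (hu : Continuous u) {K : ℝ}
    (hK : ∀ x, |u x| ≤ K) : IsCb π (mollify π θ u) := by
  refine ⟨h.isCn_mollify hπ hu, fun l => ?_⟩
  obtain ⟨θ', h', e⟩ : ∃ θ', IsKernel θ' ∧
      l.foldr (pderiv π) (mollify π θ u) = mollify π θ' u := by
    induction l with
    | nil => exact ⟨θ, h, rfl⟩
    | cons k l ih =>
      obtain ⟨θ', h', e⟩ := ih
      exact ⟨GLE.kernelDeriv k θ', h'.kernelDeriv k, by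
        rw [List.foldr_cons, e, h'.pderiv_mollify hπ hu]⟩
  exact ⟨_, fun x => e ▸ h'.abs_mollify_le hK x⟩

end IsKernel

/-- Approximate identities whose derivatives have uniformly bounded first moments. -/
lemma exists_kernel (d m : ℕ) : ∃ C : ℝ, 0 ≤ C ∧ ∀ ε : ℝ, 0 < ε →
    ∃ κ : Phase d m (Euc d) → ℝ, IsKernel κ ∧ (∀ y, 0 ≤ κ y) ∧ ∫ y, κ y = 1 ∧
      (∀ y, κ y ≠ 0 → ‖y‖ ≤ ε) ∧ ∀ k, ∫ y, |kernelDeriv k κ y| * ‖y‖ ≤ C := by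
  obtain ⟨κ, hκ, hκs, hκ0, hκ1, hκb⟩ : ∃ κ : Phase d m (Euc d) → ℝ, ContDiff ℝ ∞ κ ∧
      HasCompactSupport κ ∧ (∀ y, 0 ≤ κ y) ∧ ∫ y, κ y = 1 ∧ ∀ y, κ y ≠ 0 → ‖y‖ ≤ 1 := by
    -- The radii are forgotten by `have`, so the support is normalised by dilating with the outer
    -- radius.
    have φ : ContDiffBump (0 : Phase d m (Euc d)) := ⟨1 / 2, 1, by norm_num, by norm_num⟩
    have ψ : ContDiff ℝ ∞ (φ.normed volume) := φ.contDiff_normed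
    let c := φ.rOut
    have hc : 0 < c := φ.rOut_pos
    set N := Module.finrank ℝ (Phase d m (Euc d))
    refine ⟨fun y => c ^ N * φ.normed volume (c • y),
      contDiff_const.mul (ψ.comp (contDiff_const_smul c)), ?_, fun y => ?_, ?_, fun y hy => ?_⟩
    · exact HasCompactSupport.mul_left (φ.hasCompactSupport_normed.comp_smul hc.ne')
    · exact mul_nonneg (by positivity) (φ.nonneg_normed _)
    · rw [integral_const_mul, Measure.integral_comp_smul_of_nonneg volume _ c (hR := hc.le),
        φ.integral_normed, smul_eq_mul, mul_one, mul_inv_cancel₀ (by positivity)]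
    · have h1 : c • y ∈ Function.support (φ.normed volume) := fun h => hy (by simp [h])
      rw [φ.support_normed_eq, mem_ball_zero_iff, norm_smul, Real.norm_eq_abs, abs_of_pos hc] at h1
      have : c * ‖y‖ ≤ c * 1 := by rw [mul_one]; exact h1.le
      exact le_of_mul_le_mul_left this hc
  set N := Module.finrank ℝ (Phase d m (Euc d))
  refine ⟨∑ k : Coord d m, ∫ y, |kernelDeriv k κ y| * ‖y‖, Finset.sum_nonneg fun k _ =>
    integral_nonneg fun y => by positivity, fun ε hε => ?_⟩
  have hder : ∀ k y, kernelDeriv k (fun y => (ε ^ N)⁻¹ * κ (ε⁻¹ • y)) y =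
      (ε ^ N)⁻¹ * (ε⁻¹ * kernelDeriv k κ (ε⁻¹ • y)) := fun k y => by
    have h1 : HasFDerivAt (fun y : Phase d m (Euc d) => ε⁻¹ • y)
        (ε⁻¹ • ContinuousLinearMap.id ℝ _) y := (hasFDerivAt_id y).const_smul ε⁻¹
    have h2 := (((hκ.differentiable (by simp)) (ε⁻¹ • y)).hasFDerivAt.comp y h1).const_mul
      (ε ^ N)⁻¹
    have h3 : fderiv ℝ (fun y => (ε ^ N)⁻¹ * κ (ε⁻¹ • y)) y = _ := h2.fderiv
    rw [kernelDeriv, h3]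
    simp [kernelDeriv]
  refine ⟨fun y => (ε ^ N)⁻¹ * κ (ε⁻¹ • y),
    ⟨contDiff_const.mul (hκ.comp (contDiff_const_smul _)),
      HasCompactSupport.mul_left (hκs.comp_smul (by positivity))⟩,
    fun y => mul_nonneg (by positivity) (hκ0 _), ?_, fun y hy => ?_, fun k => ?_⟩
  · rw [integral_const_mul, Measure.integral_comp_inv_smul_of_nonneg volume _ hε.le, hκ1,
      smul_eq_mul, mul_one, inv_mul_cancel₀ (by positivity)]
  · have h1 := hκb (ε⁻¹ • y) fun h => hy (by simp [h])
    rw [norm_smul, Real.norm_eq_abs, abs_of_pos (inv_pos.2 hε), inv_mul_le_iff₀ hε, mul_one] at h1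
    exact h1
  -- Differentiation costs a factor `ε⁻¹` and the moment returns a factor `ε`; the bound is
  -- therefore independent of `ε`.
  · have e : ∀ y, |kernelDeriv k (fun y => (ε ^ N)⁻¹ * κ (ε⁻¹ • y)) y| * ‖y‖ =
        (ε ^ N)⁻¹ * (|kernelDeriv k κ (ε⁻¹ • y)| * ‖ε⁻¹ • y‖) := fun y => by
      rw [hder, abs_mul, abs_mul, norm_smul, Real.norm_eq_abs, abs_of_pos (inv_pos.2 hε),
        abs_of_pos (inv_pos.2 (pow_pos hε N))]
      ring
    simp only [e]
    rw [integral_const_mul, Measure.integral_comp_inv_smul_of_nonneg volume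
      (fun y => |kernelDeriv k κ y| * ‖y‖) hε.le, smul_eq_mul, inv_mul_cancel_left₀ (by positivity)]
    exact Finset.single_le_sum (f := fun k => ∫ y, |kernelDeriv k κ y| * ‖y‖)
      (fun k _ => integral_nonneg fun y => by positivity) (Finset.mem_univ k)

end Mollify

/-! ### Taylor estimates for the finite difference scheme -/

section Scheme

variable {d m : ℕ} {Q : Type} [AddCommGroup Q] [TopologicalSpace Q] [IsTopologicalAddGroup Q]
  [SecondCountableTopology Q] [T2Space Q] [LocallyCompactSpace Q] [MeasureSpace Q] [BorelSpace Q]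
  [(volume : Measure Q).IsAddHaarMeasure] {π : Euc d →+ Q}

variable {β : ℝ} {V : Q → ℝ} {lam alpha : Fin m → ℝ}

/-- The mean value inequality for `s ↦ W(x + s v)` minus its linear part, whose derivative is small
because the partial derivatives of `W` are Lipschitz. -/
lemma abs_taylor_le {W : Phase d m Q → ℝ} (hW : IsCn π 2 W) (hπ : IsOpenQuotientMap π)
    {C : ℝ} (hC : ∀ k l x, |pderiv π k (pderiv π l W) x| ≤ C) (x : Phase d m Q)
    (v : Phase d m (Euc d)) :
    |W (x + cover π v) - W x - ∑ k, coord v k * pderiv π k W x| ≤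
      Fintype.card (Coord d m) ^ 2 * C * ‖v‖ ^ 2 := by
  set N := (Fintype.card (Coord d m) : ℝ)
  have hd : ∀ s : ℝ, HasDerivAt
      (fun s : ℝ => W (x + cover π (s • v)) - s * ∑ k, coord v k * pderiv π k W x)
      (∑ k, coord v k * pderiv π k W (x + cover π (s • v)) -
        1 * ∑ k, coord v k * pderiv π k W x) s := fun s =>
    (hW.hasDerivAt_line hπ two_ne_zero x v s).sub ((hasDerivAt_id s).mul_const _)
  have h1 := norm_image_sub_le_of_norm_deriv_le_segment_01' (C := N ^ 2 * C * ‖v‖ ^ 2)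
    (fun s _ => (hd s).hasDerivWithinAt) fun s hs => ?_
  · have e : ∀ a b c : ℝ, a - 1 * b - (c - 0 * b) = a - c - b := fun a b c => by ring
    simpa only [one_smul, zero_smul, cover_zero, add_zero, e, Real.norm_eq_abs] using h1
  · rw [one_mul, ← Finset.sum_sub_distrib]
    refine (norm_sum_le _ _).trans ?_
    have hk : ∀ k ∈ Finset.univ, ‖coord v k * pderiv π k W (x + cover π (s • v)) -
        coord v k * pderiv π k W x‖ ≤ N * C * ‖v‖ ^ 2 := fun k _ => by
      have h2 := (hW.pderiv (n' := 1) (by norm_num) k).abs_line_sub_le hπ one_ne_zero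
        (fun l x => hC l k x) x (s • v)
      have h3 : ‖s • v‖ ≤ ‖v‖ := by
        rw [norm_smul, Real.norm_eq_abs, abs_of_nonneg hs.1]
        exact mul_le_of_le_one_left (norm_nonneg _) hs.2.le
      have hC0 : 0 ≤ C := (abs_nonneg _).trans (hC k k x)
      rw [← mul_sub, Real.norm_eq_abs, abs_mul]
      calc _ ≤ ‖v‖ * (N * C * ‖s • v‖) :=
            mul_le_mul (abs_coord_le v k) h2 (abs_nonneg _) (norm_nonneg _)
        _ ≤ ‖v‖ * (N * C * ‖v‖) := by gcongr
        _ = _ := by ring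
    refine (Finset.sum_le_sum hk).trans_eq ?_
    rw [Finset.sum_const, Finset.card_univ, nsmul_eq_mul]
    ring

/-- Differentiating in the step length turns the second difference into `F(x + s e) - F(x - s e) - 2
s ∂F(x)`, with `F = ∂_k W`; this is quadratic in `s` by Taylor's formula at `±s`. -/
lemma abs_second_difference_le {W : Phase d m Q → ℝ} (hW : IsCn π 3 W)
    (hπ : IsOpenQuotientMap π) {C : ℝ}
    (hC : ∀ j k l x, |pderiv π j (pderiv π k (pderiv π l W)) x| ≤ C) (k : Coord d m)
    (x : Phase d m Q) {h : ℝ} (hh : 0 ≤ h) :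
    |W (x + cover π (h • unitVec k)) + W (x - cover π (h • unitVec k)) - 2 * W x -
      h ^ 2 * pderiv π k (pderiv π k W) x| ≤ 2 * Fintype.card (Coord d m) ^ 2 * C * h ^ 3 := by
  set N := (Fintype.card (Coord d m) : ℝ)
  have hC0 : 0 ≤ C := (abs_nonneg _).trans (hC k k k x)
  set F := pderiv π k W with hF
  have hF2 : IsCn π 2 F := hW.pderiv (by norm_num) k
  have hT : ∀ s : ℝ, |F (x + cover π (s • unitVec k)) - F x - s * pderiv π k F x| ≤
      N ^ 2 * C * s ^ 2 := fun s => by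
    have h1 := abs_taylor_le hF2 hπ (fun i j x => hC i j k x) x (s • unitVec k)
    have h2 : ∑ l, coord (s • unitVec k : Phase d m (Euc d)) l * pderiv π l F x =
        s * pderiv π k F x := by
      have h3 : ∀ l, coord (s • unitVec k : Phase d m (Euc d)) l = s * if l = k then 1 else 0 := by
        intro l
        rw [← coord_unitVec k l]
        rcases l with i | i | ⟨j, i⟩ <;> rfl
      simp [h3]
    rw [h2] at h1
    refine h1.trans ?_
    have h4 : ‖s • (unitVec k : Phase d m (Euc d))‖ ≤ |s| := by
      rw [norm_smul, Real.norm_eq_abs]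
      exact mul_le_of_le_one_right (abs_nonneg s) (norm_unitVec_le k)
    have h5 := pow_le_pow_left₀ (norm_nonneg _) h4 2
    rw [sq_abs] at h5
    exact mul_le_mul_of_nonneg_left h5 (by positivity)
  have hd : ∀ s : ℝ, HasDerivAt (fun s : ℝ => W (x + cover π (s • unitVec k)) +
      W (x + cover π ((-s) • unitVec k)) - s ^ 2 * pderiv π k F x)
      (F (x + cover π (s • unitVec k)) + F (x + cover π ((-s) • unitVec k)) * (-1) -
        2 * s * pderiv π k F x) s := fun s => by
    have h1 := hW.hasDerivAt hπ (by norm_num) k x s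
    have h2 := (hW.hasDerivAt hπ (by norm_num) k x (-s)).comp s (hasDerivAt_neg s)
    have h3 := ((hasDerivAt_id s).fun_pow 2).mul_const (pderiv π k F x)
    simp only [id, Nat.cast_ofNat, Nat.add_one_sub_one, pow_one, mul_one] at h3
    exact (h1.add h2).sub h3
  have h1 := norm_image_sub_le_of_norm_deriv_le_segment' (a := 0) (b := h)
    (C := 2 * N ^ 2 * C * h ^ 2) (fun s _ => (hd s).hasDerivWithinAt) (fun s hs => ?_) h
    ⟨hh, le_rfl⟩
  · simp only [neg_zero, zero_smul, cover_zero, add_zero, Real.norm_eq_abs, neg_smul, cover_neg,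
      ← sub_eq_add_neg] at h1
    refine (le_of_eq ?_).trans (h1.trans_eq ?_)
    · congr 1
      ring
    · ring
  · have a1 := hT s
    have a2 := hT (-s)
    rw [neg_sq] at a2
    have a3 : s ^ 2 ≤ h ^ 2 := pow_le_pow_left₀ hs.1 hs.2.le 2
    have a4 : N ^ 2 * C * s ^ 2 ≤ N ^ 2 * C * h ^ 2 :=
      mul_le_mul_of_nonneg_left a3 (by positivity)
    rw [Real.norm_eq_abs]
    rw [abs_le] at a1 a2 ⊢
    constructor <;> linarith

/-- The drift as a vector field. -/
def driftVec (π : Euc d →+ Q) (lam alpha : Fin m → ℝ) (V : Q → ℝ) (x : Phase d m Q) :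
    Phase d m (Euc d) :=
  ∑ k, drift π lam alpha V k x • unitVec k

omit [TopologicalSpace Q] [IsTopologicalAddGroup Q] [SecondCountableTopology Q] [T2Space Q]
  [LocallyCompactSpace Q] [MeasureSpace Q] [BorelSpace Q] [AddCommGroup Q]
  [(volume : Measure Q).IsAddHaarMeasure] in
lemma coord_sum_smul (c : Coord d m → ℝ) (k : Coord d m) :
    coord (∑ l, c l • unitVec l : Phase d m (Euc d)) k = c k := by
  have h1 : coord (∑ l, c l • unitVec l : Phase d m (Euc d)) k =
      ∑ l, c l * coord (unitVec l : Phase d m (Euc d)) k := by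
    rcases k with i | i | ⟨j, i⟩ <;>
      simp [coord, Prod.fst_sum, Prod.snd_sum, Finset.sum_apply]
  rw [h1]
  simp only [coord_unitVec, mul_ite, mul_one, mul_zero, Finset.sum_ite_eq, Finset.mem_univ, if_true]

lemma coord_driftVec (x : Phase d m Q) (k : Coord d m) :
    coord (driftVec π lam alpha V x) k = drift π lam alpha V k x := coord_sum_smul _ k

namespace IsAdmissible

variable (hV : IsAdmissible π β V)
include hV

lemma continuous_driftVec :
    Continuous (driftVec π lam alpha V : Phase d m Q → Phase d m (Euc d)) :=
  continuous_finsetSum _ fun k _ => (hV.isTame_drift k).1.smul continuous_const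

/-- A consequence of the bounded Hessian. Its constant is the threshold beyond which the resolvent
equation preserves Lipschitz bounds. -/
lemma exists_driftVec_lipschitz : ∃ Λ : ℝ, 0 ≤ Λ ∧ ∀ (x : Phase d m Q) (v : Phase d m (Euc d)),
    ‖driftVec π lam alpha V (x + cover π v) - driftVec π lam alpha V x‖ ≤ Λ * ‖v‖ := by
  obtain ⟨C, hC0, hC⟩ := hV.exists_pderiv_drift_le (m := m) (lam := lam) (alpha := alpha)
  refine ⟨Fintype.card (Coord d m) * (Fintype.card (Coord d m) * C), by positivity,
    fun x v => ?_⟩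
  rw [driftVec, driftVec, ← Finset.sum_sub_distrib]
  have : ∀ k ∈ Finset.univ, ‖drift π lam alpha V k (x + cover π v) • unitVec k -
      drift π lam alpha V k x • (unitVec k : Phase d m (Euc d))‖ ≤
      Fintype.card (Coord d m) * C * ‖v‖ := fun k _ => by
    rw [← sub_smul, norm_smul]
    exact (mul_le_of_le_one_right (norm_nonneg _) (norm_unitVec_le k)).trans
      ((hV.isCn_drift k).abs_line_sub_le hV.quot one_ne_zero (fun l x => hC l k x) x v)
  refine (norm_sum_le _ _).trans ((Finset.sum_le_sum this).trans_eq ?_)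
  rw [Finset.sum_const, Finset.card_univ, nsmul_eq_mul]
  ring

/-- The drift is linear in `∇H`. The estimate is needed since the Taylor remainder of the transport
step is quadratic in the drift. -/
lemma exists_driftVec_sq_le : ∃ C : ℝ, 0 ≤ C ∧ ∀ x : Phase d m Q,
    ‖driftVec π lam alpha V x‖ ^ 2 ≤ C * growth π V x := by
  set A := ∑ k : Coord d m, (∑ l, |symplectic lam k l| + |diffusion alpha k|) with hA
  have hA0 : 0 ≤ A := by positivity
  refine ⟨A ^ 2, sq_nonneg _, fun x => ?_⟩
  have hg : 0 ≤ growth π V x := zero_le_one.trans (one_le_growth x)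
  have h1 : ∀ l, |gradH π V l x| ≤ √(growth π V x) := fun l => by
    refine Real.abs_le_sqrt (le_add_of_nonneg_of_le zero_le_one ?_)
    exact Finset.single_le_sum (f := fun k => gradH π V k x ^ 2) (fun _ _ => sq_nonneg _)
      (Finset.mem_univ l)
  have h2 : ‖driftVec π lam alpha V x‖ ≤ A * √(growth π V x) := by
    rw [hA, Finset.sum_mul]
    refine (norm_sum_le _ _).trans (Finset.sum_le_sum fun k _ => ?_)
    rw [norm_smul, Real.norm_eq_abs]
    refine (mul_le_of_le_one_right (abs_nonneg _) (norm_unitVec_le k)).trans ?_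
    rw [add_mul, Finset.sum_mul, drift]
    refine (abs_sub _ _).trans (add_le_add ((Finset.abs_sum_le_sum_abs _ _).trans
      (Finset.sum_le_sum fun l _ => ?_)) ?_)
    · rw [abs_mul]
      exact mul_le_mul_of_nonneg_left (h1 l) (abs_nonneg _)
    · rw [abs_mul]
      exact mul_le_mul_of_nonneg_left (h1 k) (abs_nonneg _)
  calc ‖driftVec π lam alpha V x‖ ^ 2 ≤ (A * √(growth π V x)) ^ 2 :=
        pow_le_pow_left₀ (norm_nonneg _) h2 2
    _ = _ := by rw [mul_pow, Real.sq_sqrt hg]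

end IsAdmissible

end Scheme

/-! ### The resolvent equation of the scheme -/

section DiscreteResolvent

open scoped BoundedContinuousFunction NNReal

variable {d m : ℕ} {Q : Type} [AddCommGroup Q] [TopologicalSpace Q] [IsTopologicalAddGroup Q]
  [SecondCountableTopology Q] [T2Space Q] [LocallyCompactSpace Q] [MeasureSpace Q] [BorelSpace Q]
  [(volume : Measure Q).IsAddHaarMeasure] {π : Euc d →+ Q}

variable {β : ℝ} {V : Q → ℝ} {lam alpha : Fin m → ℝ}

/-- The discretised generator with step `h`: transport along the drift, and second differences. -/
def discreteGenerator (π : Euc d →+ Q) (lam alpha : Fin m → ℝ) (β : ℝ) (V : Q → ℝ) (h : ℝ)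
    (u : Phase d m Q → ℝ) (x : Phase d m Q) : ℝ :=
  h⁻¹ * (u (x + cover π (h • driftVec π lam alpha V x)) - u x) +
    ∑ k, β⁻¹ * diffusion alpha k * (h ^ 2)⁻¹ * (u (x + cover π (h • unitVec k)) +
      u (x - cover π (h • unitVec k)) - 2 * u x)

lemma diffusion_nonneg (halpha : ∀ j, 0 < alpha j) (k : Coord d m) : 0 ≤ diffusion alpha k := by
  rcases k with i | i | ⟨j, i⟩
  · exact le_rfl
  · exact le_rfl
  · exact (halpha j).le

/-- The right side divided by `c` is a contraction in the sup norm because `∑ w_i < c`. A property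
stable under one step and under pointwise limits passes to the fixed point through the iterates
starting from zero. -/
lemma exists_averaging_fixedPoint {X : Type*} [TopologicalSpace X] {ι : Type*} [Fintype ι]
    {c K : ℝ} {f : X → ℝ} (hf : Continuous f) (hK : ∀ x, |f x| ≤ K) {w : ι → ℝ}
    (hw : ∀ i, 0 ≤ w i) (hc : ∑ i, w i < c) {τ : ι → X → X} (hτ : ∀ i, Continuous (τ i))
    (P : (X → ℝ) → Prop) (hP0 : P fun _ => 0)
    (hP : ∀ u : X → ℝ, P u → P fun x => c⁻¹ * (f x + ∑ i, w i * u (τ i x)))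
    (hPc : ∀ (u : ℕ → X → ℝ) (v : X → ℝ), (∀ n, P (u n)) →
      (∀ x, Tendsto (fun n => u n x) atTop (𝓝 (v x))) → P v) :
    ∃ u : X → ℝ, Continuous u ∧ P u ∧ ∀ x, c * u x = f x + ∑ i, w i * u (τ i x) := by
  have hS : 0 ≤ ∑ i, w i := Finset.sum_nonneg fun i _ => hw i
  have hc0 : 0 < c := hS.trans_lt hc
  have hsum : ∀ (u : X →ᵇ ℝ) (D : ℝ), (∀ x, |u x| ≤ D) → ∀ x,
      |∑ i, w i * u (τ i x)| ≤ (∑ i, w i) * D := fun u D hD x => by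
    rw [Finset.sum_mul]
    refine (Finset.abs_sum_le_sum_abs _ _).trans (Finset.sum_le_sum fun i _ => ?_)
    rw [abs_mul, abs_of_nonneg (hw i)]
    exact mul_le_mul_of_nonneg_left (hD _) (hw i)
  let T : (X →ᵇ ℝ) → (X →ᵇ ℝ) := fun u => BoundedContinuousFunction.ofNormedAddCommGroup
    (fun x => c⁻¹ * (f x + ∑ i, w i * u (τ i x)))
    (continuous_const.mul (hf.add (continuous_finsetSum _ fun i _ =>
      continuous_const.mul (u.continuous.comp (hτ i)))))
    (c⁻¹ * (K + (∑ i, w i) * ‖u‖)) fun x => by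
      rw [norm_mul, Real.norm_eq_abs, abs_of_pos (inv_pos.2 hc0)]
      refine mul_le_mul_of_nonneg_left ?_ (inv_pos.2 hc0).le
      exact (abs_add_le _ _).trans (add_le_add (hK x) (hsum u _ (fun x => u.norm_coe_le_norm x) x))
  have hT : ∀ u x, T u x = c⁻¹ * (f x + ∑ i, w i * u (τ i x)) := fun u x => rfl
  have hlip : ContractingWith (c⁻¹ * ∑ i, w i).toNNReal T := by
    refine ⟨?_, LipschitzWith.of_dist_le_mul fun u v => ?_⟩
    · rw [← NNReal.coe_lt_coe, Real.coe_toNNReal _ (by positivity), NNReal.coe_one,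
        inv_mul_lt_iff₀ hc0, mul_one]
      exact hc
    · rw [Real.coe_toNNReal _ (by positivity)]
      refine (BoundedContinuousFunction.dist_le (by positivity)).2 fun x => ?_
      rw [Real.dist_eq, hT, hT, ← mul_sub, add_sub_add_left_eq_sub, ← Finset.sum_sub_distrib,
        abs_mul, abs_of_pos (inv_pos.2 hc0), mul_assoc]
      refine mul_le_mul_of_nonneg_left ?_ (inv_pos.2 hc0).le
      have := hsum (u - v) (dist u v) (fun x => by
        rw [dist_eq_norm]; exact (u - v).norm_coe_le_norm x) x
      simpa only [BoundedContinuousFunction.coe_sub, Pi.sub_apply, mul_sub] using this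
  set u := ContractingWith.fixedPoint T hlip with hu
  have hfix : T u = u := hlip.fixedPoint_isFixedPt
  have hiter : ∀ n : ℕ, P (T^[n] 0) := fun n => by
    induction n with
    | zero => exact hP0
    | succ n ih =>
      rw [Function.iterate_succ_apply']
      exact hP _ ih
  have hlim := hlip.tendsto_iterate_fixedPoint 0
  refine ⟨u, u.continuous, hPc (fun n => T^[n] 0) u hiter fun x => ?_, fun x => ?_⟩
  · exact ((continuous_eval_const (F := X →ᵇ ℝ) x).tendsto u).comp hlim
  · have h1 := hT u x
    rw [hfix] at h1
    rw [h1, mul_inv_cancel_left₀ hc0.ne']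

namespace IsAdmissible

variable (hV : IsAdmissible π β V)
include hV

/-- The discretised resolvent equation has bounded Lipschitz solutions, uniformly in the step. -/
lemma exists_discrete_resolvent (halpha : ∀ j, 0 < alpha j) {Λ : ℝ} (hΛ0 : 0 ≤ Λ)
    (hΛ : ∀ (x : Phase d m Q) (v : Phase d m (Euc d)),
      ‖driftVec π lam alpha V (x + cover π v) - driftVec π lam alpha V x‖ ≤ Λ * ‖v‖)
    {l : ℝ} (hl : Λ < l) {f : Phase d m Q → ℝ} (hf : Continuous f) {K ℓ : ℝ}
    (hK : ∀ x, |f x| ≤ K)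
    (hℓ : ∀ x (v : Phase d m (Euc d)), |f (x + cover π v) - f x| ≤ ℓ * ‖v‖) (hℓ0 : 0 ≤ ℓ)
    {h : ℝ} (hh : 0 < h) :
    ∃ u : Phase d m Q → ℝ, Continuous u ∧ (∀ x, |u x| ≤ K / l) ∧
      (∀ x (v : Phase d m (Euc d)), |u (x + cover π v) - u x| ≤ ℓ / (l - Λ) * ‖v‖) ∧
      ∀ x, l * u x - f x = discreteGenerator π lam alpha β V h u x := by
  have hβ := hV.pos
  have hl0 : 0 < l := hΛ0.trans_lt hl
  have hlΛ : 0 < l - Λ := sub_pos.2 hl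
  have hK0 : 0 ≤ K := (abs_nonneg _).trans (hK 0)
  have hcov := (isOpenQuotientMap_cover (m := m) hV.quot).continuous
  let a : Coord d m → ℝ := fun k => β⁻¹ * diffusion alpha k * (h ^ 2)⁻¹
  have ha : ∀ k, 0 ≤ a k := fun k =>
    mul_nonneg (mul_nonneg (by positivity) (diffusion_nonneg halpha k)) (by positivity)
  -- Collecting the `u x` terms, the equation becomes `(l + S) u = f + ∑ w_i u ∘ τ_i` with `S = ∑
  -- w_i`: `none` is transport along the drift, the two summands are the forward and backward
  -- shifts.
  let w : Option (Coord d m ⊕ Coord d m) → ℝ := fun i => i.elim h⁻¹ (Sum.elim a a)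
  let τ : Option (Coord d m ⊕ Coord d m) → Phase d m Q → Phase d m Q := fun i x =>
    i.elim (x + cover π (h • driftVec π lam alpha V x)) (Sum.elim
      (fun k => x + cover π (h • unitVec k)) (fun k => x - cover π (h • unitVec k)))
  have hw : ∀ i, 0 ≤ w i := by
    rintro (_ | k | k)
    · exact (inv_pos.2 hh).le
    · exact ha k
    · exact ha k
  have hτ : ∀ i, Continuous (τ i) := by
    rintro (_ | k | k)
    · exact continuous_id.add (hcov.comp (hV.continuous_driftVec.const_smul h))
    · exact continuous_id.add continuous_const
    · exact continuous_id.sub continuous_const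
  have hsum : ∀ g : Option (Coord d m ⊕ Coord d m) → ℝ,
      ∑ i, g i = g none + (∑ k, g (some (.inl k)) + ∑ k, g (some (.inr k))) := fun g => by
    rw [Fintype.sum_option, Fintype.sum_sum_type]
  set S := ∑ i, w i with hS
  have hS0 : 0 ≤ S := Finset.sum_nonneg fun i _ => hw i
  set c := l + S with hc
  have hc0 : 0 < c := by positivity
  set L := ℓ / (l - Λ) with hL
  have hL0 : 0 ≤ L := by positivity
  -- Shifts preserve a Lipschitz bound. Transport worsens it by the factor `1 + hΛ`, and with weight
  -- `h⁻¹` the excess is `LΛ`, free of `h`. This is compensated by `l`, whence the constant `L = ℓ /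
  -- (l - Λ)`.
  have hτlip : ∀ u : Phase d m Q → ℝ,
      (∀ x (v : Phase d m (Euc d)), |u (x + cover π v) - u x| ≤ L * ‖v‖) → ∀ i x
      (v : Phase d m (Euc d)), w i * |u (τ i (x + cover π v)) - u (τ i x)| ≤
        w i * (L * ‖v‖) + if i = none then L * Λ * ‖v‖ else 0 := by
    intro u hu i x v
    rcases i with _ | k | k
    · have e : τ none (x + cover π v) = τ none x + cover π (v + h •
          (driftVec π lam alpha V (x + cover π v) - driftVec π lam alpha V x)) := by
        simp only [τ, Option.elim, cover_add, smul_sub, cover_sub]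
        abel
      have h1 : ‖v + h • (driftVec π lam alpha V (x + cover π v) - driftVec π lam alpha V x)‖ ≤
          ‖v‖ + h * (Λ * ‖v‖) := by
        refine (norm_add_le _ _).trans (add_le_add le_rfl ?_)
        rw [norm_smul, Real.norm_eq_abs, abs_of_pos hh]
        exact mul_le_mul_of_nonneg_left (hΛ x v) hh.le
      rw [e, if_pos rfl]
      calc w none * _ ≤ h⁻¹ * (L * (‖v‖ + h * (Λ * ‖v‖))) :=
            mul_le_mul_of_nonneg_left ((hu _ _).trans (mul_le_mul_of_nonneg_left h1 hL0))
              (inv_pos.2 hh).le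
        _ = h⁻¹ * (L * ‖v‖) + h⁻¹ * h * (L * Λ * ‖v‖) := by ring
        _ = _ := by rw [inv_mul_cancel₀ hh.ne', one_mul]; rfl
    · have e : τ (some (.inl k)) (x + cover π v) = τ (some (.inl k)) x + cover π v := by
        simp only [τ, Option.elim, Sum.elim_inl]
        abel
      rw [e]
      simpa using mul_le_mul_of_nonneg_left (hu (τ (some (.inl k)) x) v) (hw (some (.inl k)))
    · have e : τ (some (.inr k)) (x + cover π v) = τ (some (.inr k)) x + cover π v := by
        simp only [τ, Option.elim, Sum.elim_inr]
        abel
      rw [e]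
      simpa using mul_le_mul_of_nonneg_left (hu (τ (some (.inr k)) x) v) (hw (some (.inr k)))
  have hP : ∀ u : Phase d m Q → ℝ, (∀ x, |u x| ≤ K / l) →
      (∀ x (v : Phase d m (Euc d)), |u (x + cover π v) - u x| ≤ L * ‖v‖) →
      (∀ x, |c⁻¹ * (f x + ∑ i, w i * u (τ i x))| ≤ K / l) ∧
      ∀ x (v : Phase d m (Euc d)), |c⁻¹ * (f (x + cover π v) + ∑ i, w i * u (τ i (x + cover π v))) -
        c⁻¹ * (f x + ∑ i, w i * u (τ i x))| ≤ L * ‖v‖ := by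
    refine fun u h1 h2 => ⟨fun x => ?_, fun x v => ?_⟩
    · rw [abs_mul, abs_of_pos (inv_pos.2 hc0), inv_mul_le_iff₀ hc0]
      have h3 : |∑ i, w i * u (τ i x)| ≤ S * (K / l) := by
        rw [hS, Finset.sum_mul]
        refine (Finset.abs_sum_le_sum_abs _ _).trans (Finset.sum_le_sum fun i _ => ?_)
        rw [abs_mul, abs_of_nonneg (hw i)]
        exact mul_le_mul_of_nonneg_left (h1 _) (hw i)
      calc _ ≤ K + S * (K / l) := (abs_add_le _ _).trans (add_le_add (hK x) h3)
        _ = c * (K / l) := by rw [hc]; field_simp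
    · rw [← mul_sub, abs_mul, abs_of_pos (inv_pos.2 hc0), inv_mul_le_iff₀ hc0,
        add_sub_add_comm, ← Finset.sum_sub_distrib]
      have h3 : |∑ i, (w i * u (τ i (x + cover π v)) - w i * u (τ i x))| ≤
          S * (L * ‖v‖) + L * Λ * ‖v‖ := by
        refine (Finset.abs_sum_le_sum_abs _ _).trans ?_
        have h4 : ∀ i ∈ Finset.univ, |w i * u (τ i (x + cover π v)) - w i * u (τ i x)| ≤
            w i * (L * ‖v‖) + if i = none then L * Λ * ‖v‖ else 0 := fun i _ => by
          rw [← mul_sub, abs_mul, abs_of_nonneg (hw i)]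
          exact hτlip u h2 i x v
        refine (Finset.sum_le_sum h4).trans_eq ?_
        rw [Finset.sum_add_distrib, ← Finset.sum_mul, Finset.sum_ite_eq' Finset.univ none,
          if_pos (Finset.mem_univ _)]
      have h5 : ℓ = (l - Λ) * L := by rw [hL]; field_simp
      calc _ ≤ ℓ * ‖v‖ + (S * (L * ‖v‖) + L * Λ * ‖v‖) :=
            (abs_add_le _ _).trans (add_le_add (hℓ x v) h3)
        _ = c * (L * ‖v‖) := by rw [h5, hc]; ring
  obtain ⟨u, hu, ⟨hu1, hu2⟩, hu3⟩ := exists_averaging_fixedPoint (c := c) hf hK hw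
    (by linarith) hτ
    (fun u => (∀ x, |u x| ≤ K / l) ∧
      ∀ x (v : Phase d m (Euc d)), |u (x + cover π v) - u x| ≤ L * ‖v‖)
    ⟨fun x => by rw [abs_zero]; positivity, fun x v => by
      rw [sub_zero, abs_zero]; positivity⟩
    (fun u hu => hP u hu.1 hu.2)
    (fun u v hP hlim => ⟨fun x => le_of_tendsto (hlim x).abs
      (Eventually.of_forall fun n => (hP n).1 x), fun x y => le_of_tendsto
      ((hlim _).sub (hlim x)).abs (Eventually.of_forall fun n => (hP n).2 x y)⟩)
  refine ⟨u, hu, hu1, hu2, fun x => ?_⟩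
  have h1 := hu3 x
  rw [hsum] at h1
  rw [hc, hS, hsum] at h1
  simp only [w, τ, Option.elim, Sum.elim_inl, Sum.elim_inr, a] at h1
  simp only [discreteGenerator, mul_sub, mul_add, Finset.sum_add_distrib,
    Finset.sum_sub_distrib]
  have h2 : ∑ k : Coord d m, β⁻¹ * diffusion alpha k * (h ^ 2)⁻¹ * (2 * u x) =
      2 * (∑ k : Coord d m, β⁻¹ * diffusion alpha k * (h ^ 2)⁻¹) * u x := by
    rw [Finset.mul_sum, Finset.sum_mul]
    exact Finset.sum_congr rfl fun k _ => by ring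
  rw [h2]
  linarith

end IsAdmissible

end DiscreteResolvent

/-! ### Approximate solutions of the resolvent equation -/

section Consistency

variable {d m : ℕ} {Q : Type} [AddCommGroup Q] [TopologicalSpace Q] [IsTopologicalAddGroup Q]
  [SecondCountableTopology Q] [T2Space Q] [LocallyCompactSpace Q] [MeasureSpace Q] [BorelSpace Q]
  [(volume : Measure Q).IsAddHaarMeasure] {π : Euc d →+ Q}

variable {β : ℝ} {V : Q → ℝ} {lam alpha : Fin m → ℝ}

lemma three_le_smooth : (3 : ℕ∞ω) ≤ ∞ :=
  (WithTop.coe_le_coe.2 (le_top : (3 : ℕ∞) ≤ ⊤) : ((3 : ℕ∞) : ℕ∞ω) ≤ ∞)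

namespace IsAdmissible

variable (hV : IsAdmissible π β V)
include hV

/-- Mollification commutes with constant shifts. The only commutator comes from transport, where the
drift at `x - y` is compared with the drift frozen at `x`. -/
lemma mollify_discreteGenerator {θ : Phase d m (Euc d) → ℝ} (hθ : IsKernel θ)
    {u : Phase d m Q → ℝ} (hu : Continuous u) (h : ℝ) (x : Phase d m Q) :
    mollify π θ (discreteGenerator π lam alpha β V h u) x =
      h⁻¹ * (∫ y, θ y * (u (x - cover π y + cover π (h • driftVec π lam alpha V (x - cover π y))) -
        u (x - cover π y + cover π (h • driftVec π lam alpha V x)))) +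
      discreteGenerator π lam alpha β V h (mollify π θ u) x := by
  have hcov := (isOpenQuotientMap_cover (m := m) hV.quot).continuous
  have hx := continuous_sub_cover (m := m) hV.quot x
  set b := driftVec π lam alpha V with hb
  have hbc : Continuous b := hV.continuous_driftVec
  have c1 : Continuous fun y => u (x - cover π y + cover π (h • b (x - cover π y))) :=
    hu.comp (hx.add (hcov.comp ((hbc.comp hx).const_smul h)))
  have c2 : Continuous fun y => u (x - cover π y + cover π (h • b x)) :=
    hu.comp (hx.add continuous_const)
  have i1 : Integrable fun y => h⁻¹ * (θ y *
      (u (x - cover π y + cover π (h • b (x - cover π y))) -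
        u (x - cover π y + cover π (h • b x)))) := (hθ.integrable_mul (c1.sub c2)).const_mul _
  have i2 := fun z => hθ.integrable_mollify hV.quot hu z
  have e : ∀ y, θ y * discreteGenerator π lam alpha β V h u (x - cover π y) =
      h⁻¹ * (θ y * (u (x - cover π y + cover π (h • b (x - cover π y))) -
        u (x - cover π y + cover π (h • b x)))) +
      (h⁻¹ * (θ y * u (x + cover π (h • b x) - cover π y) - θ y * u (x - cover π y)) +
      ∑ k, β⁻¹ * diffusion alpha k * (h ^ 2)⁻¹ * (θ y * u (x + cover π (h • unitVec k) - cover π y) +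
        θ y * u (x - cover π (h • unitVec k) - cover π y) - 2 * (θ y * u (x - cover π y)))) := by
    intro y
    rw [discreteGenerator, mul_add, Finset.mul_sum, ← add_assoc]
    congr 1
    · rw [show x + cover π (h • b x) - cover π y = x - cover π y + cover π (h • b x) by abel]
      ring
    · refine Finset.sum_congr rfl fun k _ => ?_
      rw [show x + cover π (h • unitVec k) - cover π y =
        x - cover π y + cover π (h • unitVec k) by abel,
        show x - cover π (h • unitVec k) - cover π y =
        x - cover π y - cover π (h • unitVec k) by abel]
      ring
  have j2 : Integrable fun y => h⁻¹ *
      (θ y * u (x + cover π (h • b x) - cover π y) - θ y * u (x - cover π y)) :=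
    ((i2 _).sub (i2 _)).const_mul _
  have j3 : ∀ k, Integrable fun y => θ y * u (x + cover π (h • unitVec k) - cover π y) +
      θ y * u (x - cover π (h • unitVec k) - cover π y) := fun k => (i2 _).add (i2 _)
  have j4 : ∀ k, Integrable fun y => θ y * u (x + cover π (h • unitVec k) - cover π y) +
      θ y * u (x - cover π (h • unitVec k) - cover π y) - 2 * (θ y * u (x - cover π y)) :=
    fun k => (j3 k).sub ((i2 x).const_mul 2)
  have j5 : Integrable fun y => ∑ k, β⁻¹ * diffusion alpha k * (h ^ 2)⁻¹ *
      (θ y * u (x + cover π (h • unitVec k) - cover π y) +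
        θ y * u (x - cover π (h • unitVec k) - cover π y) - 2 * (θ y * u (x - cover π y))) :=
    integrable_finsetSum _ fun k _ => (j4 k).const_mul _
  have j6 : Integrable fun y => h⁻¹ *
      (θ y * u (x + cover π (h • b x) - cover π y) - θ y * u (x - cover π y)) +
      ∑ k, β⁻¹ * diffusion alpha k * (h ^ 2)⁻¹ *
      (θ y * u (x + cover π (h • unitVec k) - cover π y) +
        θ y * u (x - cover π (h • unitVec k) - cover π y) - 2 * (θ y * u (x - cover π y))) :=
    j2.add j5
  rw [mollify]
  simp only [e]
  rw [integral_add i1 j6, integral_const_mul]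
  congr 1
  rw [discreteGenerator, integral_add j2 j5, integral_const_mul, integral_sub (i2 _) (i2 _),
    integral_finsetSum _ fun k _ => (j4 k).const_mul _]
  congr 1
  refine Finset.sum_congr rfl fun k _ => ?_
  rw [integral_const_mul, integral_sub (j3 k) ((i2 x).const_mul 2),
    integral_add (i2 _) (i2 _), integral_const_mul]
  rfl

/-- Taylor's formula, with the derivatives of the mollified function bounded by the kernel and `K`
alone; hence the constant is uniform in `u` and `h`. -/
lemma exists_discreteGenerator_sub_le (halpha : ∀ j, 0 < alpha j) {θ : Phase d m (Euc d) → ℝ}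
    (hθ : IsKernel θ) {K : ℝ} (hK : 0 ≤ K) : ∃ C, 0 ≤ C ∧ ∀ u : Phase d m Q → ℝ, Continuous u →
    (∀ x, |u x| ≤ K) → ∀ h, 0 < h → ∀ x,
      |discreteGenerator π lam alpha β V h (mollify π θ u) x -
        generator π lam alpha β V (mollify π θ u) x| ≤ h * (C * growth π V x) := by
  have hβ := hV.pos
  obtain ⟨C₁, hC₁, hb⟩ := hV.exists_driftVec_sq_le (m := m) (lam := lam) (alpha := alpha)
  set C₂ := K * ∑ k, ∑ l, ∫ y, |kernelDeriv k (kernelDeriv l θ) y| with hC₂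
  set C₃ := K * ∑ j, ∑ k, ∑ l, ∫ y, |kernelDeriv j (kernelDeriv k (kernelDeriv l θ)) y| with hC₃
  have n1 : ∀ θ' : Phase d m (Euc d) → ℝ, 0 ≤ ∫ y, |θ' y| := fun θ' =>
    integral_nonneg fun y => abs_nonneg _
  have hC₂0 : 0 ≤ C₂ := mul_nonneg hK (Finset.sum_nonneg fun k _ =>
    Finset.sum_nonneg fun l _ => n1 _)
  have hC₃0 : 0 ≤ C₃ := mul_nonneg hK (Finset.sum_nonneg fun j _ => Finset.sum_nonneg fun k _ =>
    Finset.sum_nonneg fun l _ => n1 _)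
  set N := (Fintype.card (Coord d m) : ℝ)
  set S := ∑ k : Coord d m, β⁻¹ * diffusion alpha k
  have hd := fun k : Coord d m => diffusion_nonneg (d := d) halpha k
  have hS0 : 0 ≤ S := Finset.sum_nonneg fun k _ => mul_nonneg (by positivity) (hd k)
  refine ⟨N ^ 2 * C₂ * C₁ + S * (2 * N ^ 2 * C₃), by positivity, fun u hu huK h hh x => ?_⟩
  set W := mollify π θ u with hW
  have hWn : IsCn π ∞ W := hθ.isCn_mollify hV.quot hu
  have hW2 : ∀ k l x, |pderiv π k (pderiv π l W) x| ≤ C₂ := fun k l x => by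
    rw [hW, hθ.pderiv_mollify hV.quot hu, (hθ.kernelDeriv l).pderiv_mollify hV.quot hu]
    refine (((hθ.kernelDeriv l).kernelDeriv k).abs_mollify_le huK x).trans ?_
    refine mul_le_mul_of_nonneg_left ?_ hK
    exact (Finset.single_le_sum (f := fun l => ∫ y, |kernelDeriv k (kernelDeriv l θ) y|)
      (fun l _ => n1 _) (Finset.mem_univ l)).trans
      (Finset.single_le_sum (f := fun k => ∑ l, ∫ y, |kernelDeriv k (kernelDeriv l θ) y|)
        (fun k _ => Finset.sum_nonneg fun l _ => n1 _) (Finset.mem_univ k))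
  have hW3 : ∀ j k l x, |pderiv π j (pderiv π k (pderiv π l W)) x| ≤ C₃ := fun j k l x => by
    rw [hW, hθ.pderiv_mollify hV.quot hu, (hθ.kernelDeriv l).pderiv_mollify hV.quot hu,
      ((hθ.kernelDeriv l).kernelDeriv k).pderiv_mollify hV.quot hu]
    refine ((((hθ.kernelDeriv l).kernelDeriv k).kernelDeriv j).abs_mollify_le huK x).trans ?_
    refine mul_le_mul_of_nonneg_left ?_ hK
    exact (Finset.single_le_sum
      (f := fun l => ∫ y, |kernelDeriv j (kernelDeriv k (kernelDeriv l θ)) y|)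
      (fun l _ => n1 _) (Finset.mem_univ l)).trans ((Finset.single_le_sum
        (f := fun k => ∑ l, ∫ y, |kernelDeriv j (kernelDeriv k (kernelDeriv l θ)) y|)
        (fun k _ => Finset.sum_nonneg fun l _ => n1 _) (Finset.mem_univ k)).trans
      (Finset.single_le_sum
        (f := fun j => ∑ k, ∑ l, ∫ y, |kernelDeriv j (kernelDeriv k (kernelDeriv l θ)) y|)
        (fun j _ => Finset.sum_nonneg fun k _ => Finset.sum_nonneg fun l _ => n1 _)
        (Finset.mem_univ j)))
  set b := driftVec π lam alpha V x with hbdef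
  have t1 : |h⁻¹ * (W (x + cover π (h • b)) - W x) - ∑ k, drift π lam alpha V k x * pderiv π k W x| ≤
      h * (N ^ 2 * C₂ * C₁ * growth π V x) := by
    have h1 := abs_taylor_le (hWn.of_le two_le_smooth) hV.quot hW2 x (h • b)
    have h2 : ∑ k, coord (h • b) k * pderiv π k W x =
        h * ∑ k, drift π lam alpha V k x * pderiv π k W x := by
      rw [Finset.mul_sum]
      refine Finset.sum_congr rfl fun k _ => ?_
      rw [← coord_driftVec (lam := lam) (alpha := alpha) x k, ← hbdef, ← mul_assoc]
      congr 1
      rcases k with i | i | ⟨j, i⟩ <;> rfl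
    rw [h2] at h1
    have h3 : h⁻¹ * (W (x + cover π (h • b)) - W x) - ∑ k, drift π lam alpha V k x * pderiv π k W x =
        h⁻¹ * (W (x + cover π (h • b)) - W x -
          h * ∑ k, drift π lam alpha V k x * pderiv π k W x) := by
      rw [mul_sub h⁻¹ (_ - _), inv_mul_cancel_left₀ hh.ne']
    rw [h3, abs_mul, abs_of_pos (inv_pos.2 hh), inv_mul_le_iff₀ hh]
    refine h1.trans ?_
    rw [norm_smul, Real.norm_eq_abs, abs_of_pos hh, mul_pow]
    calc N ^ 2 * C₂ * (h ^ 2 * ‖b‖ ^ 2) ≤ N ^ 2 * C₂ * (h ^ 2 * (C₁ * growth π V x)) := by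
          gcongr
          exact hb x
      _ = _ := by ring
  have t2 : ∀ k, |β⁻¹ * diffusion alpha k * (h ^ 2)⁻¹ * (W (x + cover π (h • unitVec k)) +
      W (x - cover π (h • unitVec k)) - 2 * W x) -
      β⁻¹ * diffusion alpha k * pderiv π k (pderiv π k W) x| ≤
      β⁻¹ * diffusion alpha k * (h * (2 * N ^ 2 * C₃)) := fun k => by
    have h1 := abs_second_difference_le (hWn.of_le three_le_smooth) hV.quot hW3 k x hh.le
    have h3 : ∀ a p q : ℝ, a * (h ^ 2)⁻¹ * p - a * q = a * ((h ^ 2)⁻¹ * (p - h ^ 2 * q)) :=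
      fun a p q => by
        rw [mul_sub (h ^ 2)⁻¹, inv_mul_cancel_left₀ (by positivity)]
        ring
    have h4 : 0 ≤ β⁻¹ * diffusion alpha k := mul_nonneg (by positivity) (hd k)
    rw [h3, abs_mul, abs_of_nonneg h4]
    refine mul_le_mul_of_nonneg_left ?_ h4
    rw [abs_mul, abs_of_pos (by positivity), inv_mul_le_iff₀ (by positivity)]
    refine h1.trans_eq ?_
    ring
  have t3 : |∑ k, β⁻¹ * diffusion alpha k * (h ^ 2)⁻¹ * (W (x + cover π (h • unitVec k)) +
      W (x - cover π (h • unitVec k)) - 2 * W x) - noise π alpha β W x| ≤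
      S * (h * (2 * N ^ 2 * C₃)) := by
    rw [noise, ← Finset.sum_sub_distrib, Finset.sum_mul]
    exact (Finset.abs_sum_le_sum_abs _ _).trans (Finset.sum_le_sum fun k _ => t2 k)
  rw [discreteGenerator, generator, add_sub_add_comm]
  refine (abs_add_le _ _).trans ((add_le_add t1 t3).trans ?_)
  have hg := one_le_growth (π := π) (V := V) x
  have : S * (h * (2 * N ^ 2 * C₃)) * 1 ≤ S * (h * (2 * N ^ 2 * C₃)) * growth π V x := by gcongr
  linarith

/-- Consistency of the discretisation after mollification. -/
lemma exists_mollify_discreteGenerator_sub_le (halpha : ∀ j, 0 < alpha j) {Λ : ℝ}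
    (hΛ : ∀ (x : Phase d m Q) (v : Phase d m (Euc d)),
      ‖driftVec π lam alpha V (x + cover π v) - driftVec π lam alpha V x‖ ≤ Λ * ‖v‖)
    {θ : Phase d m (Euc d) → ℝ} (hθ : IsKernel θ) {K L : ℝ} (hK : 0 ≤ K) (hL : 0 ≤ L) :
    ∃ C, 0 ≤ C ∧ ∀ u : Phase d m Q → ℝ, Continuous u → (∀ x, |u x| ≤ K) →
      (∀ x (v : Phase d m (Euc d)), |u (x + cover π v) - u x| ≤ L * ‖v‖) → ∀ h, 0 < h → ∀ x,
      |mollify π θ (discreteGenerator π lam alpha β V h u) x -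
        generator π lam alpha β V (mollify π θ u) x| ≤
      L * Λ * (∫ y, |θ y| * ‖y‖) + h * (C * growth π V x) := by
  obtain ⟨C, hC0, hC⟩ := hV.exists_discreteGenerator_sub_le (lam := lam) halpha hθ hK
  refine ⟨C, hC0, fun u hu huK huL h hh x => ?_⟩
  rw [hV.mollify_discreteGenerator hθ hu, add_sub_assoc]
  refine (abs_add_le _ _).trans (add_le_add ?_ (hC u hu huK h hh x))
  rw [abs_mul, abs_of_pos (inv_pos.2 hh), inv_mul_le_iff₀ hh]
  have h1 := hθ.abs_integral_mul_le (b := fun y => h * (L * Λ) * ‖y‖)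
    (g := fun y => u (x - cover π y + cover π (h • driftVec π lam alpha V (x - cover π y))) -
        u (x - cover π y + cover π (h • driftVec π lam alpha V x)))
    (continuous_const.mul continuous_norm) fun y => ?_
  · refine h1.trans_eq ?_
    have e : ∀ y, |θ y| * (h * (L * Λ) * ‖y‖) = h * (L * Λ) * (|θ y| * ‖y‖) := fun y => by ring
    simp only [e]
    rw [integral_const_mul]
    ring
  · set z := x - cover π y with hz
    have e : z + cover π (h • driftVec π lam alpha V z) = z + cover π (h • driftVec π lam alpha V x) +
        cover π (h • (driftVec π lam alpha V z - driftVec π lam alpha V x)) := by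
      rw [smul_sub, cover_sub]
      abel
    have e2 : z = x + cover π (-y) := by rw [cover_neg, hz, sub_eq_add_neg]
    have h2 : ‖driftVec π lam alpha V z - driftVec π lam alpha V x‖ ≤ Λ * ‖y‖ := by
      rw [e2, ← norm_neg y]
      exact hΛ x (-y)
    rw [e]
    refine (huL _ _).trans ?_
    rw [norm_smul, Real.norm_eq_abs, abs_of_pos hh]
    calc _ ≤ L * (h * (Λ * ‖y‖)) := by gcongr
      _ = _ := by ring

/-- Approximate solutions of the resolvent equation: the residual is small, and its gradient is
bounded. -/
lemma exists_approx_resolvent (halpha : ∀ j, 0 < alpha j) : ∃ l₀ : ℝ, 0 ≤ l₀ ∧ ∀ l, l₀ < l →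
    ∀ f : Phase d m Q → ℝ, IsCb π f → ∃ C, ∀ ε, 0 < ε → ∃ φ : Phase d m Q → ℝ, IsCb π φ ∧
      (∀ x, |l * φ x - generator π lam alpha β V φ x - f x| ≤ ε * growth π V x) ∧
      ∀ k x, |l * pderiv π k φ x - pderiv π k (generator π lam alpha β V φ) x| ≤
        C * growth π V x := by
  obtain ⟨Λ, hΛ0, hΛ⟩ := hV.exists_driftVec_lipschitz (m := m) (lam := lam) (alpha := alpha)
  obtain ⟨B, hB0, hB⟩ := hV.exists_pderiv_drift_le (m := m) (lam := lam) (alpha := alpha)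
  refine ⟨Λ, hΛ0, fun l hl f hf => ?_⟩
  have hl0 : 0 < l := hΛ0.trans_lt hl
  have hlΛ : 0 < l - Λ := sub_pos.2 hl
  set N := (Fintype.card (Coord d m) : ℝ) with hN
  have hfc := hf.1.continuous hV.quot
  obtain ⟨K, hK⟩ := hf.bounded
  have hK0 : 0 ≤ K := (abs_nonneg _).trans (hK 0)
  choose D hD using fun k => (hf.pderiv k).bounded
  set D' := ∑ k, |D k| with hD'
  have hD'0 : 0 ≤ D' := by positivity
  have hfD : ∀ k x, |pderiv π k f x| ≤ D' := fun k x => (hD k x).trans ((le_abs_self _).trans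
    (Finset.single_le_sum (f := fun k => |D k|) (fun k _ => abs_nonneg _) (Finset.mem_univ k)))
  set ℓ := N * D' with hℓ
  have hℓ0 : 0 ≤ ℓ := by positivity
  have hfℓ : ∀ x (v : Phase d m (Euc d)), |f (x + cover π v) - f x| ≤ ℓ * ‖v‖ := fun x v =>
    hf.1.abs_line_sub_le hV.quot (by simp) hfD x v
  set L := ℓ / (l - Λ) with hL
  have hL0 : 0 ≤ L := by positivity
  obtain ⟨M, hM0, hker⟩ := exists_kernel d m
  refine ⟨ℓ + L * Λ * M + 1 + N * (B * L), fun ε hε => ?_⟩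
  -- The width of the kernel: the mollification errors of `f` and of the transport term then cost at
  -- most `ε / 2` together.
  set ε' := ε / (2 * (ℓ + L * Λ + 1)) with hε'
  have hε'0 : 0 < ε' := by positivity
  obtain ⟨κ, hκ, hκ0, hκ1, hκs, hκM⟩ := hker ε' hε'0
  have hκabs : ∫ y, |κ y| = 1 := by simp only [abs_of_nonneg (hκ0 _), hκ1]
  have hKl : 0 ≤ K / l := by positivity
  obtain ⟨C₀, hC₀, hcons⟩ := hV.exists_mollify_discreteGenerator_sub_le halpha hΛ hκ hKl hL0
  choose C₁ hC₁ hcons₁ using fun k =>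
    hV.exists_mollify_discreteGenerator_sub_le halpha hΛ (hκ.kernelDeriv k) hKl hL0
  -- The step is taken after the kernel, since the consistency constants depend on derivatives of
  -- the kernel but not on the step.
  obtain ⟨h, hh, hh0, hh1⟩ : ∃ h : ℝ, 0 < h ∧ h * C₀ ≤ ε / 2 ∧ ∀ k, h * C₁ k ≤ 1 := by
    set S := C₀ + ∑ k, C₁ k with hS
    have hS1 : ∀ k, C₁ k ≤ S := fun k => (Finset.single_le_sum (f := C₁) (fun k _ => hC₁ k)
      (Finset.mem_univ k)).trans (le_add_of_nonneg_left hC₀)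
    have hS0 : C₀ ≤ S := le_add_of_nonneg_right (Finset.sum_nonneg fun k _ => hC₁ k)
    have hSn : 0 ≤ S := hC₀.trans hS0
    refine ⟨min (ε / 2) 1 / (S + 1), by positivity, ?_, fun k => ?_⟩
    · rw [div_mul_eq_mul_div, div_le_iff₀ (by positivity)]
      exact mul_le_mul (min_le_left _ _) (by linarith) hC₀ (by positivity)
    · rw [div_mul_eq_mul_div, div_le_iff₀ (by positivity)]
      exact mul_le_mul (min_le_right _ _) (by linarith [hS1 k]) (hC₁ k) zero_le_one
  obtain ⟨u, hu, huK, huL, hueq⟩ := hV.exists_discrete_resolvent halpha hΛ0 hΛ hl hfc hK hfℓ hℓ0 hh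
  have hmol : ∀ θ : Phase d m (Euc d) → ℝ, IsKernel θ → ∀ x,
      mollify π θ (discreteGenerator π lam alpha β V h u) x =
        l * mollify π θ u x - mollify π θ f x := fun θ hθ x => by
    have e : ∀ y, θ y * discreteGenerator π lam alpha β V h u (x - cover π y) =
        l * (θ y * u (x - cover π y)) - θ y * f (x - cover π y) := fun y => by
      rw [← hueq]
      ring
    rw [mollify]
    simp only [e]
    rw [integral_sub ((hθ.integrable_mollify hV.quot hu x).const_mul l)
      (hθ.integrable_mollify hV.quot hfc x), integral_const_mul]
    rfl
  have hφ : IsCb π (mollify π κ u) := hκ.isCb_mollify hV.quot hu huK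
  have hlip : ∀ (g : Phase d m Q → ℝ) (L : ℝ), Continuous g → 0 ≤ L →
      (∀ x (v : Phase d m (Euc d)), |g (x + cover π v) - g x| ≤ L * ‖v‖) → ∀ k x,
      |pderiv π k (mollify π κ g) x| ≤ L := by
    intro g L hg hL0 hgL k x
    have hd := (hκ.isCn_mollify hV.quot hg).hasDerivAt_zero hV.quot (by simp) k x
    have := hd.le_of_lip' hL0 (Eventually.of_forall fun s => ?_)
    · simpa using this
    · have h1 := hκ.abs_mollify_sub_le hV.quot hg hgL x (s • unitVec k)
      rw [hκabs, mul_one] at h1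
      simp only [zero_smul, cover_zero, add_zero, sub_zero, Real.norm_eq_abs]
      refine h1.trans (mul_le_mul_of_nonneg_left ?_ hL0)
      rw [norm_smul, Real.norm_eq_abs]
      exact mul_le_of_le_one_right (abs_nonneg _) (norm_unitVec_le k)
  refine ⟨mollify π κ u, hφ, fun x => ?_, fun k x => ?_⟩
  · have hg := one_le_growth (π := π) (V := V) x
    have h1 := hcons u hu huK huL h hh x
    rw [hmol κ hκ] at h1
    have h2 : ∫ y, |κ y| * ‖y‖ ≤ ε' := by
      calc ∫ y, |κ y| * ‖y‖ ≤ ∫ y, κ y * ε' := by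
            refine integral_mono_of_nonneg (Eventually.of_forall fun y => by positivity)
              (hκ.integrable_mul continuous_const) (Eventually.of_forall fun y => ?_)
            simp only [abs_of_nonneg (hκ0 y)]
            by_cases hy : κ y = 0
            · simp [hy]
            · exact mul_le_mul_of_nonneg_left (hκs y hy) (hκ0 y)
        _ = ε' := by rw [integral_mul_const, hκ1, one_mul]
    have h3 : |mollify π κ f x - f x| ≤ ℓ * ε' := by
      have e : mollify π κ f x - f x = ∫ y, κ y * (f (x - cover π y) - f x) := by
        simp only [mul_sub]
        rw [integral_sub (hκ.integrable_mollify hV.quot hfc x)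
          (hκ.integrable_mul continuous_const), integral_mul_const, hκ1, one_mul]
        rfl
      rw [e]
      refine (hκ.abs_integral_mul_le (b := fun y => ℓ * ‖y‖)
        (continuous_const.mul continuous_norm) fun y => ?_).trans ?_
      · have := hfℓ x (-y)
        rwa [cover_neg, ← sub_eq_add_neg, norm_neg] at this
      · have e2 : ∀ y, |κ y| * (ℓ * ‖y‖) = ℓ * (|κ y| * ‖y‖) := fun y => by ring
        simp only [e2]
        rw [integral_const_mul]
        exact mul_le_mul_of_nonneg_left h2 hℓ0
    have h4 : L * Λ * (∫ y, |κ y| * ‖y‖) ≤ L * Λ * ε' :=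
      mul_le_mul_of_nonneg_left h2 (by positivity)
    have h5 : h * (C₀ * growth π V x) ≤ ε / 2 * growth π V x := by
      rw [← mul_assoc]
      exact mul_le_mul_of_nonneg_right hh0 (by linarith)
    have h6 : (ℓ + L * Λ) * ε' ≤ ε / 2 := by
      rw [hε', mul_div_assoc', div_le_iff₀ (by positivity)]
      have : 0 ≤ L * Λ := by positivity
      nlinarith
    have h7 : ε / 2 * 1 ≤ ε / 2 * growth π V x := by gcongr
    have e3 : l * mollify π κ u x - generator π lam alpha β V (mollify π κ u) x - f x =
        (l * mollify π κ u x - mollify π κ f x - generator π lam alpha β V (mollify π κ u) x) +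
        (mollify π κ f x - f x) := by ring
    rw [e3]
    refine (abs_add_le _ _).trans ?_
    linarith
  · have hg := one_le_growth (π := π) (V := V) x
    -- Differentiating amounts to mollifying with `∂_k κ`. The transport error is now bounded
    -- through the first moment `M` of `∂_k κ`, which does not depend on `ε`; so the differentiated
    -- residual stays bounded, although it need not be small.
    have h1 := hcons₁ k u hu huK huL h hh x
    rw [hmol _ (hκ.kernelDeriv k), ← hκ.pderiv_mollify hV.quot hu,
      ← hκ.pderiv_mollify hV.quot hfc] at h1
    have h2 := hlip f ℓ hfc hℓ0 hfℓ k x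
    have h3 : |∑ r, pderiv π k (drift π lam alpha V r) x * pderiv π r (mollify π κ u) x| ≤
        N * (B * L) := by
      refine (Finset.abs_sum_le_sum_abs _ _).trans ?_
      have : ∀ r ∈ Finset.univ, |pderiv π k (drift π lam alpha V r) x *
          pderiv π r (mollify π κ u) x| ≤ B * L := fun r _ => by
        rw [abs_mul]
        exact mul_le_mul (hB k r x) (hlip u L hu hL0 huL r x) (abs_nonneg _) hB0
      refine (Finset.sum_le_sum this).trans_eq ?_
      rw [Finset.sum_const, Finset.card_univ, nsmul_eq_mul]
    have h4 : L * Λ * (∫ y, |kernelDeriv k κ y| * ‖y‖) ≤ L * Λ * M :=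
      mul_le_mul_of_nonneg_left (hκM k) (by positivity)
    have h5 : h * (C₁ k * growth π V x) ≤ 1 * growth π V x := by
      rw [← mul_assoc]
      exact mul_le_mul_of_nonneg_right (hh1 k) (by linarith)
    have h6 : (ℓ + L * Λ * M + N * (B * L)) * 1 ≤
        (ℓ + L * Λ * M + N * (B * L)) * growth π V x := by gcongr
    rw [hV.pderiv_generator hφ]
    rw [abs_le] at h1 h2 h3 ⊢
    constructor <;> linarith

end IsAdmissible

end Consistency

/-! ### Mollification in `L²` and the Meyers–Serrin argument -/

section VolumeMollification

variable {d m : ℕ} {Q : Type} [AddCommGroup Q] [TopologicalSpace Q] [IsTopologicalAddGroup Q]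
  [SecondCountableTopology Q] [T2Space Q] [LocallyCompactSpace Q] [MeasureSpace Q] [BorelSpace Q]
  [(volume : Measure Q).IsAddHaarMeasure] {π : Euc d →+ Q}

open scoped Pointwise

variable {θ : Phase d m (Euc d) → ℝ} {g ψ : Phase d m Q → ℝ}

lemma isTest_mollify (h : IsKernel θ) (hπ : IsOpenQuotientMap π) (hg : Continuous g)
    (hgs : HasCompactSupport g) : IsTest π (mollify π θ g) := by
  refine ⟨h.isCn_mollify hπ hg, HasCompactSupport.intro
    (K := tsupport g + cover π '' tsupport θ) (hgs.isCompact.add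
      (h.compact.isCompact.image (isOpenQuotientMap_cover hπ).continuous)) fun x hx => ?_⟩
  have : ∀ y, θ y * g (x - cover π y) = 0 := fun y => by
    by_contra hy
    rw [mul_eq_zero, not_or] at hy
    exact hx ⟨_, subset_tsupport _ hy.2, _, ⟨y, subset_tsupport _ hy.1, rfl⟩,
      sub_add_cancel _ _⟩
  simp [mollify, this]

lemma isKernel_comp_neg (h : IsKernel θ) : IsKernel fun y => θ (-y) :=
  ⟨h.smooth.comp contDiff_neg, h.compact.comp_homeomorph (Homeomorph.neg _)⟩

lemma kernelDeriv_comp_neg (h : IsKernel θ) (k : Coord d m) :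
    kernelDeriv k (fun y => θ (-y)) = fun y => -kernelDeriv k θ (-y) := by
  ext y
  have h1 : HasFDerivAt (fun y : Phase d m (Euc d) => -y)
      (-ContinuousLinearMap.id ℝ _) y := (hasFDerivAt_id y).neg
  have h2 := ((h.smooth.differentiable (by simp)) (-y)).hasFDerivAt.comp y h1
  have h3 : fderiv ℝ (fun y => θ (-y)) y = _ := h2.fderiv
  rw [kernelDeriv, h3]
  simp [kernelDeriv]

lemma integral_mollify_mul_eq (h : IsKernel θ) (hπ : IsOpenQuotientMap π) (hg : Continuous g)
    (hψ : Continuous ψ) (hψs : HasCompactSupport ψ) :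
    ∫ x, mollify π θ g x * ψ x = ∫ y, θ y * ∫ x, g (x - cover π y) * ψ x := by
  have hc : Continuous (fun x y => θ y * (g (x - cover π y) * ψ x) :
      Phase d m Q → Phase d m (Euc d) → ℝ).uncurry := by
    have := (isOpenQuotientMap_cover (m := m) hπ).continuous
    have := h.smooth.continuous
    simp only [Function.uncurry_def]
    fun_prop
  have hs : HasCompactSupport (fun x y => θ y * (g (x - cover π y) * ψ x) :
      Phase d m Q → Phase d m (Euc d) → ℝ).uncurry := by
    refine HasCompactSupport.intro (hψs.isCompact.prod h.compact.isCompact) fun x hx => ?_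
    by_contra hy
    simp only [Function.uncurry_def, mul_eq_zero, not_or] at hy
    exact hx ⟨subset_tsupport _ hy.2.2, subset_tsupport _ hy.1⟩
  have h1 := integral_integral_swap_of_hasCompactSupport hc hs (μ := volume) (ν := volume)
  simp only [integral_const_mul] at h1
  rw [← h1]
  refine integral_congr_ae (Eventually.of_forall fun x => ?_)
  simp only [mollify]
  rw [← integral_mul_const]
  simp only [mul_assoc]

/-- The adjoint of convolution with a kernel is convolution with the reflected kernel. -/
lemma integral_mollify_mul (h : IsKernel θ) (hπ : IsOpenQuotientMap π) (hg : Continuous g)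
    (hgs : HasCompactSupport g) (hψ : Continuous ψ) (hψs : HasCompactSupport ψ) :
    ∫ x, mollify π θ g x * ψ x = ∫ x, mollify π (fun y => θ (-y)) ψ x * g x := by
  rw [integral_mollify_mul_eq h hπ hg hψ hψs,
    integral_mollify_mul_eq (isKernel_comp_neg h) hπ hψ hg hgs,
    ← integral_neg_eq_self (fun y => θ y * ∫ x, g (x - cover π y) * ψ x)]
  refine integral_congr_ae (Eventually.of_forall fun y => ?_)
  simp only
  congr 1
  rw [← integral_sub_right_eq_self (fun x => g (x - cover π (-y)) * ψ x) (cover π y)]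
  refine integral_congr_ae (Eventually.of_forall fun x => ?_)
  simp only
  rw [show cover π (-y) = -cover π y from Prod.ext (by simp [cover]) rfl, mul_comm]
  simp

/-- Young's convolution inequality `L¹ * L² ⊂ L²`, proved by testing the convolution against itself.
-/
lemma integral_mollify_sq_le (h : IsKernel θ) (hπ : IsOpenQuotientMap π) (hg : Continuous g)
    (hgs : HasCompactSupport g) :
    ∫ x, mollify π θ g x ^ 2 ≤ (∫ y, |θ y|) ^ 2 * ∫ x, g x ^ 2 := by
  set w := mollify π θ g
  have hw := isTest_mollify h hπ hg hgs
  have hwc : Continuous w := (h.isCn_mollify hπ hg).continuous hπ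
  have i1 : Integrable fun x => w x ^ 2 := by
    simp only [sq]
    exact (hwc.mul hwc).integrable_of_hasCompactSupport hw.2.mul_right
  have i2 : Integrable fun x => g x ^ 2 := by
    simp only [sq]
    exact (hg.mul hg).integrable_of_hasCompactSupport hgs.mul_right
  have hP : 0 ≤ ∫ x, g x ^ 2 := integral_nonneg fun x => sq_nonneg _
  have hM : 0 ≤ ∫ y, |θ y| := integral_nonneg fun x => abs_nonneg _
  -- For `s = ∫ |θ|` the last term is half of the left side and can be absorbed; if the kernel has
  -- zero mass, `s = 1` already gives the claim.
  have key : ∀ s : ℝ, 0 < s → ∫ x, w x ^ 2 ≤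
      (∫ y, |θ y|) * (s / 2 * (∫ x, g x ^ 2) + 1 / (2 * s) * ∫ x, w x ^ 2) := fun s hs => by
    have e : ∫ x, w x ^ 2 = ∫ y, θ y * ∫ x, g (x - cover π y) * w x := by
      rw [← integral_mollify_mul_eq h hπ hg hwc hw.2]
      simp only [sq]
      rfl
    conv_lhs => rw [e]
    refine (le_abs_self _).trans ((h.abs_integral_mul_le (b := fun _ =>
      s / 2 * (∫ x, g x ^ 2) + 1 / (2 * s) * ∫ x, w x ^ 2) continuous_const fun y => ?_).trans_eq
      (integral_mul_const _ _))
    have i3 : Integrable fun x => s / 2 * g (x - cover π y) ^ 2 :=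
      (i2.comp_sub_right (cover π y)).const_mul _
    have i4 : Integrable fun x => 1 / (2 * s) * w x ^ 2 := i1.const_mul _
    refine (norm_integral_le_integral_norm fun x => g (x - cover π y) * w x).trans ?_
    refine (integral_mono_of_nonneg (Eventually.of_forall fun x => norm_nonneg _) (i3.add i4)
      (Eventually.of_forall fun x => ?_)).trans_eq ?_
    · simp only [Real.norm_eq_abs, Pi.add_apply, abs_mul]
      rw [← sq_abs (g _), ← sq_abs (w x)]
      have : 0 ≤ 1 / (2 * s) * (s * |g (x - cover π y)| - |w x|) ^ 2 := by positivity
      have e2 : 1 / (2 * s) * (s * |g (x - cover π y)| - |w x|) ^ 2 =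
        s / 2 * |g (x - cover π y)| ^ 2 + 1 / (2 * s) * |w x| ^ 2
          - |g (x - cover π y)| * |w x| := by
        field_simp
        ring
      linarith
    · simp only [Pi.add_apply]
      rw [integral_add i3 i4, integral_const_mul, integral_const_mul,
        integral_sub_right_eq_self (fun x => g x ^ 2)]
  rcases hM.eq_or_lt with h0 | h0
  · have := key 1 one_pos
    rw [← h0] at this ⊢
    simpa using this
  · have := key _ h0
    have e : (∫ y, |θ y|) * ((∫ y, |θ y|) / 2 * (∫ x, g x ^ 2) +
      1 / (2 * (∫ y, |θ y|)) * ∫ x, w x ^ 2) =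
      (∫ y, |θ y|) ^ 2 * (∫ x, g x ^ 2) / 2 + (∫ x, w x ^ 2) / 2 := by
      field_simp
    linarith

/-- Uniform approximation of a continuous function with compact support by mollification. -/
lemma exists_mollify_near (hπ : IsOpenQuotientMap π) (hg : Continuous g)
    (hgs : HasCompactSupport g) : ∃ K : Set (Phase d m Q), IsCompact K ∧ ∀ ε : ℝ, 0 < ε →
      ∃ κ : Phase d m (Euc d) → ℝ, IsKernel κ ∧ (∀ y, 0 ≤ κ y) ∧ ∫ y, κ y = 1 ∧
        (∀ x, |mollify π κ g x - g x| ≤ ε) ∧ ∀ x ∉ K, mollify π κ g x - g x = 0 := by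
  have hcov := (isOpenQuotientMap_cover (m := m) hπ).continuous
  set K := tsupport g + cover π '' (Metric.closedBall (0 : Phase d m (Euc d)) 1) with hKdef
  have hK : IsCompact K := hgs.isCompact.add ((isCompact_closedBall _ _).image hcov)
  refine ⟨K, hK, fun ε hε => ?_⟩
  have h1 : ∀ᶠ v in 𝓝 (0 : Phase d m (Euc d)), ∀ x ∈ K, |g (x - cover π v) - g x| < ε := by
    refine hK.eventually_forall_of_forall_eventually fun x _ => ?_
    have hc : Continuous fun z : Phase d m (Euc d) × Phase d m Q =>
        |g (z.2 - cover π z.1) - g z.2| := by fun_prop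
    refine hc.continuousAt.eventually (gt_mem_nhds ?_)
    have h0 : cover π (0 : Phase d m (Euc d)) = 0 := cover_zero π
    simpa [h0] using hε
  obtain ⟨δ, hδ, hδε⟩ := Metric.eventually_nhds_iff.1 h1
  obtain ⟨C, -, hC⟩ := exists_kernel d m
  obtain ⟨κ, hκ, hκ0, hκ1, hκb, -⟩ := hC (min 1 (δ / 2)) (by positivity)
  have hout : ∀ x ∉ K, ∀ v : Phase d m (Euc d), ‖v‖ ≤ 1 → g (x - cover π v) = 0 :=
    fun x hx v hv => by
      by_contra h
      exact hx ⟨_, subset_tsupport _ h, _, ⟨v, by simpa using hv, rfl⟩, sub_add_cancel _ _⟩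
  have hx0 : ∀ x ∉ K, g x = 0 := fun x hx => by
    have h0 : cover π (0 : Phase d m (Euc d)) = 0 := cover_zero π
    simpa [h0] using hout x hx 0 (by simp)
  refine ⟨κ, hκ, hκ0, hκ1, fun x => ?_, fun x hx => ?_⟩
  · have e : mollify π κ g x - g x = ∫ y, κ y * (g (x - cover π y) - g x) := by
      simp only [mul_sub]
      rw [integral_sub (hκ.integrable_mollify hπ hg x) (hκ.integrable_mul continuous_const),
        integral_mul_const, hκ1, one_mul]
      rfl
    rw [e]
    refine (norm_integral_le_integral_norm fun y => κ y * (g (x - cover π y) - g x)).trans ?_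
    refine (integral_mono_of_nonneg (g := fun y => κ y * ε) (Eventually.of_forall fun y =>
      norm_nonneg _) (hκ.integrable_mul continuous_const) (Eventually.of_forall fun y => ?_)).trans ?_
    · simp only [norm_mul, Real.norm_eq_abs, abs_of_nonneg (hκ0 y)]
      by_cases hy : κ y = 0
      · simp [hy]
      refine mul_le_mul_of_nonneg_left ?_ (hκ0 y)
      have hy1 := hκb y hy
      by_cases hx : x ∈ K
      · refine (hδε (y := y) ?_ x hx).le
        rw [dist_zero_right]
        linarith [min_le_right 1 (δ / 2)]
      · rw [hout x hx y (hy1.trans (min_le_left _ _)), hx0 x hx]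
        simpa using hε.le
    · rw [integral_mul_const, hκ1, one_mul]
  · have : ∀ y, κ y * g (x - cover π y) = 0 := fun y => by
      by_cases hy : κ y = 0
      · simp [hy]
      · rw [hout x hx y ((hκb y hy).trans (min_le_left _ _)), mul_zero]
    simp [mollify, this, hx0 x hx]

lemma exists_integral_mollify_sub_sq_le (hπ : IsOpenQuotientMap π) (hg : Continuous g)
    (hgs : HasCompactSupport g) (ν : Measure (Phase d m Q)) [IsFiniteMeasureOnCompacts ν] {ε : ℝ}
    (hε : 0 < ε) : ∃ κ : Phase d m (Euc d) → ℝ, IsKernel κ ∧ (∀ y, 0 ≤ κ y) ∧ ∫ y, κ y = 1 ∧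
      ∫ x, (mollify π κ g x - g x) ^ 2 ∂ν ≤ ε := by
  obtain ⟨K, hK, h⟩ := exists_mollify_near hπ hg hgs
  set N := ν.real K
  have hN : 0 ≤ N := measureReal_nonneg
  obtain ⟨κ, hκ, hκ0, hκ1, hb, ho⟩ := h (min 1 (ε / (N + 1))) (by positivity)
  refine ⟨κ, hκ, hκ0, hκ1, ?_⟩
  have h1 : ∫ x in K, (mollify π κ g x - g x) ^ 2 ∂ν = ∫ x, (mollify π κ g x - g x) ^ 2 ∂ν :=
    setIntegral_eq_integral_of_forall_compl_eq_zero fun x hx => by rw [ho x hx]; simp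
  rw [← h1]
  have h2 := norm_setIntegral_le_of_norm_le_const (μ := ν) (C := ε / (N + 1))
    (f := fun x => (mollify π κ g x - g x) ^ 2) hK.measure_lt_top fun x _ => by
      rw [Real.norm_eq_abs, abs_pow, sq]
      have h3 := hb x
      have := min_le_left 1 (ε / (N + 1))
      have := min_le_right 1 (ε / (N + 1))
      calc _ ≤ |mollify π κ g x - g x| * 1 :=
            mul_le_mul_of_nonneg_left (by linarith) (abs_nonneg _)
        _ ≤ _ := by linarith
  refine (le_abs_self _).trans (h2.trans ?_)
  change ε / (N + 1) * N ≤ ε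
  rw [div_mul_eq_mul_div, div_le_iff₀ (by positivity)]
  nlinarith

lemma integral_mul_le_of_memLp {X : Type*} [MeasurableSpace X] {μ : Measure X} {f g : X → ℝ}
    (hf : MemLp f 2 μ) (hg : MemLp g 2 μ) {t : ℝ} (ht : 0 < t) :
    |∫ x, f x * g x ∂μ| ≤ t * (∫ x, f x ^ 2 ∂μ) + 1 / (4 * t) * ∫ x, g x ^ 2 ∂μ := by
  have i1 : Integrable (fun x => t * f x ^ 2) μ := hf.integrable_sq.const_mul _
  have i2 : Integrable (fun x => 1 / (4 * t) * g x ^ 2) μ := hg.integrable_sq.const_mul _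
  refine (norm_integral_le_integral_norm fun x => f x * g x).trans ?_
  refine (integral_mono_of_nonneg (Eventually.of_forall fun x => norm_nonneg _) (i1.add i2)
    (Eventually.of_forall fun x => ?_)).trans_eq ?_
  · simp only [Real.norm_eq_abs, Pi.add_apply, abs_mul]
    rw [← sq_abs (f x), ← sq_abs (g x)]
    have : 0 ≤ 1 / (4 * t) * (2 * t * |f x| - |g x|) ^ 2 := by positivity
    have e2 : 1 / (4 * t) * (2 * t * |f x| - |g x|) ^ 2 =
      t * |f x| ^ 2 + 1 / (4 * t) * |g x| ^ 2 - |f x| * |g x| := by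
      field_simp
      ring
    linarith
  · simp only [Pi.add_apply]
    rw [integral_add i1 i2, integral_const_mul, integral_const_mul]

lemma exists_compactSupport_integral_sub_sq_le {ν : Measure (Phase d m Q)} [ν.Regular]
    {U : Phase d m Q → ℝ} (hU : MemLp U 2 ν) {ε : ℝ} (hε : 0 < ε) :
    ∃ g : Phase d m Q → ℝ, Continuous g ∧ HasCompactSupport g ∧ ∫ x, (g x - U x) ^ 2 ∂ν ≤ ε := by
  obtain ⟨g, hg, h, hc, -⟩ := MemLp.exists_hasCompactSupport_integral_rpow_sub_le (μ := ν)
    (p := 2) two_pos (f := U) (by simpa using hU) hε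
  refine ⟨g, hc, hg, le_of_eq_of_le (integral_congr_ae (Eventually.of_forall fun x => ?_)) h⟩
  simp only [Real.norm_eq_abs]
  rw [show (2 : ℝ) = ((2 : ℕ) : ℝ) by norm_num, Real.rpow_natCast, sq_abs]
  ring

lemma integral_add_sq_le {X : Type*} [MeasurableSpace X] {μ : Measure X} {f g : X → ℝ}
    (hf : MemLp f 2 μ) (hg : MemLp g 2 μ) :
    ∫ x, (f x + g x) ^ 2 ∂μ ≤ 2 * (∫ x, f x ^ 2 ∂μ) + 2 * ∫ x, g x ^ 2 ∂μ := by
  have i1 : Integrable (fun x => 2 * f x ^ 2) μ := hf.integrable_sq.const_mul _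
  have i2 : Integrable (fun x => 2 * g x ^ 2) μ := hg.integrable_sq.const_mul _
  refine (integral_mono_of_nonneg (Eventually.of_forall fun x => sq_nonneg _) (i1.add i2)
    (Eventually.of_forall fun x => ?_)).trans_eq ?_
  · simp only [Pi.add_apply]
    nlinarith [sq_nonneg (f x - g x)]
  · simp only [Pi.add_apply]
    rw [integral_add i1 i2, integral_const_mul, integral_const_mul]

instance : (volume : Measure (Phase d m Q)).Regular := by
  have : TopologicalSpace.PseudoMetrizableSpace (Phase d m Q) := inferInstance
  exact Measure.Regular.of_sigmaCompactSpace_of_isLocallyFiniteMeasure _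

lemma memLp_of_isTest (hπ : IsOpenQuotientMap π) {φ : Phase d m Q → ℝ} (h : IsTest π φ)
    (ν : Measure (Phase d m Q)) [IsFiniteMeasureOnCompacts ν] : MemLp φ 2 ν :=
  (h.isCn.continuous hπ).memLp_of_hasCompactSupport h.2

/-- Square integrable functions with square integrable weak gradient are limits of test functions
with bounded gradient. -/
lemma exists_isTest_near (hπ : IsOpenQuotientMap π) {U : Phase d m Q → ℝ}
    {U' : Coord d m → Phase d m Q → ℝ} (hU : MemLp U 2) (hU' : ∀ k, MemLp (U' k) 2)
    (hw : ∀ k φ, IsTest π φ → ∫ x, U x * pderiv π k φ x = -∫ x, U' k x * φ x) :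
    ∃ C : ℝ, ∀ ε : ℝ, 0 < ε → ∃ φ : Phase d m Q → ℝ, IsTest π φ ∧
      ∫ x, (φ x - U x) ^ 2 ≤ ε ∧ ∀ k, ∫ x, pderiv π k φ x ^ 2 ≤ C := by
  refine ⟨∑ k : Coord d m, 2 * ((∫ x, U' k x ^ 2) + 1), fun ε' hε' => ?_⟩
  -- Generous room for the repeated use of `(a + b)² ≤ 2a² + 2b²`.
  obtain ⟨ε, hε, rfl⟩ : ∃ ε : ℝ, 0 < ε ∧ ε' = 20 * ε := ⟨ε' / 20, by positivity, by ring⟩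
  obtain ⟨g₀, hg₀, hg₀s, hg₀ε⟩ := exists_compactSupport_integral_sub_sq_le hU hε
  obtain ⟨κ, hκ, hκ0, hκ1, hκε⟩ := exists_integral_mollify_sub_sq_le hπ hg₀ hg₀s volume hε
  set t : Coord d m → ℝ := fun k => 1 + (∫ y, |kernelDeriv k κ y|) ^ 2 with htdef
  have ht : ∀ k, 0 < t k := fun k => by positivity
  -- The order of choices matters: the kernel is fixed by a first approximation `g₀`, and only then
  -- is `U` approximated by `g`, to an accuracy that compensates the `L¹` norms of the derivatives
  -- of the kernel.
  obtain ⟨g, hg, hgs, hgε⟩ := exists_compactSupport_integral_sub_sq_le hU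
    (ε := min ε (1 / (1 + ∑ k, t k))) (lt_min hε (by
      have := Finset.sum_nonneg fun k (_ : k ∈ Finset.univ) => (ht k).le
      positivity))
  have mg : MemLp g 2 := hg.memLp_of_hasCompactSupport hgs
  have mg₀ : MemLp g₀ 2 := hg₀.memLp_of_hasCompactSupport hg₀s
  have hκabs : ∫ y, |κ y| = 1 := by simp only [abs_of_nonneg (hκ0 _), hκ1]
  have hφ := isTest_mollify hκ hπ hg hgs
  have mφ := memLp_of_isTest hπ hφ volume
  refine ⟨mollify π κ g, hφ, ?_, fun k => ?_⟩
  · have m0 : MemLp (fun x => mollify π κ g₀ x - g₀ x) 2 :=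
      (memLp_of_isTest hπ (isTest_mollify hκ hπ hg₀ hg₀s) volume).sub mg₀
    have m1 : MemLp (fun x => g₀ x - U x) 2 := mg₀.sub hU
    have m2 : MemLp (fun x => mollify π κ (fun x => g x - g₀ x) x) 2 :=
      memLp_of_isTest hπ (isTest_mollify hκ hπ (hg.sub hg₀) (hgs.sub hg₀s)) volume
    have a1 := integral_add_sq_le m2 (m0.add m1)
    have a2 := integral_add_sq_le m0 m1
    have a3 := integral_mollify_sq_le hκ hπ (hg.sub hg₀) (hgs.sub hg₀s)
    have a4 := integral_add_sq_le (f := fun x => g x - U x) (mg.sub hU)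
      (g := fun x => -(g₀ x - U x)) m1.neg
    simp only [Pi.sub_apply, Pi.add_apply, hκabs, one_pow, one_mul, neg_sq] at a1 a3 a4
    have e1 : ∀ x, g x - U x + -(g₀ x - U x) = g x - g₀ x := fun x => by ring
    have e2 : ∀ x, mollify π κ (fun x => g x - g₀ x) x =
        mollify π κ g x - mollify π κ g₀ x := fun x => by
      simp only [mollify, mul_sub]
      exact integral_sub (hκ.integrable_mollify hπ hg x) (hκ.integrable_mollify hπ hg₀ x)
    have e3 : ∀ x, mollify π κ g x - mollify π κ g₀ x +
        (mollify π κ g₀ x - g₀ x + (g₀ x - U x)) = mollify π κ g x - U x := fun x => by ring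
    have a3' : ∫ x, (mollify π κ (fun x => g x - g₀ x) x) ^ 2 ≤ ∫ x, (g x - g₀ x) ^ 2 := a3
    simp only [e1] at a4
    simp only [e2] at a3'
    simp only [e2, e3] at a1
    have := hgε.trans (min_le_left _ _)
    linarith
  · set ψ := pderiv π k (mollify π κ g) with hψdef
    have hψ : IsTest π ψ := hφ.pderiv hπ k
    have hψc := hψ.isCn.continuous hπ
    have mψ := memLp_of_isTest hπ hψ volume
    have hκ' := isKernel_comp_neg hκ
    -- Moving the kernel to the other factor gives `∫ ψ² = -∫ ∂_k χ · g`. Replacing `g` by `U` makes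
    -- an error at most `1 + ¼ ∫ ψ²`, and the weak derivative turns the rest into `∫ U'_k χ`, at
    -- most `∫ U'_k² + ¼ ∫ ψ²`. Absorption leaves `∫ ψ² ≤ 2 (∫ U'_k² + 1)`.
    set χ := mollify π (fun y => κ (-y)) ψ
    have hχ : IsTest π χ := isTest_mollify hκ' hπ hψc hψ.2
    have mχ := memLp_of_isTest hπ hχ volume
    have mχ' := memLp_of_isTest hπ (hχ.pderiv hπ k) volume
    have eχ : pderiv π k χ = mollify π (kernelDeriv k fun y => κ (-y)) ψ :=
      hκ'.pderiv_mollify hπ hψc k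
    have b1 : ∫ x, χ x ^ 2 ≤ ∫ x, ψ x ^ 2 := by
      have := integral_mollify_sq_le hκ' hπ hψc hψ.2
      rwa [integral_neg_eq_self (fun y => |κ y|), hκabs, one_pow, one_mul] at this
    have b2 : ∫ x, pderiv π k χ x ^ 2 ≤ t k * ∫ x, ψ x ^ 2 := by
      have := integral_mollify_sq_le (hκ'.kernelDeriv k) hπ hψc hψ.2
      rw [kernelDeriv_comp_neg hκ] at this
      simp only [abs_neg] at this
      rw [integral_neg_eq_self (fun y => |kernelDeriv k κ y|)] at this
      rw [eχ, kernelDeriv_comp_neg hκ]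
      refine this.trans (mul_le_mul_of_nonneg_right ?_ (integral_nonneg fun x => sq_nonneg _))
      simp only [htdef]
      linarith
    have b3 : ∫ x, ψ x ^ 2 = -∫ x, pderiv π k χ x * g x := by
      rw [eχ, kernelDeriv_comp_neg hκ]
      have e : ∀ x, mollify π (fun y => -kernelDeriv k κ (-y)) ψ x * g x =
          -(mollify π (fun y => kernelDeriv k κ (-y)) ψ x * g x) := fun x => by
        simp [mollify, integral_neg]
      simp only [e]
      rw [integral_neg, neg_neg, ← integral_mollify_mul (hκ.kernelDeriv k) hπ hg hgs hψc hψ.2,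
        ← hκ.pderiv_mollify hπ hg]
      simp only [sq]
      rfl
    have b4 : ∫ x, pderiv π k χ x * g x =
        (∫ x, pderiv π k χ x * (g x - U x)) - ∫ x, U' k x * χ x := by
      have j1 : Integrable fun x => pderiv π k χ x * (g x - U x) := mχ'.integrable_mul (mg.sub hU)
      have j2 : Integrable fun x => U x * pderiv π k χ x := hU.integrable_mul mχ'
      rw [sub_eq_add_neg, ← hw k χ hχ, ← integral_add j1 j2]
      refine integral_congr_ae (Eventually.of_forall fun x => ?_)
      simp only
      ring
    have b5 := integral_mul_le_of_memLp (hU' k) mχ one_pos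
    have b6 := integral_mul_le_of_memLp (f := fun x => g x - U x) (mg.sub hU) mχ' (ht k)
    have b7 : 1 / (4 * t k) * ∫ x, pderiv π k χ x ^ 2 ≤ (∫ x, ψ x ^ 2) / 4 := by
      rw [one_div_mul_eq_div, div_le_div_iff₀ (by linarith [ht k]) (by norm_num)]
      nlinarith
    have b8 : t k * ∫ x, (g x - U x) ^ 2 ≤ 1 := by
      have h1 : t k ≤ ∑ k, t k := Finset.single_le_sum (fun k _ => (ht k).le) (Finset.mem_univ k)
      have h2 := hgε.trans (min_le_right _ _)
      rw [le_div_iff₀ (by linarith [ht k])] at h2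
      have h3 : 0 ≤ ∫ x, (g x - U x) ^ 2 := integral_nonneg fun x => sq_nonneg _
      nlinarith
    have b9 : ∫ x, pderiv π k χ x * (g x - U x) = ∫ x, (g x - U x) * pderiv π k χ x := by
      simp only [mul_comm]
    rw [← b9] at b6
    have c1 := abs_le.1 b5
    have c2 := abs_le.1 b6
    refine le_trans ?_ (Finset.single_le_sum (f := fun k => 2 * ((∫ x, U' k x ^ 2) + 1))
      (fun k _ => mul_nonneg zero_le_two (add_nonneg (integral_nonneg fun x => sq_nonneg _)
        zero_le_one)) (Finset.mem_univ k))
    linarith [c1.2, c2.1]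

end VolumeMollification

/-! ### Generation from a core, and comparison of semigroups -/

section Core

open NormedSpace

variable {X : Type*} [NormedAddCommGroup X] [NormedSpace ℝ X] [CompleteSpace X]
variable {B : X →L[ℝ] X →L[ℝ] ℝ} {c κ : ℝ} {D : Submodule ℝ (X × X)}

/-- Generation of a semigroup by the closure of a dissipative operator with dense domain whose
resolvent equations are solvable up to small errors. -/
theorem exists_semigroup_of_core (hB : IsCoerciveForm B c) (hκ : 0 ≤ κ)
    (hdiss : ∀ p ∈ D, κ * B p.1 p.1 ≤ B p.1 p.2) {l₀ : ℝ} (hl₀ : 0 ≤ l₀)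
    (hrange : ∀ l > l₀, ∀ f : X, ∀ ε > 0, ∃ p ∈ D, ‖l • p.1 + p.2 - f‖ < ε)
    (hdense : ∀ x : X, ∀ ε > 0, ∃ p ∈ D, ‖x - p.1‖ < ε) :
    (∀ l > l₀, ∀ f : X, ∃ p ∈ D.topologicalClosure, l • p.1 + p.2 = f) ∧
    ∃ (T : ℝ → X →L[ℝ] X) (A : ℕ → X →L[ℝ] X),
      IsSemigroupOf T (D.topologicalClosure : Set (X × X)) ∧
      (∀ t, 0 ≤ t → ∀ x, B (T t x) (T t x) ≤ Real.exp (-(2 * κ) * t) * B x x) ∧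
      (∀ n : ℕ, l₀ < n → IsYosida D.topologicalClosure n (A n)) ∧
      ∀ t, 0 ≤ t → ∀ x, Tendsto (fun n => exp (t • A n) x) atTop (𝓝 (T t x)) := by
  have hsub : D ≤ D.topologicalClosure := D.le_topologicalClosure
  have hdiss' : ∀ p ∈ D.topologicalClosure, κ * B p.1 p.1 ≤ B p.1 p.2 := by
    intro p hp
    have hcl : IsClosed {p : X × X | κ * B p.1 p.1 ≤ B p.1 p.2} :=
      isClosed_le (by fun_prop) (by fun_prop)
    exact closure_minimal (fun p hp => hdiss p hp) hcl hp
  have hr : ∀ l > l₀, ∀ f : X, ∃ p ∈ D.topologicalClosure, l • p.1 + p.2 = f := by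
    intro l hl f
    have hl' : 0 < l := hl₀.trans_lt hl
    let Φ : X × X →L[ℝ] X := l • ContinuousLinearMap.fst ℝ X X + ContinuousLinearMap.snd ℝ X X
    have hΦ : ∀ p : X × X, Φ p = l • p.1 + p.2 := fun p => rfl
    set K : ℝ := ‖B‖ / (l * c) with hK
    have hc := hB.pos
    have hK0 : 0 ≤ K := by positivity
    -- An a priori estimate on the closed graph: with the bound on `p.2` below, `l + G` is
    -- antilipschitz there, so its range is closed; being dense, it is everything.
    have h1 : ∀ p ∈ D.topologicalClosure, ‖p.1‖ ≤ K * ‖Φ p‖ := fun p hp => by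
      have h2 : l * B p.1 p.1 ≤ B p.1 (Φ p) := by
        rw [hΦ, map_add, map_smul, smul_eq_mul]
        have := (mul_nonneg hκ (hB.nonneg p.1)).trans (hdiss' p hp)
        linarith
      have h3 := h2.trans (IsCoerciveForm.apply_le B p.1 (Φ p))
      have h4 := hB.le p.1
      rcases (norm_nonneg p.1).eq_or_lt with h0 | h0
      · rw [← h0]
        positivity
      have h5 : l * c * ‖p.1‖ ≤ ‖B‖ * ‖Φ p‖ := by
        refine le_of_mul_le_mul_right ?_ h0
        nlinarith
      rw [hK, div_mul_eq_mul_div, le_div_iff₀ (by positivity)]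
      linarith
    have h2 : ∀ p ∈ D.topologicalClosure, ‖p‖ ≤ (K + (1 + l * K)) * ‖Φ p‖ := fun p hp => by
      have h3 := h1 p hp
      have h4 : ‖p.2‖ ≤ (1 + l * K) * ‖Φ p‖ := by
        have e : p.2 = Φ p - l • p.1 := by rw [hΦ]; abel
        have := norm_sub_le (Φ p) (l • p.1)
        rw [← e, norm_smul, Real.norm_eq_abs, abs_of_pos hl'] at this
        nlinarith
      rw [Prod.norm_def]
      refine max_le ?_ ?_
      · exact h3.trans (mul_le_mul_of_nonneg_right (by nlinarith [mul_nonneg hl'.le hK0])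
          (norm_nonneg _))
      · exact h4.trans (mul_le_mul_of_nonneg_right (by linarith) (norm_nonneg _))
    have : CompleteSpace D.topologicalClosure :=
      D.isClosed_topologicalClosure.completeSpace_coe
    let Ψ : D.topologicalClosure →L[ℝ] X := Φ.comp D.topologicalClosure.subtypeL
    have h3 : AntilipschitzWith (K + (1 + l * K)).toNNReal Ψ :=
      Ψ.antilipschitz_of_bound fun p => by
        rw [Real.coe_toNNReal _ (by positivity)]
        exact h2 p p.2
    have h4 : IsClosed (Set.range Ψ) := h3.isClosed_range Ψ.uniformContinuous
    have h5 : f ∈ closure (Set.range Ψ) := by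
      rw [Metric.mem_closure_iff]
      intro ε hε
      obtain ⟨p, hp, h⟩ := hrange l hl f ε hε
      refine ⟨Ψ ⟨p, hsub hp⟩, ⟨_, rfl⟩, ?_⟩
      rw [dist_comm, dist_eq_norm]
      exact h
    rw [h4.closure_eq] at h5
    obtain ⟨p, hp⟩ := h5
    exact ⟨p, p.2, hp⟩
  exact ⟨hr, exists_semigroup hB hκ hdiss' hl₀ hr fun x ε hε =>
    (hdense x ε hε).imp fun p hp => ⟨hsub hp.1, hp.2⟩⟩

/-- Semigroups with intertwined generators are intertwined. -/
lemma semigroup_intertwine {Y : Type*} [NormedAddCommGroup Y] [NormedSpace ℝ Y] [CompleteSpace Y]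
    (P : X →L[ℝ] Y) {G : Submodule ℝ (X × X)} {G' : Submodule ℝ (Y × Y)} {l₀ l₀' : ℝ}
    (hP : ∀ p ∈ G, (P p.1, P p.2) ∈ G') (hr : ∀ l > l₀, ∀ f : X, ∃ p ∈ G, l • p.1 + p.2 = f)
    {A : ℕ → X →L[ℝ] X} {A' : ℕ → Y →L[ℝ] Y} (hA : ∀ n : ℕ, l₀ < n → IsYosida G n (A n))
    (hA' : ∀ n : ℕ, l₀' < n → IsYosida G' n (A' n)) {t : ℝ} {x y : X} {z : Y}
    (h : Tendsto (fun n => exp (t • A n) x) atTop (𝓝 y))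
    (h' : Tendsto (fun n => exp (t • A' n) (P x)) atTop (𝓝 z)) : P y = z := by
  refine tendsto_nhds_unique ((P.continuous.tendsto y).comp h) (h'.congr' ?_)
  filter_upwards [eventually_gt_atTop ⌈max l₀ l₀'⌉₊] with n hn
  have hn' : max l₀ l₀' < n := (Nat.le_ceil _).trans_lt (by exact_mod_cast hn)
  -- Bounded approximations are intertwined exactly, because the same pair solves both resolvent
  -- equations; the limits inherit this.
  refine (map_exp_smul_of_intertwine P (fun x => ?_) t x).symm
  obtain ⟨p, hp, rfl⟩ := hr n ((le_max_left _ _).trans_lt hn') x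
  have h1 := hA' n ((le_max_right _ _).trans_lt hn') _ (hP p hp)
  rw [hA n ((le_max_left _ _).trans_lt hn') p hp, map_add, map_smul, h1, map_neg, map_smul]

/-- Semigroups fix the kernels of their generators. -/
lemma semigroup_fixed {G : Submodule ℝ (X × X)} {l₀ : ℝ} {A : ℕ → X →L[ℝ] X}
    (hA : ∀ n : ℕ, l₀ < n → IsYosida G n (A n)) {t : ℝ} {x y : X} (hx : (x, 0) ∈ G)
    (h : Tendsto (fun n => exp (t • A n) x) atTop (𝓝 y)) : y = x := by
  refine tendsto_nhds_unique h (tendsto_const_nhds.congr' ?_)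
  filter_upwards [eventually_gt_atTop ⌈max l₀ 0⌉₊] with n hn
  have hn' : max l₀ 0 < n := (Nat.le_ceil _).trans_lt (by exact_mod_cast hn)
  have hn0 : (n : ℝ) ≠ 0 := ((le_max_right _ _).trans_lt hn').ne'
  have h1 := hA n ((le_max_left _ _).trans_lt hn') _ hx
  simp only [add_zero, smul_zero, neg_zero, map_smul, smul_eq_zero, hn0, false_or] at h1
  -- `A n` kills `x`, so `r ↦ r x` intertwines the zero operator with `A n`, and the exponential of
  -- zero is the identity.
  have h2 := map_exp_smul_of_intertwine (ContinuousLinearMap.toSpanSingleton ℝ x) (A := 0)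
    (A' := A n) (fun r => by simp [h1]) t 1
  simpa [exp_zero] using h2

end Core

/-! ### Closedness under bounded approximation in a weaker norm -/

section WeakApproximation

variable {H L : Type*} [NormedAddCommGroup H] [InnerProductSpace ℝ H] [CompleteSpace H]
  [NormedAddCommGroup L] [InnerProductSpace ℝ L] [CompleteSpace L]

/-- Bounded approximation in a weaker norm implies approximation. -/
lemma mem_closure_of_injective (A : H →L[ℝ] L) (hA : ∀ x, A x = 0 → x = 0) (R : Submodule ℝ H)
    {u : H} {C : ℝ} (h : ∀ ε : ℝ, 0 < ε → ∃ r ∈ R, ‖A r - A u‖ ≤ ε ∧ ‖r‖ ≤ C) :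
    u ∈ R.topologicalClosure := by
  rw [← R.orthogonal_orthogonal_eq_closure, Submodule.mem_orthogonal]
  intro e he
  have hC : 0 ≤ C := by
    obtain ⟨r, -, -, h⟩ := h 1 one_pos
    exact (norm_nonneg r).trans h
  have hker : A.kerᗮ = ⊤ := by
    rw [(LinearMap.ker_eq_bot' (f := (A : H →ₗ[ℝ] L))).2 hA, Submodule.bot_orthogonal_eq_top]
  -- An injective operator has an adjoint of dense range, so a vector orthogonal to `R` is
  -- approximated by some `A† g`. Pairings with `A† g` see only the weak norm, and the remainder is
  -- controlled by the uniform bound.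
  have hd : e ∈ (ContinuousLinearMap.adjoint A).range.topologicalClosure := by
    rw [← ContinuousLinearMap.orthogonal_ker, hker]
    trivial
  by_contra hne
  have hpos : 0 < |inner ℝ e u| := abs_pos.2 hne
  set s := |inner ℝ e u|
  obtain ⟨w, ⟨g, rfl⟩, hw⟩ := Metric.mem_closure_iff.1 hd (s / (4 * (‖u‖ + C + 1)))
    (by positivity)
  rw [dist_eq_norm] at hw
  obtain ⟨r, hr, hr1, hr2⟩ := h (s / (4 * (‖g‖ + 1))) (by positivity)
  have e1 : inner ℝ e r = 0 := by
    rw [real_inner_comm]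
    exact (Submodule.mem_orthogonal _ _).1 he r hr
  have e2 : inner ℝ e u = inner ℝ (e - ContinuousLinearMap.adjoint A g) (u - r) +
      inner ℝ g (A u - A r) := by
    rw [← map_sub, ← ContinuousLinearMap.adjoint_inner_left, ← inner_add_left, sub_add_cancel,
      inner_sub_right, e1, sub_zero]
  have b1 : |inner ℝ (e - ContinuousLinearMap.adjoint A g) (u - r)| ≤ s / 4 := by
    refine (abs_real_inner_le_norm _ _).trans ?_
    have h1 : ‖u - r‖ ≤ ‖u‖ + C + 1 := (norm_sub_le _ _).trans (by linarith)
    refine (mul_le_mul hw.le h1 (norm_nonneg _) (by positivity)).trans_eq ?_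
    field_simp
  have b2 : |inner ℝ g (A u - A r)| ≤ s / 4 := by
    refine (abs_real_inner_le_norm _ _).trans ?_
    rw [norm_sub_rev]
    refine (mul_le_mul (by linarith : ‖g‖ ≤ ‖g‖ + 1) hr1 (norm_nonneg _)
      (by positivity)).trans_eq ?_
    field_simp
  have := abs_add_le (inner ℝ (e - ContinuousLinearMap.adjoint A g) (u - r))
    (inner ℝ g (A u - A r))
  rw [← e2] at this
  change s ≤ _ at this
  linarith

/-- Bounded approximation in a norm which is weaker on a closed subspace. -/
lemma mem_closure_of_injOn (A : H →L[ℝ] L) {M : Submodule ℝ H} (hM : IsClosed (M : Set H))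
    (hA : ∀ x ∈ M, A x = 0 → x = 0) {R : Submodule ℝ H} (hR : R ≤ M) {u : H} (hu : u ∈ M) {C : ℝ}
    (h : ∀ ε : ℝ, 0 < ε → ∃ r ∈ R, ‖A r - A u‖ ≤ ε ∧ ‖r‖ ≤ C) :
    u ∈ R.topologicalClosure := by
  have : CompleteSpace M := hM.completeSpace_coe
  have h1 := mem_closure_of_injective (A.comp M.subtypeL) (fun x hx => by
    have := hA x x.2 hx
    exact Subtype.ext this) (R.comap M.subtype) (u := ⟨u, hu⟩) (C := C) fun ε hε => by
      obtain ⟨r, hr, h2, h3⟩ := h ε hε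
      exact ⟨⟨r, hR hr⟩, hr, h2, h3⟩
  have h2 : (R.comap M.subtype).map M.subtype ≤ R := Submodule.map_comap_le _ _
  exact closure_mono (show M.subtype '' (R.comap M.subtype : Set M) ⊆ R from
    fun x ⟨y, hy, e⟩ => e ▸ hy) (image_closure_subset_closure_image M.subtypeL.continuous
      ⟨⟨u, hu⟩, h1, rfl⟩)

end WeakApproximation

/-! ### The weighted Sobolev space as a closed space of jets -/

section Jets

variable {d m : ℕ} {Q : Type} [AddCommGroup Q] [TopologicalSpace Q] [IsTopologicalAddGroup Q]
  [SecondCountableTopology Q] [T2Space Q] [LocallyCompactSpace Q] [MeasureSpace Q] [BorelSpace Q]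
  [(volume : Measure Q).IsAddHaarMeasure] {π : Euc d →+ Q}

variable {β : ℝ} {V : Q → ℝ} {lam alpha : Fin m → ℝ}

open Classical in
/-- The class of a function in `L²_ρ`; it is zero if the function is not square integrable. -/
def lift (β : ℝ) (V : Q → ℝ) (F : Phase d m Q → ℝ) : L2 d m β V :=
  if h : MemLp F 2 (gibbs m β V) then h.toLp F else 0

section Lift

variable {F G : Phase d m Q → ℝ}

lemma coe_lift (h : MemLp F 2 (gibbs m β V)) : lift β V F =ᵐ[gibbs m β V] F := by
  rw [lift, dif_pos h]
  exact h.coeFn_toLp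

/-- Square integrability of `F` is inherited from `f`, so no separate hypothesis is required. -/
lemma eq_lift {f : L2 d m β V} (h : f =ᵐ[gibbs m β V] F) : f = lift β V F :=
  Lp.ext (h.trans (coe_lift ((memLp_congr_ae h).1 (Lp.memLp f))).symm)

lemma lift_coe (f : L2 d m β V) : lift β V (f : Phase d m Q → ℝ) = f :=
  (eq_lift (ae_eq_refl _)).symm

lemma lift_add (hF : MemLp F 2 (gibbs m β V)) (hG : MemLp G 2 (gibbs m β V)) :
    lift β V (fun x => F x + G x) = lift β V F + lift β V G := by
  refine (eq_lift ?_).symm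
  filter_upwards [Lp.coeFn_add (lift β V F) (lift β V G), coe_lift hF, coe_lift hG] with x h1 h2 h3
  rw [h1, Pi.add_apply, h2, h3]

lemma lift_sub (hF : MemLp F 2 (gibbs m β V)) (hG : MemLp G 2 (gibbs m β V)) :
    lift β V (fun x => F x - G x) = lift β V F - lift β V G := by
  refine (eq_lift ?_).symm
  filter_upwards [Lp.coeFn_sub (lift β V F) (lift β V G), coe_lift hF, coe_lift hG] with x h1 h2 h3
  rw [h1, Pi.sub_apply, h2, h3]

lemma lift_const_mul (hF : MemLp F 2 (gibbs m β V)) (c : ℝ) :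
    lift β V (fun x => c * F x) = c • lift β V F := by
  refine (eq_lift ?_).symm
  filter_upwards [Lp.coeFn_smul c (lift β V F), coe_lift hF] with x h1 h2
  rw [h1, Pi.smul_apply, h2, smul_eq_mul]

lemma inner_L2 (f g : L2 d m β V) : inner ℝ f g = ∫ x, f x * g x ∂(gibbs m β V) := by
  rw [L2.inner_def]
  refine integral_congr_ae (Eventually.of_forall fun x => ?_)
  simp [mul_comm]

lemma norm_sq_L2 (f : L2 d m β V) : ‖f‖ ^ 2 = ∫ x, f x ^ 2 ∂(gibbs m β V) := by
  rw [← real_inner_self_eq_norm_sq, inner_L2]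
  simp only [sq]

lemma inner_lift (hF : MemLp F 2 (gibbs m β V)) (f : L2 d m β V) :
    inner ℝ (lift β V F) f = ∫ x, F x * f x ∂(gibbs m β V) := by
  rw [inner_L2]
  exact integral_congr_ae ((coe_lift hF).mono fun x hx => by simp only [hx])

lemma inner_lift_lift (hF : MemLp F 2 (gibbs m β V)) (hG : MemLp G 2 (gibbs m β V)) :
    inner ℝ (lift β V F) (lift β V G) = ∫ x, F x * G x ∂(gibbs m β V) := by
  rw [inner_lift hF]
  exact integral_congr_ae ((coe_lift hG).mono fun x hx => by simp only [hx])

lemma norm_lift_sq (hF : MemLp F 2 (gibbs m β V)) :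
    ‖lift β V F‖ ^ 2 = ∫ x, F x ^ 2 ∂(gibbs m β V) := by
  rw [← real_inner_self_eq_norm_sq, inner_lift_lift hF hF]
  simp only [sq]

lemma norm_lift_sub_sq (hF : MemLp F 2 (gibbs m β V)) (f : L2 d m β V) :
    ‖lift β V F - f‖ ^ 2 = ∫ x, (F x - f x) ^ 2 ∂(gibbs m β V) := by
  conv_lhs => rw [← lift_coe f]
  rw [← lift_sub hF (Lp.memLp f), norm_lift_sq (F := fun x => F x - f x) (hF.sub (Lp.memLp f))]

end Lift

/-- The jet with given components. -/
def mkJet (β : ℝ) (V : Q → ℝ) (U : Phase d m Q → ℝ) (U' : Coord d m → Phase d m Q → ℝ) :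
    Jet d m β V :=
  WithLp.toLp 2 (lift β V U, WithLp.toLp 2 fun k => lift β V (U' k))

/-- The jet of a function. -/
def jet (π : Euc d →+ Q) (β : ℝ) (V : Q → ℝ) (F : Phase d m Q → ℝ) : Jet d m β V :=
  mkJet β V F fun k => pderiv π k F

lemma mkJet_fst (U : Phase d m Q → ℝ) (U' : Coord d m → Phase d m Q → ℝ) :
    (mkJet β V U U').fst = lift β V U := rfl

lemma mkJet_snd (U : Phase d m Q → ℝ) (U' : Coord d m → Phase d m Q → ℝ) (k : Coord d m) :
    (mkJet β V U U').snd k = lift β V (U' k) := rfl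

lemma jet_fst (F : Phase d m Q → ℝ) : (jet π β V F).fst = lift β V F := rfl

lemma jet_snd (F : Phase d m Q → ℝ) (k : Coord d m) :
    (jet π β V F).snd k = lift β V (pderiv π k F) := rfl

lemma jet_ext {u v : Jet d m β V} (h : u.fst = v.fst) (h' : ∀ k, u.snd k = v.snd k) : u = v := by
  refine (WithLp.ofLp_injective 2) (Prod.ext h ?_)
  exact PiLp.ext h'

lemma norm_sq_jet (u : Jet d m β V) : ‖u‖ ^ 2 = ‖u.fst‖ ^ 2 + ∑ k, ‖u.snd k‖ ^ 2 := by
  rw [WithLp.prod_norm_sq_eq_of_L2, PiLp.norm_sq_eq_of_L2]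

/-- The projection of a jet to the function. -/
def fstL (m : ℕ) (β : ℝ) (V : Q → ℝ) : Jet d m β V →L[ℝ] L2 d m β V :=
  WithLp.fstL 2 ℝ _ _

/-- The projection of a jet to a component of the gradient. -/
def sndL (β : ℝ) (V : Q → ℝ) (k : Coord d m) : Jet d m β V →L[ℝ] L2 d m β V :=
  (PiLp.proj 2 (fun _ : Coord d m => L2 d m β V) k).comp (WithLp.sndL 2 ℝ _ _)

lemma fstL_apply (u : Jet d m β V) : fstL m β V u = u.fst := rfl

lemma sndL_apply (k : Coord d m) (u : Jet d m β V) : sndL β V k u = u.snd k := rfl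

namespace IsAdmissible

variable (hV : IsAdmissible π β V)
include hV

lemma isFiniteMeasureOnCompacts_gibbs :
    IsFiniteMeasureOnCompacts (gibbs (d := d) (Q := Q) m β V) := by
  have := hV.isProbabilityMeasure (m := m)
  infer_instance

lemma regular_gibbs : (gibbs (d := d) (Q := Q) m β V).Regular := by
  have := hV.isProbabilityMeasure (m := m)
  have : TopologicalSpace.PseudoMetrizableSpace (Phase d m Q) := inferInstance
  exact Measure.Regular.of_sigmaCompactSpace_of_isLocallyFiniteMeasure _

lemma memLp_of_compact {g : Phase d m Q → ℝ} (hg : Continuous g) (hgs : HasCompactSupport g) :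
    MemLp g 2 (gibbs m β V) :=
  have := hV.isFiniteMeasureOnCompacts_gibbs (m := m)
  hg.memLp_of_hasCompactSupport hgs

lemma memLp_div_dens {g : Phase d m Q → ℝ} (hg : Continuous g) (hgs : HasCompactSupport g) :
    MemLp (fun x => g x / dens β V x) 2 (gibbs m β V) := by
  refine hV.memLp_of_compact (hg.div hV.continuous_dens fun x => (hV.dens_pos x).ne') ?_
  simp only [div_eq_mul_inv]
  exact hgs.mul_right

/-- Integration against a function with compact support as an inner product in `L²_ρ`. -/
lemma integral_mul_eq_inner {g : Phase d m Q → ℝ} (hg : Continuous g) (hgs : HasCompactSupport g)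
    (f : L2 d m β V) :
    ∫ x, f x * g x = inner ℝ (lift β V fun x => g x / dens β V x) f := by
  rw [inner_lift (hV.memLp_div_dens hg hgs), hV.integral_gibbs]
  refine integral_congr_ae (Eventually.of_forall fun x => ?_)
  simp only
  have := (hV.dens_pos x).ne'
  field_simp

/-- Dividing test functions by the density turns integrals over the volume into inner products in
`L²_ρ`, which exhibits the weak derivative condition as linear and closed. -/
lemma mem_H1_iff {u : Jet d m β V} : u ∈ H1 π m β V ↔ ∀ (k : Coord d m) (φ : Phase d m Q → ℝ),
    IsTest π φ → inner ℝ (lift β V fun x => pderiv π k φ x / dens β V x) u.fst +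
      inner ℝ (lift β V fun x => φ x / dens β V x) (u.snd k) = 0 := by
  refine forall_congr' fun k => forall_congr' fun φ => forall_congr' fun hφ => ?_
  have h1 := hφ.pderiv hV.quot k
  rw [hV.integral_mul_eq_inner (h1.isCn.continuous hV.quot) h1.2,
    hV.integral_mul_eq_inner (hφ.isCn.continuous hV.quot) hφ.2, eq_neg_iff_add_eq_zero]

/-- The weighted Sobolev space as a submodule. -/
def sobolev : Submodule ℝ (Jet d m β V) where
  carrier := H1 π m β V
  zero_mem' := by
    rw [hV.mem_H1_iff]
    intro k φ _
    change inner ℝ _ (fstL m β V 0) + inner ℝ _ (sndL β V k 0) = 0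
    simp
  add_mem' := by
    intro u v hu hv
    rw [hV.mem_H1_iff] at hu hv ⊢
    intro k φ hφ
    change inner ℝ _ (fstL m β V (u + v)) + inner ℝ _ (sndL β V k (u + v)) = 0
    have h1 := hu k φ hφ
    have h2 := hv k φ hφ
    rw [← fstL_apply, ← sndL_apply] at h1 h2
    rw [map_add, map_add, inner_add_right, inner_add_right]
    linarith
  smul_mem' := by
    intro c u hu
    rw [hV.mem_H1_iff] at hu ⊢
    intro k φ hφ
    change inner ℝ _ (fstL m β V (c • u)) + inner ℝ _ (sndL β V k (c • u)) = 0
    have h1 := hu k φ hφ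
    rw [← fstL_apply, ← sndL_apply] at h1
    rw [map_smul, map_smul, inner_smul_right, inner_smul_right, ← mul_add, h1, mul_zero]

lemma isClosed_sobolev : IsClosed (hV.sobolev (m := m) : Set (Jet d m β V)) := by
  have : (hV.sobolev (m := m) : Set (Jet d m β V)) = ⋂ (k : Coord d m)
      (φ : {φ : Phase d m Q → ℝ // IsTest π φ}), {u : Jet d m β V |
        inner ℝ (lift β V fun x => pderiv π k φ.1 x / dens β V x) (fstL m β V u) +
        inner ℝ (lift β V fun x => φ.1 x / dens β V x) (sndL β V k u) = 0} := by
    ext u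
    simp only [SetLike.mem_coe, Set.mem_iInter, Set.mem_ofPred_eq, Subtype.forall]
    exact hV.mem_H1_iff
  rw [this]
  exact isClosed_iInter fun k => isClosed_iInter fun φ => isClosed_eq (by fun_prop) (by fun_prop)

lemma mkJet_mem {U : Phase d m Q → ℝ} {U' : Coord d m → Phase d m Q → ℝ}
    (hU : MemLp U 2 (gibbs m β V)) (hU' : ∀ k, MemLp (U' k) 2 (gibbs m β V))
    (h : ∀ (k : Coord d m) (φ : Phase d m Q → ℝ), IsTest π φ →
      ∫ x, U x * pderiv π k φ x = -∫ x, U' k x * φ x) : mkJet β V U U' ∈ H1 π m β V := by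
  intro k φ hφ
  rw [mkJet_fst, mkJet_snd]
  have h1 : ∀ᵐ x, lift β V U x = U x := hV.ac_gibbs.ae_le (coe_lift hU)
  have h2 : ∀ᵐ x, lift β V (U' k) x = U' k x := hV.ac_gibbs.ae_le (coe_lift (hU' k))
  refine (integral_congr_ae (h1.mono fun x hx => by simp only [hx])).trans ((h k φ hφ).trans ?_)
  exact congrArg Neg.neg (integral_congr_ae (h2.mono fun x hx => by simp only [hx]))

/-- Jets of continuously differentiable functions belong to the Sobolev space. -/
lemma jet_mem {F : Phase d m Q → ℝ} (hF : IsCn π 1 F) (h0 : MemLp F 2 (gibbs m β V))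
    (h1 : ∀ k, MemLp (pderiv π k F) 2 (gibbs m β V)) : jet π β V F ∈ H1 π m β V := by
  refine hV.mkJet_mem h0 h1 fun k φ hφ => ?_
  have hφ' := hφ.pderiv hV.quot k
  have cF := hF.continuous hV.quot
  have cF' := hV.continuous_pderiv hF le_rfl k
  have cφ := hφ.isCn.continuous hV.quot
  have cφ' := hφ'.isCn.continuous hV.quot
  have i1 : Integrable fun x => F x * pderiv π k φ x :=
    (cF.mul cφ').integrable_of_hasCompactSupport hφ'.2.mul_left
  have i2 : Integrable fun x => pderiv π k F x * φ x :=
    (cF'.mul cφ).integrable_of_hasCompactSupport hφ.2.mul_left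
  have e : ∀ x, pderiv π k (fun x => F x * φ x) x =
      pderiv π k F x * φ x + F x * pderiv π k φ x := fun x =>
    hF.pderiv_mul (hφ.isCn.of_le (by simp)) hV.quot one_ne_zero k x
  have h2 := integral_pderiv_eq_zero hV.quot (F := fun x => F x * φ x) (k := k)
    (hF.mul (hφ.isCn.of_le (by simp)))
    ((cF.mul cφ).integrable_of_hasCompactSupport hφ.2.mul_left) (by
      rw [funext e]
      exact i2.add i1)
  simp only [e] at h2
  rw [integral_add i2 i1] at h2
  linarith

/-- Test functions divided by the density are dense in `L²_ρ`, and so are test functions. -/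
lemma exists_isTest_lift_near (f : L2 d m β V) {ε : ℝ} (hε : 0 < ε) :
    (∃ φ : Phase d m Q → ℝ, IsTest π φ ∧ ‖lift β V φ - f‖ ≤ ε) ∧
    ∃ φ : Phase d m Q → ℝ, IsTest π φ ∧ ‖lift β V (fun x => φ x / dens β V x) - f‖ ≤ ε := by
  have := hV.regular_gibbs (m := m)
  have := hV.isProbabilityMeasure (m := m)
  obtain ⟨h, hc, hs, hh⟩ := exists_compactSupport_integral_sub_sq_le (Lp.memLp f)
    (ε := (ε / 2) ^ 2) (by positivity)
  have mh := hV.memLp_of_compact hc hs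
  rw [← norm_lift_sub_sq mh] at hh
  have hh' := abs_le_of_sq_le_sq' hh (by positivity)
  -- The Gibbs measure has mass one, so uniform closeness to `h` is closeness in `L²_ρ`.
  have aux : ∀ F : Phase d m Q → ℝ, MemLp F 2 (gibbs m β V) → (∀ x, |F x - h x| ≤ ε / 2) →
      ‖lift β V F - f‖ ≤ ε := fun F hF hb => by
    have h1 : ‖lift β V F - lift β V h‖ ^ 2 ≤ (ε / 2) ^ 2 := by
      rw [← lift_sub hF mh, norm_lift_sq (F := fun x => F x - h x) (hF.sub mh)]
      refine (integral_mono_of_nonneg (Eventually.of_forall fun x => sq_nonneg _)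
        (integrable_const ((ε / 2) ^ 2)) (Eventually.of_forall fun x => ?_)).trans_eq (by simp)
      rw [← sq_abs]
      exact pow_le_pow_left₀ (abs_nonneg _) (hb x) 2
    have h2 := abs_le_of_sq_le_sq' h1 (by positivity)
    have := norm_sub_le_norm_sub_add_norm_sub (lift β V F) (lift β V h) f
    linarith [hh'.2, h2.2]
  constructor
  · obtain ⟨K, -, hK⟩ := exists_mollify_near hV.quot hc hs
    obtain ⟨κ, hκ, -, -, h1, -⟩ := hK (ε / 2) (by positivity)
    have ht := isTest_mollify hκ hV.quot hc hs
    exact ⟨_, ht, aux _ (hV.memLp_of_compact (ht.isCn.continuous hV.quot) ht.2) h1⟩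
  -- The product `ρ h` is mollified rather than `h`. The error is supported in a fixed compact set,
  -- where the density is bounded below, so it can be divided by the density.
  · have hc' : Continuous fun x => dens β V x * h x := hV.continuous_dens.mul hc
    have hs' : HasCompactSupport fun x => dens β V x * h x := hs.mul_left
    obtain ⟨K, hK, hKε⟩ := exists_mollify_near hV.quot hc' hs'
    obtain ⟨δ, hδ, hKδ⟩ : ∃ δ > 0, ∀ x ∈ K, δ ≤ dens β V x := by
      rcases K.eq_empty_or_nonempty with rfl | hne
      · exact ⟨1, one_pos, by simp⟩
      · obtain ⟨x₀, -, h0⟩ := hK.exists_isMinOn hne hV.continuous_dens.continuousOn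
        exact ⟨_, hV.dens_pos x₀, fun x hx => h0 hx⟩
    obtain ⟨κ, hκ, -, -, h1, h2⟩ := hKε (ε / 2 * δ) (by positivity)
    have ht := isTest_mollify hκ hV.quot hc' hs'
    refine ⟨_, ht, aux _ (hV.memLp_div_dens (ht.isCn.continuous hV.quot) ht.2) fun x => ?_⟩
    have hx := hV.dens_pos x
    have e : mollify π κ (fun x => dens β V x * h x) x / dens β V x - h x =
        (mollify π κ (fun x => dens β V x * h x) x - dens β V x * h x) / dens β V x := by
      field_simp
    rw [e]
    by_cases hxK : x ∈ K
    · rw [abs_div, abs_of_pos hx, div_le_iff₀ hx]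
      exact (h1 x).trans (mul_le_mul_of_nonneg_left (hKδ x hxK) (by positivity))
    · rw [h2 x hxK]
      simpa using by positivity

/-- Elements of the Sobolev space are determined by their function. -/
lemma eq_zero_of_fst {u : Jet d m β V} (hu : u ∈ H1 π m β V) (h : u.fst = 0) : u = 0 := by
  refine jet_ext h fun k => ?_
  rw [hV.mem_H1_iff] at hu
  change u.snd k = 0
  by_contra hne
  have hpos := norm_pos_iff.2 hne
  -- A derivative component orthogonal to all `φ / ρ` would be within half its norm of one of them,
  -- which is impossible unless it vanishes.
  obtain ⟨φ, hφ, h1⟩ := (hV.exists_isTest_lift_near (u.snd k) (half_pos hpos)).2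
  have h2 := hu k φ hφ
  rw [h, inner_zero_right, zero_add] at h2
  have h3 : ‖u.snd k‖ ^ 2 =
      -inner ℝ (lift β V (fun x => φ x / dens β V x) - u.snd k) (u.snd k) := by
    rw [inner_sub_left, h2, real_inner_self_eq_norm_sq]
    ring
  have h4 := abs_le.1 (abs_real_inner_le_norm
    (lift β V (fun x => φ x / dens β V x) - u.snd k) (u.snd k))
  nlinarith [h4.1]

end IsAdmissible

end Jets

/-! ### Density of smooth functions in the Sobolev space -/

section Density

variable {d m : ℕ} {Q : Type} [AddCommGroup Q] [TopologicalSpace Q] [IsTopologicalAddGroup Q]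
  [SecondCountableTopology Q] [T2Space Q] [LocallyCompactSpace Q] [MeasureSpace Q] [BorelSpace Q]
  [(volume : Measure Q).IsAddHaarMeasure] {π : Euc d →+ Q}

variable {β : ℝ} {V : Q → ℝ} {lam alpha : Fin m → ℝ}

lemma pderiv_eventuallyEq (hπ : IsOpenQuotientMap π) {F G : Phase d m Q → ℝ} {x : Phase d m Q}
    (h : F =ᶠ[𝓝 x] G) (k : Coord d m) : pderiv π k F =ᶠ[𝓝 x] pderiv π k G := by
  filter_upwards [h.eventually_nhds] with y hy
  have hc : Continuous fun s : ℝ => y + cover π (s • unitVec k) :=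
    continuous_const.add ((isOpenQuotientMap_cover hπ).continuous.comp
      (continuous_id.smul continuous_const))
  have h2 : Tendsto (fun s : ℝ => y + cover π (s • unitVec k)) (𝓝 0) (𝓝 y) := by
    simpa using hc.tendsto 0
  have h3 : (fun s : ℝ => F (y + cover π (s • unitVec k))) =ᶠ[𝓝 0]
      fun s : ℝ => G (y + cover π (s • unitVec k)) := h2.eventually hy
  exact h3.deriv_eq

lemma generator_eq_of_eventuallyEq (hπ : IsOpenQuotientMap π) {F G : Phase d m Q → ℝ}
    {x : Phase d m Q} (h : F =ᶠ[𝓝 x] G) :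
    generator π lam alpha β V F x = generator π lam alpha β V G x := by
  simp only [generator, noise, (pderiv_eventuallyEq hπ h _).self_of_nhds,
    (pderiv_eventuallyEq hπ (pderiv_eventuallyEq hπ h _) _).self_of_nhds]

/-- Continuously differentiable functions of moderate growth. -/
structure IsTameC1 (π : Euc d →+ Q) (V : Q → ℝ) (F : Phase d m Q → ℝ) : Prop where
  isCn : IsCn π 1 F
  tame : IsTame π V F
  tame_pderiv : ∀ k, IsTame π V (pderiv π k F)

/-- Dominated convergence for squares; eventual equality at each point suffices because it is only
applied to cutoffs. -/
lemma tendsto_lift_of_dominated {F : ℕ → Phase d m Q → ℝ} {F₀ G : Phase d m Q → ℝ}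
    (hF : ∀ n, MemLp (F n) 2 (gibbs m β V)) (hF₀ : MemLp F₀ 2 (gibbs m β V))
    (hG : MemLp G 2 (gibbs m β V)) (hb : ∀ n x, |F n x| ≤ G x)
    (hlim : ∀ x, ∀ᶠ n in atTop, F n x = F₀ x) :
    Tendsto (fun n => lift β V (F n)) atTop (𝓝 (lift β V F₀)) := by
  rw [tendsto_iff_norm_sub_tendsto_zero]
  have h1 : Tendsto (fun n => ∫ x, (F n x - F₀ x) ^ 2 ∂(gibbs m β V)) atTop
      (𝓝 (∫ _, 0 ∂(gibbs (d := d) m β V))) := by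
    refine tendsto_integral_of_dominated_convergence (fun x => 4 * G x ^ 2)
      (fun n => ((hF n).sub hF₀).1.pow 2) (hG.integrable_sq.const_mul 4)
      (fun n => Eventually.of_forall fun x => ?_) (Eventually.of_forall fun x => ?_)
    · have h0 : |F₀ x| ≤ G x := by
        obtain ⟨N, hN⟩ := (hlim x).exists
        exact hN ▸ hb N x
      have h2 : |F n x - F₀ x| ≤ 2 * G x := (abs_sub _ _).trans (by linarith [hb n x])
      rw [Real.norm_eq_abs, abs_pow]
      calc _ ≤ (2 * G x) ^ 2 := pow_le_pow_left₀ (abs_nonneg _) h2 2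
        _ = _ := by ring
    · exact tendsto_const_nhds.congr' ((hlim x).mono fun n hn => by simp [hn])
  rw [integral_zero] at h1
  have h2 := h1.sqrt
  rw [Real.sqrt_zero] at h2
  refine h2.congr fun n => ?_
  rw [← lift_sub (hF n) hF₀, ← norm_lift_sq (F := fun x => F n x - F₀ x) ((hF n).sub hF₀),
    Real.sqrt_sq (norm_nonneg _)]

lemma memLp_bounded_mul {μ : Measure (Phase d m Q)} {f g : Phase d m Q → ℝ}
    (hf : MemLp f 2 μ) (hg : Continuous g) {C : ℝ} (hC : ∀ x, |g x| ≤ C) :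
    MemLp (fun x => g x * f x) 2 μ :=
  hf.of_le_mul (c := C) (hg.aestronglyMeasurable.mul hf.1) (Eventually.of_forall fun x => by
    rw [norm_mul]
    exact mul_le_mul_of_nonneg_right (hC x) (norm_nonneg _))

lemma norm_lift_bounded_mul_le (f : L2 d m β V) {g : Phase d m Q → ℝ} (hg : Continuous g) {C : ℝ}
    (hC0 : 0 ≤ C) (hC : ∀ x, |g x| ≤ C) : ‖lift β V fun x => g x * f x‖ ≤ C * ‖f‖ := by
  refine le_of_sq_le_sq ?_ (by positivity)
  rw [norm_lift_sq (memLp_bounded_mul (Lp.memLp f) hg hC), mul_pow, norm_sq_L2,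
    ← integral_const_mul]
  refine integral_mono_of_nonneg (Eventually.of_forall fun x => sq_nonneg _)
    ((Lp.memLp f).integrable_sq.const_mul _) (Eventually.of_forall fun x => ?_)
  simp only [mul_pow]
  refine mul_le_mul_of_nonneg_right ?_ (sq_nonneg _)
  rw [← sq_abs]
  exact pow_le_pow_left₀ (abs_nonneg _) (hC x) 2

namespace IsAdmissible

variable (hV : IsAdmissible π β V)
include hV

lemma isTameC1_of_isCb {φ : Phase d m Q → ℝ} (h : IsCb π φ) : IsTameC1 π V φ :=
  ⟨h.1.of_le (by simp), hV.isTame_of_isCb2 h.isCb2, hV.isTame_pderiv h.isCb2⟩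

lemma isTameC1_generator {φ : Phase d m Q → ℝ} (h : IsCb π φ) :
    IsTameC1 π V (generator π lam alpha β V φ) :=
  ⟨hV.isCn_generator h, hV.isTame_generator h.isCb2, hV.isTame_pderiv_generator h⟩

lemma jet_mem_of_isTameC1 {F : Phase d m Q → ℝ} (h : IsTameC1 π V F) :
    jet π β V F ∈ hV.sobolev (m := m) :=
  hV.jet_mem h.isCn (h.tame.memLp hV) fun k => (h.tame_pderiv k).memLp hV

lemma isTameC1_add_mul {F G : Phase d m Q → ℝ} (hF : IsTameC1 π V F) (hG : IsTameC1 π V G)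
    (a : ℝ) : IsTameC1 π V (fun x => F x + a * G x) ∧
      jet π β V (fun x => F x + a * G x) = jet π β V F + a • jet π β V G := by
  have e : ∀ k, pderiv π k (fun x => F x + a * G x) =
      fun x => pderiv π k F x + a * pderiv π k G x := fun k => by
    ext x
    rw [hF.isCn.pderiv_add ((IsCn.const a).mul hG.isCn) hV.quot one_ne_zero k x,
      IsCn.pderiv_const_mul]
  refine ⟨⟨hF.isCn.add ((IsCn.const a).mul hG.isCn), hF.tame.add (hG.tame.const_mul a),
    fun k => ?_⟩, jet_ext ?_ fun k => ?_⟩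
  · rw [e]
    exact (hF.tame_pderiv k).add ((hG.tame_pderiv k).const_mul a)
  · change lift β V (fun x => F x + a * G x) = lift β V F + a • lift β V G
    rw [lift_add (hF.tame.memLp hV) ((hG.tame.const_mul a).memLp hV),
      lift_const_mul (hG.tame.memLp hV)]
  · change lift β V (pderiv π k fun x => F x + a * G x) =
      lift β V (pderiv π k F) + a • lift β V (pderiv π k G)
    rw [e, lift_add ((hF.tame_pderiv k).memLp hV) (((hG.tame_pderiv k).const_mul a).memLp hV),
      lift_const_mul ((hG.tame_pderiv k).memLp hV)]

/-- The jets of smooth functions with bounded derivatives. -/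
def smoothJets : Submodule ℝ (Jet d m β V) where
  carrier := {u | ∃ φ : Phase d m Q → ℝ, IsCb π φ ∧ jet π β V φ = u}
  zero_mem' := by
    have h0 : IsCb π fun _ : Phase d m Q => (0 : ℝ) := IsCb.const 0
    have h := (hV.isTameC1_add_mul (hV.isTameC1_of_isCb h0) (hV.isTameC1_of_isCb h0) (-1)).2
    refine ⟨_, h0, ?_⟩
    simp only [mul_zero, add_zero] at h
    simpa using h
  add_mem' := by
    rintro _ _ ⟨φ, hφ, rfl⟩ ⟨ψ, hψ, rfl⟩
    refine ⟨_, hφ.add_mul hV.quot hψ 1, ?_⟩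
    rw [(hV.isTameC1_add_mul (hV.isTameC1_of_isCb hφ) (hV.isTameC1_of_isCb hψ) 1).2, one_smul]
  smul_mem' := by
    rintro c _ ⟨φ, hφ, rfl⟩
    refine ⟨_, hφ.add_mul hV.quot hφ (c - 1), ?_⟩
    rw [(hV.isTameC1_add_mul (hV.isTameC1_of_isCb hφ) (hV.isTameC1_of_isCb hφ) (c - 1)).2,
      sub_smul, one_smul]
    abel

lemma smoothJets_le : hV.smoothJets (m := m) ≤ hV.sobolev := by
  rintro _ ⟨φ, hφ, rfl⟩
  exact hV.jet_mem_of_isTameC1 (hV.isTameC1_of_isCb hφ)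

/-- On the support of `g` the density is bounded below, so local integrability for the Gibbs measure
and for the volume agree. -/
lemma integrable_mul_compact {f : Phase d m Q → ℝ} (hf : Integrable f (gibbs m β V))
    {g : Phase d m Q → ℝ} (hg : Continuous g) (hgs : HasCompactSupport g) :
    Integrable fun x => f x * g x := by
  have hc : Continuous fun x => g x / dens β V x :=
    hg.div hV.continuous_dens fun x => (hV.dens_pos x).ne'
  have hcs : HasCompactSupport fun x => g x / dens β V x := by
    simp only [div_eq_mul_inv]
    exact hgs.mul_right
  obtain ⟨C, hC⟩ := hcs.exists_bound_of_continuous hc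
  have h0 : Integrable (fun x => f x * (g x / dens β V x)) (gibbs m β V) :=
    (hf.norm.mul_const C).mono' (hf.1.mul hc.aestronglyMeasurable) (Eventually.of_forall fun x => by
      rw [norm_mul]
      exact mul_le_mul_of_nonneg_left (hC x) (norm_nonneg _))
  refine ((hV.integrable_gibbs_iff (m := m)).1 h0).congr (Eventually.of_forall fun x => ?_)
  have := (hV.dens_pos x).ne'
  simp only
  field_simp

lemma memLp_volume_compact_mul (f : L2 d m β V) {g : Phase d m Q → ℝ} (hg : Continuous g)
    (hgs : HasCompactSupport g) : MemLp (fun x => g x * f x) 2 volume := by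
  have hm : AEStronglyMeasurable f (volume : Measure (Phase d m Q)) :=
    (Lp.memLp f).1.mono_ac hV.ac_gibbs
  refine (memLp_two_iff_integrable_sq (f := fun x => g x * f x)
    (hg.aestronglyMeasurable.mul hm)).2 ?_
  refine (hV.integrable_mul_compact (Lp.memLp f).integrable_sq (g := fun x => g x ^ 2) (hg.pow 2)
    ?_).congr (Eventually.of_forall fun x => ?_)
  · simp only [sq]
    exact hgs.mul_right
  · simp only [mul_pow, mul_comm]

lemma integrable_coe (f : L2 d m β V) : Integrable f (gibbs m β V) :=
  have := hV.isProbabilityMeasure (m := m)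
  (Lp.memLp f).integrable (by norm_num)

lemma exists_norm_lift_sq_le : ∃ D : ℝ, 0 ≤ D ∧ ∀ F : Phase d m Q → ℝ, MemLp F 2 volume →
    MemLp F 2 (gibbs m β V) ∧ ‖lift β V F‖ ^ 2 ≤ D * ∫ x, F x ^ 2 := by
  obtain ⟨D, hD0, hD⟩ := hV.exists_dens_le (m := m)
  refine ⟨D, hD0.le, fun F hF => ?_⟩
  have i1 : Integrable fun x => dens β V x * F x ^ 2 := by
    refine (hF.integrable_sq.const_mul D).mono'
      (hV.continuous_dens.aestronglyMeasurable.mul (hF.1.pow 2)) (Eventually.of_forall fun x => ?_)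
    rw [Real.norm_eq_abs, abs_of_nonneg (mul_nonneg (hV.dens_pos x).le (sq_nonneg _))]
    exact mul_le_mul_of_nonneg_right (hD x) (sq_nonneg _)
  have h1 : MemLp F 2 (gibbs m β V) :=
    (memLp_two_iff_integrable_sq (hF.1.mono_ac hV.gibbs_ac)).2
      ((hV.integrable_gibbs_iff (F := fun x => F x ^ 2)).2 i1)
  refine ⟨h1, ?_⟩
  rw [norm_lift_sq h1, hV.integral_gibbs, ← integral_const_mul]
  exact integral_mono i1 (hF.integrable_sq.const_mul D) fun x =>
    mul_le_mul_of_nonneg_right (hD x) (sq_nonneg _)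

/-- Localised elements of the Sobolev space are limits of jets of smooth functions. -/
lemma mkJet_mul_mem_closure {u : Jet d m β V} (hu : u ∈ H1 π m β V) {χ : Phase d m Q → ℝ}
    (hχ : IsTest π χ) : mkJet β V (fun x => χ x * u.fst x)
      (fun k x => χ x * u.snd k x + pderiv π k χ x * u.fst x) ∈
      (hV.smoothJets (m := m)).topologicalClosure := by
  set U : Phase d m Q → ℝ := fun x => χ x * u.fst x with hU
  set U' : Coord d m → Phase d m Q → ℝ :=
    fun k x => χ x * u.snd k x + pderiv π k χ x * u.fst x with hU'
  have cχ := hχ.isCn.continuous hV.quot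
  have tχ := fun k => hχ.pderiv hV.quot k
  have cχ' := fun k => (tχ k).isCn.continuous hV.quot
  have mU : MemLp U 2 volume := hV.memLp_volume_compact_mul _ cχ hχ.2
  have mU' : ∀ k, MemLp (U' k) 2 volume := fun k =>
    (hV.memLp_volume_compact_mul _ cχ hχ.2).add (hV.memLp_volume_compact_mul _ (cχ' k) (tχ k).2)
  have hw : ∀ k φ, IsTest π φ → ∫ x, U x * pderiv π k φ x = -∫ x, U' k x * φ x := by
    intro k φ hφ
    have cφ := hφ.isCn.continuous hV.quot
    have tφ := hφ.pderiv hV.quot k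
    have cφ' := tφ.isCn.continuous hV.quot
    have h1 := hu k (fun x => χ x * φ x) (hχ.mul_left hφ.isCn)
    have e : ∀ x, pderiv π k (fun x => χ x * φ x) x =
        pderiv π k χ x * φ x + χ x * pderiv π k φ x := fun x =>
      hχ.isCn.pderiv_mul hφ.isCn hV.quot (by simp) k x
    simp only [e] at h1
    have i1 : Integrable fun x => u.fst x * (pderiv π k χ x * φ x) :=
      hV.integrable_mul_compact (hV.integrable_coe _) ((cχ' k).mul cφ) hφ.2.mul_left
    have i2 : Integrable fun x => u.fst x * (χ x * pderiv π k φ x) :=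
      hV.integrable_mul_compact (hV.integrable_coe _) (cχ.mul cφ') tφ.2.mul_left
    have i3 : Integrable fun x => u.snd k x * (χ x * φ x) :=
      hV.integrable_mul_compact (hV.integrable_coe _) (cχ.mul cφ) hφ.2.mul_left
    have e1 : ∀ x, U x * pderiv π k φ x = u.fst x * (χ x * pderiv π k φ x) := fun x => by
      simp only [hU]; ring
    have e2 : ∀ x, U' k x * φ x = u.snd k x * (χ x * φ x) + u.fst x * (pderiv π k χ x * φ x) :=
      fun x => by simp only [hU']; ring
    simp only [mul_add] at h1
    rw [integral_add i1 i2] at h1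
    simp only [e1, e2]
    rw [integral_add i3 i1]
    linarith
  obtain ⟨D, hD0, hD⟩ := hV.exists_norm_lift_sq_le (m := m)
  obtain ⟨C, hC⟩ := exists_isTest_near hV.quot mU mU' hw
  have hmem : mkJet β V U U' ∈ hV.sobolev (m := m) :=
    hV.mkJet_mem (hD _ mU).1 (fun k => (hD _ (mU' k)).1) hw
  -- The Meyers–Serrin approximants converge in `L²` with merely bounded gradients, which is enough
  -- by weak compactness in disguise.
  refine mem_closure_of_injOn (fstL m β V) hV.isClosed_sobolev
    (fun x hx h => hV.eq_zero_of_fst hx h) hV.smoothJets_le hmem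
    (C := √((‖lift β V U‖ + 1) ^ 2 + Fintype.card (Coord d m) * (D * C))) fun ε hε => ?_
  obtain ⟨φ, hφ, h1, h2⟩ := hC ((min ε 1) ^ 2 / (D + 1)) (by positivity)
  have mφ := memLp_of_isTest hV.quot hφ volume
  have hφc := hφ.isCb hV.quot
  have h3 : ‖lift β V φ - lift β V U‖ ≤ min ε 1 := by
    rw [← lift_sub (hD _ mφ).1 (hD _ mU).1]
    refine le_of_sq_le_sq (((hD _ (mφ.sub mU)).2.trans
      (mul_le_mul_of_nonneg_left h1 hD0)).trans ?_) (by positivity)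
    rw [mul_div_assoc', div_le_iff₀ (by positivity)]
    nlinarith [sq_nonneg (min ε 1)]
  refine ⟨_, ⟨φ, hφc, rfl⟩, h3.trans (min_le_left _ _), Real.le_sqrt_of_sq_le ?_⟩
  rw [norm_sq_jet, jet_fst]
  have h4 : ‖lift β V φ‖ ≤ ‖lift β V U‖ + 1 := by
    have := norm_le_insert' (lift β V φ) (lift β V U)
    linarith [min_le_right ε 1]
  refine add_le_add (pow_le_pow_left₀ (norm_nonneg _) h4 2) ?_
  refine (Finset.sum_le_card_nsmul _ _ (D * C) fun k _ => ?_).trans_eq (by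
    rw [nsmul_eq_mul, Finset.card_univ])
  exact (hD _ (memLp_of_isTest hV.quot (hφ.pderiv hV.quot k) volume)).2.trans
    (mul_le_mul_of_nonneg_left (h2 k) hD0)

/-- Jets of smooth functions are dense in the Sobolev space. -/
lemma sobolev_le_closure : hV.sobolev (m := m) ≤ hV.smoothJets.topologicalClosure := by
  intro u hu
  obtain ⟨χ, C, hC0, hχ, hχ1⟩ := hV.exists_cutoff (m := m)
  have cχ := fun n => (hχ n).1.isCn.continuous hV.quot
  have cχ' := fun n k => ((hχ n).1.pderiv hV.quot k).isCn.continuous hV.quot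
  have hle : hV.smoothJets (m := m) |>.topologicalClosure |> (· ≤ hV.sobolev) :=
    Submodule.topologicalClosure_minimal _ hV.smoothJets_le hV.isClosed_sobolev
  have hlim : Tendsto (fun n => lift β V fun x => χ n x * u.fst x) atTop (𝓝 u.fst) := by
    have := tendsto_lift_of_dominated (F := fun n x => χ n x * u.fst x) (F₀ := u.fst)
      (G := fun x => |u.fst x|)
      (fun n => memLp_bounded_mul (Lp.memLp _) (cχ n) (hχ n).2.1) (Lp.memLp _) (Lp.memLp _).abs
      (fun n x => by
        rw [abs_mul]
        exact mul_le_of_le_one_left (abs_nonneg _) ((hχ n).2.1 x))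
      (fun x => (hχ1 x).mono fun n hn => by simp only [hn.self_of_nhds, one_mul])
    rwa [lift_coe] at this
  -- Cutoffs of `u` converge in `L²_ρ` and remain bounded in `H¹_ρ`; convergence of the gradients
  -- never has to be checked.
  have key := mem_closure_of_injOn (fstL m β V) hV.isClosed_sobolev
    (fun x hx h => hV.eq_zero_of_fst hx h) hle hu
    (C := √(‖u.fst‖ ^ 2 + ∑ k, (‖u.snd k‖ + C * ‖u.fst‖) ^ 2)) fun ε hε => by
      obtain ⟨n, hn⟩ := ((tendsto_iff_norm_sub_tendsto_zero.1 hlim).eventually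
        (gt_mem_nhds hε)).exists
      refine ⟨_, hV.mkJet_mul_mem_closure hu (hχ n).1, hn.le, Real.le_sqrt_of_sq_le ?_⟩
      rw [norm_sq_jet]
      refine add_le_add (pow_le_pow_left₀ (norm_nonneg _) ?_ 2)
        (Finset.sum_le_sum fun k _ => pow_le_pow_left₀ (norm_nonneg _) ?_ 2)
      · have := norm_lift_bounded_mul_le u.fst (cχ n) zero_le_one (hχ n).2.1
        rwa [one_mul] at this
      · rw [mkJet_snd, lift_add (memLp_bounded_mul (Lp.memLp _) (cχ n) (hχ n).2.1)
          (memLp_bounded_mul (Lp.memLp _) (cχ' n k) ((hχ n).2.2.1 k))]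
        refine (norm_add_le _ _).trans (add_le_add ?_
          (norm_lift_bounded_mul_le u.fst (cχ' n k) hC0.le ((hχ n).2.2.1 k)))
        have := norm_lift_bounded_mul_le (u.snd k) (cχ n) zero_le_one (hχ n).2.1
        rwa [one_mul] at this
  rwa [(Submodule.isClosed_topologicalClosure _).submodule_topologicalClosure_eq] at key

end IsAdmissible

end Density

/-! ### The graph of `𝓛`, enlarged cores and approximate resolvents -/

section SemigroupL2

variable {d m : ℕ} {Q : Type} [AddCommGroup Q] [TopologicalSpace Q] [IsTopologicalAddGroup Q]
  [SecondCountableTopology Q] [T2Space Q] [LocallyCompactSpace Q] [MeasureSpace Q] [BorelSpace Q]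
  [(volume : Measure Q).IsAddHaarMeasure] {π : Euc d →+ Q}

variable {β : ℝ} {V : Q → ℝ} {lam alpha : Fin m → ℝ}

lemma generator_add_mul (hπ : IsOpenQuotientMap π) {φ ψ : Phase d m Q → ℝ} (hφ : IsCb π φ)
    (hψ : IsCb π ψ) (a : ℝ) (x : Phase d m Q) :
    generator π lam alpha β V (fun x => φ x + a * ψ x) x =
      generator π lam alpha β V φ x + a * generator π lam alpha β V ψ x := by
  have e : ∀ (k : Coord d m) {φ ψ : Phase d m Q → ℝ}, IsCb π φ → IsCb π ψ →
      pderiv π k (fun x => φ x + a * ψ x) = fun x => pderiv π k φ x + a * pderiv π k ψ x :=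
    fun k {φ ψ} hφ hψ => by
      ext x
      rw [IsCn.pderiv_add hφ.1 ((IsCn.const a).mul hψ.1) hπ (by simp) k x, IsCn.pderiv_const_mul]
  simp only [generator, noise, e _ hφ hψ, e _ (hφ.pderiv _) (hψ.pderiv _), mul_add,
    Finset.sum_add_distrib, Finset.mul_sum]
  simp only [mul_left_comm a]
  ring

lemma generator_const (c : ℝ) (x : Phase d m Q) :
    generator π lam alpha β V (fun _ => c) x = 0 := by
  have e : ∀ (c : ℝ) (k : Coord d m), pderiv π k (fun _ : Phase d m Q => c) = fun _ => 0 :=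
    fun c k => funext fun x => IsCn.pderiv_const c k x
  simp [generator, noise, e]

namespace IsAdmissible

variable (hV : IsAdmissible π β V)
include hV

/-- A dominating function for the generator on truncated functions, uniform in the truncation.
Second derivatives of the cutoff matter only in directions where the diffusion is nonzero. -/
lemma exists_cutoff_generator_le {φ : Phase d m Q → ℝ} (hφ : IsCb π φ)
    {χ : ℕ → Phase d m Q → ℝ} {C : ℝ} (hχ : ∀ n, IsTest π (χ n) ∧ (∀ x, |χ n x| ≤ 1) ∧
      (∀ k x, |pderiv π k (χ n) x| ≤ C) ∧ ∀ (k : Fin d ⊕ Fin m × Fin d) x,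
        |pderiv π (Sum.inr k) (pderiv π (Sum.inr k) (χ n)) x| ≤ C) :
    ∃ K, ∀ n x, |generator π lam alpha β V (fun x => χ n x * φ x) x| ≤ K * growth π V x := by
  obtain ⟨K₁, hK₁⟩ := (hV.isTame_generator (lam := lam) (alpha := alpha) hφ.isCb2).2
  obtain ⟨K₂, hK₂⟩ := hφ.bounded
  choose D hD using fun k => (hV.isTame_drift (lam := lam) (alpha := alpha) k).2
  choose E hE using fun k => (hφ.pderiv k).bounded
  set S : ℝ := ∑ k : Coord d m, (D k * C + |β⁻¹ * diffusion alpha k| * C)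
  refine ⟨K₁ + K₂ * S + |2 * β⁻¹| * ∑ k : Coord d m, |diffusion alpha k| * (C * E k),
    fun n x => ?_⟩
  obtain ⟨ht, h0, h1, h2⟩ := hχ n
  have hg := one_le_growth (π := π) (V := V) x
  have hg0 : 0 ≤ growth π V x := zero_le_one.trans hg
  have hC0 : ∀ k : Coord d m, 0 ≤ C := fun k => (abs_nonneg _).trans (h1 k x)
  have hS : |generator π lam alpha β V (χ n) x| ≤ S * growth π V x := by
    rw [generator, noise, ← Finset.sum_add_distrib, Finset.sum_mul]
    refine (Finset.abs_sum_le_sum_abs _ _).trans (Finset.sum_le_sum fun k _ => ?_)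
    rw [_root_.add_mul]
    refine (abs_add_le _ _).trans (add_le_add ?_ ?_)
    · rw [abs_mul]
      calc _ ≤ (D k * growth π V x) * C :=
            mul_le_mul (hD k x) (h1 k x) (abs_nonneg _) ((abs_nonneg _).trans (hD k x))
        _ = _ := by ring
    · rw [abs_mul]
      rcases k with i | k
      · simp [diffusion]
      · calc _ ≤ |β⁻¹ * diffusion alpha (Sum.inr k)| * C :=
              mul_le_mul_of_nonneg_left (h2 k x) (abs_nonneg _)
          _ ≤ _ := le_mul_of_one_le_right (mul_nonneg (abs_nonneg _) (hC0 (Sum.inr k))) hg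
  rw [hV.generator_mul (ht.isCb hV.quot).isCb2 hφ.isCb2]
  have b1 : |χ n x * generator π lam alpha β V φ x| ≤ K₁ * growth π V x := by
    rw [abs_mul]
    exact (mul_le_of_le_one_left (abs_nonneg _) (h0 x)).trans (hK₁ x)
  have b2 : |φ x * generator π lam alpha β V (χ n) x| ≤ K₂ * S * growth π V x := by
    rw [abs_mul, mul_assoc]
    exact mul_le_mul (hK₂ x) hS (abs_nonneg _) ((abs_nonneg _).trans (hK₂ x))
  have b3 : |2 * β⁻¹ * ∑ k, diffusion alpha k * (pderiv π k (χ n) x * pderiv π k φ x)| ≤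
      (|2 * β⁻¹| * ∑ k : Coord d m, |diffusion alpha k| * (C * E k)) * growth π V x := by
    have h3 : |∑ k, diffusion alpha k * (pderiv π k (χ n) x * pderiv π k φ x)| ≤
        ∑ k : Coord d m, |diffusion alpha k| * (C * E k) := by
      refine (Finset.abs_sum_le_sum_abs _ _).trans (Finset.sum_le_sum fun k _ => ?_)
      rw [abs_mul, abs_mul]
      exact mul_le_mul_of_nonneg_left (mul_le_mul (h1 k x) (hE k x) (abs_nonneg _) (hC0 k))
        (abs_nonneg _)
    rw [abs_mul]
    have h4 := mul_le_mul_of_nonneg_left h3 (abs_nonneg (2 * β⁻¹))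
    exact h4.trans (le_mul_of_one_le_right ((mul_nonneg (abs_nonneg _) (abs_nonneg _)).trans h4) hg)
  refine ((abs_add_le _ _).trans (add_le_add ((abs_add_le _ _).trans (add_le_add b1 b2)) b3)).trans_eq
    (by ring)

/-- The smooth functions with bounded derivatives belong to the domain of `𝓛`. -/
lemma mem_closedGraph {φ : Phase d m Q → ℝ} (hφ : IsCb π φ) :
    (lift β V φ, lift β V (operator π lam alpha β V φ)) ∈ closedGraph π lam alpha β V := by
  obtain ⟨χ, C, hC0, hχ, hχ1⟩ := hV.exists_cutoff (m := m)
  obtain ⟨K, hK⟩ := hV.exists_cutoff_generator_le (lam := lam) (alpha := alpha) hφ hχ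
  obtain ⟨K', hK'⟩ := hφ.bounded
  have ht : ∀ n, IsTest π fun x => χ n x * φ x := fun n => (hχ n).1.mul_left hφ.1
  have tφ := (hV.isTameC1_of_isCb hφ).tame
  have tG := (hV.isTameC1_generator (lam := lam) (alpha := alpha) hφ).tame
  have tχ := fun n => (hV.isTameC1_of_isCb ((ht n).isCb hV.quot)).tame
  have tχG := fun n => (hV.isTameC1_generator (lam := lam) (alpha := alpha)
    ((ht n).isCb hV.quot)).tame
  have tg : IsTame π V fun x : Phase d m Q => K * growth π V x :=
    IsTame.const_mul ⟨hV.continuous_growth, 1, fun x => by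
      rw [one_mul, abs_of_nonneg (zero_le_one.trans (one_le_growth x))]⟩ K
  have l1 : Tendsto (fun n => lift β V fun x => χ n x * φ x) atTop (𝓝 (lift β V φ)) :=
    tendsto_lift_of_dominated (G := fun _ => K') (fun n => (tχ n).memLp hV) (tφ.memLp hV)
      ((IsTame.of_bounded continuous_const ⟨|K'|, fun _ => le_rfl⟩).memLp hV)
      (fun n x => by
        rw [abs_mul]
        exact (mul_le_of_le_one_left (abs_nonneg _) ((hχ n).2.1 x)).trans (hK' x))
      fun x => (hχ1 x).mono fun n hn => by simp only [hn.self_of_nhds, one_mul]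
  have l2 : Tendsto (fun n => lift β V (operator π lam alpha β V fun x => χ n x * φ x)) atTop
      (𝓝 (lift β V (operator π lam alpha β V φ))) := by
    simp only [operator_eq_neg]
    refine tendsto_lift_of_dominated (G := fun x => K * growth π V x)
      (fun n => (tχG n).neg.memLp hV) (tG.neg.memLp hV) (tg.memLp hV)
      (fun n x => by rw [abs_neg]; exact hK n x) fun x => (hχ1 x).mono fun n hn => ?_
    rw [generator_eq_of_eventuallyEq hV.quot
      (hn.mono fun y hy => by simp only [hy, one_mul] : (fun x => χ n x * φ x) =ᶠ[𝓝 x] φ)]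
  refine mem_closure_of_tendsto (l1.prodMk_nhds l2) (Eventually.of_forall fun n => ?_)
  refine ⟨_, ht n, coe_lift ((tχ n).memLp hV), coe_lift ?_⟩
  rw [operator_eq_neg]
  exact (tχG n).neg.memLp hV

/-- The graph of `𝓛` on smooth functions with bounded derivatives, in terms of jets. -/
def jetCore (lam alpha : Fin m → ℝ) : Submodule ℝ (Jet d m β V × Jet d m β V) where
  carrier := {p | ∃ φ : Phase d m Q → ℝ, IsCb π φ ∧
    (jet π β V φ, -jet π β V (generator π lam alpha β V φ)) = p}
  zero_mem' := by
    have h0 : IsCb π fun _ : Phase d m Q => (0 : ℝ) := IsCb.const 0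
    have t0 := hV.isTameC1_of_isCb h0
    have h := (hV.isTameC1_add_mul t0 t0 (-1)).2
    simp only [mul_zero, add_zero] at h
    refine ⟨_, h0, ?_⟩
    rw [show generator π lam alpha β V (fun _ : Phase d m Q => (0 : ℝ)) = fun _ => 0 from
      funext fun x => generator_const 0 x, h]
    simp
  add_mem' := by
    rintro _ _ ⟨φ, hφ, rfl⟩ ⟨ψ, hψ, rfl⟩
    refine ⟨_, hφ.add_mul hV.quot hψ 1, ?_⟩
    rw [show generator π lam alpha β V (fun x => φ x + 1 * ψ x) = _ from
      funext fun x => generator_add_mul hV.quot hφ hψ 1 x,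
      (hV.isTameC1_add_mul (hV.isTameC1_of_isCb hφ) (hV.isTameC1_of_isCb hψ) 1).2,
      (hV.isTameC1_add_mul (hV.isTameC1_generator hφ) (hV.isTameC1_generator hψ) 1).2,
      one_smul, one_smul, neg_add]
    rfl
  smul_mem' := by
    rintro c _ ⟨φ, hφ, rfl⟩
    refine ⟨_, hφ.add_mul hV.quot hφ (c - 1), ?_⟩
    have e : ∀ u : Jet d m β V, u + (c - 1) • u = c • u := fun u => by
      rw [sub_smul, one_smul]
      abel
    rw [show generator π lam alpha β V (fun x => φ x + (c - 1) * φ x) = _ from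
      funext fun x => generator_add_mul hV.quot hφ hφ (c - 1) x,
      (hV.isTameC1_add_mul (hV.isTameC1_of_isCb hφ) (hV.isTameC1_of_isCb hφ) _).2,
      (hV.isTameC1_add_mul (hV.isTameC1_generator hφ) (hV.isTameC1_generator hφ) _).2,
      e, e, ← smul_neg]
    rfl

/-- The graph of `𝓛` on smooth functions with bounded derivatives. -/
def core (lam alpha : Fin m → ℝ) : Submodule ℝ (L2 d m β V × L2 d m β V) :=
  (hV.jetCore lam alpha).map
    ((fstL (d := d) m β V).prodMap (fstL (d := d) m β V)).toLinearMap

lemma mem_core {p : L2 d m β V × L2 d m β V} : p ∈ hV.core lam alpha ↔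
    ∃ φ : Phase d m Q → ℝ, IsCb π φ ∧
      (lift β V φ, -lift β V (generator π lam alpha β V φ)) = p := by
  constructor
  · rintro ⟨_, ⟨φ, hφ, rfl⟩, rfl⟩
    refine ⟨φ, hφ, Prod.ext rfl ?_⟩
    exact (map_neg (fstL m β V) (jet π β V (generator π lam alpha β V φ))).symm
  · rintro ⟨φ, hφ, rfl⟩
    refine ⟨_, ⟨φ, hφ, rfl⟩, Prod.ext rfl ?_⟩
    exact map_neg (fstL m β V) (jet π β V (generator π lam alpha β V φ))

lemma lift_operator {φ : Phase d m Q → ℝ} (hφ : IsCb π φ) :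
    lift β V (operator π lam alpha β V φ) = -lift β V (generator π lam alpha β V φ) := by
  rw [operator_eq_neg]
  have h := (hV.isTameC1_generator (lam := lam) (alpha := alpha) hφ).tame.memLp hV
  have := lift_const_mul h (-1)
  simpa using this

/-- Enlarging test functions to bounded smooth functions does not change the closure. The larger
core contains the constants and the mollified solutions of the scheme. -/
lemma closure_core : ((hV.core lam alpha).topologicalClosure : Set (L2 d m β V × L2 d m β V)) =
    closedGraph π lam alpha β V := by
  refine Set.Subset.antisymm (closure_minimal ?_ isClosed_closure) (closure_mono ?_)
  · intro p hp
    obtain ⟨φ, hφ, rfl⟩ := hV.mem_core.1 hp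
    rw [← hV.lift_operator hφ]
    exact hV.mem_closedGraph hφ
  · rintro ⟨f, g⟩ ⟨φ, hφ, h1, h2⟩
    refine hV.mem_core.2 ⟨φ, hφ.isCb hV.quot, ?_⟩
    rw [← hV.lift_operator (hφ.isCb hV.quot)]
    exact Prod.ext (eq_lift h1).symm (eq_lift h2).symm

lemma mem_kernel_iff {f : L2 d m β V} : f ∈ kernel π lam alpha β V ↔
    (f, 0) ∈ (hV.core lam alpha).topologicalClosure := by
  rw [← SetLike.mem_coe, hV.closure_core]
  rfl

lemma integral_mul_generator_self {φ : Phase d m Q → ℝ} (hφ : IsCb π φ) :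
    ∫ x, φ x * generator π lam alpha β V φ x ∂(gibbs m β V) =
      -(β⁻¹ * ∑ k, diffusion alpha k * ∫ x, pderiv π k φ x ^ 2 ∂(gibbs m β V)) := by
  have := hV.integral_mul_generator (lam := lam) (alpha := alpha) hφ.isCb2 hφ.isCb2
  simp only [← sq] at this
  linarith

/-- The resolvent equation is solvable up to small errors. -/
lemma exists_near_resolvent {l : ℝ} {f : Phase d m Q → ℝ} (hf : IsCb π f)
    (h : ∃ C, ∀ ε, 0 < ε → ∃ φ : Phase d m Q → ℝ, IsCb π φ ∧
      (∀ x, |l * φ x - generator π lam alpha β V φ x - f x| ≤ ε * growth π V x) ∧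
      ∀ k x, |l * pderiv π k φ x - pderiv π k (generator π lam alpha β V φ) x| ≤
        C * growth π V x) :
    ∃ C, ∀ ε, 0 < ε → ∃ φ : Phase d m Q → ℝ, IsCb π φ ∧
      ‖l • lift β V φ - lift β V (generator π lam alpha β V φ) - lift β V f‖ ≤ ε ∧
      ‖l • jet π β V φ - jet π β V (generator π lam alpha β V φ)‖ ≤ C := by
  have hg : MemLp (fun x : Phase d m Q => growth π V x) 2 (gibbs m β V) :=
    hV.memLp_of_le hV.continuous_growth (C := 1) fun x => by
      rw [one_mul, abs_of_nonneg (zero_le_one.trans (one_le_growth x))]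
  set N : ℝ := ‖lift β V fun x : Phase d m Q => growth π V x‖ with hN
  have hN0 : 0 ≤ N := norm_nonneg _
  have aux : ∀ {F : Phase d m Q → ℝ} {K : ℝ}, MemLp F 2 (gibbs m β V) →
      (∀ x, |F x| ≤ K * growth π V x) → ‖lift β V F‖ ^ 2 ≤ (K * N) ^ 2 := fun {F K} hF hK => by
    rw [norm_lift_sq hF, mul_pow, hN, norm_lift_sq hg, ← integral_const_mul]
    refine integral_mono_of_nonneg (Eventually.of_forall fun x => sq_nonneg _)
      (hg.integrable_sq.const_mul _) (Eventually.of_forall fun x => ?_)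
    simp only
    rw [← sq_abs, ← mul_pow]
    exact pow_le_pow_left₀ (abs_nonneg _) (hK x) 2
  obtain ⟨C, hC⟩ := h
  refine ⟨√((N + ‖lift β V f‖) ^ 2 + ∑ _k : Coord d m, (C * N) ^ 2), fun ε hε => ?_⟩
  -- The cap `1` keeps the function part of the jet bounded uniformly in `ε`.
  obtain ⟨φ, hφ, h1, h2⟩ := hC (min 1 (ε / (N + 1))) (by positivity)
  have tφ := hV.isTameC1_of_isCb hφ
  have tG := hV.isTameC1_generator (lam := lam) (alpha := alpha) hφ
  have tf := hV.isTameC1_of_isCb hf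
  have e0 : l • lift β V φ - lift β V (generator π lam alpha β V φ) =
      lift β V fun x => l * φ x - generator π lam alpha β V φ x := by
    rw [lift_sub ((tφ.tame.const_mul l).memLp hV) (tG.tame.memLp hV),
      lift_const_mul (tφ.tame.memLp hV)]
  have e1 : l • lift β V φ - lift β V (generator π lam alpha β V φ) - lift β V f =
      lift β V fun x => l * φ x - generator π lam alpha β V φ x - f x := by
    rw [e0, lift_sub (((tφ.tame.const_mul l).sub tG.tame).memLp hV) (tf.tame.memLp hV)]
  have e2 : ∀ k, l • lift β V (pderiv π k φ) - lift β V (pderiv π k (generator π lam alpha β V φ)) =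
      lift β V fun x => l * pderiv π k φ x - pderiv π k (generator π lam alpha β V φ) x :=
    fun k => by
      rw [lift_sub (((tφ.tame_pderiv k).const_mul l).memLp hV) ((tG.tame_pderiv k).memLp hV),
        lift_const_mul ((tφ.tame_pderiv k).memLp hV)]
  have h3 := aux ((((tφ.tame.const_mul l).sub tG.tame).sub tf.tame).memLp hV) h1
  rw [← e1] at h3
  have h4 : ‖l • lift β V φ - lift β V (generator π lam alpha β V φ) - lift β V f‖ ≤
      min 1 (ε / (N + 1)) * N := abs_le_of_sq_le_sq' h3 (by positivity) |>.2
  refine ⟨φ, hφ, h4.trans ?_, Real.le_sqrt_of_sq_le ?_⟩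
  · refine (mul_le_mul_of_nonneg_right (min_le_right _ _) hN0).trans ?_
    rw [div_mul_eq_mul_div, div_le_iff₀ (by positivity)]
    nlinarith
  · rw [norm_sq_jet]
    refine add_le_add (pow_le_pow_left₀ (norm_nonneg _) ?_ 2) (Finset.sum_le_sum fun k _ => ?_)
    · change ‖l • lift β V φ - lift β V (generator π lam alpha β V φ)‖ ≤ _
      have h5 := norm_le_insert' (l • lift β V φ - lift β V (generator π lam alpha β V φ))
        (lift β V f)
      have h6 := h4.trans (mul_le_mul_of_nonneg_right (min_le_left _ _) hN0)
      linarith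
    · change ‖l • lift β V (pderiv π k φ) -
        lift β V (pderiv π k (generator π lam alpha β V φ))‖ ^ 2 ≤ _
      rw [e2]
      exact aux ((((tφ.tame_pderiv k).const_mul l).sub (tG.tame_pderiv k)).memLp hV) (h2 k)

end IsAdmissible

end SemigroupL2

/-! ### Dissipation of the modified Sobolev form -/

section Dissipation

variable {d m : ℕ} {Q : Type} [AddCommGroup Q] [TopologicalSpace Q] [IsTopologicalAddGroup Q]
  [SecondCountableTopology Q] [T2Space Q] [LocallyCompactSpace Q] [MeasureSpace Q] [BorelSpace Q]
  [(volume : Measure Q).IsAddHaarMeasure] {π : Euc d →+ Q}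

variable {β : ℝ} {V : Q → ℝ} {lam alpha : Fin m → ℝ}

lemma sum_mul_integral_eq {X ι : Type*} [MeasurableSpace X] {μ : Measure X} [Fintype ι]
    (M : ι → ι → ℝ) {f g : ι → X → ℝ} (hf : ∀ k, MemLp (f k) 2 μ) (hg : ∀ k, MemLp (g k) 2 μ) :
    Integrable (fun x => ∑ k, ∑ l, M k l * (f k x * g l x)) μ ∧
    ∑ k, ∑ l, M k l * ∫ x, f k x * g l x ∂μ = ∫ x, ∑ k, ∑ l, M k l * (f k x * g l x) ∂μ := by
  have i1 : ∀ k l, Integrable (fun x => M k l * (f k x * g l x)) μ := fun k l =>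
    ((hf k).integrable_mul (hg l)).const_mul _
  have i2 : ∀ k, Integrable (fun x => ∑ l, M k l * (f k x * g l x)) μ := fun k =>
    integrable_finsetSum _ fun l _ => i1 k l
  refine ⟨integrable_finsetSum _ fun k _ => i2 k, ?_⟩
  rw [integral_finsetSum _ fun k _ => i2 k]
  refine Finset.sum_congr rfl fun k _ => ?_
  rw [integral_finsetSum _ fun l _ => i1 k l]
  exact Finset.sum_congr rfl fun l _ => (integral_const_mul _ _).symm

lemma pderiv_gradH_inr (k : Coord d m) (l : Fin d ⊕ (Fin m × Fin d)) (x : Phase d m Q) :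
    pderiv π k (gradH π V (.inr l)) x = if k = .inr l then 1 else 0 := by
  have aux : ∀ c : ℝ, (∀ s : ℝ, gradH π V (.inr l) (x + cover π (s • unitVec k)) =
      gradH π V (.inr l) x + s * c) → pderiv π k (gradH π V (.inr l)) x = c := fun c h => by
    rw [pderiv, funext h]
    exact ((hasDerivAt_mul_const c).const_add _).deriv
  refine aux _ fun s => ?_
  rcases l with i | ⟨j, i⟩ <;> rcases k with i' | i' | ⟨j', i'⟩
  · simp [gradH, cover, unitVec]
  · simp [gradH, cover, unitVec, eq_comm]
  · simp [gradH, cover, unitVec]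
  · simp [gradH, cover, unitVec]
  · simp [gradH, cover, unitVec]
  · by_cases h : j = j'
    · subst h
      simp [gradH, cover, unitVec, eq_comm]
    · simp [gradH, cover, unitVec, h, eq_comm]

lemma pderiv_inr_gradH (k : Fin d ⊕ (Fin m × Fin d)) (l : Coord d m) (x : Phase d m Q) :
    pderiv π (.inr k) (gradH π V l) x = if l = .inr k then 1 else 0 := by
  rcases l with i | l
  · have h : pderiv π (.inr k) (gradH π V (.inl i)) x = 0 :=
      pderiv_pos_inr (π := π) k (posDeriv π i V) x
    simp [h]
  · simp only [pderiv_gradH_inr, eq_comm]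

namespace IsAdmissible

variable (hV : IsAdmissible π β V)
include hV

lemma sum_pderiv_drift_inr (k : Fin d ⊕ (Fin m × Fin d)) (ξ : Coord d m → ℝ) (x : Phase d m Q) :
    ∑ r, pderiv π (.inr k) (drift π lam alpha V r) x * ξ r =
      ∑ r, symplectic lam r (.inr k) * ξ r - diffusion alpha (.inr k) * ξ (.inr k) := by
  simp only [hV.pderiv_drift, pderiv_inr_gradH, mul_ite, mul_one, mul_zero, Finset.sum_ite_eq',
    Finset.mem_univ, if_true, sub_mul, Finset.sum_sub_distrib, ite_mul, zero_mul]

lemma sum_pderiv_drift_inl (i : Fin d) (ξ : Coord d m → ℝ) (x : Phase d m Q) :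
    ∑ r, pderiv π (.inl i) (drift π lam alpha V r) x * ξ r =
      -∑ l, posDeriv π i (posDeriv π l V) x.1 * ξ (.inr (.inl l)) := by
  have h : ∀ l, pderiv π (.inl i) (gradH π V (.inl l)) x = posDeriv π i (posDeriv π l V) x.1 :=
    fun l => pderiv_pos (π := π) i (posDeriv π l V) x
  simp only [hV.pderiv_drift, Fintype.sum_sum_type, Fintype.sum_prod_type, pderiv_gradH_inr, h]
  simp [symplectic, diffusion]

/-- The generator dissipates the modified norm. -/
lemma exists_dissipation (halpha : ∀ j, 0 < alpha j) (hlam : ∃ j, lam j ≠ 0) :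
    ∃ ε a c : ℝ, 0 < a ∧ 0 < c ∧
    (∀ ξ : Coord d m → ℝ, c * ∑ k, ξ k ^ 2 ≤ ∑ k, ∑ l, hypoMatrix lam ε k l * (ξ k * ξ l)) ∧
    ∀ φ : Phase d m Q → ℝ, IsCb π φ → c * ∑ k, ∫ x, pderiv π k φ x ^ 2 ∂(gibbs m β V) ≤
      -(a * ∫ x, φ x * generator π lam alpha β V φ x ∂(gibbs m β V)) -
      ∑ k, ∑ l, hypoMatrix lam ε k l * ∫ x, pderiv π k φ x *
        pderiv π l (generator π lam alpha β V φ) x ∂(gibbs m β V) := by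
  obtain ⟨C, hC⟩ := hV.hess
  -- Each of the `d` components of the Hessian applied to the `p`-gradient has square at most `d C²`
  -- times that of the gradient.
  obtain ⟨ε, a, c, ha, hc, h1, h2⟩ := exists_hypoMatrix hV.pos halpha hlam (d := d)
    (K := d * (d * C ^ 2)) (by positivity)
  refine ⟨ε, a, c, ha, hc, h1, fun φ hφ => ?_⟩
  set M : Coord d m → Coord d m → ℝ := hypoMatrix lam ε with hM
  set ζ : Coord d m → Phase d m Q → ℝ := fun k x =>
    ∑ r, pderiv π k (drift π lam alpha V r) x * pderiv π r φ x with hζ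
  have mξ : ∀ k, MemLp (pderiv π k φ) 2 (gibbs m β V) := fun k =>
    (hV.isTame_pderiv hφ.isCb2 k).memLp hV
  have tζ : ∀ k, IsTame π V (ζ k) := fun k => by
    obtain ⟨D, -, hD⟩ := hV.exists_pderiv_drift_le (m := m) (lam := lam) (alpha := alpha)
    exact IsTame.sum fun r _ => (IsTame.of_bounded (hV.continuous_pderiv_drift k r)
      ⟨D, fun x => hD k r x⟩).mul_bounded (hV.continuous_pderiv_isCb2 hφ.isCb2 r)
      (hφ.isCb2.pderiv_bounded r)
  have mζ : ∀ k, MemLp (ζ k) 2 (gibbs m β V) := fun k => (tζ k).memLp hV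
  have tG : ∀ l, IsTame π V (generator π lam alpha β V (pderiv π l φ)) := fun l =>
    hV.isTame_generator (hφ.pderiv l).isCb2
  have mG : ∀ l, MemLp (generator π lam alpha β V (pderiv π l φ)) 2 (gibbs m β V) := fun l =>
    (tG l).memLp hV
  have hpt : ∀ x, c * ∑ k, pderiv π k φ x ^ 2 ≤
      a * β⁻¹ * ∑ k, diffusion alpha k * pderiv π k φ x ^ 2 -
        ∑ k, ∑ l, M k l * (pderiv π k φ x * ζ l x) := fun x => by
    refine h2 (fun k => pderiv π k φ x) (fun k => ζ k x) ?_ (fun i => ?_) fun j i => ?_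
    · have hi : ∀ i, ζ (.inl i) x ^ 2 ≤ d * C ^ 2 * ∑ i, pderiv π (.inr (.inl i)) φ x ^ 2 :=
        fun i => by
          rw [hζ]
          simp only
          rw [hV.sum_pderiv_drift_inl, neg_sq, mul_assoc, Finset.mul_sum]
          refine (sq_sum_le_card_mul_sum_sq (s := Finset.univ)).trans ?_
          rw [Finset.card_univ, Fintype.card_fin]
          refine mul_le_mul_of_nonneg_left (Finset.sum_le_sum fun l _ => ?_) (by positivity)
          rw [mul_pow]
          refine mul_le_mul_of_nonneg_right ?_ (sq_nonneg _)
          rw [← sq_abs]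
          exact pow_le_pow_left₀ (abs_nonneg _) (hC l i x.1) 2
      refine (Finset.sum_le_card_nsmul _ _ _ fun i _ => hi i).trans_eq ?_
      rw [Finset.card_univ, Fintype.card_fin, nsmul_eq_mul]
      ring
    · rw [hζ]
      simp only
      rw [hV.sum_pderiv_drift_inr]
      simp [Fintype.sum_sum_type, Fintype.sum_prod_type, symplectic, diffusion, sub_eq_add_neg,
        Finset.sum_neg_distrib]
    · rw [hζ]
      simp only
      rw [hV.sum_pderiv_drift_inr]
      simp [Fintype.sum_sum_type, symplectic, diffusion]
  obtain ⟨i1, e1⟩ := sum_mul_integral_eq M mξ mζ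
  have i2 : ∀ k, Integrable (fun x => pderiv π k φ x ^ 2) (gibbs m β V) := fun k =>
    (mξ k).integrable_sq
  have i3 : Integrable (fun x => a * β⁻¹ * ∑ k, diffusion alpha k * pderiv π k φ x ^ 2)
      (gibbs m β V) :=
    (integrable_finsetSum _ fun k _ => (i2 k).const_mul _).const_mul _
  have i4 : Integrable (fun x => c * ∑ k, pderiv π k φ x ^ 2) (gibbs m β V) :=
    (integrable_finsetSum _ fun k _ => i2 k).const_mul _
  have h3 := integral_mono i4 (i3.sub i1) hpt
  simp only [Pi.sub_apply] at h3
  rw [integral_sub i3 i1, integral_const_mul, integral_const_mul,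
    integral_finsetSum _ fun k _ => i2 k,
    integral_finsetSum _ fun k _ => (i2 k).const_mul (diffusion alpha k), ← e1] at h3
  simp only [integral_const_mul] at h3
  -- The part where the generator acts on `∂_l φ` has a sign. After symmetrisation it is `-β⁻¹`
  -- times a sum over directions `r`, with nonnegative diffusion coefficients, of the positive form
  -- evaluated on second derivatives `∂_r ∇φ`.
  have h4 : ∑ k, ∑ l, M k l * ∫ x, pderiv π k φ x *
      generator π lam alpha β V (pderiv π l φ) x ∂(gibbs m β V) ≤ 0 := by
    have h5 : ∑ k, ∑ l, M k l * ∫ x, pderiv π k φ x *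
        generator π lam alpha β V (pderiv π l φ) x ∂(gibbs m β V) =
        ∑ k, ∑ l, M k l * ∫ x, pderiv π l φ x *
        generator π lam alpha β V (pderiv π k φ) x ∂(gibbs m β V) := by
      rw [Finset.sum_comm]
      exact Finset.sum_congr rfl fun k _ => Finset.sum_congr rfl fun l _ => by
        rw [hM, hypoMatrix_symm]
    have h6 : ∀ k l, M k l * (∫ x, pderiv π k φ x *
        generator π lam alpha β V (pderiv π l φ) x ∂(gibbs m β V)) + M k l * (∫ x, pderiv π l φ x *
        generator π lam alpha β V (pderiv π k φ) x ∂(gibbs m β V)) =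
        -(2 * β⁻¹) * ∑ r, diffusion alpha r * (M k l * ∫ x, pderiv π r (pderiv π k φ) x *
          pderiv π r (pderiv π l φ) x ∂(gibbs m β V)) := fun k l => by
      rw [← mul_add, hV.integral_mul_generator (hφ.pderiv k).isCb2 (hφ.pderiv l).isCb2]
      simp only [mul_left_comm _ (M k l), ← Finset.mul_sum]
      ring
    have h7 : ∀ r, 0 ≤ ∑ k, ∑ l, M k l * ∫ x, pderiv π r (pderiv π k φ) x *
        pderiv π r (pderiv π l φ) x ∂(gibbs m β V) := fun r => by
      have mm : ∀ k, MemLp (pderiv π r (pderiv π k φ)) 2 (gibbs m β V) := fun k =>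
        (hV.isTame_pderiv_pderiv hφ.isCb2 r k).memLp hV
      rw [(sum_mul_integral_eq M mm mm).2]
      refine integral_nonneg fun x => le_trans ?_ (h1 fun k => pderiv π r (pderiv π k φ) x)
      have := Finset.sum_nonneg fun k (_ : k ∈ Finset.univ) =>
        sq_nonneg (pderiv π r (pderiv π k φ) x)
      positivity
    have h8 : ∑ k, ∑ l, (M k l * (∫ x, pderiv π k φ x *
        generator π lam alpha β V (pderiv π l φ) x ∂(gibbs m β V)) + M k l * (∫ x, pderiv π l φ x *
        generator π lam alpha β V (pderiv π k φ) x ∂(gibbs m β V))) =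
        -(2 * β⁻¹) * ∑ r, diffusion alpha r * ∑ k, ∑ l, M k l *
          ∫ x, pderiv π r (pderiv π k φ) x * pderiv π r (pderiv π l φ) x ∂(gibbs m β V) := by
      simp only [h6, ← Finset.mul_sum]
      congr 1
      simp only [Finset.mul_sum]
      rw [Finset.sum_congr rfl fun k _ => Finset.sum_comm, Finset.sum_comm]
    simp only [Finset.sum_add_distrib] at h8
    rw [← h5] at h8
    have h9 : 0 ≤ ∑ r, diffusion alpha r * ∑ k, ∑ l, M k l *
        ∫ x, pderiv π r (pderiv π k φ) x * pderiv π r (pderiv π l φ) x ∂(gibbs m β V) :=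
      Finset.sum_nonneg fun r _ => mul_nonneg (diffusion_nonneg halpha r) (h7 r)
    have : 0 ≤ 2 * β⁻¹ := by have := hV.pos; positivity
    nlinarith
  -- The commutator formula separates the signed second order part from the first order part `ζ`, to
  -- which the pointwise matrix inequality applies.
  have h10 : ∀ k l, M k l * (∫ x, pderiv π k φ x *
      pderiv π l (generator π lam alpha β V φ) x ∂(gibbs m β V)) =
      M k l * (∫ x, pderiv π k φ x * generator π lam alpha β V (pderiv π l φ) x ∂(gibbs m β V)) +
      M k l * ∫ x, pderiv π k φ x * ζ l x ∂(gibbs m β V) := fun k l => by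
    have j1 : Integrable (fun x => pderiv π k φ x * generator π lam alpha β V (pderiv π l φ) x)
      (gibbs m β V) := (mξ k).integrable_mul (mG l)
    have j2 : Integrable (fun x => pderiv π k φ x * ζ l x) (gibbs m β V) :=
      (mξ k).integrable_mul (mζ l)
    rw [← mul_add, ← integral_add j1 j2]
    congr 1
    refine integral_congr_ae (Eventually.of_forall fun x => ?_)
    simp only [hV.pderiv_generator hφ, mul_add, hζ]
  simp only [h10, Finset.sum_add_distrib]
  rw [hV.integral_mul_generator_self hφ]
  have h11 : -(a * -(β⁻¹ * ∑ k, diffusion alpha k * ∫ x, pderiv π k φ x ^ 2 ∂(gibbs m β V))) =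
      a * β⁻¹ * ∑ k, diffusion alpha k * ∫ x, pderiv π k φ x ^ 2 ∂(gibbs m β V) := by ring
  rw [h11]
  linarith

end IsAdmissible

end Dissipation

/-! ### Exponential decay on the quotient by the kernel -/

section Decay

variable {d m : ℕ} {Q : Type} [AddCommGroup Q] [TopologicalSpace Q] [IsTopologicalAddGroup Q]
  [SecondCountableTopology Q] [T2Space Q] [LocallyCompactSpace Q] [MeasureSpace Q] [BorelSpace Q]
  [(volume : Measure Q).IsAddHaarMeasure] {π : Euc d →+ Q}

variable {β : ℝ} {V : Q → ℝ} {lam alpha : Fin m → ℝ}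

/-- The inner product as a continuous bilinear form. -/
def innerForm (E : Type*) [NormedAddCommGroup E] [InnerProductSpace ℝ E] : E →L[ℝ] E →L[ℝ] ℝ :=
  (isBoundedBilinearMap_inner (𝕜 := ℝ) (E := E)).toContinuousLinearMap

lemma innerForm_apply {E : Type*} [NormedAddCommGroup E] [InnerProductSpace ℝ E] (x y : E) :
    innerForm E x y = inner ℝ x y := rfl

lemma isCoerciveForm_innerForm (E : Type*) [NormedAddCommGroup E] [InnerProductSpace ℝ E] :
    IsCoerciveForm (innerForm E) 1 :=
  ⟨fun x y => real_inner_comm y x, one_pos, fun x => by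
    rw [innerForm_apply, real_inner_self_eq_norm_sq, one_mul]⟩

/-- The modified inner product on jets. -/
def jetForm (β : ℝ) (V : Q → ℝ) (a : ℝ) (M : Coord d m → Coord d m → ℝ) :
    Jet d m β V →L[ℝ] Jet d m β V →L[ℝ] ℝ :=
  a • (innerForm (L2 d m β V)).bilinearComp (fstL m β V) (fstL m β V) +
    ∑ k, ∑ l, M k l • (innerForm (L2 d m β V)).bilinearComp (sndL β V k) (sndL β V l)

lemma jetForm_apply (a : ℝ) (M : Coord d m → Coord d m → ℝ) (u v : Jet d m β V) :
    jetForm β V a M u v = a * inner ℝ u.fst v.fst +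
      ∑ k, ∑ l, M k l * inner ℝ (u.snd k) (v.snd l) := by
  simp only [jetForm, add_apply, smul_apply, sum_apply, ContinuousLinearMap.bilinearComp_apply,
    innerForm_apply, fstL_apply, sndL_apply, smul_eq_mul]

/-- The jet of a constant function. -/
def constJet (π : Euc d →+ Q) (β : ℝ) (V : Q → ℝ) (c : ℝ) : Jet d m β V := jet π β V fun _ => c

/-- The mean of a function in `L²_ρ`. -/
def mean (m : ℕ) (β : ℝ) (V : Q → ℝ) : L2 d m β V →L[ℝ] ℝ :=
  innerForm (L2 d m β V) (lift β V fun _ => 1)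

namespace IsAdmissible

variable (hV : IsAdmissible π β V)
include hV

/-- The generation theorem in `L²_ρ`. -/
lemma exists_semigroup_L2 (halpha : ∀ j, 0 < alpha j) {l₀ : ℝ} (hl₀ : 0 ≤ l₀)
    (h : ∀ l, l₀ < l → ∀ f : Phase d m Q → ℝ, IsCb π f → ∃ C, ∀ ε, 0 < ε →
      ∃ φ : Phase d m Q → ℝ, IsCb π φ ∧
      ‖l • lift β V φ - lift β V (generator π lam alpha β V φ) - lift β V f‖ ≤ ε ∧
      ‖l • jet π β V φ - jet π β V (generator π lam alpha β V φ)‖ ≤ C) :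
    ∃ (T : ℝ → L2 d m β V →L[ℝ] L2 d m β V) (A : ℕ → L2 d m β V →L[ℝ] L2 d m β V),
      IsSemigroupOf T (closedGraph π lam alpha β V) ∧
      (∀ n : ℕ, l₀ < n → IsYosida (hV.core lam alpha).topologicalClosure n (A n)) ∧
      ∀ t, 0 ≤ t → ∀ x, Tendsto (fun n => NormedSpace.exp (t • A n) x) atTop (𝓝 (T t x)) := by
  obtain ⟨-, T, A, h1, -, h2, h3⟩ := exists_semigroup_of_core
    (isCoerciveForm_innerForm (L2 d m β V)) le_rfl (D := hV.core lam alpha) (fun p hp => by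
      obtain ⟨φ, hφ, rfl⟩ := hV.mem_core.1 hp
      rw [zero_mul, innerForm_apply, inner_neg_right,
        inner_lift_lift ((hV.isTameC1_of_isCb hφ).tame.memLp hV)
          ((hV.isTameC1_generator hφ).tame.memLp hV), hV.integral_mul_generator_self hφ, neg_neg]
      refine mul_nonneg (inv_nonneg.2 hV.pos.le) (Finset.sum_nonneg fun k _ =>
        mul_nonneg (diffusion_nonneg halpha k) (integral_nonneg fun x => sq_nonneg _))) hl₀
    (fun l hl f ε hε => by
      obtain ⟨φ₀, hφ₀, h0⟩ := (hV.exists_isTest_lift_near f (half_pos (half_pos hε))).1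
      obtain ⟨C, hC⟩ := h l hl φ₀ (hφ₀.isCb hV.quot)
      obtain ⟨φ, hφ, h4, -⟩ := hC (ε / 2) (half_pos hε)
      refine ⟨_, hV.mem_core.2 ⟨φ, hφ, rfl⟩, ?_⟩
      have e : l • lift β V φ + -lift β V (generator π lam alpha β V φ) - f =
          (l • lift β V φ - lift β V (generator π lam alpha β V φ) - lift β V φ₀) +
            (lift β V φ₀ - f) := by abel
      simp only [e]
      exact (norm_add_le _ _).trans_lt (by linarith))
    (fun x ε hε => by
      obtain ⟨φ, hφ, h0⟩ := (hV.exists_isTest_lift_near x (half_pos hε)).1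
      refine ⟨_, hV.mem_core.2 ⟨φ, hφ.isCb hV.quot, rfl⟩, ?_⟩
      rw [norm_sub_rev]
      exact h0.trans_lt (half_lt_self hε))
  rw [hV.closure_core] at h1
  exact ⟨T, A, h1, h2, h3⟩

lemma constJet_mem (c : ℝ) : constJet (m := m) π β V c ∈ H1 π m β V :=
  hV.jet_mem_of_isTameC1 (hV.isTameC1_of_isCb (IsCb.const c))

lemma constJet_snd (c : ℝ) (k : Coord d m) : (constJet (m := m) π β V c).snd k = 0 := by
  change lift β V (pderiv π k fun _ => c) = 0
  rw [show pderiv π k (fun _ : Phase d m Q => c) = fun _ => 0 from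
    funext fun x => IsCn.pderiv_const c k x]
  exact (eq_lift (Lp.coeFn_zero ℝ 2 _)).symm

lemma constJet_fst (c : ℝ) : (constJet (m := m) π β V c).fst = lift β V fun _ => c := rfl

lemma memLp_const (c : ℝ) : MemLp (fun _ : Phase d m Q => c) 2 (gibbs m β V) :=
  have := hV.isProbabilityMeasure (m := m)
  MeasureTheory.memLp_const c

lemma constJet_fst_mem_kernel (c : ℝ) :
    (constJet (m := m) π β V c).fst ∈ kernel π lam alpha β V := by
  rw [hV.mem_kernel_iff]
  refine (hV.core lam alpha).le_topologicalClosure (hV.mem_core.2 ⟨_, IsCb.const c, ?_⟩)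
  rw [show generator π lam alpha β V (fun _ : Phase d m Q => c) = fun _ => 0 from
    funext fun x => generator_const c x,
    show lift β V (fun _ : Phase d m Q => (0 : ℝ)) = 0 from (eq_lift (Lp.coeFn_zero ℝ 2 _)).symm,
    neg_zero]
  rfl

lemma mean_lift {F : Phase d m Q → ℝ} (hF : MemLp F 2 (gibbs m β V)) :
    mean m β V (lift β V F) = ∫ x, F x ∂(gibbs m β V) := by
  rw [mean, innerForm_apply, inner_lift_lift (hV.memLp_const 1) hF]
  simp only [one_mul]

lemma abs_mean_le (f : L2 d m β V) : |mean m β V f| ≤ ‖f‖ := by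
  have := hV.isProbabilityMeasure (m := m)
  have h1 : ‖lift β V fun _ : Phase d m Q => (1 : ℝ)‖ ^ 2 = 1 := by
    rw [norm_lift_sq (hV.memLp_const 1)]
    simp
  have h2 : ‖lift β V fun _ : Phase d m Q => (1 : ℝ)‖ = 1 := by
    nlinarith [norm_nonneg (lift β V fun _ : Phase d m Q => (1 : ℝ))]
  refine (abs_real_inner_le_norm (lift β V fun _ => (1 : ℝ)) f).trans_eq ?_
  rw [h2, one_mul]

lemma mean_const (c : ℝ) : mean m β V (lift (d := d) β V fun _ => c) = c := by
  have := hV.isProbabilityMeasure (m := m)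
  rw [hV.mean_lift (hV.memLp_const c)]
  simp

/-- The elements of the Sobolev space of mean zero. -/
def meanZero : Submodule ℝ (Jet d m β V) :=
  hV.sobolev ⊓ ((mean m β V).comp (fstL m β V)).ker

lemma isClosed_meanZero : IsClosed (hV.meanZero (m := m) : Set (Jet d m β V)) :=
  hV.isClosed_sobolev.inter ((mean m β V).comp (fstL m β V)).isClosed_ker

lemma norm_constJet_le (c : ℝ) : ‖constJet (m := m) π β V c‖ ≤ |c| := by
  have := hV.isProbabilityMeasure (m := m)
  refine le_of_sq_le_sq ?_ (abs_nonneg c)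
  rw [norm_sq_jet, sq_abs]
  simp only [hV.constJet_snd, norm_zero]
  rw [hV.constJet_fst, norm_lift_sq (hV.memLp_const c)]
  simp

/-- The mean is a contraction for a probability measure, so removing it at most doubles the norm. -/
lemma sub_constJet_mem {u : Jet d m β V} (hu : u ∈ H1 π m β V) :
    u - constJet (m := m) π β V (mean m β V u.fst) ∈ hV.meanZero (m := m) ∧
      ‖u - constJet (m := m) π β V (mean m β V u.fst)‖ ≤ 2 * ‖u‖ := by
  refine ⟨⟨hV.sobolev.sub_mem hu (hV.constJet_mem _), ?_⟩, ?_⟩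
  · change mean m β V (fstL m β V (u - constJet (m := m) π β V (mean m β V u.fst))) = 0
    rw [map_sub, map_sub, fstL_apply, fstL_apply, hV.constJet_fst, hV.mean_const, sub_self]
  · have h1 : ‖u.fst‖ ≤ ‖u‖ := by
      refine le_of_sq_le_sq ?_ (norm_nonneg _)
      rw [norm_sq_jet]
      exact le_add_of_nonneg_right (Finset.sum_nonneg fun k _ => sq_nonneg _)
    have h2 := norm_sub_le u (constJet (m := m) π β V (mean m β V u.fst))
    linarith [hV.norm_constJet_le (m := m) (mean m β V u.fst), hV.abs_mean_le u.fst]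

lemma jet_sub_const {φ : Phase d m Q → ℝ} (hφ : IsCb π φ) (c : ℝ) :
    jet π β V (fun x => φ x + -1 * c) = jet π β V φ - constJet (m := m) π β V c := by
  rw [(hV.isTameC1_add_mul (hV.isTameC1_of_isCb hφ)
    (hV.isTameC1_of_isCb (IsCb.const c)) (-1)).2, neg_one_smul, ← sub_eq_add_neg]
  rfl

/-- Invariance of the Gibbs measure makes the image of the generator mean zero, so the dynamics
restricts to mean zero functions. -/
lemma jet_generator_mem {φ : Phase d m Q → ℝ} (hφ : IsCb π φ) :
    jet π β V (generator π lam alpha β V φ) ∈ hV.meanZero (m := m) := by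
  refine ⟨hV.jet_mem_of_isTameC1 (hV.isTameC1_generator hφ), ?_⟩
  change mean m β V (lift β V (generator π lam alpha β V φ)) = 0
  rw [hV.mean_lift ((hV.isTameC1_generator hφ).tame.memLp hV)]
  exact hV.integral_generator hφ.isCb2

lemma generator_sub_const {φ : Phase d m Q → ℝ} (hφ : IsCb π φ) (c : ℝ) :
    generator π lam alpha β V (fun x => φ x + -1 * c) = generator π lam alpha β V φ := by
  ext x
  rw [generator_add_mul hV.quot hφ (IsCb.const c), generator_const, mul_zero, add_zero]

/-- Approximation in the Sobolev space by smooth functions. -/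
lemma exists_jet_near {u : Jet d m β V} (hu : u ∈ H1 π m β V) {ε : ℝ} (hε : 0 < ε) :
    ∃ φ : Phase d m Q → ℝ, IsCb π φ ∧ ‖jet π β V φ - u‖ ≤ ε := by
  obtain ⟨_, ⟨φ, hφ, rfl⟩, h⟩ := Metric.mem_closure_iff.1 (hV.sobolev_le_closure hu) ε hε
  refine ⟨φ, hφ, ?_⟩
  rw [← dist_eq_norm, dist_comm]
  exact h.le

/-- The mean zero version of approximation by smooth functions. -/
lemma exists_sub_constJet_near {u : Jet d m β V} (hu : u ∈ hV.meanZero (m := m)) {ε : ℝ}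
    (hε : 0 < ε) : ∃ φ : Phase d m Q → ℝ, IsCb π φ ∧
      ‖jet π β V φ - constJet (m := m) π β V (mean m β V (lift β V φ)) - u‖ ≤ ε := by
  obtain ⟨φ, hφ, h⟩ := hV.exists_jet_near hu.1 (half_pos hε)
  refine ⟨φ, hφ, ?_⟩
  have h1 := (hV.sub_constJet_mem (hV.sobolev.sub_mem
    (hV.jet_mem_of_isTameC1 (hV.isTameC1_of_isCb hφ)) hu.1)).2
  have h2 : mean m β V (jet π β V φ - u).fst = mean m β V (lift β V φ) := by
    change mean m β V (fstL m β V (jet π β V φ - u)) = _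
    have h0 : mean m β V u.fst = 0 := hu.2
    rw [map_sub, map_sub, fstL_apply, fstL_apply, h0, sub_zero]
    rfl
  rw [h2] at h1
  rw [sub_right_comm]
  linarith

/-! ### Semigroup on an isometric copy of the mean zero Sobolev space -/

section Model

variable {X : Type*} [NormedAddCommGroup X] [NormedSpace ℝ X] [CompleteSpace X]
  (ι : X →L[ℝ] Jet d m β V)

/-- The graph of `𝓛` on jets of mean zero, in a space identified with the space of these jets. -/
def meanZeroCore (lam alpha : Fin m → ℝ) : Submodule ℝ (X × X) :=
  (hV.jetCore lam alpha).comap (ι.prodMap ι).toLinearMap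

lemma mem_meanZeroCore_iff {p : X × X} : p ∈ hV.meanZeroCore ι lam alpha ↔
    ∃ φ : Phase d m Q → ℝ, IsCb π φ ∧
      (jet π β V φ, -jet π β V (generator π lam alpha β V φ)) = (ι p.1, ι p.2) :=
  Iff.rfl

variable (hm : ∀ u, u ∈ hV.meanZero ↔ ∃ x, ι x = u)
include hm

/-- Subtracting its mean from `φ` leaves the generator unchanged, because constants are killed. -/
lemma exists_mem_meanZeroCore {φ : Phase d m Q → ℝ} (hφ : IsCb π φ) :
    ∃ p ∈ hV.meanZeroCore ι lam alpha,
      ι p.1 = jet π β V φ - constJet (m := m) π β V (mean m β V (lift β V φ)) ∧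
      ι p.2 = -jet π β V (generator π lam alpha β V φ) := by
  obtain ⟨x, hx⟩ := (hm _).1
    (hV.sub_constJet_mem (hV.jet_mem_of_isTameC1 (hV.isTameC1_of_isCb hφ))).1
  obtain ⟨y, hy⟩ := (hm _).1
    (hV.meanZero.neg_mem (hV.jet_generator_mem (lam := lam) (alpha := alpha) hφ))
  refine ⟨(x, y), (hV.mem_meanZeroCore_iff ι).2
    ⟨_, hφ.add_mul hV.quot (IsCb.const (mean m β V (lift β V φ))) (-1), ?_⟩, hx, hy⟩
  rw [hV.generator_sub_const hφ, hV.jet_sub_const hφ, hx, hy]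
  rfl

variable (hn : ∀ x, ‖ι x‖ = ‖x‖)
include hn

/-- The generation theorem, with exponential decay, in the Sobolev space. -/
lemma exists_semigroup_meanZero (halpha : ∀ j, 0 < alpha j) (hlam : ∃ j, lam j ≠ 0) {l₀ : ℝ}
    (hl₀ : 0 ≤ l₀)
    (h : ∀ l, l₀ < l → ∀ f : Phase d m Q → ℝ, IsCb π f → ∃ C, ∀ ε, 0 < ε →
      ∃ φ : Phase d m Q → ℝ, IsCb π φ ∧
      ‖l • lift β V φ - lift β V (generator π lam alpha β V φ) - lift β V f‖ ≤ ε ∧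
      ‖l • jet π β V φ - jet π β V (generator π lam alpha β V φ)‖ ≤ C) :
    ∃ (T : ℝ → X →L[ℝ] X)
      (A : ℕ → X →L[ℝ] X) (C κ : ℝ), 0 < C ∧ 0 < κ ∧
      (∀ t, 0 ≤ t → ∀ u, ‖T t u‖ ≤ C * Real.exp (-κ * t) * ‖u‖) ∧
      (∀ l > l₀, ∀ f, ∃ p ∈ (hV.meanZeroCore ι lam alpha).topologicalClosure, l • p.1 + p.2 = f) ∧
      (∀ n : ℕ, l₀ < n → IsYosida (hV.meanZeroCore ι lam alpha).topologicalClosure n (A n)) ∧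
      ∀ t, 0 ≤ t → ∀ x, Tendsto (fun n => NormedSpace.exp (t • A n) x) atTop (𝓝 (T t x)) := by
  obtain ⟨ε₀, a, c, ha, hc, hco, hdis⟩ := hV.exists_dissipation halpha hlam
  obtain ⟨P, hP0, hP⟩ := hV.exists_poincare (m := m)
  set M : Coord d m → Coord d m → ℝ := hypoMatrix lam ε₀ with hM
  set B : X →L[ℝ] X →L[ℝ] ℝ :=
    (jetForm β V a M).bilinearComp ι ι with hBdef
  have hBapp : ∀ u v : X, B u v = a * inner ℝ (ι u).fst
      (ι v).fst + ∑ k, ∑ l, M k l * inner ℝ ((ι u).snd k)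
        ((ι v).snd l) := fun u v => jetForm_apply a M (ι u) (ι v)
  have hB : IsCoerciveForm B (min a c) := by
    refine ⟨fun u v => ?_, lt_min ha hc, fun u => ?_⟩
    · rw [hBapp, hBapp, real_inner_comm, Finset.sum_comm]
      congr 1
      exact Finset.sum_congr rfl fun k _ => Finset.sum_congr rfl fun l _ => by
        rw [hM, hypoMatrix_symm, real_inner_comm]
    · rw [hBapp, real_inner_self_eq_norm_sq]
      have e : ‖u‖ ^ 2 = ‖(ι u).fst‖ ^ 2 + ∑ k, ‖(ι u).snd k‖ ^ 2 :=
        (hn u).symm ▸ norm_sq_jet (ι u)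
      have h1 : c * ∑ k, ‖(ι u).snd k‖ ^ 2 ≤ ∑ k, ∑ l, M k l *
          inner ℝ ((ι u).snd k) ((ι u).snd l) := by
        have mu : ∀ k, MemLp ((ι u).snd k) 2 (gibbs m β V) := fun k => Lp.memLp _
        obtain ⟨i1, e1⟩ := sum_mul_integral_eq M mu mu
        simp only [inner_L2, norm_sq_L2]
        rw [e1, ← integral_finsetSum _ fun k _ => (mu k).integrable_sq, ← integral_const_mul]
        exact integral_mono ((integrable_finsetSum _ fun k _ =>
          (mu k).integrable_sq).const_mul c) i1 fun x => hco _
      have h2 : 0 ≤ ∑ k, ‖(ι u).snd k‖ ^ 2 := Finset.sum_nonneg fun k _ => sq_nonneg _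
      rw [e, mul_add]
      exact add_le_add (mul_le_mul_of_nonneg_right (min_le_left _ _) (sq_nonneg _))
        ((mul_le_mul_of_nonneg_right (min_le_right _ _) h2).trans h1)
  set N : ℝ := ∑ k, ∑ l, |M k l| with hN
  have hN0 : 0 ≤ N := Finset.sum_nonneg fun k _ => Finset.sum_nonneg fun l _ => abs_nonneg _
  -- By the Poincaré inequality the modified form is at most `(aP + N) ‖∇φ‖²`, while its dissipation
  -- is at least `c ‖∇φ‖²`.
  set κ : ℝ := c / (a * P + N) with hκdef
  have hκ : 0 < κ := by positivity
  have hdiss : ∀ p ∈ hV.meanZeroCore ι lam alpha, κ * B p.1 p.1 ≤ B p.1 p.2 := by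
    intro p hp
    obtain ⟨φ, hφ, hpφ⟩ := (hV.mem_meanZeroCore_iff ι).1 hp
    have e1 : (ι p.1) = jet π β V φ := (congrArg Prod.fst hpφ).symm
    have e2 : (ι p.2) = -jet π β V (generator π lam alpha β V φ) :=
      (congrArg Prod.snd hpφ).symm
    have tφ := hV.isTameC1_of_isCb hφ
    have tG := hV.isTameC1_generator (lam := lam) (alpha := alpha) hφ
    have mφ := fun k => (tφ.tame_pderiv k).memLp hV
    set S : ℝ := ∑ k, ∫ x, pderiv π k φ x ^ 2 ∂(gibbs m β V) with hS
    have hS0 : ∀ k, 0 ≤ ∫ x, pderiv π k φ x ^ 2 ∂(gibbs m β V) := fun k =>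
      integral_nonneg fun x => sq_nonneg _
    have hmean : ∫ x, φ x ∂(gibbs m β V) = 0 := by
      rw [← hV.mean_lift (tφ.tame.memLp hV)]
      have := ((hm _).2 ⟨p.1, rfl⟩).2
      rw [e1] at this
      exact this
    have h1 := hdis φ hφ
    have h2 := hP φ hφ.isCb2 hmean
    have b1 : B p.1 p.1 ≤ (a * P + N) * S := by
      rw [hBapp, e1, add_mul, mul_assoc]
      refine add_le_add ?_ ?_
      · rw [real_inner_self_eq_norm_sq, jet_fst, norm_lift_sq (tφ.tame.memLp hV)]
        exact mul_le_mul_of_nonneg_left h2 ha.le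
      · rw [hN, Finset.sum_mul]
        refine Finset.sum_le_sum fun k _ => ?_
        rw [Finset.sum_mul]
        refine Finset.sum_le_sum fun l _ => ?_
        refine (le_abs_self _).trans ?_
        rw [abs_mul]
        refine mul_le_mul_of_nonneg_left ((abs_real_inner_le_norm _ _).trans ?_) (abs_nonneg _)
        rw [jet_snd, jet_snd]
        have hk : ‖lift β V (pderiv π k φ)‖ ^ 2 ≤ S := by
          rw [norm_lift_sq (mφ k)]
          exact Finset.single_le_sum (fun k _ => hS0 k) (Finset.mem_univ k)
        have hl : ‖lift β V (pderiv π l φ)‖ ^ 2 ≤ S := by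
          rw [norm_lift_sq (mφ l)]
          exact Finset.single_le_sum (fun k _ => hS0 k) (Finset.mem_univ l)
        nlinarith [sq_nonneg (‖lift β V (pderiv π k φ)‖ - ‖lift β V (pderiv π l φ)‖)]
    have b2 : c * S ≤ B p.1 p.2 := by
      rw [hBapp, e1, e2]
      refine h1.trans_eq ?_
      have e3 : (-jet π β V (generator π lam alpha β V φ)).fst =
          -lift β V (generator π lam alpha β V φ) := rfl
      have e4 : ∀ l, (-jet π β V (generator π lam alpha β V φ)).snd l =
          -lift β V (pderiv π l (generator π lam alpha β V φ)) := fun l => rfl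
      simp only [e3, e4, jet_fst, jet_snd, inner_neg_right]
      rw [inner_lift_lift (tφ.tame.memLp hV) (tG.tame.memLp hV)]
      simp only [inner_lift_lift (mφ _) ((tG.tame_pderiv _).memLp hV), mul_neg,
        Finset.sum_neg_distrib]
      ring
    calc κ * B p.1 p.1 ≤ κ * ((a * P + N) * S) := mul_le_mul_of_nonneg_left b1 hκ.le
      _ = c * S := by rw [hκdef]; field_simp
      _ ≤ _ := b2
  have hdense : ∀ x : X, ∀ ε > 0, ∃ p ∈ hV.meanZeroCore ι lam alpha,
      ‖x - p.1‖ < ε := by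
    intro x ε hε
    obtain ⟨φ, hφ, h1⟩ := hV.exists_sub_constJet_near ((hm _).2 ⟨x, rfl⟩) (half_pos hε)
    obtain ⟨p, hp, h2, -⟩ := hV.exists_mem_meanZeroCore ι hm (lam := lam) (alpha := alpha) hφ
    refine ⟨p, hp, ?_⟩
    rw [← h2, ← map_sub, hn] at h1
    rw [norm_sub_rev]
    exact h1.trans_lt (half_lt_self hε)
  -- Approximate resolvents have residuals small in `L²_ρ` but only bounded in `H¹_ρ`. They
  -- therefore place a smooth datum in the closure of the range by the weak approximation criterion,
  -- and smooth data are dense.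
  have hrange : ∀ l > l₀, ∀ f : X, ∀ ε > 0, ∃ p ∈ hV.meanZeroCore ι lam alpha,
      ‖l • p.1 + p.2 - f‖ < ε := by
    intro l hl f ε hε
    have hl0 : 0 < l := hl₀.trans_lt hl
    set Φ : X × X →L[ℝ] Jet d m β V :=
      ι.comp (l • ContinuousLinearMap.fst ℝ X X + ContinuousLinearMap.snd ℝ X X) with hΦ
    have hΦa : ∀ p, Φ p = l • (ι p.1) + (ι p.2) := fun p => by
      simp [hΦ]
    set R : Submodule ℝ (Jet d m β V) := (hV.meanZeroCore ι lam alpha).map Φ.toLinearMap with hR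
    have hRle : R ≤ hV.sobolev := by
      rintro _ ⟨p, -, rfl⟩
      exact ((hm _).2 ⟨_, rfl⟩).1
    obtain ⟨φ₀, hφ₀, h1⟩ := hV.exists_sub_constJet_near ((hm _).2 ⟨f, rfl⟩) (half_pos hε)
    have hφ₁ := hφ₀.add_mul hV.quot (IsCb.const (mean m β V (lift β V φ₀))) (-1)
    set u₁ := jet π β V φ₀ - constJet (m := m) π β V (mean m β V (lift β V φ₀)) with hu₁
    have eu₁ : jet π β V (fun x => φ₀ x + -1 * mean m β V (lift β V φ₀)) = u₁ :=
      hV.jet_sub_const hφ₀ _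
    have hu₁m : u₁ ∈ hV.meanZero (m := m) :=
      (hV.sub_constJet_mem (hV.jet_mem_of_isTameC1 (hV.isTameC1_of_isCb hφ₀))).1
    obtain ⟨C, hC⟩ := h l hl _ hφ₁
    have key : u₁ ∈ R.topologicalClosure := by
      refine mem_closure_of_injOn (fstL m β V) hV.isClosed_sobolev
        (fun x hx h => hV.eq_zero_of_fst hx h) hRle hu₁m.1 (C := 2 * C) fun δ hδ => ?_
      obtain ⟨φ, hφ, h2, h3⟩ := hC (δ / 2) (half_pos hδ)
      obtain ⟨p, hp, hp1, hp2⟩ := hV.exists_mem_meanZeroCore ι hm (lam := lam) (alpha := alpha) hφ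
      set w : Jet d m β V := l • jet π β V φ - jet π β V (generator π lam alpha β V φ) with hw
      have hwm : w ∈ H1 π m β V := hV.sobolev.sub_mem
        (hV.sobolev.smul_mem l (hV.jet_mem_of_isTameC1 (hV.isTameC1_of_isCb hφ)))
        (hV.jet_mem_of_isTameC1 (hV.isTameC1_generator hφ))
      have hwf : w.fst = l • lift β V φ - lift β V (generator π lam alpha β V φ) := rfl
      have hwmean : mean m β V w.fst = l * mean m β V (lift β V φ) := by
        have := (hV.jet_generator_mem (lam := lam) (alpha := alpha) hφ).2
        have h0 : mean m β V (lift β V (generator π lam alpha β V φ)) = 0 := this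
        rw [hwf, map_sub, map_smul, h0, sub_zero, smul_eq_mul]
      have hconst : l • constJet (m := m) π β V (mean m β V (lift β V φ)) =
          constJet (m := m) π β V (l * mean m β V (lift β V φ)) := by
        refine jet_ext ?_ fun k => ?_
        · change l • lift β V (fun _ => mean m β V (lift β V φ)) = lift β V fun _ => _
          rw [← lift_const_mul (hV.memLp_const _)]
        · change l • (constJet (m := m) π β V (mean m β V (lift β V φ))).snd k = _
          rw [hV.constJet_snd, hV.constJet_snd, smul_zero]
      -- Passing to mean zero representatives subtracts exactly the mean of the residual expression
      -- `w`; as the datum has mean zero, this mean is as small as the residual.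
      have hΦp : Φ p = w - constJet (m := m) π β V (mean m β V w.fst) := by
        rw [hΦa, hp1, hp2, hwmean, ← hconst, smul_sub, hw]
        abel
      refine ⟨Φ p, ⟨p, hp, rfl⟩, ?_, ?_⟩
      · have h4 : mean m β V (w.fst - u₁.fst) = mean m β V w.fst := by
          have h0 : mean m β V u₁.fst = 0 := hu₁m.2
          rw [map_sub, h0, sub_zero]
        have h5 : ‖w.fst - u₁.fst‖ ≤ δ / 2 := by
          rw [← eu₁]
          exact h2
        have h6 : fstL m β V (Φ p) - fstL m β V u₁ =
            (w.fst - u₁.fst) - (constJet (m := m) π β V (mean m β V w.fst)).fst := by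
          rw [hΦp, map_sub, fstL_apply, fstL_apply, fstL_apply]
          abel
        have h7 : ‖(constJet (m := m) π β V (mean m β V w.fst)).fst‖ ≤ δ / 2 := by
          have h8 : ‖(constJet (m := m) π β V (mean m β V w.fst)).fst‖ ≤
              ‖constJet (m := m) π β V (mean m β V w.fst)‖ := by
            refine le_of_sq_le_sq ?_ (norm_nonneg _)
            rw [norm_sq_jet]
            exact le_add_of_nonneg_right (Finset.sum_nonneg fun k _ => sq_nonneg _)
          refine h8.trans ((hV.norm_constJet_le _).trans ?_)
          rw [← h4]
          exact (hV.abs_mean_le _).trans h5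
        rw [h6]
        exact (norm_sub_le _ _).trans (by linarith)
      · rw [hΦp]
        exact (hV.sub_constJet_mem hwm).2.trans (mul_le_mul_of_nonneg_left h3 zero_le_two)
    obtain ⟨_, ⟨p, hp, rfl⟩, h9⟩ := Metric.mem_closure_iff.1 key (ε / 2) (half_pos hε)
    refine ⟨p, hp, ?_⟩
    rw [dist_eq_norm] at h9
    have e' : ‖l • p.1 + p.2 - f‖ = ‖(u₁ - ι f) - (u₁ - Φ p)‖ := by
      rw [← hn, map_sub, map_add, map_smul, hΦa]
      congr 1
      abel
    rw [e']
    exact (norm_sub_le _ _).trans_lt (by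
      have : ‖u₁ - Φ p‖ < ε / 2 := h9
      linarith)
  obtain ⟨hr, T, A, -, hT, hA, hlim⟩ := exists_semigroup_of_core hB hκ.le hdiss hl₀ hrange hdense
  have hcmin := hB.pos
  refine ⟨T, A, √(‖B‖ / min a c) + 1, κ, by positivity, hκ, fun t ht u => ?_, hr, hA, hlim⟩
  have h1 := hB.norm_le (x := T t u) (y := u) (Real.exp_pos (-κ * t)).le (by
    refine (hT t ht u).trans_eq ?_
    rw [← Real.exp_nat_mul]
    congr 2
    push_cast
    ring)
  refine h1.trans ?_
  gcongr
  linarith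

/-- Modulo the kernel every Sobolev function has a mean zero representative: `u - k` minus its mean
decays, while `k` and constants stay fixed. Hence the orbit of `u` approaches the kernel at the rate
of the mean zero semigroup. -/
lemma exponentialDecay_of_model (halpha : ∀ j, 0 < alpha j) (hlam : ∃ j, lam j ≠ 0) :
    ExponentialDecay π lam alpha β V := by
  obtain ⟨l₀, hl₀, h0⟩ := hV.exists_approx_resolvent (m := m) (lam := lam) halpha
  have h := fun l hl f hf => hV.exists_near_resolvent (lam := lam) (alpha := alpha) (l := l) hf
    (h0 l hl f hf)
  obtain ⟨T, A, hT, hA, hlim⟩ := hV.exists_semigroup_L2 halpha hl₀ h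
  obtain ⟨T', A', C, κ, hC, hκ, hdecay, hr', hA', hlim'⟩ :=
    hV.exists_semigroup_meanZero ι hm hn halpha hlam hl₀ h
  -- Forgetting derivatives maps the mean zero core into the `L²_ρ` core, and closures follow by
  -- continuity.
  have hinter : ∀ t, 0 ≤ t → ∀ u : X,
      (ι (T' t u)).fst = T t (ι u).fst := fun t ht u => by
    refine semigroup_intertwine ((fstL m β V).comp ι)
      (G' := (hV.core lam alpha).topologicalClosure) (fun p hp => ?_) hr' hA' hA (hlim' t ht u)
      (hlim t ht _)
    let P := (fstL m β V).comp ι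
    have hsub : (P.prodMap P) '' (hV.meanZeroCore ι lam alpha : Set _) ⊆
        (hV.core lam alpha : Set _) := by
      rintro _ ⟨q, hq, rfl⟩
      exact ⟨_, hq, rfl⟩
    exact closure_mono hsub (image_closure_subset_closure_image (P.prodMap P).continuous
      ⟨p, hp, rfl⟩)
  have hfix : ∀ t, 0 ≤ t → ∀ f ∈ kernel π lam alpha β V, T t f = f := fun t ht f hf =>
    semigroup_fixed hA (hV.mem_kernel_iff.1 hf) (hlim t ht f)
  set S : Set (Jet d m β V) := {k | k ∈ H1 π m β V ∧ k.fst ∈ kernel π lam alpha β V} with hS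
  have hkadd : ∀ f g : L2 d m β V, f ∈ kernel π lam alpha β V → g ∈ kernel π lam alpha β V →
      f + g ∈ kernel π lam alpha β V := fun f g hf hg => by
    rw [hV.mem_kernel_iff] at hf hg ⊢
    have := (hV.core lam alpha).topologicalClosure.add_mem hf hg
    rwa [Prod.mk_add_mk, add_zero] at this
  have hSconst : ∀ c, constJet (m := m) π β V c ∈ S := fun c =>
    ⟨hV.constJet_mem c, hV.constJet_fst_mem_kernel c⟩
  have key : ∀ t, 0 ≤ t → ∀ u ∈ H1 π m β V, ∀ k ∈ S, ∃ w ∈ H1 π m β V, w.fst = T t u.fst ∧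
      Metric.infDist w S ≤ 2 * C * Real.exp (-κ * t) * dist u k := by
    intro t ht u hu k hk
    have hv : u - k ∈ H1 π m β V := hV.sobolev.sub_mem hu hk.1
    obtain ⟨h1, h2⟩ := hV.sub_constJet_mem hv
    set c := mean m β V (u - k).fst
    obtain ⟨v, hvdef⟩ := (hm _).1 h1
    -- The constant and `k` together form the invariant part of the decomposition of `u`; it is also
    -- the comparison element at time `t`.
    have hck : constJet (m := m) π β V c + k ∈ S :=
      ⟨hV.sobolev.add_mem (hV.constJet_mem c) hk.1, hkadd _ _ (hSconst c).2 hk.2⟩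
    refine ⟨ι (T' t v) + (constJet (m := m) π β V c + k), hV.sobolev.add_mem ((hm _).2 ⟨T' t v, rfl⟩).1 hck.1, ?_, ?_⟩
    · change fstL m β V (ι (T' t v) + (constJet (m := m) π β V c + k)) = T t (fstL m β V u)
      have e : u = (ι v) + (constJet (m := m) π β V c + k) := by
        rw [hvdef]
        abel
      conv_rhs => rw [e]
      rw [map_add, map_add (fstL m β V) (ι v), map_add (T t)]
      congr 1
      · exact hinter t ht v
      · exact (hfix t ht _ hck.2).symm
    · refine (Metric.infDist_le_dist_of_mem hck).trans ?_
      rw [dist_eq_norm, add_sub_cancel_right, dist_eq_norm]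
      have h3 : ‖ι (T' t v)‖ ≤ C * Real.exp (-κ * t) * ‖v‖ := (hn _).trans_le (hdecay t ht v)
      have h4 : ‖v‖ ≤ 2 * ‖u - k‖ := by rwa [← hn, hvdef]
      refine h3.trans ?_
      calc _ ≤ C * Real.exp (-κ * t) * (2 * ‖u - k‖) := by gcongr
        _ = _ := by ring
  refine ⟨T, hT, 2 * C, κ, by positivity, hκ, fun t ht u hu => ?_⟩
  obtain ⟨w, hw, hwT, -⟩ := key t ht u hu _ (hSconst 0)
  refine ⟨w, hw, hwT, ?_⟩
  have hne : S.Nonempty := ⟨_, hSconst 0⟩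
  have hpos : 0 < 2 * C * Real.exp (-κ * t) := by positivity
  change Metric.infDist w S ≤ 2 * C * Real.exp (-κ * t) * Metric.infDist u S
  rw [← div_le_iff₀' hpos, Metric.le_infDist hne]
  -- The evolved jet constructed for each `k` is the same, since a Sobolev jet is determined by its
  -- function; so one may take the infimum over `k`.
  intro k hk
  obtain ⟨w', hw', hwT', hd⟩ := key t ht u hu k hk
  have e : w' = w := by
    refine sub_eq_zero.1 (hV.eq_zero_of_fst (hV.sobolev.sub_mem hw' hw) ?_)
    change fstL m β V (w' - w) = 0
    rw [map_sub, fstL_apply, fstL_apply, hwT, hwT', sub_self]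
  rw [div_le_iff₀' hpos, ← e]
  exact hd

end Model

/-- Exponential decay for admissible potentials. -/
theorem exponentialDecay (halpha : ∀ j, 0 < alpha j) (hlam : ∃ j, lam j ≠ 0) :
    ExponentialDecay π lam alpha β V := by
  have : CompleteSpace (hV.meanZero (m := m)) := hV.isClosed_meanZero.completeSpace_coe
  exact hV.exponentialDecay_of_model (hV.meanZero (m := m)).subtypeL
    (fun u => ⟨fun h => ⟨⟨u, h⟩, rfl⟩, fun ⟨x, hx⟩ => hx ▸ x.2⟩) (fun x => rfl) halpha hlam

end IsAdmissible

end Decay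

/-! ### Potentials on the torus -/

section Torus

variable {d : ℕ}

lemma isOpenQuotientMap_torusProj (d : ℕ) : IsOpenQuotientMap (torusProj d) :=
  (IsOpenQuotientMap.piMap fun _ : Fin d =>
    (QuotientAddGroup.isOpenQuotientMap_mk : IsOpenQuotientMap ((↑) : ℝ → UnitAddCircle))).comp
    (PiLp.homeomorph 2 fun _ : Fin d => ℝ).isOpenQuotientMap

/-- The half-open unit cube. -/
def unitCube (d : ℕ) : Set (Euc d) := {x | ∀ i, x i ∈ Set.Ioc (0 : ℝ) 1}

lemma measurePreserving_torusProj (d : ℕ) :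
    MeasurePreserving (torusProj d) (volume.restrict (unitCube d)) volume := by
  have h1 : MeasurePreserving (fun (x : Fin d → ℝ) i => (x i : UnitAddCircle))
      (volume.restrict (Set.univ.pi fun _ => Set.Ioc (0 : ℝ) 1)) volume := by
    have := measurePreserving_pi (fun _ : Fin d => volume.restrict (Set.Ioc (0 : ℝ) (0 + 1)))
      (fun _ => (volume : Measure UnitAddCircle)) fun _ => UnitAddCircle.measurePreserving_mk 0
    rwa [← Measure.restrict_pi_pi, zero_add] at this
  have h2 := (PiLp.volume_preserving_ofLp (Fin d)).restrict_preimage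
    (s := Set.univ.pi fun _ => Set.Ioc (0 : ℝ) 1) (MeasurableSet.univ_pi fun _ => measurableSet_Ioc)
  have h3 : (WithLp.ofLp ⁻¹' (Set.univ.pi fun _ => Set.Ioc (0 : ℝ) 1) : Set (Euc d)) =
      unitCube d := by
    ext x
    simp [unitCube]
  rw [h3] at h2
  exact h1.comp h2

/-- The calculus was set up on phase spaces; with no auxiliary variables a function of position
becomes such a function, and restriction to `p = 0` recovers it. -/
lemma posDeriv_posDeriv_continuous {Q : Type} [AddCommGroup Q] [TopologicalSpace Q]
    [IsTopologicalAddGroup Q] [SecondCountableTopology Q] [T2Space Q] [LocallyCompactSpace Q]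
    [MeasureSpace Q] [BorelSpace Q] [(volume : Measure Q).IsAddHaarMeasure]
    {π : Euc d →+ Q} (hπ : IsOpenQuotientMap π) {V : Q → ℝ}
    (hV : ContDiff ℝ 2 fun q => V (π q)) (i k : Fin d) :
    Continuous fun q => posDeriv π k (posDeriv π i V) q := by
  have h0 : IsCn π 2 fun x : Phase d 0 Q => V x.1 := hV.comp contDiff_fst
  have h1 : IsCn π 1 fun x : Phase d 0 Q => posDeriv π i V x.1 := by
    have := h0.pderiv (n' := 1) (by norm_num) (.inl i)
    rwa [show pderiv π (.inl i) (fun x : Phase d 0 Q => V x.1) = fun x => posDeriv π i V x.1 from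
      funext fun x => pderiv_pos i V x] at this
  have h2 : Continuous fun x : Phase d 0 Q => posDeriv π k (posDeriv π i V) x.1 := by
    have := (h1.pderiv (n' := 0) (by norm_num) (.inl k)).continuous hπ
    rwa [show pderiv π (.inl k) (fun x : Phase d 0 Q => posDeriv π i V x.1) =
      fun x => posDeriv π k (posDeriv π i V) x.1 from funext fun x => pderiv_pos k _ x] at this
  exact h2.comp (continuous_id.prodMk continuous_const : Continuous fun q : Q =>
    ((q, 0) : Phase d 0 Q))

/-- Every potential on the torus is admissible. -/
lemma isAdmissible_torus {β : ℝ} (hβ : 0 < β) {V : UnitAddTorus (Fin d) → ℝ}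
    (hV : ContDiff ℝ 2 fun q : Euc d => V (torusProj d q)) : IsAdmissible (torusProj d) β V := by
  have hπ := isOpenQuotientMap_torusProj d
  have hVc : Continuous V := hπ.continuous_comp_iff.1 hV.continuous
  have hbd : ∀ f : UnitAddTorus (Fin d) → ℝ, Continuous f → ∃ C, ∀ q, |f q| ≤ C := fun f hf => by
    obtain ⟨C, hC⟩ := isCompact_univ.exists_bound_of_continuousOn hf.continuousOn
    exact ⟨C, fun q => hC q (Set.mem_univ q)⟩
  have hmp := measurePreserving_torusProj d
  -- Compactness makes truncation unnecessary, and the unit cube covers the whole torus, so one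
  -- region serves for every `M`.
  refine ⟨hπ, hβ, hV, ?_, ?_, ?_, ⟨fun _ _ => 1, 0, fun n => ⟨contDiff_const, ?_, fun q => by simp,
    fun i q => ?_⟩, fun q => Eventually.of_forall fun n => Eventually.of_forall fun q' => rfl⟩,
    fun M => ⟨unitCube d, Set.univ, ?_, ?_, ⟨WithLp.toLp 2 fun _ => 1, fun i => by simp⟩, ?_,
      MeasurableSet.univ, ?_, fun q _ => Set.mem_univ q, by rwa [Measure.restrict_univ]⟩⟩
  · choose C hC using fun i k => hbd _ (posDeriv_posDeriv_continuous hπ hV i k)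
    refine ⟨∑ i, ∑ k, |C i k|, fun i k q => (hC i k q).trans ((le_abs_self _).trans ?_)⟩
    exact (Finset.single_le_sum (f := fun k => |C i k|) (fun k _ => abs_nonneg _)
      (Finset.mem_univ k)).trans (Finset.single_le_sum (f := fun i => ∑ k, |C i k|)
      (fun i _ => Finset.sum_nonneg fun k _ => abs_nonneg _) (Finset.mem_univ i))
  · exact (Real.continuous_exp.comp (continuous_const.mul hVc)).integrable_of_hasCompactSupport
      (HasCompactSupport.of_compactSpace _)
  · obtain ⟨C, hC⟩ := hbd V hVc
    exact ⟨-C, fun q => (abs_le.1 (hC q)).1⟩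
  · exact HasCompactSupport.of_compactSpace _
  · simp [posDeriv]
  · have : unitCube d = ⋂ i, {x : Euc d | x i ∈ Set.Ioc (0 : ℝ) 1} := by
      ext x
      simp [unitCube]
    rw [this]
    exact convex_iInter fun i => (convex_Ioc (0 : ℝ) 1).is_linear_preimage
      (f := fun x : Euc d => x i) ⟨fun _ _ => rfl, fun _ _ => rfl⟩
  · refine (Metric.isBounded_closedBall (x := (0 : Euc d)) (r := √d)).subset fun x hx => ?_
    rw [mem_closedBall_zero_iff, EuclideanSpace.norm_eq]
    refine Real.sqrt_le_sqrt ((Finset.sum_le_card_nsmul _ _ 1 fun i _ => ?_).trans_eq (by simp))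
    rw [Real.norm_eq_abs, sq_abs]
    have := hx i
    nlinarith [this.1, this.2]
  · have : unitCube d = ⋂ i, {x : Euc d | x i ∈ Set.Ioc (0 : ℝ) 1} := by
      ext x
      simp [unitCube]
    rw [this]
    exact MeasurableSet.iInter fun i =>
      (by fun_prop : Measurable fun x : Euc d => x i) measurableSet_Ioc
  · have h1 := hmp.measure_preimage MeasurableSet.univ.nullMeasurableSet
    rw [Set.preimage_univ, Measure.restrict_apply_univ] at h1
    rw [h1]
    exact NeZero.ne _

end Torus

/-! ### Confining potentials on Euclidean space -/

section EuclideanPotential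

variable {d : ℕ}

lemma posDeriv_id {f : Euc d → ℝ} {q : Euc d} (hf : DifferentiableAt ℝ f q) (i : Fin d) :
    posDeriv (AddMonoidHom.id (Euc d)) i f q = fderiv ℝ f q (EuclideanSpace.single i 1) :=
  hf.lineDeriv_eq_fderiv

lemma posDeriv_posDeriv_id {V : Euc d → ℝ} (hV : ContDiff ℝ 2 V) (i k : Fin d) (q : Euc d) :
    posDeriv (AddMonoidHom.id (Euc d)) k (posDeriv (AddMonoidHom.id (Euc d)) i V) q =
      iteratedFDeriv ℝ 2 V q ![EuclideanSpace.single k 1, EuclideanSpace.single i 1] := by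
  have h1 : posDeriv (AddMonoidHom.id (Euc d)) i V =
      fun q => fderiv ℝ V q (EuclideanSpace.single i 1) :=
    funext fun q => posDeriv_id ((hV.differentiable two_ne_zero) q) i
  have h2 : DifferentiableAt ℝ (fderiv ℝ V) q :=
    ((hV.fderiv_right (m := 1) (by norm_num)).differentiable one_ne_zero) q
  rw [h1, posDeriv_id (h2.clm_apply (differentiableAt_const _)), iteratedFDeriv_two_apply,
    fderiv_clm_apply h2 (differentiableAt_const _)]
  simp

/-- Confining potentials with bounded Hessian are admissible. -/
lemma isAdmissible_euclidean {β : ℝ} (hβ : 0 < β) {V : Euc d → ℝ} (hV : ContDiff ℝ 2 V)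
    (hc : IsConfining β V) (hH : HasBoundedHessian V) :
    IsAdmissible (AddMonoidHom.id (Euc d)) β V := by
  obtain ⟨c, hcb⟩ := hH
  have hess : ∀ i k q, |iteratedFDeriv ℝ 2 V q
      ![EuclideanSpace.single i 1, EuclideanSpace.single k 1]| ≤ c := fun i k q => by
    refine le_trans (Real.abs_le_sqrt ?_) (hcb q)
    exact (Finset.single_le_sum (f := fun k => iteratedFDeriv ℝ 2 V q
      ![EuclideanSpace.single i 1, EuclideanSpace.single k 1] ^ 2) (fun k _ => sq_nonneg _)
      (Finset.mem_univ k)).trans (Finset.single_le_sum (f := fun i => ∑ k, iteratedFDeriv ℝ 2 V q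
      ![EuclideanSpace.single i 1, EuclideanSpace.single k 1] ^ 2)
      (fun i _ => Finset.sum_nonneg fun k _ => sq_nonneg _) (Finset.mem_univ i))
  have hgrad : ∀ q, ∑ i, posDeriv (AddMonoidHom.id (Euc d)) i V q ^ 2 = ‖gradient V q‖ ^ 2 :=
    fun q => by
      rw [EuclideanSpace.norm_sq_eq]
      refine Finset.sum_congr rfl fun i _ => ?_
      rw [posDeriv_id ((hV.differentiable two_ne_zero) q), ← toDual_gradient,
        InnerProductSpace.toDual_apply_apply, EuclideanSpace.inner_single_right]
      simp
  -- The Laplacian is bounded below by the Hessian bound, so the confinement condition forces `|∇V|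
  -- → ∞`.
  have hlap : ∀ q, -(d * c) ≤ Δ V q := fun q => by
    rw [InnerProductSpace.laplacian_eq_iteratedFDeriv_orthonormalBasis V
      (EuclideanSpace.basisFun (Fin d) ℝ)]
    have : ∑ _i : Fin d, -c ≤ ∑ i, iteratedFDeriv ℝ 2 V q
        ![EuclideanSpace.basisFun (Fin d) ℝ i, EuclideanSpace.basisFun (Fin d) ℝ i] :=
      Finset.sum_le_sum fun i _ => by
        rw [EuclideanSpace.basisFun_apply]
        exact (abs_le.1 (hess i i q)).1
    simpa using this
  refine ⟨IsOpenQuotientMap.id, hβ, hV, ⟨c, fun i k q => ?_⟩, hc.integrable, ?_, ?_, fun M => ?_⟩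
  · rw [posDeriv_posDeriv_id hV]
    exact hess k i q
  · obtain ⟨x, hx⟩ := hV.continuous.exists_forall_le hc.tendsto
    exact ⟨V x, hx⟩
  · obtain ⟨ψ, C, hψ, hψs, hC0, hψ1, hC, -, hψone⟩ :=
      exists_bump_with_bounds fun i : Fin d => (EuclideanSpace.single i 1 : Euc d)
    let r : ℕ → ℝ := fun n => ((n : ℝ) + 1)⁻¹
    have hr0 : ∀ n, 0 < r n := fun n => by positivity
    have hr1 : ∀ n, r n ≤ 1 := fun n =>
      inv_le_one_of_one_le₀ (by linarith [n.cast_nonneg (α := ℝ)])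
    have hs : ∀ n, ContDiff ℝ ∞ fun q : Euc d => ψ (r n • q) := fun n =>
      hψ.comp (contDiff_const_smul _)
    refine ⟨fun n q => ψ (r n • q), C, fun n => ⟨hs n, hψs.comp_smul (hr0 n).ne',
      fun q => hψ1 _, fun i q => ?_⟩, fun q => ?_⟩
    · have h1 : HasFDerivAt (fun y : Euc d => r n • y) (r n • ContinuousLinearMap.id ℝ _) q :=
        (hasFDerivAt_id q).const_smul (r n)
      have h2 := ((hψ.differentiable (by simp)) (r n • q)).hasFDerivAt.comp q h1
      have h3 : fderiv ℝ (fun q => ψ (r n • q)) q = _ := h2.fderiv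
      rw [posDeriv_id (((hs n).differentiable (by simp)) q), h3]
      simp only [ContinuousLinearMap.comp_apply, smul_apply, ContinuousLinearMap.id_apply,
        map_smul, smul_eq_mul, abs_mul, abs_of_pos (hr0 n)]
      exact (mul_le_of_le_one_left (abs_nonneg _) (hr1 n)).trans (hC i _)
    · filter_upwards [tendsto_natCast_atTop_atTop.eventually_ge_atTop ‖q‖] with n hn
      filter_upwards [(continuous_norm.tendsto q).eventually (gt_mem_nhds (lt_add_one ‖q‖))] with y hy
      refine hψone _ ?_
      rw [norm_smul, Real.norm_eq_abs, abs_of_pos (hr0 n), inv_mul_le_iff₀ (by positivity)]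
      linarith
  -- If `|∇V|² ≤ M` then `½|∇V|² - ΔV ≤ M/2 + dc`, which holds only on a bounded set; a ball around
  -- it is the required convex region, with radius at least one so that its volume is positive.
  · have h1 := hc.gradient.eventually_gt_atTop (M / 2 + d * c)
    rw [← Metric.cobounded_eq_cocompact] at h1
    have hb : Bornology.IsBounded {q : Euc d |
        ¬ (M / 2 + d * c < ‖gradient V q‖ ^ 2 / 2 - Δ V q)} := by
      rw [Bornology.isBounded_def]
      filter_upwards [h1] with q hq
      exact fun h => h hq
    obtain ⟨R, hR⟩ := (Metric.isBounded_iff_subset_closedBall (0 : Euc d)).1 hb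
    refine ⟨Metric.closedBall 0 (max R 1), Metric.closedBall 0 (max R 1), convex_closedBall _ _,
      Metric.isBounded_closedBall, ⟨0, by simp⟩, measurableSet_closedBall,
      measurableSet_closedBall, (Metric.measure_closedBall_pos _ _ (by positivity)).ne',
      fun q hq => ?_, MeasurePreserving.id _⟩
    rw [hgrad] at hq
    refine Metric.closedBall_subset_closedBall (le_max_left R 1) (hR ?_)
    intro h
    linarith [hlap q]

end EuclideanPotential

end GLE

end

theorem mainTheorem2 (d m : ℕ) (lam alpha : Fin m → ℝ) (β : ℝ) (hβ : 0 < β)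
    (halpha : ∀ j, 0 < alpha j) (hlam : ∃ j, lam j ≠ 0) :
    (∀ V : UnitAddTorus (Fin d) → ℝ, ContDiff ℝ 2 (fun q : GLE.Euc d => V (GLE.torusProj d q)) →
      GLE.ExponentialDecay (GLE.torusProj d) lam alpha β V) ∧
    (∀ V : GLE.Euc d → ℝ, ContDiff ℝ 2 V → GLE.IsConfining β V → GLE.HasBoundedHessian V →
      GLE.ExponentialDecay (AddMonoidHom.id (GLE.Euc d)) lam alpha β V) :=
  ⟨fun _ hV => (GLE.isAdmissible_torus hβ hV).exponentialDecay halpha hlam,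
    fun _ hV hc hH => (GLE.isAdmissible_euclidean hβ hV hc hH).exponentialDecay halpha hlam⟩
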